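/- Let $(M,\omega)$ be a compact connected symplectic manifold of dimension $2n$ with a prequantum bundle $L\to M$, i.e. a Hermitian line bundle with a compatible connection $\nabla$ of curvature $\frac1i\omega$. Let $\mathcal J$ be the space of almost complex structures $j$ of $M$ that are compatible with $\omega$ and positive ($\omega(v,jv)>0$ for $v\neq0$). For $j_a,j_b\in\mathcal J$ let $\Psi_{j_a,j_b}:\Lambda^{n,0}_{j_a}T^*M\to\Lambda^{n,0}_{j_b}T^*M$ be the bundle map with $\Psi_{j_a,j_b}(\alpha)\wedge\bar\beta=\alpha\wedge\bar\beta$ for all $\alpha,\beta\in\Lambda^{n,0}_{j_a}T^*M$. Fix $j_0\in\mathcal J$ and a half-form bundle of $(M,j_0)$: a line bundle $\delta\to M$ with an isomorphism $\varphi_{j_0}:\delta^2\to\Lambda^{n,0}_{j_0}T^*M$. For $j\in\mathcal J$ put $\delta_j=\delta$ and $\varphi_j=\Psi_{j_0,j}\circ\varphi_{j_0}$. Let $k\ge1$ be an integer. **Prequantum spaces.** The bundle $\mathcal P_k\to\mathcal J$ has fibre $\mathcal P_{k,j}=C^\infty(M,L^k\otimes\delta_j)$ at $j$. If $j_t$ is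 a smooth curve in $\mathcal J$ and $\Phi_t\in\mathcal P_{k,j_t}$ a smooth family, the covariant derivative at $t=t_0$ is $\frac{d}{dt}\big|_{t_0}\Psi_t^{-1}\Phi_t$, where $\Psi_t:\delta_{j_{t_0}}\to\delta_{j_t}$ is the continuous family of bundle isomorphisms with $\varphi_{j_t}\circ\Psi_t^2=\Psi_{j_{t_0},j_t}\circ\varphi_{j_{t_0}}$ and $\Psi_{t_0}=\mathrm{id}$. The curvature $R^{\mathcal P_k}(\eta,\mu)\in\mathrm{End}(\mathcal P_{k,j})$ at tangent vectors $\eta,\mu$ of $\mathcal J$ at $j$ is given by $R^{\mathcal P_k}(\eta,\mu)\Phi_{0,0}=(\nabla_s\nabla_t-\nabla_t\nabla_s)\Phi\big|_{(0,0)}$, for all smooth families $j_{s,t}$ in $\mathcal J$, $(s,t)\in\mathbb R^2$, with $j_{0,0}=j$, $\partial_sj(0,0)=\eta$, $\partial_tj(0,0)=\mu$, and all smooth families $\Phi_{s,t}\in\mathcal P_{k,j_{s,t}}$. **Operators.** For $f\in C^\infty(M,\mathbb R)$ let $X_f$ be the vector field with $\omega(X_f,\cdot)=-df$, and let $\{f,g\}=\omega(X_f,X_g)=X_f\cdot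 g$. For $j\in\mathcal J$ let $p_j$ be the projection of $\Lambda^nT^*M\otimes\mathbb C$ onto $\Lambda^{n,0}_jT^*M$ whose kernel is the sum of the other $\Lambda^{p,q}_j$, and let $D_X$ be the first order operator on $C^\infty(M,\delta_j)$ with $p_j\mathcal L_X\varphi_j(\beta^2)=2\varphi_j(\beta\otimes D_X\beta)$ for all $\beta$. Put $$\operatorname{Op}_k(f)=f+\tfrac1{ik}\bigl(\nabla^{L^k}_{X_f}\otimes\mathrm{id}+\mathrm{id}\otimes D_{X_f}\bigr):\mathcal P_{k,j}\to\mathcal P_{k,j}.$$ The infinitesimal action of $f$ on $\mathcal J$ at $j$ is $\frac{d}{dt}\big|_{0}\phi_t^*j$, where $\phi_t$ is the flow of $X_f$ and $(\phi^*j)_x=(d_x\phi)^{-1}\circ j_{\phi(x)}\circ d_x\phi$. **Quantum spaces.** If $j$ is integrable, let $\mathcal Q_{k,j}\subset\mathcal P_{k,j}$ be the space of $j$-holomorphic sections of $L^k\otimes\delta_j$ (the holomorphic structure of $L$ is given by $\nabla$, that of $\delta_j$ is such that $\varphi_j$ is an isomorphism of holomorphic bundles) and let $\Pi_{k,j}$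 be the orthogonal projector of $\mathcal P_{k,j}$ onto $\mathcal Q_{k,j}$, for the scalar product defined by the Liouville measure, the metric of $L$ and the metric of $\delta_j$ for which $\varphi_j$ is an isomorphism of Hermitian bundles. Put $Q_k(f)=\Pi_{k,j}\operatorname{Op}_k(f):\mathcal Q_{k,j}\to\mathcal Q_{k,j}$. Let $S\subset\mathcal J$ be a set of integrable complex structures (for instance a submanifold of $\mathcal J$) over which the spaces $\mathcal Q_{k,j}$ form a smooth subbundle of finite rank of $\mathcal P_k$: over every smooth two-parameter family in $S$ they have, locally, frames of smooth families of sections. The connection of $\mathcal Q_k\to S$ is $\Pi_k\circ\nabla^{\mathcal P_k}$, and its curvature $R^{\mathcal Q_k}(\eta,\mu)\in\mathrm{End}(\mathcal Q_{k,j})$ is defined as above, with families $j_{s,t}$ in $S$ and $\Phi_{s,t}\in\mathcal Q_{k,j_{s,t}}$. The vectors $\eta,\mu$ are called tangent to $S$ at $j\in S$ if they are the velocities $\partial_sj(0,0)$, $\partial_tj(0,0)$ of a smooth two-parameter family in $S$ with $j_{0,0}=j$. **Theorem.** Let $f,g\in C^\infty(M,\mathbb R)$. (1) For every $j\in\mathcal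 J$, with $\eta,\mu$ the infinitesimal actions of $f,g$ at $j$, the curvature $R^{\mathcal P_k}(\eta,\mu)$ is a well-defined endomorphism of $\mathcal P_{k,j}$, and on $\mathcal P_{k,j}$ $$ik\,[\operatorname{Op}_k(f),\operatorname{Op}_k(g)]=\operatorname{Op}_k(\{f,g\})+(ik)^{-1}R^{\mathcal P_k}(\eta,\mu).$$ (2) For every $S$ as above and every $j\in S$ such that the infinitesimal actions $\eta,\mu$ of $f,g$ at $j$ are tangent to $S$, the curvature $R^{\mathcal Q_k}(\eta,\mu)$ is a well-defined endomorphism of $\mathcal Q_{k,j}$, and on $\mathcal Q_{k,j}$ $$ik\,[Q_k(f),Q_k(g)]=Q_k(\{f,g\})+(ik)^{-1}R^{\mathcal Q_k}(\eta,\mu).$$ -/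

import Mathlib

open Bundle Manifold Set MeasureTheory
open scoped ContDiff TensorProduct ComplexConjugate Topology

noncomputable section

namespace GeomQuant

/-! ### Linear algebra of forms of type `(n, 0)` -/

section LinearAlgebra

variable {n : ℕ} {V : Type*} [AddCommGroup V] [Module ℝ V]

/-- Complex valued `n`-forms of type `(n, 0)` for the complex structure `J`. -/
def typeN0 (n : ℕ) (J : V → V) : Submodule ℂ (V [⋀^Fin n]→ₗ[ℝ] ℂ) where
  carrier := {α | ∀ (v : Fin n → V) (a : Fin n),
    α (Function.update v a (J (v a))) = Complex.I * α v}
  add_mem' := by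
    intro α β hα hβ v a
    simp only [mem_ofPred_eq, AlternatingMap.add_apply] at *
    rw [hα, hβ, mul_add]
  zero_mem' := by
    intro v a
    simp
  smul_mem' := by
    intro c α hα v a
    simp only [mem_ofPred_eq, AlternatingMap.smul_apply, smul_eq_mul] at *
    rw [hα]
    ring

/-- Wedge product of two complex valued `n`-forms. -/
def wedge (α β : V [⋀^Fin n]→ₗ[ℝ] ℂ) : V [⋀^Fin n ⊕ Fin n]→ₗ[ℝ] ℂ :=
  (LinearMap.mul' ℝ ℂ).compAlternatingMap (α.domCoprod β)

/-- Complex conjugate of a form. -/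
def conjForm (α : V [⋀^Fin n]→ₗ[ℝ] ℂ) : V [⋀^Fin n]→ₗ[ℝ] ℂ :=
  Complex.conjAe.toLinearMap.compAlternatingMap α

/-- The map `Ψ_{ja, jb}` from forms of type `(n, 0)` for `ja` to forms of type `(n, 0)` for `jb`,
determined by `Ψ_{ja, jb} α ∧ conj β = α ∧ conj β` for all `β` of type `(n, 0)` for `ja`. -/
def Psi (ja jb : V → V) (α : V [⋀^Fin n]→ₗ[ℝ] ℂ) : V [⋀^Fin n]→ₗ[ℝ] ℂ :=
  Classical.epsilon fun γ : V [⋀^Fin n]→ₗ[ℝ] ℂ =>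
    γ ∈ typeN0 n jb ∧ ∀ β ∈ typeN0 n ja, wedge γ (conjForm β) = wedge α (conjForm β)

end LinearAlgebra

/-! ### Symplectic manifolds -/

/-- The model space of a manifold of dimension `2n`. -/
abbrev Model (n : ℕ) := EuclideanSpace ℝ (Fin (2 * n))

section Manifold

variable {n : ℕ} {M : Type*} [TopologicalSpace M] [ChartedSpace (Model n) M]
  [IsManifold 𝓘(ℝ, Model n) ∞ M]

/-- Tangent space at `x`. -/
abbrev Tan (n : ℕ) {M : Type*} [TopologicalSpace M] [ChartedSpace (Model n) M] (x : M) :=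
  TangentSpace 𝓘(ℝ, Model n) x

instance (x : M) : FiniteDimensional ℝ (Tan n x) :=
  inferInstanceAs (FiniteDimensional ℝ (Model n))

/-- (Not necessarily smooth) real vector fields. -/
abbrev VF (n : ℕ) (M : Type*) [TopologicalSpace M] [ChartedSpace (Model n) M] :=
  (x : M) → Tan n x

/-- Smoothness of a vector field. -/
def SmoothVF (X : VF n M) : Prop :=
  ContMDiff 𝓘(ℝ, Model n) (𝓘(ℝ, Model n).tangent) ∞
    (fun x => (⟨x, X x⟩ : TangentBundle 𝓘(ℝ, Model n) M))

/-- Derivative of a function along a vector field. -/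
def dirDeriv {F : Type*} [NormedAddCommGroup F] [NormedSpace ℝ F]
    (X : VF n M) (u : M → F) (x : M) : F :=
  mvfderiv 𝓘(ℝ, Model n) u x (X x)

/-- Lie bracket of vector fields. -/
def bracket (X Y : VF n M) : VF n M :=
  VectorField.mlieBracket 𝓘(ℝ, Model n) X Y

/-- Symplectic forms: smooth, nondegenerate, closed two-forms. -/
structure SymplecticForm (n : ℕ) (M : Type*) [TopologicalSpace M]
    [ChartedSpace (Model n) M] [IsManifold 𝓘(ℝ, Model n) ∞ M] where
  toFun : ∀ x : M, LinearMap.BilinForm ℝ (Tan n x)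
  alt : ∀ x, (toFun x).IsAlt
  nondeg : ∀ x, (toFun x).Nondegenerate
  smooth : ∀ X Y : VF n M, SmoothVF X → SmoothVF Y →
    ContMDiff 𝓘(ℝ, Model n) 𝓘(ℝ, ℝ) ∞ (fun x => toFun x (X x) (Y x))
  closed : ∀ X Y Z : VF n M, SmoothVF X → SmoothVF Y → SmoothVF Z → ∀ x,
    dirDeriv X (fun y => toFun y (Y y) (Z y)) x
      + dirDeriv Y (fun y => toFun y (Z y) (X y)) x
      + dirDeriv Z (fun y => toFun y (X y) (Y y)) x
      - toFun x (bracket X Y x) (Z x)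
      - toFun x (bracket Y Z x) (X x)
      - toFun x (bracket Z X x) (Y x) = 0

instance : CoeFun (SymplecticForm n M) (fun _ => ∀ x : M, LinearMap.BilinForm ℝ (Tan n x)) :=
  ⟨SymplecticForm.toFun⟩

/-- The Hamiltonian vector field `X` of `f`, with the sign convention `Ω(X, ·) = -df`. -/
def hamVF (Ω : SymplecticForm n M) (f : M → ℝ) : VF n M := fun x =>
  ((Ω x).toDual (Ω.nondeg x)).symm (-(mvfderiv 𝓘(ℝ, Model n) f x).toLinearMap)

/-- The Poisson bracket `{f, g} = Ω(X_f, X_g) = X_f · g`. -/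
def poisson (Ω : SymplecticForm n M) (f g : M → ℝ) : M → ℝ := fun x =>
  Ω x (hamVF Ω f x) (hamVF Ω g x)

/-- The Liouville measure `|Ω ^ n / n!|`. In the chart at `x₀` its density with respect to the
Lebesgue measure is the square root of the determinant of the matrix of `Ω` in the coordinate frame;
these chart measures agree on overlaps and are glued by taking their supremum. -/
def liouville [MeasurableSpace M] (Ω : SymplecticForm n M) : Measure M :=
  ⨆ x₀ : M, (((volume : Measure (Model n)).restrict (chartAt (Model n) x₀).target).withDensity
    (fun y => ENNReal.ofReal (Real.sqrt (Matrix.det (Matrix.of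
      (fun a b : Fin (2 * n) => Ω ((chartAt (Model n) x₀).symm y)
        (mfderiv 𝓘(ℝ, Model n) 𝓘(ℝ, Model n) (chartAt (Model n) x₀).symm y
          (EuclideanSpace.single a (1 : ℝ)))
        (mfderiv 𝓘(ℝ, Model n) 𝓘(ℝ, Model n) (chartAt (Model n) x₀).symm y
          (EuclideanSpace.single b (1 : ℝ))))))))).map
    (chartAt (Model n) x₀).symm

/-! ### The space of almost complex structures -/

/-- The space of almost complex structures of `M` compatible with `Ω` and positive. -/
structure CompatACS (Ω : SymplecticForm n M) where
  toFun : ∀ x : M, Tan n x →L[ℝ] Tan n x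
  sq : ∀ x v, toFun x (toFun x v) = -v
  compat : ∀ x u v, Ω x (toFun x u) (toFun x v) = Ω x u v
  pos : ∀ x v, v ≠ 0 → 0 < Ω x v (toFun x v)
  smooth : ∀ X : VF n M, SmoothVF X → SmoothVF (fun x => toFun x (X x))

instance (Ω : SymplecticForm n M) :
    CoeFun (CompatACS Ω) (fun _ => ∀ x : M, Tan n x →L[ℝ] Tan n x) := ⟨CompatACS.toFun⟩

variable {Ω : SymplecticForm n M}

/-- Integrability: the Nijenhuis tensor vanishes. -/
def CompatACS.Integrable (j : CompatACS Ω) : Prop :=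
  ∀ X Y : VF n M, SmoothVF X → SmoothVF Y → ∀ x,
    bracket (fun y => j y (X y)) (fun y => j y (Y y)) x
      - j x (bracket (fun y => j y (X y)) Y x)
      - j x (bracket X (fun y => j y (Y y)) x)
      - bracket X Y x = 0

/-- Smooth two-parameter families of almost complex structures. -/
def SmoothSurface (p : ℝ × ℝ → CompatACS Ω) : Prop :=
  ∀ X : VF n M, SmoothVF X →
    ContMDiff (𝓘(ℝ, ℝ × ℝ).prod 𝓘(ℝ, Model n)) (𝓘(ℝ, Model n).tangent) ∞
      (fun z : (ℝ × ℝ) × M =>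
        (⟨z.2, p z.1 z.2 (X z.2)⟩ : TangentBundle 𝓘(ℝ, Model n) M))

/-- Fields of endomorphisms of the tangent bundle; the tangent vectors of the space of almost
complex structures are such fields. -/
abbrev EndField (n : ℕ) (M : Type*) [TopologicalSpace M] [ChartedSpace (Model n) M] :=
  (x : M) → Tan n x →L[ℝ] Tan n x

/-- The two-parameter family `p` is smooth, starts at `j`, and its velocities at the origin in the
directions of the first and second parameter are `η` and `μ`. -/
structure IsSurfaceAt (p : ℝ × ℝ → CompatACS Ω) (j : CompatACS Ω) (η μ : EndField n M) :
    Prop where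
  smooth : SmoothSurface p
  base : p (0, 0) = j
  fst : ∀ x v, HasDerivAt (fun t : ℝ => p (t, 0) x v) (η x v) 0
  snd : ∀ x v, HasDerivAt (fun t : ℝ => p (0, t) x v) (μ x v) 0

/-- `φ` is the flow of the vector field `X`. -/
structure IsFlow (X : VF n M) (φ : ℝ → M → M) : Prop where
  smooth : ContMDiff (𝓘(ℝ, ℝ).prod 𝓘(ℝ, Model n)) 𝓘(ℝ, Model n) ∞
    (fun z : ℝ × M => φ z.1 z.2)
  zero : ∀ x, φ 0 x = x
  integral : ∀ x, IsMIntegralCurve (I := 𝓘(ℝ, Model n)) (fun t => φ t x) X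

/-- Pull-back `(ψ^* j)_x = (dψ_x)⁻¹ ∘ j_{ψ x} ∘ dψ_x`. -/
def pullbackACS (ψ : M → M) (j : EndField n M) : EndField n M := fun x =>
  (mfderiv 𝓘(ℝ, Model n) 𝓘(ℝ, Model n) ψ x).inverse ∘L j (ψ x) ∘L
    mfderiv 𝓘(ℝ, Model n) 𝓘(ℝ, Model n) ψ x

/-- `η` is the value at `j` of the infinitesimal action of `f`: the derivative at `t = 0` of
`φ_t^* j`, where `φ_t` is the Hamiltonian flow of `f`. -/
def IsInfAction (Ω : SymplecticForm n M) (f : M → ℝ) (j : CompatACS Ω) (η : EndField n M) :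
    Prop :=
  ∃ φ : ℝ → M → M, IsFlow (hamVF Ω f) φ ∧
    ∀ x v, HasDerivAt (fun t : ℝ => pullbackACS (φ t) j.toFun x v) (η x v) 0

/-! ### Lie derivatives of `n`-forms -/

/-- Complex valued `n`-forms at a point. -/
abbrev Form (n : ℕ) {M : Type*} [TopologicalSpace M] [ChartedSpace (Model n) M] (x : M) :=
  Tan n x [⋀^Fin n]→ₗ[ℝ] ℂ

/-- `(L_X κ)(Y_1, …, Y_n)`. -/
def lieForm (X : VF n M) (κ : (x : M) → Form n x) (Y : Fin n → VF n M) (x : M) : ℂ :=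
  dirDeriv X (fun y => κ y (fun a => Y a y)) x
    - ∑ a : Fin n, κ x (Function.update (fun b => Y b x) a (bracket X (Y a) x))

/-- `(p_j L_X κ)(Y_1, …, Y_n)`, where `p_j` is the projection onto forms of type `(n, 0)` whose
kernel is the sum of the spaces of forms of the other types. It is the evaluation of `L_X κ`,
extended complex multilinearly, on the `(1, 0)`-parts `(Y_a - i j Y_a) / 2`. -/
def projLieForm (j : CompatACS Ω) (X : VF n M) (κ : (x : M) → Form n x) (Y : Fin n → VF n M)
    (x : M) : ℂ :=
  (1 / 2 : ℂ) ^ n * ∑ S : Finset (Fin n), (-Complex.I) ^ S.card *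
    lieForm X κ (fun a => if a ∈ S then (fun y => j y (Y a y)) else Y a) x

/-- A unitary frame of the tangent space, for the Hermitian metric determined by `Ω` and `j`. -/
def IsUnitaryFrame (Ω : SymplecticForm n M) (j : CompatACS Ω) (x : M) (v : Fin n → Tan n x) :
    Prop :=
  ∀ a b, Ω x (v a) (v b) = 0 ∧ Ω x (v a) (j x (v b)) = if a = b then 1 else 0

/-- The norm of a form of type `(n, 0)` for the Hermitian metric induced by `Ω` and `j`. -/
def normN0 (Ω : SymplecticForm n M) (j : CompatACS Ω) (x : M) (α : Form n x) : ℝ :=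
  ‖α (Classical.epsilon (IsUnitaryFrame Ω j x))‖

end Manifold

/-! ### Line bundles, prequantum bundles, half-form bundles -/

section LineBundle

variable {n : ℕ} {M : Type*} [TopologicalSpace M] [ChartedSpace (Model n) M]
  [IsManifold 𝓘(ℝ, Model n) ∞ M]

section Frames

variable (V : M → Type*) [TopologicalSpace (TotalSpace ℂ V)] [∀ x, TopologicalSpace (V x)]
  [∀ x, AddCommGroup (V x)] [∀ x, Module ℂ (V x)]
  [FiberBundle ℂ V] [VectorBundle ℂ ℂ V]

/-- The local frame of the line bundle `V` given by its preferred trivialization around `x₀`. -/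
def lineFrame (x₀ : M) (y : M) : V y := (trivializationAt ℂ V x₀).symmₗ ℂ y 1

/-- The coordinate in the local frame of `V` around `x₀`. -/
def lineCoord (x₀ : M) (y : M) : V y →ₗ[ℂ] ℂ := (trivializationAt ℂ V x₀).linearMapAt ℂ y

/-- Smooth sections of a line bundle. -/
def SmoothLineSec (n : ℕ) {M : Type*} [TopologicalSpace M] [ChartedSpace (Model n) M]
    {V : M → Type*} [TopologicalSpace (TotalSpace ℂ V)] [∀ x, TopologicalSpace (V x)]
    [FiberBundle ℂ V] (s : (x : M) → V x) : Prop :=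
  ContMDiff 𝓘(ℝ, Model n) (𝓘(ℝ, Model n).prod 𝓘(ℝ, ℂ)) ∞
    (fun x => (⟨x, s x⟩ : TotalSpace ℂ V))

end Frames

variable (L : M → Type*) [TopologicalSpace (TotalSpace ℂ L)] [∀ x, TopologicalSpace (L x)]
  [∀ x, AddCommGroup (L x)] [∀ x, Module ℂ (L x)]
  [∀ x, IsTopologicalAddGroup (L x)] [∀ x, ContinuousSMul ℝ (L x)]
  [FiberBundle ℂ L] [VectorBundle ℂ ℂ L] [VectorBundle ℝ ℂ L]
  [ContMDiffVectorBundle ∞ ℂ L 𝓘(ℝ, Model n)]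
  (δ : M → Type*) [TopologicalSpace (TotalSpace ℂ δ)] [∀ x, TopologicalSpace (δ x)]
  [∀ x, AddCommGroup (δ x)] [∀ x, Module ℂ (δ x)]
  [FiberBundle ℂ δ] [VectorBundle ℂ ℂ δ] [VectorBundle ℝ ℂ δ]
  [ContMDiffVectorBundle ∞ ℂ δ 𝓘(ℝ, Model n)]

/-- A prequantum bundle structure on the complex line bundle `L`: a smooth Hermitian metric and a
compatible connection `∇` of curvature `Ω / i`. -/
structure Prequantum (Ω : SymplecticForm n M) where
  /-- The Hermitian metric, linear in the first and antilinear in the second argument. -/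
  herm : ∀ x : M, L x → L x → ℂ
  herm_add : ∀ x u v w, herm x (u + v) w = herm x u w + herm x v w
  herm_smul : ∀ x (c : ℂ) u v, herm x (c • u) v = c * herm x u v
  herm_symm : ∀ x u v, conj (herm x u v) = herm x v u
  herm_pos : ∀ x u, u ≠ 0 → 0 < (herm x u u).re
  herm_smooth : ∀ s t : (x : M) → L x, SmoothLineSec n s → SmoothLineSec n t →
    ContMDiff 𝓘(ℝ, Model n) 𝓘(ℝ, ℂ) ∞ (fun x => herm x (s x) (t x))
  /-- The connection: `cov s x (X x) = (∇_X s)(x)`. -/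
  cov : CovariantDerivative 𝓘(ℝ, Model n) ℂ L
  cov_smooth : CovariantDerivative.ContMDiffCovariantDerivative cov ∞
  cov_complex : ∀ s : (x : M) → L x, SmoothLineSec n s → ∀ x v,
    cov (fun y => Complex.I • s y) x v = Complex.I • cov s x v
  cov_herm : ∀ s t : (x : M) → L x, SmoothLineSec n s → SmoothLineSec n t →
    ∀ (X : VF n M) x, dirDeriv X (fun y => herm y (s y) (t y)) x
      = herm x (cov s x (X x)) (t x) + herm x (s x) (cov t x (X x))
  curvature : ∀ X Y : VF n M, SmoothVF X → SmoothVF Y →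
    ∀ s : (x : M) → L x, SmoothLineSec n s → ∀ x,
      cov (fun y => cov s y (Y y)) x (X x) - cov (fun y => cov s y (X y)) x (Y x)
        - cov s x (bracket X Y x)
      = ((1 / Complex.I) * (Ω x (X x) (Y x) : ℂ)) • s x

/-- A half-form bundle structure on the complex line bundle `δ` for the almost complex structure
`j`: an isomorphism of line bundles from `δ²` to the bundle of forms of type `(n, 0)`. -/
structure HalfForm {Ω : SymplecticForm n M} (j : CompatACS Ω) where
  toEquiv : ∀ x : M, (δ x ⊗[ℂ] δ x) ≃ₗ[ℂ] (typeN0 n (j x) : Submodule ℂ (Form n x))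
  smooth : ∀ s t : (x : M) → δ x, SmoothLineSec n s → SmoothLineSec n t →
    ∀ Y : Fin n → VF n M, (∀ a, SmoothVF (Y a)) →
      ContMDiff 𝓘(ℝ, Model n) 𝓘(ℝ, ℂ) ∞
        (fun x => (toEquiv x (s x ⊗ₜ[ℂ] t x) : Form n x) (fun a => Y a x))

variable (n) in
/-- The data of the quantization of `M`: a symplectic form, a prequantum bundle `L`, and a half-form
bundle `(j₀, δ, φ₀)`, which determines a half-form bundle `(δ_j, φ_j) = (δ, Ψ_{j₀, j} ∘ φ₀)` for
every almost complex structure `j`. -/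
structure QuantData where
  form : SymplecticForm n M
  preq : Prequantum L form
  base : CompatACS form
  half : HalfForm δ base

/-- The fibre of `L^k ⊗ δ`. -/
abbrev PFib (k : ℕ) (x : M) := (⨂[ℂ]^k (L x)) ⊗[ℂ] δ x

/-- (Not necessarily smooth) sections of `L^k ⊗ δ`. -/
abbrev Sec (k : ℕ) := (x : M) → PFib L δ k x

/-- The local frame `e^k ⊗ d` of `L^k ⊗ δ` around `x₀`, with `e` and `d` the local frames of `L`
and `δ`. -/
def pFrame (k : ℕ) (x₀ y : M) : PFib L δ k y :=
  (PiTensorProduct.tprod ℂ (fun _ : Fin k => lineFrame L x₀ y)) ⊗ₜ[ℂ] lineFrame δ x₀ y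

/-- The coordinate of elements of `L^k ⊗ δ` in the local frame around `x₀`. -/
def pCoord (k : ℕ) (x₀ y : M) : PFib L δ k y →ₗ[ℂ] ℂ :=
  LinearMap.mul' ℂ ℂ ∘ₗ TensorProduct.map
    (PiTensorProduct.lift ((MultilinearMap.mkPiAlgebra ℂ (Fin k) ℂ).compLinearMap
      (fun _ => lineCoord L x₀ y)))
    (lineCoord δ x₀ y)

/-- The space of smooth sections of `L^k ⊗ δ`. Since `δ_j = δ` for all `j`, it is the fibre at any
`j` of the bundle of prequantum spaces. -/
def PSpace (n : ℕ) {M : Type*} [TopologicalSpace M] [ChartedSpace (Model n) M]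
    (L : M → Type*) [TopologicalSpace (TotalSpace ℂ L)] [∀ x, TopologicalSpace (L x)]
    [∀ x, AddCommGroup (L x)] [∀ x, Module ℂ (L x)] [FiberBundle ℂ L] [VectorBundle ℂ ℂ L]
    (δ : M → Type*) [TopologicalSpace (TotalSpace ℂ δ)] [∀ x, TopologicalSpace (δ x)]
    [∀ x, AddCommGroup (δ x)] [∀ x, Module ℂ (δ x)] [FiberBundle ℂ δ] [VectorBundle ℂ ℂ δ]
    (k : ℕ) : Submodule ℂ (Sec L δ k) where
  carrier := {s | ∀ x₀ : M, ContMDiffOn 𝓘(ℝ, Model n) 𝓘(ℝ, ℂ) ∞ (fun y => pCoord L δ k x₀ y (s y))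
    ((trivializationAt ℂ L x₀).baseSet ∩ (trivializationAt ℂ δ x₀).baseSet)}
  add_mem' := by
    intro s t hs ht x₀
    have h : (fun y => pCoord L δ k x₀ y ((s + t) y)) =
        fun y => pCoord L δ k x₀ y (s y) + pCoord L δ k x₀ y (t y) := by
      funext y
      simp
    rw [h]
    exact (hs x₀).add (ht x₀)
  zero_mem' := by
    intro x₀
    simpa using contMDiffOn_const
  smul_mem' := by
    intro c s hs x₀
    have h : (fun y => pCoord L δ k x₀ y ((c • s) y)) =
        fun y => c • pCoord L δ k x₀ y (s y) := by
      funext y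
      simp
    rw [h]
    exact ((ContinuousLinearMap.mul ℝ ℂ c).contMDiff).comp_contMDiffOn (hs x₀)

/-- Smooth two-parameter families of sections of `L^k ⊗ δ`. -/
def SmoothSecSurface (n : ℕ) {M : Type*} [TopologicalSpace M] [ChartedSpace (Model n) M]
    {L : M → Type*} [TopologicalSpace (TotalSpace ℂ L)] [∀ x, TopologicalSpace (L x)]
    [∀ x, AddCommGroup (L x)] [∀ x, Module ℂ (L x)] [FiberBundle ℂ L] [VectorBundle ℂ ℂ L]
    {δ : M → Type*} [TopologicalSpace (TotalSpace ℂ δ)] [∀ x, TopologicalSpace (δ x)]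
    [∀ x, AddCommGroup (δ x)] [∀ x, Module ℂ (δ x)] [FiberBundle ℂ δ] [VectorBundle ℂ ℂ δ]
    {k : ℕ} (Φ : ℝ × ℝ → Sec L δ k) : Prop :=
  ∀ x₀ : M, ContMDiffOn (𝓘(ℝ, ℝ × ℝ).prod 𝓘(ℝ, Model n)) 𝓘(ℝ, ℂ) ∞
    (fun z : (ℝ × ℝ) × M => pCoord L δ k x₀ z.2 (Φ z.1 z.2))
    (univ ×ˢ ((trivializationAt ℂ L x₀).baseSet ∩ (trivializationAt ℂ δ x₀).baseSet))

namespace QuantData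

variable {L δ}
variable (D : QuantData n L δ)

/-- The isomorphism `φ_j = Ψ_{j₀, j} ∘ φ₀` from `δ²` to the bundle of forms of type `(n, 0)`. -/
def phi (j : CompatACS D.form) (x : M) (τ : δ x ⊗[ℂ] δ x) : Form n x :=
  Psi (D.base x) (j x) (D.half.toEquiv x τ : Form n x)

/-! ### The operators `Op_k(f)` -/

/-- The value at `x` of `D_X d`, for a local section `d` of `δ` with `d x ≠ 0`. It is the solution
of `p_j L_X φ_j(d²) = 2 φ_j(d ⊗ D_X d)`. -/
def lieHalf (j : CompatACS D.form) (X : VF n M) (d : (x : M) → δ x) (x : M) : δ x :=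
  Classical.epsilon fun v : δ x => ∀ Y : Fin n → VF n M, (∀ a, SmoothVF (Y a)) →
    projLieForm j X (fun y => D.phi j y (d y ⊗ₜ[ℂ] d y)) Y x
      = 2 * D.phi j x (d x ⊗ₜ[ℂ] v) (fun a => Y a x)

/-- The first order operator `∇_X^{L^k} ⊗ id + id ⊗ D_X` on sections of `L^k ⊗ δ_j`. If
`s = h e^k ⊗ d` with `e`, `d` the local frames around `x`, its value at `x` is
`(X h) e^k ⊗ d + h (∑_i e ⊗ … ⊗ ∇_X e ⊗ … ⊗ e) ⊗ d + h e^k ⊗ D_X d`. -/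
def nabla (k : ℕ) (j : CompatACS D.form) (X : VF n M) (s : Sec L δ k) : Sec L δ k := fun x =>
  dirDeriv X (fun y => pCoord L δ k x y (s y)) x • pFrame L δ k x x
    + pCoord L δ k x x (s x) •
      ((∑ i : Fin k, PiTensorProduct.tprod ℂ
          (Function.update (fun _ : Fin k => lineFrame L x x) i
            (D.preq.cov (lineFrame L x) x (X x)))) ⊗ₜ[ℂ] lineFrame δ x x
        + (PiTensorProduct.tprod ℂ (fun _ : Fin k => lineFrame L x x)) ⊗ₜ[ℂ]
            D.lieHalf j X (lineFrame δ x) x)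

/-- `Op_k(f) = f + (ik)⁻¹ (∇_X^{L^k} ⊗ id + id ⊗ D_X)`, with `X` the Hamiltonian vector field of
`f`. -/
def Op (k : ℕ) (f : M → ℝ) (j : CompatACS D.form) (s : Sec L δ k) : Sec L δ k := fun x =>
  (f x : ℂ) • s x + (1 / (Complex.I * (k : ℂ))) • D.nabla k j (hamVF D.form f) s x

/-! ### Quantum spaces -/

theorem coord_mdifferentiableAt {k : ℕ} {s : Sec L δ k} (hs : s ∈ PSpace n L δ k) (x : M) :
    MDifferentiableAt 𝓘(ℝ, Model n) 𝓘(ℝ, ℂ) (fun y => pCoord L δ k x y (s y)) x := by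
  have hx : ((trivializationAt ℂ L x).baseSet ∩ (trivializationAt ℂ δ x).baseSet) ∈ 𝓝 x :=
    Filter.inter_mem
      ((trivializationAt ℂ L x).open_baseSet.mem_nhds (mem_baseSet_trivializationAt ℂ L x))
      ((trivializationAt ℂ δ x).open_baseSet.mem_nhds (mem_baseSet_trivializationAt ℂ δ x))
  exact ((hs x).contMDiffAt hx).mdifferentiableAt (by simp)

theorem nabla_add {k : ℕ} (j : CompatACS D.form) (X : VF n M) {s t : Sec L δ k}
    (hs : s ∈ PSpace n L δ k) (ht : t ∈ PSpace n L δ k) (x : M) :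
    D.nabla k j X (s + t) x = D.nabla k j X s x + D.nabla k j X t x := by
  have h : (fun y => pCoord L δ k x y ((s + t) y)) =
      (fun y => pCoord L δ k x y (s y)) + fun y => pCoord L δ k x y (t y) := by
    funext y
    simp
  have h2 : dirDeriv X (fun y => pCoord L δ k x y ((s + t) y)) x
      = dirDeriv X (fun y => pCoord L δ k x y (s y)) x
        + dirDeriv X (fun y => pCoord L δ k x y (t y)) x := by
    simp only [dirDeriv]
    rw [h, mvfderiv_add (coord_mdifferentiableAt hs x) (coord_mdifferentiableAt ht x)]
    rfl
  simp only [nabla]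
  rw [h2]
  simp only [Pi.add_apply, map_add, add_smul]
  abel

theorem nabla_smul {k : ℕ} (j : CompatACS D.form) (X : VF n M) (c : ℂ) {s : Sec L δ k}
    (hs : s ∈ PSpace n L δ k) (x : M) :
    D.nabla k j X (c • s) x = c • D.nabla k j X s x := by
  have h : (fun y => pCoord L δ k x y ((c • s) y)) =
      (ContinuousLinearMap.mul ℝ ℂ c) ∘ (fun y => pCoord L δ k x y (s y)) := by
    funext y
    simp
  have h2 : dirDeriv X (fun y => pCoord L δ k x y ((c • s) y)) x
      = c • dirDeriv X (fun y => pCoord L δ k x y (s y)) x := by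
    simp only [dirDeriv]
    rw [h]
    have := ((ContinuousLinearMap.mul ℝ ℂ c).hasMFDerivAt.comp x
      (coord_mdifferentiableAt hs x).hasMFDerivAt).mfderiv
    simp only [mvfderiv]
    rw [this]
    rfl
  simp only [nabla]
  rw [h2]
  simp only [Pi.smul_apply, map_smul, smul_add, smul_smul, smul_eq_mul]

/-- The quantum space at `j`: holomorphic sections of `L^k ⊗ δ_j`, that is, smooth sections with
`∇_X s + i ∇_{jX} s = 0` for all vector fields `X`. The holomorphic structure of `δ_j` is the one
for which `φ_j` is an isomorphism of holomorphic bundles: on forms `κ` of type `(n, 0)`, the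
derivative `L_Z κ` along a complex field `Z = X + i jX` of type `(0, 1)` is `ι_Z dκ = ι_Z ∂̄κ`. -/
def QSpace (k : ℕ) (j : CompatACS D.form) : Submodule ℂ (Sec L δ k) where
  carrier := {s | s ∈ PSpace n L δ k ∧ ∀ X : VF n M, SmoothVF X → ∀ x,
    D.nabla k j X s x + Complex.I • D.nabla k j (fun y => j y (X y)) s x = 0}
  add_mem' := by
    rintro s t ⟨hs, hs'⟩ ⟨ht, ht'⟩
    refine ⟨Submodule.add_mem _ hs ht, fun X hX x => ?_⟩
    rw [D.nabla_add j _ hs ht, D.nabla_add j _ hs ht, smul_add, add_add_add_comm,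
      hs' X hX x, ht' X hX x, add_zero]
  zero_mem' := by
    refine ⟨Submodule.zero_mem _, fun X hX x => ?_⟩
    have h : ∀ Y : VF n M, D.nabla k j Y (0 : Sec L δ k) x = 0 := fun Y => by
      have := D.nabla_smul j Y 0 (Submodule.zero_mem (PSpace n L δ k)) x
      simpa using this
    rw [h, h, smul_zero, add_zero]
  smul_mem' := by
    rintro c s ⟨hs, hs'⟩
    refine ⟨Submodule.smul_mem _ c hs, fun X hX x => ?_⟩
    rw [D.nabla_smul j _ c hs, D.nabla_smul j _ c hs, smul_comm Complex.I c, ← smul_add,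
      hs' X hX x, smul_zero]

/-- The Hermitian metric of `L^k ⊗ δ_j`; the one of `δ_j` is such that `φ_j` is an isomorphism of
Hermitian bundles. -/
def hermP (k : ℕ) (j : CompatACS D.form) (s t : Sec L δ k) (x : M) : ℂ :=
  pCoord L δ k x x (s x) * conj (pCoord L δ k x x (t x))
    * (D.preq.herm x (lineFrame L x x) (lineFrame L x x)) ^ k
    * (normN0 D.form j x (D.phi j x (lineFrame δ x x ⊗ₜ[ℂ] lineFrame δ x x)) : ℂ)

/-- The scalar product of sections of `L^k ⊗ δ_j`. -/
def scalarP [MeasurableSpace M] (k : ℕ) (j : CompatACS D.form) (s t : Sec L δ k) : ℂ :=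
  ∫ x, D.hermP k j s t x ∂(liouville D.form)

/-- The orthogonal projector `Π_{k, j}` onto the quantum space at `j`. -/
def proj [MeasurableSpace M] (k : ℕ) (j : CompatACS D.form) (s : Sec L δ k) : Sec L δ k :=
  Classical.epsilon fun q : Sec L δ k =>
    q ∈ D.QSpace k j ∧ ∀ r ∈ D.QSpace k j, D.scalarP k j (s - q) r = 0

/-- The operator `Q_k(f) = Π_{k, j} Op_k(f)` of the quantum space at `j`. -/
def QOp [MeasurableSpace M] (k : ℕ) (f : M → ℝ) (j : CompatACS D.form) (s : Sec L δ k) :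
    Sec L δ k :=
  D.proj k j (D.Op k f j s)

/-! ### Connections and curvatures -/

/-- `c` is a continuous family of half-form bundle morphisms `Ψ_t : δ_{γ t₀} → δ_{γ t}` starting at
the identity for `t = t₀`. As `δ_{γ t₀} = δ = δ_{γ t}`, the morphism `Ψ_t` is multiplication by a
function `c t`; it has to satisfy `φ_{γ t} ∘ Ψ_t² = Ψ_{γ t₀, γ t} ∘ φ_{γ t₀}`. -/
structure IsHalfFormFamily (γ : ℝ → CompatACS D.form) (t₀ : ℝ) (c : ℝ → M → ℂ) : Prop where
  cont : Continuous (fun z : ℝ × M => c z.1 z.2)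
  init : ∀ x, c t₀ x = 1
  morph : ∀ t x (τ : δ x ⊗[ℂ] δ x),
    D.phi (γ t) x ((c t x) ^ 2 • τ) = Psi (γ t₀ x) (γ t x) (D.phi (γ t₀) x τ)

/-- The covariant derivative at `t₀` of a section `Φ` over the curve `γ` for the connection of the
bundle of prequantum spaces: the derivative of `Ψ_t⁻¹ Φ(t)` at `t = t₀`. -/
def covDerivP (k : ℕ) (γ : ℝ → CompatACS D.form) (Φ : ℝ → Sec L δ k) (t₀ : ℝ) : Sec L δ k :=
  fun x => deriv (fun t => pCoord L δ k x x
    ((Classical.epsilon (D.IsHalfFormFamily γ t₀) t x)⁻¹ • Φ t x)) t₀ • pFrame L δ k x x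

/-- Covariant derivative along a two-parameter family, in the direction of the first parameter. -/
def covP₁ (k : ℕ) (p : ℝ × ℝ → CompatACS D.form) (Φ : ℝ × ℝ → Sec L δ k) :
    ℝ × ℝ → Sec L δ k :=
  fun u => D.covDerivP k (fun t => p (t, u.2)) (fun t => Φ (t, u.2)) u.1

/-- Covariant derivative along a two-parameter family, in the direction of the second parameter. -/
def covP₂ (k : ℕ) (p : ℝ × ℝ → CompatACS D.form) (Φ : ℝ × ℝ → Sec L δ k) :
    ℝ × ℝ → Sec L δ k :=
  fun u => D.covDerivP k (fun t => p (u.1, t)) (fun t => Φ (u.1, t)) u.2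

/-- The covariant derivative `Π_k ∘ ∇^P` of the bundle of quantum spaces, in the direction of the
first parameter. -/
def covQ₁ [MeasurableSpace M] (k : ℕ) (p : ℝ × ℝ → CompatACS D.form)
    (Φ : ℝ × ℝ → Sec L δ k) : ℝ × ℝ → Sec L δ k :=
  fun u => D.proj k (p u) (D.covP₁ k p Φ u)

/-- The covariant derivative `Π_k ∘ ∇^P` of the bundle of quantum spaces, in the direction of the
second parameter. -/
def covQ₂ [MeasurableSpace M] (k : ℕ) (p : ℝ × ℝ → CompatACS D.form)
    (Φ : ℝ × ℝ → Sec L δ k) : ℝ × ℝ → Sec L δ k :=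
  fun u => D.proj k (p u) (D.covP₂ k p Φ u)

/-- `R` is the curvature at `j`, evaluated at the tangent vectors `η` and `μ`, of the connection of
the bundle of prequantum spaces: `R Φ = (∇_s ∇_t - ∇_t ∇_s) Φ` at the origin, for every smooth
two-parameter family of almost complex structures with velocities `η` and `μ` at `j`, and every
smooth family of sections `Φ` over it. -/
structure IsCurvatureP (k : ℕ) (j : CompatACS D.form) (η μ : EndField n M)
    (R : PSpace n L δ k →ₗ[ℂ] PSpace n L δ k) : Prop where
  nonempty : ∃ p : ℝ × ℝ → CompatACS D.form, IsSurfaceAt p j η μ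
  eq : ∀ p : ℝ × ℝ → CompatACS D.form, IsSurfaceAt p j η μ →
    ∀ Φ : ℝ × ℝ → Sec L δ k, SmoothSecSurface n Φ →
      ∀ s : PSpace n L δ k, Φ (0, 0) = s →
        (R s : Sec L δ k) = D.covP₁ k p (D.covP₂ k p Φ) (0, 0)
          - D.covP₂ k p (D.covP₁ k p Φ) (0, 0)

/-- The quantum spaces form a smooth subbundle, of finite rank, of the bundle of prequantum spaces
over `S`: over smooth families in `S`, there exist local frames of smooth sections. -/
def IsSubbundle (k : ℕ) (S : Set (CompatACS D.form)) : Prop :=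
  ∀ p : ℝ × ℝ → CompatACS D.form, SmoothSurface p → (∀ u, p u ∈ S) → ∀ u₀ : ℝ × ℝ,
    ∃ (d : ℕ) (σ : Fin d → ℝ × ℝ → Sec L δ k), (∀ a, SmoothSecSurface n (σ a)) ∧
      ∀ᶠ u in 𝓝 u₀, LinearIndependent ℂ (fun a => σ a u) ∧
        Submodule.span ℂ (range (fun a => σ a u)) = D.QSpace k (p u)

/-- `R` is the curvature at `j`, evaluated at the tangent vectors `η` and `μ` of `S`, of the
connection `Π_k ∘ ∇^P` of the bundle of quantum spaces over `S`. -/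
structure IsCurvatureQ [MeasurableSpace M] (k : ℕ) (S : Set (CompatACS D.form))
    (j : CompatACS D.form) (η μ : EndField n M)
    (R : D.QSpace k j →ₗ[ℂ] D.QSpace k j) : Prop where
  nonempty : ∃ p : ℝ × ℝ → CompatACS D.form, IsSurfaceAt p j η μ ∧ ∀ u, p u ∈ S
  eq : ∀ p : ℝ × ℝ → CompatACS D.form, IsSurfaceAt p j η μ → (∀ u, p u ∈ S) →
    ∀ Φ : ℝ × ℝ → Sec L δ k, SmoothSecSurface n Φ → (∀ u, Φ u ∈ D.QSpace k (p u)) →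
      ∀ s : D.QSpace k j, Φ (0, 0) = s →
        (R s : Sec L δ k) = D.covQ₁ k p (D.covQ₂ k p Φ) (0, 0)
          - D.covQ₂ k p (D.covQ₁ k p Φ) (0, 0)

end QuantData
end LineBundle
end GeomQuant

set_option linter.unusedSectionVars false
set_option linter.style.haveILetI false

open Function (update)
open Complex (I)

namespace GeomQuant

local notation "ℝ²" => ℝ × ℝ

local notation "𝓜[" n "]" => 𝓘(ℝ, Model n)

local notation "Smooth[" n "]" => ContMDiff 𝓘(ℝ, Model n) 𝓘(ℝ, ℝ) ∞

/-! ### Projectable vector fields and connections on forms in a vector space -/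

section Flat

variable {F E G : Type*} [NormedAddCommGroup F] [NormedSpace ℝ F]
  [NormedAddCommGroup E] [NormedSpace ℝ E] [NormedAddCommGroup G] [NormedSpace ℝ G] {n : ℕ}

/-- Derivative of a function on `F × E` along the vector field with constant component `c` in `F`
and component `X` in `E`. -/
def along (c : F) (X : F × E → E) (u : F × E → G) (z : F × E) : G := fderiv ℝ u z (c, X z)

/-- Partial derivative, in the direction of `E`, of the vector field `X`. -/
def vert (X : F × E → E) (z : F × E) : E →L[ℝ] E :=
  fderiv ℝ X z ∘L ContinuousLinearMap.inr ℝ F E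

/-- Lie derivative of the field of endomorphisms `J` along `(c, X)`. -/
def lieEnd (c : F) (X : F × E → E) (J : F × E → E →L[ℝ] E) (z : F × E) : E →L[ℝ] E :=
  along c X J z - vert X z * J z + J z * vert X z

/-- The endomorphism `-DX - J (L_X J) / 2`. -/
def connEnd (c : F) (X : F × E → E) (J : F × E → E →L[ℝ] E) (z : F × E) : E →L[ℝ] E :=
  -vert X z - (1 / 2 : ℝ) • (J z * lieEnd c X J z)

/-- The component in `E` of the bracket of the vector fields `(c, X)` and `(c', X')`. -/
def flatBracket (c : F) (X : F × E → E) (c' : F) (X' : F × E → E) (z : F × E) : E :=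
  along c X X' z - along c' X' X z

lemma curvature_identity {R : Type*} [Ring R] [Algebra ℝ R] {j a b c d g h p q : R}
    (hj : j * j = -1) (ha : a * j = -(j * a)) (hb : b * j = -(j * b)) :
    let ηx := a - g * j + j * g
    let ηy := b - h * j + j * h
    let k := p - q + h * g - g * h
    let Ax := -g - (1 / 2 : ℝ) • (j * ηx)
    let Ay := -h - (1 / 2 : ℝ) • (j * ηy)
    let dAy := -p - (1 / 2 : ℝ) • (a * ηy + j * (c - (p * j + h * a) + (a * h + j * p)))
    let dAx := -q - (1 / 2 : ℝ) • (b * ηx + j * (d - (q * j + g * b) + (b * g + j * q)))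
    dAy - dAx + (Ax * Ay - Ay * Ax) - (-k - (1 / 2 : ℝ) • (j * ((c - d) - k * j + j * k)))
      = -(1 / 4 : ℝ) • (ηx * ηy - ηy * ηx) := by
  have h1 : ∀ x : R, j * (j * x) = -x := fun x => by rw [← mul_assoc, hj, neg_one_mul]
  have h2 : ∀ x : R, a * (j * x) = -(j * (a * x)) := fun x => by
    rw [← mul_assoc, ha, neg_mul, mul_assoc]
  have h3 : ∀ x : R, b * (j * x) = -(j * (b * x)) := fun x => by
    rw [← mul_assoc, hb, neg_mul, mul_assoc]
  intro ηx ηy k Ax Ay dAy dAx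
  simp only [ηx, ηy, k, Ax, Ay, dAy, dAx, mul_add, add_mul, mul_sub, sub_mul, mul_neg, neg_mul,
    smul_mul_assoc, mul_smul_comm, mul_assoc, h1, h2, h3, smul_add, smul_sub, smul_neg]
  module

lemma two_le_infty : minSmoothness ℝ 2 ≤ (∞ : WithTop ℕ∞) := by
  rw [minSmoothness_of_isRCLikeNormedField]
  exact WithTop.coe_le_coe.2 (show (2 : ℕ∞) ≤ ⊤ from le_top)

lemma along_congr {c : F} {X : F × E → E} {u v : F × E → G} {z : F × E} (h : u =ᶠ[𝓝 z] v) :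
    along c X u z = along c X v z := by
  rw [along, along, h.fderiv_eq]

lemma along_mul {R : Type*} [NormedRing R] [NormedAlgebra ℝ R] {c : F} {X : F × E → E}
    {u v : F × E → R} {z : F × E} (hu : DifferentiableAt ℝ u z) (hv : DifferentiableAt ℝ v z) :
    along c X (fun y => u y * v y) z = along c X u z * v z + u z * along c X v z := by
  simp only [along]
  rw [fderiv_fun_mul' hu hv]
  simp [add_comm]

lemma along_add {c : F} {X : F × E → E} {u v : F × E → G} {z : F × E} (hu : DifferentiableAt ℝ u z)
    (hv : DifferentiableAt ℝ v z) :
    along c X (fun y => u y + v y) z = along c X u z + along c X v z := by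
  simp only [along]
  rw [fderiv_fun_add hu hv]; rfl

lemma along_sub {c : F} {X : F × E → E} {u v : F × E → G} {z : F × E} (hu : DifferentiableAt ℝ u z)
    (hv : DifferentiableAt ℝ v z) :
    along c X (fun y => u y - v y) z = along c X u z - along c X v z := by
  simp only [along]
  rw [fderiv_fun_sub hu hv]; rfl

lemma along_neg {c : F} {X : F × E → E} {u : F × E → G} {z : F × E} :
    along c X (fun y => -u y) z = -along c X u z := by
  simp only [along]
  rw [fderiv_fun_neg]; rfl

lemma along_const_smul {c : F} {X : F × E → E} {u : F × E → G} {z : F × E} (r : ℝ)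
    (hu : DifferentiableAt ℝ u z) : along c X (fun y => r • u y) z = r • along c X u z := by
  simp only [along]
  rw [fderiv_fun_const_smul hu]; rfl

lemma contDiffAt_along {c : F} {X : F × E → E} {u : F × E → G} {z : F × E} (hX : ContDiffAt ℝ ∞ X z)
    (hu : ContDiffAt ℝ ∞ u z) : ContDiffAt ℝ ∞ (along c X u) z :=
  (hu.fderiv_right (m := ∞) (by simp)).clm_apply (contDiffAt_const.prodMk hX)

lemma contDiffAt_vert {X : F × E → E} {z : F × E} (hX : ContDiffAt ℝ ∞ X z) :
    ContDiffAt ℝ ∞ (vert X) z :=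
  (hX.fderiv_right (m := ∞) (by simp)).clm_comp contDiffAt_const

lemma toDiffAt {H : Type*} [NormedAddCommGroup H] [NormedSpace ℝ H] {u : H → G} {z : H}
    (hu : ContDiffAt ℝ ∞ u z) : DifferentiableAt ℝ u z :=
  hu.differentiableAt (by simp)

lemma eventually_diffAt {H : Type*} [NormedAddCommGroup H] [NormedSpace ℝ H] {u : H → G} {z : H}
    (hu : ContDiffAt ℝ ∞ u z) : ∀ᶠ y in 𝓝 z, DifferentiableAt ℝ u y := by
  have := (hu.of_le (m := 1) (by exact_mod_cast le_top)).eventually (by simp)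
  exact this.mono fun y hy => hy.differentiableAt (by simp)

lemma contDiffAt_lieEnd {c : F} {X : F × E → E} {J : F × E → E →L[ℝ] E} {z : F × E}
    (hX : ContDiffAt ℝ ∞ X z) (hJ : ContDiffAt ℝ ∞ J z) : ContDiffAt ℝ ∞ (lieEnd c X J) z :=
  ((contDiffAt_along hX hJ).sub ((contDiffAt_vert hX).clm_comp hJ)).add
    (hJ.clm_comp (contDiffAt_vert hX))

lemma contDiffAt_connEnd {c : F} {X : F × E → E} {J : F × E → E →L[ℝ] E} {z : F × E}
    (hX : ContDiffAt ℝ ∞ X z) (hJ : ContDiffAt ℝ ∞ J z) : ContDiffAt ℝ ∞ (connEnd c X J) z :=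
  (contDiffAt_vert hX).neg.sub ((hJ.clm_comp (contDiffAt_lieEnd hX hJ)).const_smul (1 / 2 : ℝ))

lemma contDiffAt_flatBracket {c c' : F} {X X' : F × E → E} {z : F × E} (hX : ContDiffAt ℝ ∞ X z)
    (hX' : ContDiffAt ℝ ∞ X' z) : ContDiffAt ℝ ∞ (flatBracket c X c' X') z :=
  (contDiffAt_along hX hX').sub (contDiffAt_along hX' hX)

lemma along_along {c c' : F} {X X' : F × E → E} {u : F × E → G} {z : F × E}
    (hX' : DifferentiableAt ℝ X' z) (hu : ContDiffAt ℝ ∞ u z) : along c X (along c' X' u) z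
      = fderiv ℝ (fderiv ℝ u) z (c, X z) (c', X' z) + fderiv ℝ u z (0, along c X X' z) := by
  have h1 : HasFDerivAt (fderiv ℝ u) (fderiv ℝ (fderiv ℝ u) z) z :=
    (toDiffAt (hu.fderiv_right (m := ∞) (by simp))).hasFDerivAt
  have h2 : HasFDerivAt (fun y => (c', X' y)) ((0 : F × E →L[ℝ] F).prod (fderiv ℝ X' z)) z :=
    (hasFDerivAt_const c' z).prodMk hX'.hasFDerivAt
  have := (h1.clm_apply h2).fderiv
  rw [along, show along c' X' u = fun y => fderiv ℝ u y (c', X' y) from rfl, this]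
  simp [along, add_comm]

lemma along_commutator {c c' : F} {X X' : F × E → E} {u : F × E → G} {z : F × E}
    (hX : DifferentiableAt ℝ X z) (hX' : DifferentiableAt ℝ X' z) (hu : ContDiffAt ℝ ∞ u z) :
    along c X (along c' X' u) z - along c' X' (along c X u) z
      = along 0 (flatBracket c X c' X') u z := by
  rw [along_along hX' hu, along_along hX hu]
  have h : IsSymmSndFDerivAt ℝ u z := hu.isSymmSndFDerivAt two_le_infty
  rw [h.eq (c, X z) (c', X' z)]
  simp only [along, flatBracket]
  have : ∀ a b : E, ((0 : F), a - b) = (0, a) - (0, b) := fun a b => by simp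
  rw [this, map_sub]
  abel

lemma along_vert {c : F} {X X' : F × E → E} {z : F × E} (hX' : ContDiffAt ℝ ∞ X' z) :
    along c X (vert X') z = fderiv ℝ (fderiv ℝ X') z (c, X z) ∘L ContinuousLinearMap.inr ℝ F E := by
  have h1 : HasFDerivAt (fderiv ℝ X') (fderiv ℝ (fderiv ℝ X') z) z :=
    (toDiffAt (hX'.fderiv_right (m := ∞) (by simp))).hasFDerivAt
  have := (h1.clm_comp (hasFDerivAt_const (ContinuousLinearMap.inr ℝ F E) z)).fderiv
  rw [along, show vert X' = fun y => (fderiv ℝ X' y) ∘L ContinuousLinearMap.inr ℝ F E from rfl,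
    this]
  ext v
  simp

lemma vert_along {c : F} {X X' : F × E → E} {z : F × E} (hX : DifferentiableAt ℝ X z)
    (hX' : ContDiffAt ℝ ∞ X' z) :
    vert (along c X X') z = along c X (vert X') z + vert X' z * vert X z := by
  have h1 : HasFDerivAt (fderiv ℝ X') (fderiv ℝ (fderiv ℝ X') z) z :=
    (toDiffAt (hX'.fderiv_right (m := ∞) (by simp))).hasFDerivAt
  have h2 : HasFDerivAt (fun y => (c, X y)) ((0 : F × E →L[ℝ] F).prod (fderiv ℝ X z)) z :=
    (hasFDerivAt_const c z).prodMk hX.hasFDerivAt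
  have h3 := (h1.clm_apply h2).fderiv
  have h : IsSymmSndFDerivAt ℝ X' z := hX'.isSymmSndFDerivAt two_le_infty
  rw [along_vert hX']
  ext v
  have : vert (along c X X') z v = fderiv ℝ (along c X X') z (0, v) := rfl
  rw [this, show along c X X' = fun y => fderiv ℝ X' y (c, X y) from rfl, h3]
  simp [vert, h.eq (c, X z) (0, v), add_comm]

lemma vert_flatBracket {c c' : F} {X X' : F × E → E} {z : F × E} (hX : ContDiffAt ℝ ∞ X z)
    (hX' : ContDiffAt ℝ ∞ X' z) :
    vert (flatBracket c X c' X') z = along c X (vert X') z - along c' X' (vert X) z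
      + vert X' z * vert X z - vert X z * vert X' z := by
  have : vert (flatBracket c X c' X') z = vert (along c X X') z - vert (along c' X' X) z := by
    simp only [vert]
    rw [show flatBracket c X c' X' = fun y => along c X X' y - along c' X' X y from rfl,
      fderiv_fun_sub (toDiffAt (contDiffAt_along hX hX'))
        (toDiffAt (contDiffAt_along hX' hX))]
    rfl
  rw [this, vert_along (toDiffAt hX) hX', vert_along (toDiffAt hX') hX]
  abel

lemma connEnd_curvature {c c' : F} {X X' : F × E → E} {J : F × E → E →L[ℝ] E} {z : F × E}
    (hX : ContDiffAt ℝ ∞ X z) (hX' : ContDiffAt ℝ ∞ X' z) (hJ : ContDiffAt ℝ ∞ J z)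
    (hsq : ∀ᶠ y in 𝓝 z, J y * J y = -1) :
    along c X (connEnd c' X' J) z - along c' X' (connEnd c X J) z
      + (connEnd c X J z * connEnd c' X' J z - connEnd c' X' J z * connEnd c X J z)
      - connEnd 0 (flatBracket c X c' X') J z
      = -(1 / 4 : ℝ) • (lieEnd c X J z * lieEnd c' X' J z - lieEnd c' X' J z * lieEnd c X J z) := by
  have hJd := eventually_diffAt hJ
  have sq1 : ∀ (e : F) (Y : F × E → E), ∀ᶠ y in 𝓝 z, along e Y J y * J y + J y * along e Y J y = 0 := by
    intro e Y
    filter_upwards [hsq.eventually_nhds, hJd] with y hy hd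
    rw [← along_mul hd hd, along_congr (v := fun _ => (-1 : E →L[ℝ] E)) hy]
    simp [along]
  have dX := toDiffAt hX
  have dX' := toDiffAt hX'
  have dJ := toDiffAt hJ
  have key : ∀ (e : F) (Y : F × E → E) (e' : F) (Y' : F × E → E), ContDiffAt ℝ ∞ Y' z →
      along e Y (connEnd e' Y' J) z = -along e Y (vert Y') z - (1 / 2 : ℝ) •
        (along e Y J z * lieEnd e' Y' J z + J z * (along e Y (along e' Y' J) z
          - (along e Y (vert Y') z * J z + vert Y' z * along e Y J z)
          + (along e Y J z * vert Y' z + J z * along e Y (vert Y') z))) := by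
    intro e Y e' Y' hY'
    have d1 := toDiffAt (contDiffAt_vert hY')
    have d2 := toDiffAt (contDiffAt_lieEnd (c := e') hY' hJ)
    have d3 := toDiffAt (contDiffAt_along (c := e') hY' hJ)
    rw [show connEnd e' Y' J = fun y => -vert Y' y - (1 / 2 : ℝ) • (J y * lieEnd e' Y' J y)
      from rfl, along_sub d1.fun_neg ((dJ.fun_mul d2).fun_const_smul _), along_neg,
      along_const_smul _ (dJ.fun_mul d2), along_mul dJ d2]
    rw [show lieEnd e' Y' J = fun y => along e' Y' J y - vert Y' y * J y + J y * vert Y' y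
      from rfl, along_add (d3.fun_sub (d1.fun_mul dJ)) (dJ.fun_mul d1), along_sub d3 (d1.fun_mul dJ),
      along_mul d1 dJ, along_mul dJ d1]
  rw [key c X c' X' hX', key c' X' c X hX]
  have hb : connEnd 0 (flatBracket c X c' X') J z
      = -(vert (flatBracket c X c' X') z) - (1 / 2 : ℝ) • (J z *
        ((along c X (along c' X' J) z - along c' X' (along c X J) z)
          - vert (flatBracket c X c' X') z * J z + J z * vert (flatBracket c X c' X') z)) := by
    rw [along_commutator dX dX' hJ]; rfl
  rw [hb, vert_flatBracket hX hX']
  exact curvature_identity hsq.self_of_nhds (eq_neg_of_add_eq_zero_left (sq1 c X).self_of_nhds)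
    (eq_neg_of_add_eq_zero_left (sq1 c' X').self_of_nhds)

end Flat

section FormCalculus

variable {V : Type*} [AddCommGroup V] [Module ℝ V] {n : ℕ}

/-- Action of an endomorphism on forms, as a derivation. -/
def act (α : V [⋀^Fin n]→ₗ[ℝ] ℂ) (K : V → V) (v : Fin n → V) : ℂ :=
  ∑ a, α (update v a (K (v a)))

lemma act_add (α : V [⋀^Fin n]→ₗ[ℝ] ℂ) (K K' : V → V) (v : Fin n → V) :
    act α (fun x => K x + K' x) v = act α K v + act α K' v := by
  simp [act, Finset.sum_add_distrib]

lemma act_sub (α : V [⋀^Fin n]→ₗ[ℝ] ℂ) (K K' : V → V) (v : Fin n → V) :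
    act α (fun x => K x - K' x) v = act α K v - act α K' v := by
  simp [act, Finset.sum_sub_distrib]

lemma act_neg (α : V [⋀^Fin n]→ₗ[ℝ] ℂ) (K : V → V) (v : Fin n → V) :
    act α (fun x => -K x) v = -act α K v := by
  simp [act]

lemma act_smul (α : V [⋀^Fin n]→ₗ[ℝ] ℂ) (r : ℝ) (K : V → V) (v : Fin n → V) :
    act α (fun x => r • K x) v = r • act α K v := by
  simp [act, Finset.mul_sum]

lemma act_smul_left (α : V [⋀^Fin n]→ₗ[ℝ] ℂ) (r : ℂ) (K : V → V) (v : Fin n → V) :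
    act (r • α) K v = r * act α K v := by
  simp [act, Finset.mul_sum]

lemma act_act_sub (α : V [⋀^Fin n]→ₗ[ℝ] ℂ) (K L : V → V) (v : Fin n → V) :
    ∑ b, act α K (update v b (L (v b))) - ∑ b, act α L (update v b (K (v b)))
      = act α (fun x => K (L x)) v - act α (fun x => L (K x)) v := by
  have h : ∀ K L : V → V, ∑ b, act α K (update v b (L (v b)))
      = act α (fun x => K (L x)) v + ∑ b, ∑ a ∈ Finset.univ.erase b,
        α (update (update v b (L (v b))) a (K (v a))) := by
    intro K L
    simp only [act]
    rw [← Finset.sum_add_distrib]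
    refine Finset.sum_congr rfl fun b _ => ?_
    rw [← Finset.add_sum_erase _ _ (Finset.mem_univ b)]
    congr 1
    · simp
    · refine Finset.sum_congr rfl fun a ha => ?_
      rw [Function.update_of_ne (Finset.ne_of_mem_erase ha)]
  rw [h K L, h L K]
  have h2 : ∑ b, ∑ a ∈ Finset.univ.erase b,
      α (update (update v b (L (v b))) a (K (v a)))
      = ∑ b, ∑ a ∈ Finset.univ.erase b,
      α (update (update v b (K (v b))) a (L (v a))) := by
    rw [Finset.sum_comm' (t' := Finset.univ) (s' := fun a => Finset.univ.erase a)]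
    · refine Finset.sum_congr rfl fun b _ => Finset.sum_congr rfl fun a ha => ?_
      rw [Function.update_comm (Finset.ne_of_mem_erase ha).symm]
    · intro a b
      simp [ne_comm]
  rw [h2]
  ring

lemma alternatingMap_expand {ι : Type*} [Fintype ι] (b : Module.Basis ι ℝ V)
    (α : V [⋀^Fin n]→ₗ[ℝ] ℂ) (w : Fin n → V) :
    α w = ∑ r : Fin n → ι, (∏ i, b.repr (w i) (r i)) • α (fun i => b (r i)) := by
  classical
  conv_lhs => rw [show w = fun i => ∑ j, b.repr (w i) j • b j from
    funext fun i => (b.sum_repr (w i)).symm]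
  have := α.toMultilinearMap.map_sum (fun i j => b.repr (w i) j • b j)
  simp only [AlternatingMap.coe_multilinearMap] at this
  rw [this]
  refine Finset.sum_congr rfl fun r _ => ?_
  exact α.toMultilinearMap.map_smul_univ (fun i => b.repr (w i) (r i)) (fun i => b (r i))

end FormCalculus

section FormSmooth

variable {H E : Type*} [NormedAddCommGroup H] [NormedSpace ℝ H]
  [NormedAddCommGroup E] [NormedSpace ℝ E] [FiniteDimensional ℝ E] {n : ℕ}

/-- Forms depending smoothly on a parameter `z`. -/
def SmoothFormAt (α : H → E [⋀^Fin n]→ₗ[ℝ] ℂ) (z : H) : Prop :=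
  ∀ v, ContDiffAt ℝ ∞ (fun y => α y v) z

lemma contDiffAt_coord {ι : Type*} (b : Module.Basis ι ℝ E) (i : ι) {w : H → E} {z : H}
    (hw : ContDiffAt ℝ ∞ w z) : ContDiffAt ℝ ∞ (fun y => b.repr (w y) i) z :=
  (LinearMap.toContinuousLinearMap (b.coord i)).contDiff.contDiffAt.comp z hw

lemma SmoothFormAt.apply {α : H → E [⋀^Fin n]→ₗ[ℝ] ℂ} {z : H} (hα : SmoothFormAt α z)
    {w : Fin n → H → E} (hw : ∀ i, ContDiffAt ℝ ∞ (w i) z) :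
    ContDiffAt ℝ ∞ (fun y => α y (fun i => w i y)) z := by
  let b := Module.finBasis ℝ E
  have : (fun y => α y (fun i => w i y)) = fun y => ∑ r : Fin n → Fin (Module.finrank ℝ E),
      (∏ i, b.repr (w i y) (r i)) • α y (fun i => b (r i)) :=
    funext fun y => alternatingMap_expand b (α y) _
  rw [this]
  exact ContDiffAt.sum fun r _ =>
    (contDiffAt_prod fun i _ => contDiffAt_coord b (r i) (hw i)).fun_smul (hα _)

/-- The continuous multilinear map underlying a form on a finite dimensional space. -/
def formToCMM (α : E [⋀^Fin n]→ₗ[ℝ] ℂ) : ContinuousMultilinearMap ℝ (fun _ : Fin n => E) ℂ where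
  toMultilinearMap := α.toMultilinearMap
  cont := by
    let b := Module.finBasis ℝ E
    have : (fun w => α w) = fun w : Fin n → E => ∑ r : Fin n → Fin (Module.finrank ℝ E),
        (∏ i, b.repr (w i) (r i)) • α (fun i => b (r i)) :=
      funext fun w => alternatingMap_expand b α w
    change Continuous fun w => α w
    rw [this]
    refine continuous_finsetSum _ fun r _ => Continuous.fun_smul
      (continuous_finsetProd _ fun i _ => ?_) continuous_const
    exact (LinearMap.continuous_of_finiteDimensional (b.coord (r i))).comp (continuous_apply i)

lemma SmoothFormAt.differentiableAt_formToCMM {α : H → E [⋀^Fin n]→ₗ[ℝ] ℂ} {z : H}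
    (hα : SmoothFormAt α z) : DifferentiableAt ℝ (fun y => formToCMM (α y)) z := by
  let b := Module.finBasis ℝ E
  let T : ContinuousMultilinearMap ℝ (fun _ : Fin n => E) ℂ →ₗ[ℝ]
      ((Fin n → Fin (Module.finrank ℝ E)) → ℂ) :=
    { toFun := fun f r => f (fun i => b (r i)), map_add' := fun _ _ => rfl, map_smul' := fun _ _ => rfl }
  have hT : LinearMap.ker T = ⊥ := by
    rw [LinearMap.ker_eq_bot]
    intro f g hfg
    apply ContinuousMultilinearMap.toMultilinearMap_injective
    exact Module.Basis.ext_multilinear (fun _ => b) fun r => congrFun hfg r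
  obtain ⟨L, hL⟩ := T.exists_leftInverse_of_injective hT
  have : (fun y => formToCMM (α y)) = fun y => LinearMap.toContinuousLinearMap L
      (fun r => α y (fun i => b (r i))) := by
    funext y
    exact (LinearMap.congr_fun hL (formToCMM (α y))).symm
  rw [this]
  exact (LinearMap.toContinuousLinearMap L).differentiableAt.comp z
    (differentiableAt_pi.2 fun r => toDiffAt (hα _))

lemma SmoothFormAt.fderiv_apply {α : H → E [⋀^Fin n]→ₗ[ℝ] ℂ} {z : H} (hα : SmoothFormAt α z)
    {w : Fin n → H → E} (hw : ∀ i, DifferentiableAt ℝ (w i) z) (ξ : H) :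
    fderiv ℝ (fun y => α y (fun i => w i y)) z ξ = fderiv ℝ (fun y => α y (fun i => w i z)) z ξ
      + ∑ i, α z (update (fun i => w i z) i (fderiv ℝ (w i) z ξ)) := by
  have h1 := hα.differentiableAt_formToCMM.hasFDerivAt
  have h2 := (h1.continuousMultilinearMap_apply fun i => (hw i).hasFDerivAt).fderiv
  have h3 := (h1.continuousMultilinearMap_apply fun i =>
    (hasFDerivAt_const (𝕜 := ℝ) (w i z) z)).fderiv
  have e2 : (fun y => α y (fun i => w i y)) = fun y => formToCMM (α y) (fun i => w i y) := rfl
  have e3 : (fun y => α y (fun i => w i z)) = fun y => formToCMM (α y) (fun i => w i z) := rfl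
  rw [e2, e3, h2, h3]
  simp
  rfl

end FormSmooth

section FlatForms

variable {F E : Type*} [NormedAddCommGroup F] [NormedSpace ℝ F]
  [NormedAddCommGroup E] [NormedSpace ℝ E] [FiniteDimensional ℝ E] {n : ℕ}

lemma SmoothFormAt.along_update {α : F × E → E [⋀^Fin n]→ₗ[ℝ] ℂ} {z : F × E} (hα : SmoothFormAt α z)
    {c : F} {X : F × E → E} {K : F × E → E →L[ℝ] E} (hK : DifferentiableAt ℝ K z) (v : Fin n → E)
    (a : Fin n) : along c X (fun y => α y (update v a (K y (v a)))) z
      = along c X (fun y => α y (update v a (K z (v a)))) z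
        + α z (update v a (along c X K z (v a))) := by
  have hw : ∀ i, DifferentiableAt ℝ (fun y => update v a (K y (v a)) i) z := by
    intro i
    rcases eq_or_ne i a with rfl | hi
    · simpa using hK.clm_apply (differentiableAt_const _)
    · simp [hi]
  have h := hα.fderiv_apply hw (c, X z)
  simp only [along]
  have e : ∀ y, (fun i => update v a (K y (v a)) i) = update v a (K y (v a)) :=
    fun y => rfl
  simp only [e] at h
  rw [h]
  congr 1
  rw [Finset.sum_eq_single a]
  · simp only [Function.update_self, Function.update_idem]
    rw [fderiv_clm_apply hK (differentiableAt_const _)]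
    simp
  · intro i _ hi
    have : (fun y => update v a (K y (v a)) i) = fun _ => v i := by
      funext y; simp [hi]
    rw [this]
    apply (α z).map_coord_zero i
    simp
  · simp

lemma SmoothFormAt.act {α : F × E → E [⋀^Fin n]→ₗ[ℝ] ℂ} {z : F × E} (hα : SmoothFormAt α z)
    {K : F × E → E →L[ℝ] E} (hK : ContDiffAt ℝ ∞ K z) (v : Fin n → E) :
    ContDiffAt ℝ ∞ (fun y => act (α y) (K y) v) z := by
  refine ContDiffAt.sum fun a _ => ?_
  refine hα.apply (w := fun i y => update v a (K y (v a)) i) fun i => ?_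
  rcases eq_or_ne i a with rfl | hi
  · simpa using hK.clm_apply contDiffAt_const
  · simpa [hi] using contDiffAt_const

lemma SmoothFormAt.along_act {α : F × E → E [⋀^Fin n]→ₗ[ℝ] ℂ} {z : F × E} (hα : SmoothFormAt α z)
    {c : F} {X : F × E → E} {K : F × E → E →L[ℝ] E} (hK : ContDiffAt ℝ ∞ K z) (v : Fin n → E) :
    along c X (fun y => GeomQuant.act (α y) (K y) v) z
      = ∑ a, along c X (fun y => α y (update v a (K z (v a)))) z
        + GeomQuant.act (α z) (along c X K z : E →L[ℝ] E) v := by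
  have : ∀ a, ContDiffAt ℝ ∞ (fun y => α y (update v a (K y (v a)))) z := by
    intro a
    refine hα.apply (w := fun i y => update v a (K y (v a)) i) fun i => ?_
    rcases eq_or_ne i a with rfl | hi
    · simpa using hK.clm_apply contDiffAt_const
    · simpa [hi] using contDiffAt_const
  simp only [GeomQuant.act]
  rw [← Finset.sum_add_distrib]
  simp_rw [← hα.along_update (toDiffAt hK) v]
  simp only [along]
  rw [fderiv_fun_sum fun a _ => toDiffAt (this a)]
  simp

/-- `θ` is the coefficient, at `z`, of the connection along `(c, X)`: the relation
`2 θ α = L α`, where `L` is the part of type `(n, 0)` of the Lie derivative. -/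
def IsConnCoeff (c : F) (X : F × E → E) (J : F × E → E →L[ℝ] E) (α : F × E → E [⋀^Fin n]→ₗ[ℝ] ℂ)
    (z : F × E) (θ : ℂ) : Prop :=
  ∀ v, 2 * θ * α z v = along c X (fun y => α y v) z - act (α z) (connEnd c X J z) v

lemma IsConnCoeff.unique {c : F} {X : F × E → E} {J : F × E → E →L[ℝ] E}
    {α : F × E → E [⋀^Fin n]→ₗ[ℝ] ℂ} {z : F × E} {θ θ' : ℂ} (h0 : α z ≠ 0)
    (h : IsConnCoeff c X J α z θ) (h' : IsConnCoeff c X J α z θ') : θ = θ' := by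
  obtain ⟨v, hv⟩ : ∃ v, α z v ≠ 0 := by
    by_contra! h1
    exact h0 (AlternatingMap.ext h1)
  have h1 := (h v).trans (h' v).symm
  have h2 := mul_right_cancel₀ hv h1
  exact mul_left_cancel₀ two_ne_zero h2

lemma IsConnCoeff.contDiffAt {c : F} {X : F × E → E} {J : F × E → E →L[ℝ] E}
    {α : F × E → E [⋀^Fin n]→ₗ[ℝ] ℂ} {z : F × E} {θ : F × E → ℂ} (h0 : α z ≠ 0)
    (hX : ContDiffAt ℝ ∞ X z) (hJ : ContDiffAt ℝ ∞ J z) (hα : SmoothFormAt α z)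
    (h : ∀ᶠ y in 𝓝 z, IsConnCoeff c X J α y (θ y)) : ContDiffAt ℝ ∞ θ z := by
  obtain ⟨v, hv⟩ : ∃ v, α z v ≠ 0 := by
    by_contra! h1
    exact h0 (AlternatingMap.ext h1)
  have hne := (hα v).continuousAt.eventually_ne hv
  have : θ =ᶠ[𝓝 z] fun y => (along c X (fun y => α y v) y - act (α y) (connEnd c X J y) v)
      * (2 * α y v)⁻¹ := by
    filter_upwards [h, hne] with y hy hy'
    rw [← hy v]
    field_simp
  refine ContDiffAt.congr_of_eventuallyEq ?_ this
  exact ((contDiffAt_along hX (hα v)).sub (hα.act (contDiffAt_connEnd hX hJ) v)).mul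
    ((contDiffAt_const.mul (hα v)).inv (mul_ne_zero two_ne_zero hv))

lemma IsConnCoeff.curvature {c c' : F} {X X' : F × E → E} {J : F × E → E →L[ℝ] E}
    {α : F × E → E [⋀^Fin n]→ₗ[ℝ] ℂ} {z : F × E} {θ θ' : F × E → ℂ} {θb : ℂ} (h0 : α z ≠ 0)
    (hX : ContDiffAt ℝ ∞ X z) (hX' : ContDiffAt ℝ ∞ X' z) (hJ : ContDiffAt ℝ ∞ J z)
    (hsq : ∀ᶠ y in 𝓝 z, J y * J y = -1) (hα : SmoothFormAt α z)
    (h : ∀ᶠ y in 𝓝 z, IsConnCoeff c X J α y (θ y))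
    (h' : ∀ᶠ y in 𝓝 z, IsConnCoeff c' X' J α y (θ' y))
    (hb : IsConnCoeff 0 (flatBracket c X c' X') J α z θb) (v : Fin n → E) :
    2 * (along c X θ' z - along c' X' θ z - θb) * α z v
      = (1 / 4 : ℝ) • act (α z)
        (lieEnd c X J z * lieEnd c' X' J z - lieEnd c' X' J z * lieEnd c X J z) v := by
  have hθ := toDiffAt (IsConnCoeff.contDiffAt h0 hX hJ hα h)
  have hθ' := toDiffAt (IsConnCoeff.contDiffAt h0 hX' hJ hα h')
  have key : ∀ (e : F) (Y : F × E → E) (e' : F) (Y' : F × E → E) (t t' : F × E → ℂ),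
      ContDiffAt ℝ ∞ Y z → ContDiffAt ℝ ∞ Y' z →
      DifferentiableAt ℝ t' z → (∀ᶠ y in 𝓝 z, IsConnCoeff e Y J α y (t y)) →
      (∀ᶠ y in 𝓝 z, IsConnCoeff e' Y' J α y (t' y)) →
      2 * along e Y t' z * α z v = along e Y (along e' Y' (fun y => α y v)) z
        - ∑ a, act (α z) (connEnd e Y J z) (update v a (connEnd e' Y' J z (v a)))
        - act (α z) (along e Y (connEnd e' Y' J) z : E →L[ℝ] E) v
        - 4 * t z * t' z * α z v - 2 * t z * act (α z) (connEnd e' Y' J z) v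
        - 2 * t' z * act (α z) (connEnd e Y J z) v := by
    intro e Y e' Y' t t' hY hY' dt' ht ht'
    have dα := toDiffAt (hα v)
    have h1 : along e Y (fun y => 2 * t' y * α y v) z
        = along e Y (fun y => along e' Y' (fun y => α y v) y - act (α y) (connEnd e' Y' J y) v) z :=
      along_congr (ht'.mono fun y hy => hy v)
    have hA := contDiffAt_connEnd (c := e') hY' hJ
    rw [along_sub (toDiffAt (contDiffAt_along hY' (hα v)))
      (toDiffAt (hα.act hA v)), hα.along_act hA, along_mul (dt'.const_mul 2) dα] at h1
    have h2 : along e Y (fun y => 2 * t' y) z = 2 * along e Y t' z := by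
      simp only [along]
      rw [fderiv_const_mul dt']
      rfl
    rw [h2] at h1
    have h3 : ∀ w, along e Y (fun y => α y w) z
        = 2 * t z * α z w + act (α z) (connEnd e Y J z) w := fun w => by
      rw [ht.self_of_nhds w]; ring
    simp only [h3, Finset.sum_add_distrib, ← Finset.mul_sum] at h1
    have h4 : ∑ a, α z (update v a (connEnd e' Y' J z (v a)))
      = act (α z) (connEnd e' Y' J z) v := rfl
    rw [h4] at h1
    linear_combination h1
  have k1 := key c X c' X' θ θ' hX hX' hθ' h h'
  have k2 := key c' X' c X θ' θ hX' hX hθ h' h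
  have k3 := along_commutator (c := c) (c' := c') (toDiffAt hX)
    (toDiffAt hX') (hα v)
  have k4 := hb v
  have k5 := act_act_sub (α z) (connEnd c X J z) (connEnd c' X' J z) v
  have k6 := connEnd_curvature (c := c) (c' := c') hX hX' hJ hsq
  have k7 : act (α z) (along c X (connEnd c' X' J) z : E →L[ℝ] E) v
        - act (α z) (along c' X' (connEnd c X J) z : E →L[ℝ] E) v
      + (act (α z) (fun x => connEnd c X J z (connEnd c' X' J z x)) v
        - act (α z) (fun x => connEnd c' X' J z (connEnd c X J z x)) v)
      - act (α z) (connEnd 0 (flatBracket c X c' X') J z) v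
      = -((1 / 4 : ℝ) • act (α z)
        (lieEnd c X J z * lieEnd c' X' J z - lieEnd c' X' J z * lieEnd c X J z) v) := by
    rw [← act_sub, ← act_sub, ← act_add, ← act_sub, ← act_smul, ← act_neg]
    congr 1
    funext x
    have := congrArg (fun T : E →L[ℝ] E => T x) k6
    simpa using this
  linear_combination k1 - k2 + k3 - k4 - k5 - k7

end FlatForms

section PsiFormula

variable {n : ℕ} {V : Type*} [AddCommGroup V] [Module ℝ V]

lemma typeN0_update {J : V → V} {α : V [⋀^Fin n]→ₗ[ℝ] ℂ} (hα : α ∈ typeN0 n J) (v : Fin n → V)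
    (a : Fin n) (w : V) : α (update v a (J w)) = I * α (update v a w) := by
  have := hα (update v a w) a
  simpa using this

/-- The value of a form on the `(1, 0)` parts of its arguments with indices in `ι₁` and on the
`(0, 1)` parts of its other arguments, where `ε a` is `-i` and `i` respectively, up to a power of
two. -/
def typeSum {ι : Type*} [Fintype ι] [DecidableEq ι] (j : V → V) (ε : ι → ℂ) (T : (ι → V) → ℂ)
    (w : ι → V) : ℂ :=
  ∑ S : Finset ι, (∏ i ∈ S, ε i) * T (S.piecewise (fun i => j (w i)) w)

lemma typeSum_eq_zero {ι : Type*} [Fintype ι] [DecidableEq ι] {j : V → V} {ε : ι → ℂ}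
    {T : (ι → V) → ℂ} (w : ι → V) (i : ι) (h : ∀ u : ι → V, ε i * T (update u i (j (u i))) = -T u) :
    typeSum j ε T w = 0 := by
  rw [typeSum, ← Finset.powerset_univ, ← Finset.insert_erase (Finset.mem_univ i),
    Finset.sum_powerset_insert (Finset.notMem_erase i _), ← Finset.sum_add_distrib]
  refine Finset.sum_eq_zero fun S hS => ?_
  have hi : i ∉ S := fun hi => Finset.notMem_erase i _ (Finset.mem_powerset.1 hS hi)
  rw [Finset.prod_insert hi, Finset.piecewise_insert]
  have := h (S.piecewise (fun i => j (w i)) w)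
  rw [Finset.piecewise_eq_of_notMem _ _ _ hi] at this
  linear_combination (∏ i ∈ S, ε i) * this

lemma typeSum_eq {ι : Type*} [Fintype ι] [DecidableEq ι] {j : V → V} {ε : ι → ℂ}
    (T : MultilinearMap ℝ (fun _ : ι => V) ℂ) (K : ι → V → V) (w : ι → V)
    (h : ∀ (i : ι) (u : ι → V) (x : V), ε i * T (update u i (j x)) = T (update u i (K i x))) :
    typeSum j ε T w = T (fun i => K i (w i) + w i) := by
  have : (fun i => K i (w i) + w i) = (fun i => K i (w i)) + w := rfl
  rw [this, T.map_add_univ, typeSum]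
  refine Finset.sum_congr rfl fun S _ => ?_
  suffices H : ∀ S' : Finset ι, S' ⊆ S → (∏ i ∈ S', ε i) * T (S.piecewise (fun i => j (w i)) w)
      = T (S'.piecewise (fun i => K i (w i)) (S.piecewise (fun i => j (w i)) w)) by
    rw [H S subset_rfl]
    congr 1
    funext i
    by_cases hi : i ∈ S <;> simp [hi]
  intro S'
  induction S' using Finset.induction_on with
  | empty => simp
  | insert i S' hi ih =>
    intro hS
    have hS' : S' ⊆ S := fun x hx => hS (Finset.mem_insert_of_mem hx)
    have hiS : i ∈ S := hS (Finset.mem_insert_self _ _)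
    rw [Finset.prod_insert hi, mul_assoc, ih hS', Finset.piecewise_insert, ← h]
    congr 2
    funext a
    rcases eq_or_ne a i with rfl | ha
    · simp [hi, hiS]
    · simp [ha]

lemma typeSum_sum {ι κ : Type*} [Fintype ι] [DecidableEq ι] (s : Finset κ) (j : V → V) (ε : ι → ℂ)
    (T : κ → (ι → V) → ℂ) (w : ι → V) :
    typeSum j ε (fun u => ∑ q ∈ s, T q u) w = ∑ q ∈ s, typeSum j ε (T q) w := by
  simp only [typeSum, Finset.mul_sum]
  rw [Finset.sum_comm]

lemma exists_inl_of_ne_one (σ : Equiv.Perm (Fin n ⊕ Fin n))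
    (hσ : (Quotient.mk'' σ : Equiv.Perm.ModSumCongr (Fin n) (Fin n)) ≠ Quotient.mk'' 1) :
    ∃ a b, σ (Sum.inr b) = Sum.inl a := by
  by_contra! hcon
  apply hσ
  have h1 : Set.MapsTo σ (Set.range Sum.inr) (Set.range (Sum.inr : Fin n → Fin n ⊕ Fin n)) := by
    rintro _ ⟨b, rfl⟩
    rcases h : σ (Sum.inr b) with a | c
    · exact absurd h (hcon a b)
    · exact ⟨c, rfl⟩
  have h3 := (Equiv.Perm.perm_mapsTo_inl_iff_mapsTo_inr σ).2 h1
  have h4 := Equiv.Perm.mem_sumCongrHom_range_of_perm_mapsTo_inl h3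
  refine Quotient.sound' ?_
  rw [QuotientGroup.leftRel_apply, mul_one]
  exact inv_mem h4

lemma wedge_typeSum {ja jb : V →ₗ[ℝ] V} {γ β : V [⋀^Fin n]→ₗ[ℝ] ℂ} (hγ : γ ∈ typeN0 n jb)
    (hβ : β ∈ typeN0 n ja) (v v' : Fin n → V) :
    typeSum ja (Sum.elim (fun _ : Fin n => -I) (fun _ : Fin n => I))
      (wedge γ (conjForm β)) (Sum.elim v v')
      = γ (fun a => v a - jb (ja (v a))) * conj (β (fun a => v' a + v' a)) := by
  have hI : I * I = -1 := Complex.I_mul_I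
  have e : (wedge γ (conjForm β) : (Fin n ⊕ Fin n → V) → ℂ)
      = fun u => ∑ q : Equiv.Perm.ModSumCongr (Fin n) (Fin n),
        LinearMap.mul' ℝ ℂ (AlternatingMap.domCoprod.summand γ (conjForm β) q u) := by
    funext u
    rw [wedge, LinearMap.compAlternatingMap_apply, AlternatingMap.domCoprod_apply,
      _root_.sum_apply, map_sum]
  rw [e, typeSum_sum]
  refine (Fintype.sum_eq_single (Quotient.mk'' 1 : Equiv.Perm.ModSumCongr (Fin n) (Fin n))
    ?_).trans ?_
  rotate_left
  · have e1 : (fun u => LinearMap.mul' ℝ ℂ (AlternatingMap.domCoprod.summand γ (conjForm β)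
        (Quotient.mk'' 1) u)) = ((LinearMap.mul' ℝ ℂ).compMultilinearMap
          (MultilinearMap.domCoprod (γ : MultilinearMap ℝ (fun _ : Fin n => V) ℂ)
            (conjForm β : MultilinearMap ℝ (fun _ : Fin n => V) ℂ))) := by
      funext u
      rw [AlternatingMap.domCoprod.summand_mk'']
      simp
    rw [e1, typeSum_eq _ (Sum.elim (fun _ x => -jb (ja x)) (fun _ x => x))]
    · simp only [LinearMap.compMultilinearMap_apply, MultilinearMap.domCoprod_apply,
        LinearMap.mul'_apply, AlternatingMap.coe_multilinearMap, Sum.elim_inl, Sum.elim_inr]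
      congr 2
      funext a
      abel
    · rintro (i | i) u x
      · have h1 : ∀ y, (fun a => update u (Sum.inl i) y (Sum.inl a))
          = update (fun a => u (Sum.inl a)) i y := fun y => by
          funext a; simp [Function.update_apply]
        have h2 : ∀ y, (fun a => update u (Sum.inl i) y (Sum.inr a))
          = (fun a => u (Sum.inr a)) := fun y => by
          funext a; simp
        simp only [LinearMap.compMultilinearMap_apply, MultilinearMap.domCoprod_apply,
          LinearMap.mul'_apply, AlternatingMap.coe_multilinearMap, Sum.elim_inl, h1, h2]
        rw [← map_neg, typeN0_update hγ, AlternatingMap.map_update_neg]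
        ring
      · have h1 : ∀ y, (fun a => update u (Sum.inr i) y (Sum.inr a))
          = update (fun a => u (Sum.inr a)) i y := fun y => by
          funext a; simp [Function.update_apply]
        have h2 : ∀ y, (fun a => update u (Sum.inr i) y (Sum.inl a))
          = (fun a => u (Sum.inl a)) := fun y => by
          funext a; simp
        simp only [LinearMap.compMultilinearMap_apply, MultilinearMap.domCoprod_apply,
          LinearMap.mul'_apply, AlternatingMap.coe_multilinearMap, Sum.elim_inr, h1, h2]
        have h3 : ∀ w, conjForm β w = conj (β w) := fun w => rfl
        rw [h3, h3, typeN0_update hβ, map_mul, Complex.conj_I]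
        linear_combination (-γ (fun a => u (Sum.inl a))
          * conj (β (update (fun a => u (Sum.inr a)) i x))) * hI
  · intro q hq
    induction q using Quotient.inductionOn' with | _ σ
    obtain ⟨a, b, hab⟩ := exists_inl_of_ne_one σ hq
    refine typeSum_eq_zero _ (Sum.inl a) fun u => ?_
    rw [AlternatingMap.domCoprod.summand_mk'']
    simp only [_root_.smul_apply, MultilinearMap.domDomCongr_apply, MultilinearMap.domCoprod_apply,
      AlternatingMap.coe_multilinearMap, Sum.elim_inl]
    have h1 : (fun i => update u (Sum.inl a) (ja (u (Sum.inl a))) (σ (Sum.inr i)))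
        = update (fun i => u (σ (Sum.inr i))) b (ja (u (σ (Sum.inr b)))) := by
      funext i
      rcases eq_or_ne i b with rfl | hi
      · simp [hab]
      · have : σ (Sum.inr i) ≠ Sum.inl a := fun h => hi (by
          have := σ.injective (h.trans hab.symm)
          simpa using this)
        simp [hi, this]
    have h2 : (fun i => update u (Sum.inl a) (ja (u (Sum.inl a))) (σ (Sum.inl i)))
        = fun i => u (σ (Sum.inl i)) := by
      funext i
      have : σ (Sum.inl i) ≠ Sum.inl a := fun h => by
        have := σ.injective (h.trans hab.symm)
        simp at this
      simp [this]
    rw [h1, h2]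
    have h3 : ∀ w, conjForm β w = conj (β w) := fun w => rfl
    rw [h3, h3, typeN0_update hβ, Function.update_eq_self, map_mul, Complex.conj_I]
    rcases Int.units_eq_one_or (Equiv.Perm.sign σ) with h | h <;> rw [h]
    · simp only [one_smul, LinearMap.mul'_apply]
      linear_combination (γ (fun i => u (σ (Sum.inl i))) * conj (β fun i => u (σ (Sum.inr i)))) * hI
    · simp only [Units.neg_smul, one_smul, map_neg, LinearMap.mul'_apply]
      linear_combination -(γ (fun i => u (σ (Sum.inl i))) * conj (β fun i => u (σ (Sum.inr i)))) * hI

lemma typeN0_apply_add_self (α : V [⋀^Fin n]→ₗ[ℝ] ℂ) (v : Fin n → V) :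
    α (fun a => v a + v a) = 2 ^ n * α v := by
  have := α.toMultilinearMap.map_smul_univ (fun _ : Fin n => (2 : ℝ)) v
  simp only [two_smul] at this
  simpa using this

lemma wedge_eq_iff [FiniteDimensional ℝ V] (hdim : Module.finrank ℝ V = 2 * n) {ja jb : V →ₗ[ℝ] V}
    (hja : ∀ v, ja (ja v) = -v) {γ α : V [⋀^Fin n]→ₗ[ℝ] ℂ} (hγ : γ ∈ typeN0 n jb)
    (hα : α ∈ typeN0 n ja) (hne : ∃ β ∈ typeN0 n ja, β ≠ 0) :
    (∀ β ∈ typeN0 n ja, wedge γ (conjForm β) = wedge α (conjForm β)) ↔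
      ∀ v : Fin n → V, γ (fun a => v a - jb (ja (v a))) = 2 ^ n * α v := by
  have hα' : ∀ v : Fin n → V, α (fun a => v a - ja (ja (v a))) = 2 ^ n * α v := fun v => by
    rw [← typeN0_apply_add_self]
    simp [hja]
  have nz : ∀ β : V [⋀^Fin n]→ₗ[ℝ] ℂ, β ≠ 0 → ∃ v, β v ≠ 0 := by
    intro β hβ
    by_contra! h
    exact hβ (AlternatingMap.ext h)
  have two : (2 : ℂ) ^ n ≠ 0 := pow_ne_zero _ two_ne_zero
  constructor
  · intro h v
    obtain ⟨β, hβ, hβ0⟩ := hne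
    obtain ⟨v', hv'⟩ := nz β hβ0
    have h1 := wedge_typeSum hγ hβ v v'
    have h2 := wedge_typeSum hα hβ v v'
    rw [h β hβ, h2, hα'] at h1
    refine (mul_right_cancel₀ ?_ h1).symm
    rw [typeN0_apply_add_self]
    simpa using hv'
  · intro h β hβ
    by_cases hβ0 : β = 0
    · subst hβ0
      have : conjForm (0 : V [⋀^Fin n]→ₗ[ℝ] ℂ) = 0 := by
        ext; simp [conjForm]
      have h0 : ∀ δ : V [⋀^Fin n]→ₗ[ℝ] ℂ, wedge δ (0 : V [⋀^Fin n]→ₗ[ℝ] ℂ) = 0 := by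
        intro δ
        have : δ.domCoprod (0 : V [⋀^Fin n]→ₗ[ℝ] ℂ) = 0 := by
          rw [← AlternatingMap.domCoprod'_apply]
          simp
        rw [wedge, this]
        ext; simp
      rw [this, h0, h0]
    obtain ⟨v', hv'⟩ := nz β hβ0
    have top : ∃ T₀ : V [⋀^Fin n ⊕ Fin n]→ₗ[ℝ] ℝ, ∀ T : V [⋀^Fin n ⊕ Fin n]→ₗ[ℝ] ℂ,
        ∃ c : ℂ, ∀ w, T w = c * T₀ w := by
      have hc : Fintype.card (Fin n ⊕ Fin n) = Module.finrank ℝ V := by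
        rw [hdim]; simp; ring
      let e : Module.Basis (Fin n ⊕ Fin n) ℝ V := (Module.finBasis ℝ V).reindex
        (Fintype.equivOfCardEq (by simp [hc]))
      refine ⟨e.det, fun T => ⟨T e, ?_⟩⟩
      let T' : V [⋀^Fin n ⊕ Fin n]→ₗ[ℝ] ℂ :=
        ((LinearMap.toSpanSingleton ℝ ℂ (T e)).compAlternatingMap e.det)
      have : T = T' := by
        refine Module.Basis.ext_alternating e fun r hr => ?_
        let σ : Equiv.Perm (Fin n ⊕ Fin n) :=
          Equiv.ofBijective r (Finite.injective_iff_bijective.1 hr)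
        have h1 : ∀ Q : V [⋀^Fin n ⊕ Fin n]→ₗ[ℝ] ℂ, Q (fun i => e (r i))
            = Equiv.Perm.sign σ • Q e := fun Q => Q.map_perm e σ
        rw [h1 T, h1 T']
        simp [T', Module.Basis.det_self]
      intro w
      rw [this]
      have h1 : e.det e = 1 := e.det_self
      simp [T', LinearMap.compAlternatingMap_apply, mul_comm, h1]
    obtain ⟨T₀, hT₀⟩ := top
    have lin : ∀ (T : V [⋀^Fin n ⊕ Fin n]→ₗ[ℝ] ℂ) (c : ℂ), (∀ w, T w = c * T₀ w) →
        typeSum ja (Sum.elim (fun _ : Fin n => -I) (fun _ : Fin n => I)) T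
          (Sum.elim v' v') = c * typeSum ja (Sum.elim (fun _ : Fin n => -I)
            (fun _ : Fin n => I)) (fun w => T₀ w) (Sum.elim v' v') := by
      intro T c hc
      simp only [typeSum, Finset.mul_sum, hc]
      exact Finset.sum_congr rfl fun _ _ => by ring
    obtain ⟨c₁, hc₁⟩ := hT₀ (wedge γ (conjForm β))
    obtain ⟨c₂, hc₂⟩ := hT₀ (wedge α (conjForm β))
    obtain ⟨c₃, hc₃⟩ := hT₀ (wedge β (conjForm β))
    have h1 := wedge_typeSum hγ hβ v' v'
    have h2 := wedge_typeSum hα hβ v' v'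
    have h3 := wedge_typeSum hβ hβ v' v'
    rw [lin _ _ hc₁, h] at h1
    rw [lin _ _ hc₂, hα'] at h2
    have hβ' : β (fun a => v' a - ja (ja (v' a))) = 2 ^ n * β v' := by
      rw [← typeN0_apply_add_self]
      simp [hja]
    rw [lin _ _ hc₃, hβ', typeN0_apply_add_self] at h3
    have hne : typeSum ja (Sum.elim (fun _ : Fin n => -I)
        (fun _ : Fin n => I)) (fun w => (T₀ w : ℂ)) (Sum.elim v' v') ≠ 0 := by
      intro h0
      rw [h0, mul_zero] at h3
      simp [hv'] at h3
    have : c₁ = c₂ := mul_right_cancel₀ hne (h1.trans h2.symm)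
    ext w
    rw [hc₁, hc₂, this]

/-- The map `v ↦ v - j_b j_a v`, up to a factor of two a complex linear map from `(V, j_a)` to
`(V, j_b)`. -/
def twist (ja jb : V →ₗ[ℝ] V) : V →ₗ[ℝ] V := LinearMap.id - jb ∘ₗ ja

lemma twist_comm {ja jb : V →ₗ[ℝ] V} (hja : ∀ v, ja (ja v) = -v) (hjb : ∀ v, jb (jb v) = -v) (v : V)
    : twist ja jb (ja v) = jb (twist ja jb v) := by
  simp [twist, hja, hjb, add_comm]

lemma typeN0_comp {ja jb : V →ₗ[ℝ] V} {α : V [⋀^Fin n]→ₗ[ℝ] ℂ} (hα : α ∈ typeN0 n jb)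
    (T : V →ₗ[ℝ] V) (hT : ∀ v, T (ja v) = jb (T v)) : α.compLinearMap T ∈ typeN0 n ja := by
  intro v a
  have : ∀ w, (fun i => T (update v a w i)) = update (fun i => T (v i)) a (T w) :=
    fun w => by
      funext i
      rcases eq_or_ne i a with rfl | h
      · simp
      · simp [h]
  simp only [AlternatingMap.compLinearMap_apply]
  rw [this, hT, typeN0_update hα, Function.update_eq_self]

lemma Psi_spec [FiniteDimensional ℝ V] (hdim : Module.finrank ℝ V = 2 * n) {ja jb : V →ₗ[ℝ] V}
    (hja : ∀ v, ja (ja v) = -v) (hjb : ∀ v, jb (jb v) = -v) (hinj : ∀ v, twist ja jb v = 0 → v = 0)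
    {α : V [⋀^Fin n]→ₗ[ℝ] ℂ} (hα : α ∈ typeN0 n ja) (hne : ∃ β ∈ typeN0 n ja, β ≠ 0) :
    Psi ja jb α ∈ typeN0 n jb ∧
      ∀ v : Fin n → V, Psi ja jb α (fun a => twist ja jb (v a)) = 2 ^ n * α v := by
  have hex : ∃ γ : V [⋀^Fin n]→ₗ[ℝ] ℂ, γ ∈ typeN0 n jb ∧ ∀ β ∈ typeN0 n ja,
      wedge γ (conjForm β) = wedge α (conjForm β) := by
    let T : V ≃ₗ[ℝ] V := LinearEquiv.ofInjectiveEndo (twist ja jb)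
      (LinearMap.ker_eq_bot.1 (LinearMap.ker_eq_bot'.2 hinj))
    have hT : ∀ v, T v = twist ja jb v := fun v => rfl
    have hγ : ((2 : ℂ) ^ n • α).compLinearMap T.symm.toLinearMap ∈ typeN0 n jb := by
      refine typeN0_comp (jb := ja) (Submodule.smul_mem _ _ hα) _ fun v => ?_
      apply T.injective
      rw [LinearEquiv.coe_coe, LinearEquiv.apply_symm_apply, hT, twist_comm hja hjb, ← hT,
        LinearEquiv.apply_symm_apply]
    refine ⟨_, hγ, (wedge_eq_iff hdim hja hγ hα hne).2 fun v => ?_⟩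
    have : ∀ a, v a - jb (ja (v a)) = T (v a) := fun a => rfl
    simp [this]
  have := Classical.epsilon_spec hex
  exact ⟨this.1, (wedge_eq_iff hdim hja this.1 hα hne).1 this.2⟩

lemma ne_zero_iff_exists {α : V [⋀^Fin n]→ₗ[ℝ] ℂ} : α ≠ 0 ↔ ∃ v, α v ≠ 0 := by
  constructor
  · intro h
    by_contra! h1
    exact h (AlternatingMap.ext h1)
  · rintro ⟨v, hv⟩ rfl
    simp at hv

lemma eq_of_comp_twist [FiniteDimensional ℝ V] {ja jb : V →ₗ[ℝ] V}
    (hinj : ∀ v, twist ja jb v = 0 → v = 0) {α β : V [⋀^Fin n]→ₗ[ℝ] ℂ}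
    (h : ∀ v : Fin n → V, α (fun a => twist ja jb (v a)) = β (fun a => twist ja jb (v a))) :
    α = β := by
  let T : V ≃ₗ[ℝ] V := LinearEquiv.ofInjectiveEndo (twist ja jb)
      (LinearMap.ker_eq_bot.1 (LinearMap.ker_eq_bot'.2 hinj))
  ext v
  have := h (fun a => T.symm (v a))
  have e : ∀ a, twist ja jb (T.symm (v a)) = v a := fun a => T.apply_symm_apply _
  simpa only [e] using this

/-- Every form of type `(n, 0)` is a multiple of every nonzero one. -/
lemma typeN0_line_of_twist [FiniteDimensional ℝ V] {ja jb : V →ₗ[ℝ] V} (hja : ∀ v, ja (ja v) = -v)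
    (hjb : ∀ v, jb (jb v) = -v) (hinj : ∀ v, twist ja jb v = 0 → v = 0)
    (hline : ∀ α ∈ typeN0 n ja, ∀ β ∈ typeN0 n ja, α ≠ 0 → ∃ c : ℂ, β = c • α) :
    ∀ α ∈ typeN0 n jb, ∀ β ∈ typeN0 n jb, α ≠ 0 → ∃ c : ℂ, β = c • α := by
  intro α hα β hβ h0
  have h1 := typeN0_comp hα (twist ja jb) (twist_comm hja hjb)
  have h2 := typeN0_comp hβ (twist ja jb) (twist_comm hja hjb)
  obtain ⟨c, hc⟩ := hline _ h1 _ h2 fun h => h0 (eq_of_comp_twist hinj fun v => by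
    simpa using congrArg (fun T : V [⋀^Fin n]→ₗ[ℝ] ℂ => T v) h)
  refine ⟨c, eq_of_comp_twist hinj fun v => ?_⟩
  simpa using congrArg (fun T : V [⋀^Fin n]→ₗ[ℝ] ℂ => T v) hc

end PsiFormula

section Charts

variable {n : ℕ} {M : Type*} [TopologicalSpace M] [ChartedSpace (Model n) M]
  [IsManifold 𝓜[n] ∞ M]
  {P : Type*} [NormedAddCommGroup P] [NormedSpace ℝ P]
  {G : Type*} [NormedAddCommGroup G] [NormedSpace ℝ G] {o y : M}

/-- The inverse of the chart at `o`. -/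
def chartInv (o : M) (z : Model n) : M := (extChartAt 𝓜[n] o).symm z

variable (n) in
/-- The chart at `o`. -/
def chart (o y : M) : Model n := extChartAt 𝓜[n] o y

variable (n) in
/-- The derivative at `y` of the chart at `o`. -/
def dchart (o y : M) : Tan n y →L[ℝ] Model n :=
  mfderiv 𝓜[n] 𝓜[n] (extChartAt 𝓜[n] o) y

variable (n) in
/-- The inverse of the derivative at `y` of the chart at `o`. -/
def dchartInv (o y : M) : Model n →L[ℝ] Tan n y := (dchart n o y).inverse

/-- A vector field in the chart at `o`. -/
def readV (o : M) (X : VF n M) (y : M) : Model n := dchart n o y (X y)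

/-- A field of endomorphisms in the chart at `o`. -/
def readE (o : M) (J : EndField n M) (y : M) : Model n →L[ℝ] Model n :=
  dchart n o y ∘L J y ∘L dchartInv n o y

/-- A field of forms in the chart at `o`. -/
def readF (o : M) (κ : (x : M) → Form n x) (y : M) : Model n [⋀^Fin n]→ₗ[ℝ] ℂ :=
  (κ y).compLinearMap (dchartInv n o y).toLinearMap

/-- A function on `P × M` in the chart at `o`. -/
def flat (o : M) (f : P × M → G) (w : P × Model n) : G := f (w.1, chartInv o w.2)

variable (n) in
/-- The domain of the chart at `o`. -/
def dom (o : M) : Set M := (chartAt (Model n) o).source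

lemma dom_mem_nhds (hy : y ∈ dom n o) : dom n o ∈ 𝓝 y :=
  (chartAt (Model n) o).open_source.mem_nhds hy

lemma self_mem_dom (o : M) : o ∈ dom n o := mem_chart_source _ _

lemma mem_dom_iff : y ∈ dom n o ↔ y ∈ (extChartAt 𝓜[n] o).source := by
  rw [extChartAt_source]; rfl

lemma chartInv_chart (hy : y ∈ dom n o) : chartInv o (chart n o y) = y :=
  (extChartAt 𝓜[n] o).left_inv (mem_dom_iff.1 hy)

lemma isInvertible_dchart (hy : y ∈ dom n o) : (dchart n o y).IsInvertible :=
  isInvertible_mfderiv_extChartAt (mem_dom_iff.1 hy)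

lemma dchart_dchartInv (hy : y ∈ dom n o) (v : Model n) : dchart n o y (dchartInv n o y v) = v := by
  obtain ⟨e, he⟩ := isInvertible_dchart hy
  rw [dchartInv, ← he, ContinuousLinearMap.inverse_equiv]
  simp

lemma dchartInv_dchart (hy : y ∈ dom n o) (v : Tan n y) : dchartInv n o y (dchart n o y v) = v := by
  obtain ⟨e, he⟩ := isInvertible_dchart hy
  rw [dchartInv, ← he, ContinuousLinearMap.inverse_equiv]
  simp

lemma readE_readV (hy : y ∈ dom n o) (J : EndField n M) (X : VF n M) :
    readE o J y (readV o X y) = readV o (fun y => J y (X y)) y := by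
  simp [readE, readV, dchartInv_dchart hy]

lemma readF_readV (hy : y ∈ dom n o) (κ : (x : M) → Form n x) (Y : Fin n → VF n M) :
    readF o κ y (fun a => readV o (Y a) y) = κ y (fun a => Y a y) := by
  simp [readF, readV, dchartInv_dchart hy]

lemma contMDiffAt_chartInv (hy : y ∈ dom n o) :
    ContMDiffAt 𝓜[n] 𝓜[n] ∞ (chartInv o) (chart n o y) := by
  have h := contMDiffOn_extChartAt_symm (I := 𝓜[n]) (n := ∞) o
  refine (h _ ?_).contMDiffAt ?_
  · exact (extChartAt 𝓜[n] o).map_source (mem_dom_iff.1 hy)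
  · exact extChartAt_target_mem_nhds' ((extChartAt 𝓜[n] o).map_source (mem_dom_iff.1 hy))

lemma contMDiffAt_chart (hy : y ∈ dom n o) : ContMDiffAt 𝓜[n] 𝓜[n] ∞ (chart n o) y :=
  contMDiffAt_extChartAt' hy

lemma continuousAt_chart (hy : y ∈ dom n o) :
    ContinuousAt (chart n o) y := (contMDiffAt_chart hy).continuousAt

lemma continuousAt_chartInv (hy : y ∈ dom n o) :
    ContinuousAt (chartInv o) (chart n o y) := (contMDiffAt_chartInv hy).continuousAt

lemma tendsto_chartInv (hy : y ∈ dom n o) (u : P) :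
    Filter.Tendsto (fun w : P × Model n => (w.1, chartInv o w.2)) (𝓝 (u, chart n o y))
      (𝓝 (u, y)) := by
  refine Filter.Tendsto.prodMk_nhds (continuous_fst.tendsto' _ _ rfl) ?_
  have := (continuousAt_chartInv hy).tendsto
  rw [chartInv_chart hy] at this
  exact this.comp (continuous_snd.tendsto' _ _ rfl)

lemma eventually_chart_mem (hy : y ∈ dom n o) (u : P) : ∀ᶠ w in 𝓝 (u, y), (w : P × M).2 ∈ dom n o :=
  (continuous_snd.tendsto' (u, y) y rfl).eventually (dom_mem_nhds hy)

lemma flat_chart (hy : y ∈ dom n o) (f : P × M → G) (u : P) :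
    flat o f (u, chart n o y) = f (u, y) := by
  simp [flat, chartInv_chart hy]

lemma contMDiffAt_prod_iff {f : P × Model n → G} {w : P × Model n} :
    ContMDiffAt (𝓘(ℝ, P).prod 𝓜[n]) 𝓘(ℝ, G) ∞ f w ↔ ContDiffAt ℝ ∞ f w := by
  rw [← contMDiffAt_iff_contDiffAt, modelWithCornersSelf_prod, ← chartedSpaceSelf_prod]

lemma contMDiffAt_iff_flat (hy : y ∈ dom n o) {f : P × M → G} {u : P} :
    ContMDiffAt (𝓘(ℝ, P).prod 𝓜[n]) 𝓘(ℝ, G) ∞ f (u, y) ↔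
      ContDiffAt ℝ ∞ (flat o f) (u, chart n o y) := by
  rw [← contMDiffAt_prod_iff]
  constructor
  · intro h
    have h1 : ContMDiffAt (𝓘(ℝ, P).prod 𝓜[n]) (𝓘(ℝ, P).prod 𝓜[n]) ∞
        (fun w : P × Model n => (w.1, chartInv o w.2)) (u, chart n o y) :=
      contMDiffAt_fst.prodMk (ContMDiffAt.comp (u, chart n o y) (contMDiffAt_chartInv hy)
        contMDiffAt_snd)
    have h2 : ((u, chartInv o (chart n o y)) : P × M) = (u, y) := by
      rw [chartInv_chart hy]
    rw [← h2] at h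
    exact ContMDiffAt.comp (u, chart n o y) h h1
  · intro h
    have h1 : ContMDiffAt (𝓘(ℝ, P).prod 𝓜[n]) (𝓘(ℝ, P).prod 𝓜[n]) ∞
        (fun w : P × M => (w.1, chart n o w.2)) (u, y) :=
      contMDiffAt_fst.prodMk (ContMDiffAt.comp (u, y) (contMDiffAt_chart hy) contMDiffAt_snd)
    refine (ContMDiffAt.comp (u, y) h h1).congr_of_eventuallyEq ?_
    filter_upwards [eventually_chart_mem hy u] with w hw
    exact (flat_chart hw f w.1).symm

lemma contMDiffAt_iff_chart (hy : y ∈ dom n o) {f : M → G} :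
    ContMDiffAt 𝓜[n] 𝓘(ℝ, G) ∞ f y ↔ ContDiffAt ℝ ∞ (fun z => f (chartInv o z)) (chart n o y) := by
  rw [← contMDiffAt_iff_contDiffAt]
  constructor
  · intro h
    have h2 : chartInv o (chart n o y) = y := chartInv_chart hy
    rw [← h2] at h
    exact ContMDiffAt.comp _ h (contMDiffAt_chartInv hy)
  · intro h
    refine (ContMDiffAt.comp y h (contMDiffAt_chart hy)).congr_of_eventuallyEq ?_
    filter_upwards [dom_mem_nhds hy] with w hw
    simp [chartInv_chart hw]

lemma contMDiffAt_const_param {f : M → G} {y : M} (u : P) (h : ContMDiffAt 𝓜[n] 𝓘(ℝ, G) ∞ f y) :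
    ContMDiffAt (𝓘(ℝ, P).prod 𝓜[n]) 𝓘(ℝ, G) ∞ (fun w : P × M => f w.2) (u, y) :=
  ContMDiffAt.comp (u, y) h contMDiffAt_snd

lemma contMDiffAt_fix_param {f : P × M → G} {y : M} {u : P}
    (h : ContMDiffAt (𝓘(ℝ, P).prod 𝓜[n]) 𝓘(ℝ, G) ∞ f (u, y)) :
    ContMDiffAt 𝓜[n] 𝓘(ℝ, G) ∞ (fun x => f (u, x)) y :=
  ContMDiffAt.comp y h (contMDiffAt_const.prodMk contMDiffAt_id)

lemma vf_contMDiffAt_iff (hy : y ∈ dom n o) {X : P → VF n M} {u : P} :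
    ContMDiffAt (𝓘(ℝ, P).prod 𝓜[n]) (𝓜[n].tangent) ∞
      (fun z : P × M => (⟨z.2, X z.1 z.2⟩ : TangentBundle 𝓜[n] M)) (u, y) ↔
    ContMDiffAt (𝓘(ℝ, P).prod 𝓜[n]) 𝓜[n] ∞
      (fun z : P × M => readV o (X z.1) z.2) (u, y) := by
  let e := trivializationAt (Model n) (TangentSpace 𝓜[n]) o
  have hs : ∀ (w : M) (v : Tan n w), w ∈ dom n o →
      (⟨w, v⟩ : TangentBundle 𝓜[n] M) ∈ e.source := fun w v hw => by
    rw [e.mem_source]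
    exact hw
  refine (Bundle.Trivialization.contMDiffAt_iff (IB := 𝓜[n]) (IM := 𝓘(ℝ, P).prod 𝓜[n])
    (n := ∞) (e := e) (f := fun z : P × M => (⟨z.2, X z.1 z.2⟩ : TangentBundle 𝓜[n] M))
    (x₀ := (u, y)) (hs _ _ hy)).trans ?_
  have h1 : ContMDiffAt (𝓘(ℝ, P).prod 𝓜[n]) 𝓜[n] ∞
      (fun z : P × M => z.2) (u, y) := contMDiffAt_snd
  have h2 : (fun z : P × M => (e ⟨z.2, X z.1 z.2⟩).2) =ᶠ[𝓝 (u, y)]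
      fun z : P × M => readV o (X z.1) z.2 := by
    filter_upwards [eventually_chart_mem hy u] with w hw
    have := TangentBundle.continuousLinearMapAt_trivializationAt (I := 𝓜[n])
      (x₀ := o) (x := w.2) hw
    rw [readV, dchart, ← this]
    have hb : w.2 ∈ (trivializationAt (Model n) (TangentSpace 𝓜[n]) o).baseSet := hw
    rw [Bundle.Trivialization.continuousLinearMapAt_apply, Bundle.Trivialization.linearMapAt_apply,
      if_pos hb]
  constructor
  · intro h
    exact h.2.congr_of_eventuallyEq h2.symm
  · intro h
    exact ⟨h1, h.congr_of_eventuallyEq h2⟩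

lemma vf_contMDiffAt_iff' (hy : y ∈ dom n o) {X : VF n M} : ContMDiffAt 𝓜[n] (𝓜[n].tangent) ∞
      (fun z : M => (⟨z, X z⟩ : TangentBundle 𝓜[n] M)) y ↔
    ContMDiffAt 𝓜[n] 𝓜[n] ∞ (readV o X) y := by
  constructor
  · intro h
    have h1 : ContMDiffAt (𝓘(ℝ, ℝ).prod 𝓜[n]) (𝓜[n].tangent) ∞
      (fun z : ℝ × M => (⟨z.2, X z.2⟩ : TangentBundle 𝓜[n] M)) (0, y) :=
      ContMDiffAt.comp (0, y) h contMDiffAt_snd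
    exact contMDiffAt_fix_param ((vf_contMDiffAt_iff (X := fun _ => X) hy).1 h1)
  · intro h
    have h1 := (vf_contMDiffAt_iff (X := fun _ : ℝ => X) hy).2 (contMDiffAt_const_param 0 h)
    exact ContMDiffAt.comp y h1 (contMDiffAt_const.prodMk contMDiffAt_id)

lemma SmoothVF.readV {X : VF n M} (hX : SmoothVF X) (hy : y ∈ dom n o) :
    ContMDiffAt 𝓜[n] 𝓜[n] ∞ (readV o X) y :=
  (vf_contMDiffAt_iff' hy).1 (hX y)

lemma SmoothVF.readV_chart {X : VF n M} (hX : SmoothVF X) (hy : y ∈ dom n o) :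
    ContDiffAt ℝ ∞ (fun z => GeomQuant.readV o X (chartInv o z)) (chart n o y) :=
  (contMDiffAt_iff_chart hy).1 (hX.readV hy)

lemma mfderiv_chartInv (hy : y ∈ dom n o) :
    (mfderiv 𝓜[n] 𝓜[n] (chartInv o) (chart n o y)).IsInvertible := by
  have h := isInvertible_mfderivWithin_extChartAt_symm (I := 𝓜[n]) (x := o)
    ((extChartAt 𝓜[n] o).map_source (mem_dom_iff.1 hy))
  rw [modelWithCornersSelf_coe, Set.range_id, mfderivWithin_univ] at h
  exact h

lemma dchart_comp_mfderiv_chartInv (hy : y ∈ dom n o) (v : Model n) :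
    dchart n o (chartInv o (chart n o y)) (mfderiv 𝓜[n] 𝓜[n] (chartInv o) (chart n o y) v) = v := by
  have h := mfderiv_extChartAt_comp_mfderivWithin_extChartAt_symm (I := 𝓜[n]) (x := o)
    ((extChartAt 𝓜[n] o).map_source (mem_dom_iff.1 hy))
  rw [modelWithCornersSelf_coe, Set.range_id, mfderivWithin_univ] at h
  exact congrArg (fun T : Model n →L[ℝ] Model n => T v) h

lemma mpullback_chartInv (hy : y ∈ dom n o) (X : VF n M) :
    VectorField.mpullback 𝓜[n] 𝓜[n] (chartInv o) X (chart n o y)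
      = readV o X (chartInv o (chart n o y)) := by
  have hd := isInvertible_dchart (n := n) (o := o)
    (y := chartInv o (chart n o y)) (by rwa [chartInv_chart hy])
  obtain ⟨e, he⟩ := hd
  have h2 := dchart_comp_mfderiv_chartInv hy (readV o X (chartInv o (chart n o y)))
  have h3 : mfderiv 𝓜[n] 𝓜[n] (chartInv o) (chart n o y)
      (readV o X (chartInv o (chart n o y))) = X (chartInv o (chart n o y)) := by
    rw [readV, ← he] at h2 ⊢
    exact e.injective h2
  rw [VectorField.mpullback_apply, ← h3]
  obtain ⟨e', he'⟩ := mfderiv_chartInv hy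
  rw [← he', ContinuousLinearMap.inverse_equiv]
  exact e'.symm_apply_apply _

lemma dirDeriv_eq_fderiv (hy : y ∈ dom n o) (X : VF n M) {f : M → G}
    (hf : MDifferentiableAt 𝓜[n] 𝓘(ℝ, G) f y) :
    dirDeriv X f y = fderiv ℝ (fun z => f (chartInv o z)) (chart n o y) (readV o X y) := by
  have h1 : MDifferentiableAt 𝓜[n] 𝓘(ℝ, G) f (chartInv o (chart n o y)) := by
    rwa [chartInv_chart hy]
  have h2 := mfderiv_comp (chart n o y) h1
    ((contMDiffAt_chartInv hy).mdifferentiableAt (by simp))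
  have h3 : mfderiv 𝓜[n] 𝓜[n] (chartInv o) (chart n o y)
      (readV o X (chartInv o (chart n o y))) = X (chartInv o (chart n o y)) := by
    rw [← mpullback_chartInv hy, VectorField.mpullback_apply]
    obtain ⟨e, he⟩ := mfderiv_chartInv hy
    rw [← he, ContinuousLinearMap.inverse_equiv]
    simp
  have h4 : dirDeriv X f (chartInv o (chart n o y))
      = fderiv ℝ (fun z => f (chartInv o z)) (chart n o y)
        (readV o X (chartInv o (chart n o y))) := by
    rw [← mfderiv_eq_fderiv]
    change _ = mfderiv 𝓜[n] 𝓘(ℝ, G) (f ∘ chartInv o) (chart n o y) _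
    rw [h2]
    change _ = mfderiv 𝓜[n] 𝓘(ℝ, G) f (chartInv o (chart n o y))
      (mfderiv 𝓜[n] 𝓜[n] (chartInv o) (chart n o y) _)
    rw [h3]
    rfl
  rwa [chartInv_chart hy] at h4

lemma readV_bracket (hy : y ∈ dom n o) {X Y : VF n M} (hX : SmoothVF X) (hY : SmoothVF Y) :
    readV o (bracket X Y) y = VectorField.lieBracket ℝ (fun z => readV o X (chartInv o z))
      (fun z => readV o Y (chartInv o z)) (chart n o y) := by
  have : IsManifold 𝓜[n] (minSmoothness ℝ 2) M := IsManifold.of_le (n := ∞) two_le_infty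
  have h := VectorField.mpullback_mlieBracket (I := 𝓜[n]) (I' := 𝓜[n])
    (f := chartInv o) (V := X) (W := Y) (x₀ := chart n o y) (n := ∞)
    ((hX _).mdifferentiableAt (by simp)) ((hY _).mdifferentiableAt (by simp))
    (contMDiffAt_chartInv hy) two_le_infty
  rw [← VectorField.mlieBracketWithin_univ, ← VectorField.mlieBracketWithin_univ,
    VectorField.mlieBracketWithin_eq_lieBracketWithin] at h
  have e : ∀ X : VF n M, VectorField.mpullback 𝓜[n] 𝓜[n] (chartInv o) X
      =ᶠ[𝓝 (chart n o y)] fun z => readV o X (chartInv o z) := by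
    intro X
    have ht : (extChartAt 𝓜[n] o).target ∈ 𝓝 (chart n o y) :=
      extChartAt_target_mem_nhds' ((extChartAt 𝓜[n] o).map_source (mem_dom_iff.1 hy))
    filter_upwards [ht] with z hz
    have h1 := mpullback_chartInv (n := n) (o := o) (y := chartInv o z)
      (mem_dom_iff.2 ((extChartAt 𝓜[n] o).map_target hz)) X
    have h2 : chart n o (chartInv o z) = z := (extChartAt 𝓜[n] o).right_inv hz
    rw [h2] at h1
    exact h1
  have h5 : VectorField.mpullback 𝓜[n] 𝓜[n] (chartInv o)
      (VectorField.mlieBracketWithin 𝓜[n] X Y univ) (chart n o y)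
      = readV o (VectorField.mlieBracketWithin 𝓜[n] X Y univ)
        (chartInv o (chart n o y)) := mpullback_chartInv hy _
  rw [h5, chartInv_chart hy, VectorField.mlieBracketWithin_univ] at h
  have h6 := congrFun (VectorField.lieBracketWithin_univ (𝕜 := ℝ) (E := Model n)
    (V := VectorField.mpullback 𝓜[n] 𝓜[n] (chartInv o) X)
    (W := VectorField.mpullback 𝓜[n] 𝓜[n] (chartInv o) Y)) (chart n o y)
  exact (h.trans h6).trans ((e X).lieBracket_vectorField_eq (e Y))

lemma along_flat_vertical (hy : y ∈ dom n o) (X : P → VF n M) {f : P × M → G}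
    {u : P} (hf : ContMDiffAt (𝓘(ℝ, P).prod 𝓜[n]) 𝓘(ℝ, G) ∞ f (u, y)) :
    along (0 : P) (flat (n := n) o fun w : P × M => readV (n := n) o (X w.1) w.2) (flat (n := n) o f) (u, chart n o y)
      = dirDeriv (X u) (fun x => f (u, x)) y := by
  rw [dirDeriv_eq_fderiv hy _ ((contMDiffAt_fix_param hf).mdifferentiableAt (by simp)), along,
    flat_chart hy]
  have h1 := (toDiffAt ((contMDiffAt_iff_flat hy).1 hf)).hasFDerivAt
  have h2 : HasFDerivAt (fun z : Model n => (u, z)) (ContinuousLinearMap.inr ℝ P (Model n))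
    (chart n o y) := hasFDerivAt_prodMk_right u _
  have h3 := (h1.comp (chart n o y) h2).fderiv
  have e : (flat o f ∘ fun z : Model n => (u, z)) = fun z => f (u, chartInv o z) := rfl
  rw [e] at h3
  rw [h3]
  simp

lemma along_flat_param (hy : y ∈ dom n o) (c : P) {f : P × M → G} {u : P}
    (hf : ContMDiffAt (𝓘(ℝ, P).prod 𝓜[n]) 𝓘(ℝ, G) ∞ f (u, y)) :
    HasDerivAt (fun t : ℝ => f (u + t • c, y))
      (along c (fun _ => 0) (flat o f) (u, chart n o y)) 0 := by
  have h1 := (toDiffAt ((contMDiffAt_iff_flat hy).1 hf)).hasFDerivAt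
  have h2 : HasDerivAt (fun t : ℝ => ((u + t • c, chart n o y) : P × Model n)) (c, 0) 0 := by
    refine HasDerivAt.prodMk ?_ (hasDerivAt_const _ _)
    simpa using ((hasDerivAt_id (0 : ℝ)).smul_const c).const_add u
  have h3 : HasFDerivAt (flat o f) (fderiv ℝ (flat o f) (u, chart n o y))
      ((fun t : ℝ => ((u + t • c, chart n o y) : P × Model n)) 0) := by
    simpa using h1
  have := h3.comp_hasDerivAt 0 h2
  refine this.congr_of_eventuallyEq (.of_forall fun t => ?_)
  exact (flat_chart hy f _).symm

end Charts

section TypeSums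

variable {n : ℕ} {V : Type*} [AddCommGroup V] [Module ℝ V]

lemma typeSum_typeN0 {J : V → V} {α : V [⋀^Fin n]→ₗ[ℝ] ℂ} (hα : α ∈ typeN0 n J) (w : Fin n → V) :
    typeSum J (fun _ => -I) α w = 2 ^ n * α w := by
  have h := typeSum_eq (j := J) (ε := fun _ => -I) α.toMultilinearMap (fun _ => id) w
    (fun i u x => by
      change -I * α _ = α _
      rw [typeN0_update hα, ← mul_assoc]
      simp)
  exact h.trans (typeN0_apply_add_self α w)

lemma typeSum_act_eq_zero {J K : V →ₗ[ℝ] V} (hJ : ∀ v, K (J v) = -J (K v)) {α : V [⋀^Fin n]→ₗ[ℝ] ℂ}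
    (hα : α ∈ typeN0 n J) (w : Fin n → V) : typeSum J (fun _ => -I) (act α K) w = 0 := by
  have h : (act α K : (Fin n → V) → ℂ)
      = fun u => ∑ a, α (update u a (K (u a))) := rfl
  rw [h, typeSum_sum]
  refine Finset.sum_eq_zero fun a _ => typeSum_eq_zero w a fun u => ?_
  have h1 : update (update u a (J (u a))) a
      (K (update u a (J (u a)) a)) = update u a (J (-K (u a))) := by
    rw [Function.update_self, Function.update_idem, hJ, map_neg]
  rw [h1, typeN0_update hα, ← neg_one_smul ℝ (K (u a)), α.map_update_smul, ← mul_assoc]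
  simp

end TypeSums

section ConnCoeff

variable {H F E : Type*} [NormedAddCommGroup H] [NormedSpace ℝ H] [NormedAddCommGroup F]
  [NormedSpace ℝ F] [NormedAddCommGroup E] [NormedSpace ℝ E] [FiniteDimensional ℝ E] {n : ℕ}

lemma exists_fderiv_form {α : H → E [⋀^Fin n]→ₗ[ℝ] ℂ} {z : H} (hα : SmoothFormAt α z) (ξ : H) :
    ∃ γ : E [⋀^Fin n]→ₗ[ℝ] ℂ, ∀ v, γ v = fderiv ℝ (fun y => α y v) z ξ := by
  have hd := fun v => toDiffAt (hα v)
  refine ⟨{ toFun := fun v => fderiv ℝ (fun y => α y v) z ξ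
            map_update_add' := ?_, map_update_smul' := ?_, map_eq_zero_of_eq' := ?_ }, fun v => rfl⟩
  · intro _ v i x y
    have : (fun w => α w (update v i (x + y)))
        = fun w => α w (update v i x) + α w (update v i y) := by
      funext w
      convert (α w).map_update_add v i x y
    convert congrArg (fun L : H →L[ℝ] ℂ => L ξ) ((congrArg (fun f => fderiv ℝ f z) this).trans
      (fderiv_fun_add (hd _) (hd _))) using 1
    all_goals congr!
  · intro _ v i c x
    have : (fun w => α w (update v i (c • x)))
        = fun w => c • α w (update v i x) := by
      funext w
      convert (α w).map_update_smul v i c x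
    convert congrArg (fun L : H →L[ℝ] ℂ => L ξ) ((congrArg (fun f => fderiv ℝ f z) this).trans
      (fderiv_fun_const_smul (hd _) c)) using 1
    all_goals congr!
  · intro v i j hv hij
    have : (fun w => α w v) = fun _ => 0 := by
      funext w
      exact (α w).map_eq_zero_of_eq v hv hij
    simp [this]

lemma exists_act_form (α : E [⋀^Fin n]→ₗ[ℝ] ℂ) (K : E →L[ℝ] E) :
    ∃ γ : E [⋀^Fin n]→ₗ[ℝ] ℂ, ∀ v, γ v = act α K v := by
  have hw : ∀ (v : Fin n → E) (i : Fin n), ContDiff ℝ ∞ (fun t : ℝ => v i + t • K (v i)) :=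
    fun v i => contDiff_const.add (contDiff_id.smul contDiff_const)
  have hc : SmoothFormAt (fun _ : ℝ => α) 0 := fun v => contDiffAt_const
  have hβ : SmoothFormAt (fun t : ℝ => α.compLinearMap (LinearMap.id + t • K.toLinearMap)) 0 :=
    fun v => (hc.apply (w := fun i t => v i + t • K (v i)) fun i => (hw v i).contDiffAt)
  obtain ⟨γ, hγ⟩ := exists_fderiv_form hβ 1
  refine ⟨γ, fun v => ?_⟩
  rw [hγ]
  have h2 := hc.fderiv_apply (w := fun i t => v i + t • K (v i))
    (fun i => toDiffAt (hw v i).contDiffAt) 1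
  have h3 : ∀ i, fderiv ℝ (fun t : ℝ => v i + t • K (v i)) 0 1 = K (v i) := fun i => by
    have : HasDerivAt (fun t : ℝ => v i + t • K (v i)) (K (v i)) 0 := by
      simpa using ((hasDerivAt_id (0 : ℝ)).smul_const (K (v i))).const_add (v i)
    rw [fderiv_apply_one_eq_deriv, this.deriv]
  have h4 : (fun i => v i + (0 : ℝ) • K (v i)) = v := by
    funext i
    simp
  simp only [h3, fderiv_fun_const, h4] at h2
  refine h2.trans ?_
  simp [act]

lemma lieEnd_anticomm {c : F} {X : F × E → E} {J : F × E → E →L[ℝ] E} {z : F × E}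
    (hJ : ContDiffAt ℝ ∞ J z) (hsq : ∀ᶠ y in 𝓝 z, J y * J y = -1) :
    lieEnd c X J z * J z = -(J z * lieEnd c X J z) := by
  have h1 : along c X J z * J z + J z * along c X J z = 0 := by
    rw [← along_mul (toDiffAt hJ) (toDiffAt hJ), along_congr hsq]
    simp [along]
  have h2 : J z * J z = -1 := hsq.self_of_nhds
  have h3 : along c X J z * J z = -(J z * along c X J z) := eq_neg_of_add_eq_zero_left h1
  simp only [lieEnd, mul_add, add_mul, mul_sub, sub_mul, h3, mul_assoc, h2]
  simp only [← mul_assoc, h2]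
  noncomm_ring

lemma connEnd_comm {c : F} {X : F × E → E} {J : F × E → E →L[ℝ] E} {z : F × E}
    (hJ : ContDiffAt ℝ ∞ J z) (hsq : ∀ᶠ y in 𝓝 z, J y * J y = -1) :
    J z * connEnd c X J z - connEnd c X J z * J z = along c X J z := by
  have h1 := lieEnd_anticomm (c := c) (X := X) hJ hsq
  have h2 : J z * J z = -1 := hsq.self_of_nhds
  have h3 : J z * (J z * lieEnd c X J z) = -lieEnd c X J z := by
    rw [← mul_assoc, h2, neg_one_mul]
  have h4 : J z * lieEnd c X J z * J z = lieEnd c X J z := by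
    rw [mul_assoc, h1, mul_neg, h3, neg_neg]
  simp only [connEnd, mul_sub, sub_mul, mul_smul_comm, smul_mul_assoc, h3, h4, smul_neg]
  have h5 : (1 / 2 : ℝ) • lieEnd c X J z + (1 / 2 : ℝ) • lieEnd c X J z = lieEnd c X J z := by
    rw [← add_smul]
    norm_num
  have h6 : ∀ j g q e : E →L[ℝ] E, q + q = e →
      j * -g - -q - (-g * j - q) = g * j - j * g + e := by
    intro j g q e h
    rw [← h]
    noncomm_ring
  rw [h6 _ _ _ _ h5, lieEnd]
  noncomm_ring

lemma exists_isConnCoeff {c : F} {X : F × E → E} {J : F × E → E →L[ℝ] E}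
    {α : F × E → E [⋀^Fin n]→ₗ[ℝ] ℂ} {z : F × E} (hJ : ContDiffAt ℝ ∞ J z)
    (hsq : ∀ᶠ y in 𝓝 z, J y * J y = -1) (hα : SmoothFormAt α z)
    (htype : ∀ᶠ y in 𝓝 z, α y ∈ typeN0 n (J y)) (hline : ∀ β ∈ typeN0 n (J z), ∃ r : ℂ, β = r • α z)
    : ∃ θ, IsConnCoeff c X J α z θ := by
  obtain ⟨γ, hγ⟩ := exists_fderiv_form hα (c, X z)
  obtain ⟨γ', hγ'⟩ := exists_act_form (α z) (connEnd c X J z)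
  have hz := htype.self_of_nhds
  have key : γ - γ' ∈ typeN0 n (J z) := by
    intro v b
    simp only [AlternatingMap.sub_apply, hγ, hγ']
    have h1 : fderiv ℝ (fun y => α y (update v b (J z (v b)))) z (c, X z)
        = I * fderiv ℝ (fun y => α y v) z (c, X z)
          - α z (update v b (along c X J z (v b))) := by
      have h := hα.along_update (c := c) (X := X) (toDiffAt hJ) v b
      have h' : along c X (fun y => α y (update v b (J y (v b)))) z
          = I * along c X (fun y => α y v) z := by
        have e : (fun y => α y (update v b (J y (v b)))) =ᶠ[𝓝 z]
            fun y => I * α y v := by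
          filter_upwards [htype] with y hy
          exact hy v b
        rw [along_congr e]
        simp only [along]
        rw [fderiv_const_mul (toDiffAt (hα v))]
        rfl
      rw [h'] at h
      simp only [along] at h ⊢
      rw [h]
      ring
    have h2 : act (α z) (connEnd c X J z) (update v b (J z (v b)))
        = I * act (α z) (connEnd c X J z) v
          - α z (update v b (along c X J z (v b))) := by
      have e1 : ∀ a, α z (update (update v b (J z (v b))) a
          (connEnd c X J z (update v b (J z (v b)) a)))
          = I * α z (update v a (connEnd c X J z (v a)))
            - if a = b then α z (update v b (along c X J z (v b))) else 0 := by
        intro a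
        by_cases hab : a = b
        · subst hab
          rw [if_pos rfl, Function.update_self, Function.update_idem, ← typeN0_update hz,
            ← connEnd_comm hJ hsq]
          have : connEnd c X J z (J z (v a)) = J z (connEnd c X J z (v a))
              - (J z * connEnd c X J z - connEnd c X J z * J z) (v a) := by
            simp
          rw [this, (α z).map_update_sub]
        · rw [if_neg hab, Function.update_of_ne hab, Function.update_comm (Ne.symm hab), sub_zero]
          have := hz (update v a (connEnd c X J z (v a))) b
          rwa [Function.update_of_ne (Ne.symm hab)] at this
      simp only [act, e1, Finset.sum_sub_distrib, Finset.mul_sum, Finset.sum_ite_eq',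
        Finset.mem_univ, if_true]
    rw [h1, h2]
    ring
  obtain ⟨r, hr⟩ := hline _ key
  refine ⟨r / 2, fun v => ?_⟩
  have := congrArg (fun β : E [⋀^Fin n]→ₗ[ℝ] ℂ => β v) hr
  simp only [AlternatingMap.sub_apply, AlternatingMap.smul_apply, hγ, hγ', smul_eq_mul] at this
  rw [along, this]
  ring

lemma IsConnCoeff.sub {c c' : F} {X X' : F × E → E} {J : F × E → E →L[ℝ] E}
    {α : F × E → E [⋀^Fin n]→ₗ[ℝ] ℂ} {z : F × E} {θ θ' : ℂ} (hX : DifferentiableAt ℝ X z)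
    (hX' : DifferentiableAt ℝ X' z) (h : IsConnCoeff c X J α z θ) (h' : IsConnCoeff c' X' J α z θ')
    : IsConnCoeff (c - c') (fun w => X w - X' w) J α z (θ - θ') := by
  intro v
  have e1 : along (c - c') (fun w => X w - X' w) (fun y => α y v) z
      = along c X (fun y => α y v) z - along c' X' (fun y => α y v) z := by
    simp only [along]
    rw [← map_sub]
    rfl
  have e0 : along (c - c') (fun w => X w - X' w) J z = along c X J z - along c' X' J z := by
    simp only [along]
    rw [← map_sub]
    rfl
  have e2 : vert (fun w => X w - X' w) z = vert X z - vert X' z := by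
    simp only [vert]
    rw [fderiv_fun_sub hX hX']
    rfl
  have e3 : connEnd (c - c') (fun w => X w - X' w) J z
      = connEnd c X J z - connEnd c' X' J z := by
    have h : ∀ a b g h j : E →L[ℝ] E,
        -(g - h) - (1 / 2 : ℝ) • (j * (a - b - (g - h) * j + j * (g - h)))
        = -g - (1 / 2 : ℝ) • (j * (a - g * j + j * g))
          - (-h - (1 / 2 : ℝ) • (j * (b - h * j + j * h))) := by
      intro a b g h j
      have : j * (a - b - (g - h) * j + j * (g - h))
          = j * (a - g * j + j * g) - j * (b - h * j + j * h) := by noncomm_ring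
      rw [this, smul_sub]
      abel
    simp only [connEnd, lieEnd]
    rw [e0, e2]
    exact h _ _ _ _ _
  rw [e1, e3]
  have e4 := act_sub (α z) (connEnd c X J z) (connEnd c' X' J z) v
  have e5 : act (α z) (connEnd c X J z - connEnd c' X' J z : E →L[ℝ] E) v
      = act (α z) (connEnd c X J z) v - act (α z) (connEnd c' X' J z) v := e4
  rw [e5]
  linear_combination h v - h' v

lemma IsConnCoeff.congr_slice {X X' : F × E → E} {J : F × E → E →L[ℝ] E}
    {α : F × E → E [⋀^Fin n]→ₗ[ℝ] ℂ} {z : F × E} {θ : ℂ} (hX : DifferentiableAt ℝ X z)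
    (hX' : DifferentiableAt ℝ X' z) (he : ∀ᶠ y in 𝓝 z.2, X (z.1, y) = X' (z.1, y))
    (h : IsConnCoeff 0 X J α z θ) : IsConnCoeff 0 X' J α z θ := by
  have h0 : X z = X' z := he.self_of_nhds
  have e1 : vert X z = vert X' z := by
    have hs : HasFDerivAt (fun y : E => (z.1, y)) (ContinuousLinearMap.inr ℝ F E) z.2 :=
      hasFDerivAt_prodMk_right _ _
    have h1 := HasFDerivAt.comp (g := X) z.2 hX.hasFDerivAt hs
    have h2 := HasFDerivAt.comp (g := X') z.2 hX'.hasFDerivAt hs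
    exact h1.unique (h2.congr_of_eventuallyEq he)
  intro v
  have := h v
  simpa only [connEnd, lieEnd, along, e1, h0] using this

end ConnCoeff

section Bump

variable {n : ℕ} {M : Type*} [TopologicalSpace M] [ChartedSpace (Model n) M]
  [IsManifold 𝓜[n] ∞ M]

lemma exists_bump [T2Space M] {U : Set M} {y : M} (hU : U ∈ 𝓝 y) :
    ∃ χ : M → ℝ, Smooth[n] χ ∧ (∀ᶠ z in 𝓝 y, χ z = 1) ∧ ∀ z, z ∉ U → ∀ᶠ w in 𝓝 z, χ w = 0 := by
  obtain ⟨χ, -, hχ⟩ := (SmoothBumpFunction.nhds_basis_tsupport (I := 𝓜[n]) y).mem_iff.1 hU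
  refine ⟨χ, χ.contMDiff, χ.eventuallyEq_one, fun z hz => ?_⟩
  have : (tsupport χ)ᶜ ∈ 𝓝 z :=
    (isClosed_tsupport _).isOpen_compl.mem_nhds fun h => hz (hχ h)
  filter_upwards [this] with w hw
  exact image_eq_zero_of_notMem_tsupport hw

lemma exists_constVF_at [T2Space M] (hy : y ∈ dom n o) (v : Model n) :
    ∃ X : VF n M, SmoothVF X ∧ ∀ᶠ z in 𝓝 y, readV o X z = v := by
  obtain ⟨χ, hχ, h1, h0⟩ := exists_bump (n := n) (dom_mem_nhds hy)
  refine ⟨fun z => χ z • dchartInv n o z v, fun z => ?_, ?_⟩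
  · by_cases hz : z ∈ dom n o
    · rw [vf_contMDiffAt_iff' hz]
      have h2 : ContMDiffAt 𝓜[n] 𝓜[n] ∞ (fun w => χ w • v) z :=
        ContMDiffAt.smul (hχ z) contMDiffAt_const
      refine h2.congr_of_eventuallyEq ?_
      filter_upwards [dom_mem_nhds hz] with w hw
      simp [readV, dchart_dchartInv hw]
    · rw [vf_contMDiffAt_iff' (self_mem_dom z)]
      refine (contMDiffAt_const (c := (0 : Model n))).congr_of_eventuallyEq ?_
      filter_upwards [h0 z hz] with w hw
      simp [readV, hw]
  · filter_upwards [h1, dom_mem_nhds hy] with z hz hd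
    simp [readV, hz, dchart_dchartInv hd]

end Bump

section ComplexFunctions

variable {E H N : Type*} [NormedAddCommGroup E] [NormedSpace ℝ E] [TopologicalSpace H]
  {I : ModelWithCorners ℝ E H} [TopologicalSpace N] [ChartedSpace H N] {f g : N → ℂ} {x : N}

lemma ContMDiffAt.cmul (hf : ContMDiffAt I 𝓘(ℝ, ℂ) ∞ f x) (hg : ContMDiffAt I 𝓘(ℝ, ℂ) ∞ g x) :
    ContMDiffAt I 𝓘(ℝ, ℂ) ∞ (fun y => f y * g y) x := by
  have h : ContDiff ℝ ∞ (fun z : ℂ × ℂ => z.1 * z.2) := contDiff_mul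
  exact h.contMDiff.contMDiffAt.comp x (hf.prodMk_space hg)

lemma ContMDiffAt.cpow (hf : ContMDiffAt I 𝓘(ℝ, ℂ) ∞ f x) (m : ℕ) :
    ContMDiffAt I 𝓘(ℝ, ℂ) ∞ (fun y => f y ^ m) x := by
  have h : ContDiff ℝ ∞ (fun z : ℂ => z ^ m) := contDiff_id.pow m
  exact h.contMDiff.contMDiffAt.comp x hf

end ComplexFunctions

section Frames

variable {n : ℕ} {M : Type*} [TopologicalSpace M] [ChartedSpace (Model n) M]
  [IsManifold 𝓜[n] ∞ M]
  (V : M → Type*) [TopologicalSpace (TotalSpace ℂ V)] [∀ x, TopologicalSpace (V x)]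
  [∀ x, AddCommGroup (V x)] [∀ x, Module ℂ (V x)]
  [FiberBundle ℂ V] [VectorBundle ℂ ℂ V]
  {o y : M}

/-- The domain of the preferred trivialization of a line bundle around `o`. -/
def base (o : M) : Set M := (trivializationAt ℂ V o).baseSet

variable {V}

lemma base_mem_nhds (hy : y ∈ base V o) : base V o ∈ 𝓝 y :=
  (trivializationAt ℂ V o).open_baseSet.mem_nhds hy

lemma self_mem_base (o : M) : o ∈ base V o := mem_baseSet_trivializationAt ℂ V o

lemma lineCoord_lineFrame (hy : y ∈ base V o) : lineCoord V o y (lineFrame V o y) = 1 :=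
  (trivializationAt ℂ V o).linearMapAt_symmₗ hy 1

lemma lineCoord_smul_lineFrame (hy : y ∈ base V o) (v : V y) :
    lineCoord V o y v • lineFrame V o y = v := by
  rw [lineFrame, ← map_smul, smul_eq_mul, mul_one]
  exact (trivializationAt ℂ V o).symmₗ_linearMapAt hy v

lemma lineFrame_ne_zero (hy : y ∈ base V o) : lineFrame V o y ≠ 0 := by
  intro h
  have := lineCoord_lineFrame hy
  rw [h, map_zero] at this
  exact zero_ne_one this

variable [VectorBundle ℝ ℂ V] [ContMDiffVectorBundle ∞ ℂ V 𝓜[n]]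

lemma contMDiffAt_section_iff (hy : y ∈ base V o) {s : (x : M) → V x} :
    ContMDiffAt 𝓜[n] (𝓜[n].prod 𝓘(ℝ, ℂ)) ∞
      (fun x => (⟨x, s x⟩ : TotalSpace ℂ V)) y ↔
    ContMDiffAt 𝓜[n] 𝓘(ℝ, ℂ) ∞ (fun z => lineCoord V o z (s z)) y := by
  have he : ((⟨y, s y⟩ : TotalSpace ℂ V)) ∈ (trivializationAt ℂ V o).source := by
    rw [Bundle.Trivialization.mem_source]
    exact hy
  rw [(trivializationAt ℂ V o).contMDiffAt_iff (f := fun x => (⟨x, s x⟩ : TotalSpace ℂ V)) he]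
  have h2 : (fun z => ((trivializationAt ℂ V o) ⟨z, s z⟩).2) =ᶠ[𝓝 y]
      fun z => lineCoord V o z (s z) := by
    filter_upwards [base_mem_nhds hy] with z hz
    rw [lineCoord, Bundle.Trivialization.linearMapAt_apply]
    exact (if_pos hz).symm
  constructor
  · intro h
    exact h.2.congr_of_eventuallyEq h2.symm
  · intro h
    exact ⟨contMDiffAt_id, h.congr_of_eventuallyEq h2⟩

lemma contMDiffAt_lineFrame (hy : y ∈ base V o) : ContMDiffAt 𝓜[n] (𝓜[n].prod 𝓘(ℝ, ℂ)) ∞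
      (fun x => (⟨x, lineFrame V o x⟩ : TotalSpace ℂ V)) y := by
  rw [contMDiffAt_section_iff hy]
  refine (contMDiffAt_const (c := (1 : ℂ))).congr_of_eventuallyEq ?_
  filter_upwards [base_mem_nhds hy] with z hz
  exact lineCoord_lineFrame hz

/-- A global smooth section that agrees with the local frame around `o` near a point. -/
lemma exists_section_eq_lineFrame [T2Space M] (hy : y ∈ base V o) :
    ∃ s : (x : M) → V x, SmoothLineSec n s ∧ ∀ᶠ z in 𝓝 y, s z = lineFrame V o z := by
  obtain ⟨χ, hχ, h1, h0⟩ := exists_bump (n := n) (base_mem_nhds hy)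
  refine ⟨fun z => (χ z : ℂ) • lineFrame V o z, fun z => ?_, ?_⟩
  · have hc : ContMDiffAt 𝓜[n] 𝓘(ℝ, ℂ) ∞ (fun w => (χ w : ℂ)) z :=
      Complex.ofRealCLM.contMDiff.contMDiffAt.comp z (hχ z)
    by_cases hz : z ∈ base V o
    · rw [contMDiffAt_section_iff hz]
      refine hc.congr_of_eventuallyEq ?_
      filter_upwards [base_mem_nhds hz] with w hw
      simp [lineCoord_lineFrame hw]
    · rw [contMDiffAt_section_iff (self_mem_base z)]
      refine (contMDiffAt_const (c := (0 : ℂ))).congr_of_eventuallyEq ?_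
      filter_upwards [h0 z hz] with w hw
      simp [hw]
  · filter_upwards [h1] with z hz
    simp [hz]

lemma contMDiffAt_transition {o x₁ y : M} (hy : y ∈ base V o) (hy' : y ∈ base V x₁) :
    ContMDiffAt 𝓜[n] 𝓘(ℝ, ℂ) ∞ (fun z => lineCoord V x₁ z (lineFrame V o z)) y :=
  (contMDiffAt_section_iff hy').1 (contMDiffAt_lineFrame hy)

end Frames

section PFrames

variable {n : ℕ} {M : Type*} [TopologicalSpace M] [ChartedSpace (Model n) M]
  [IsManifold 𝓜[n] ∞ M]
  {L : M → Type*} [TopologicalSpace (TotalSpace ℂ L)] [∀ x, TopologicalSpace (L x)]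
  [∀ x, AddCommGroup (L x)] [∀ x, Module ℂ (L x)]
  [FiberBundle ℂ L] [VectorBundle ℂ ℂ L]
  {δ : M → Type*} [TopologicalSpace (TotalSpace ℂ δ)] [∀ x, TopologicalSpace (δ x)]
  [∀ x, AddCommGroup (δ x)] [∀ x, Module ℂ (δ x)]
  [FiberBundle ℂ δ] [VectorBundle ℂ ℂ δ] {k : ℕ}
  {o y : M}

lemma pCoord_tprod (o y : M) (v : Fin k → L y) (w : δ y) :
    pCoord L δ k o y (PiTensorProduct.tprod ℂ v ⊗ₜ[ℂ] w)
      = (∏ i, lineCoord L o y (v i)) * lineCoord δ o y w := by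
  simp [pCoord]

lemma pCoord_pFrame (hy : y ∈ base L o) (hy' : y ∈ base δ o) :
    pCoord L δ k o y (pFrame L δ k o y) = 1 := by
  rw [pFrame, pCoord_tprod]
  simp [lineCoord_lineFrame hy, lineCoord_lineFrame hy']

lemma pCoord_smul_pFrame (hy : y ∈ base L o) (hy' : y ∈ base δ o) (s : PFib L δ k y) :
    pCoord L δ k o y s • pFrame L δ k o y = s := by
  induction s using TensorProduct.induction_on with
  | zero => simp
  | add a b ha hb => rw [map_add, add_smul, ha, hb]
  | tmul a w =>
    induction a using PiTensorProduct.induction_on with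
    | smul_tprod r v =>
      rw [← TensorProduct.smul_tmul', map_smul, smul_assoc]
      congr 1
      rw [pCoord_tprod, pFrame]
      conv_rhs => rw [← lineCoord_smul_lineFrame hy' w]
      have : v = fun i => lineCoord L o y (v i) • lineFrame L o y := by
        funext i
        rw [lineCoord_smul_lineFrame hy]
      conv_rhs => rw [this, MultilinearMap.map_smul_univ]
      rw [TensorProduct.smul_tmul_smul]
    | add a b ha hb => rw [TensorProduct.add_tmul, map_add, add_smul, ha, hb]

lemma pCoord_injective (hy : y ∈ base L o) (hy' : y ∈ base δ o) {s t : PFib L δ k y}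
    (h : pCoord L δ k o y s = pCoord L δ k o y t) : s = t := by
  rw [← pCoord_smul_pFrame hy hy' s, h, pCoord_smul_pFrame hy hy']

lemma pCoord_transition {o x₁ y : M} (hy : y ∈ base L o) (hy' : y ∈ base δ o) (s : PFib L δ k y) :
    pCoord L δ k x₁ y s
      = lineCoord L x₁ y (lineFrame L o y) ^ k * lineCoord δ x₁ y (lineFrame δ o y)
        * pCoord L δ k o y s := by
  conv_lhs => rw [← pCoord_smul_pFrame hy hy' s]
  rw [map_smul, smul_eq_mul, pFrame, pCoord_tprod, Finset.prod_const, Finset.card_univ,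
    Fintype.card_fin, mul_comm]

lemma lineTransition_mul {V : M → Type*} [TopologicalSpace (TotalSpace ℂ V)]
    [∀ x, TopologicalSpace (V x)] [∀ x, AddCommGroup (V x)] [∀ x, Module ℂ (V x)] [FiberBundle ℂ V]
    [VectorBundle ℂ ℂ V] {o x₁ y : M} (hy : y ∈ base V o) (hy' : y ∈ base V x₁) :
    lineCoord V x₁ y (lineFrame V o y) * lineCoord V o y (lineFrame V x₁ y) = 1 := by
  rw [mul_comm, ← smul_eq_mul, ← map_smul, lineCoord_smul_lineFrame hy, lineCoord_lineFrame hy']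

variable [VectorBundle ℝ ℂ L] [ContMDiffVectorBundle ∞ ℂ L 𝓜[n]]
  [VectorBundle ℝ ℂ δ] [ContMDiffVectorBundle ∞ ℂ δ 𝓜[n]]

lemma mem_PSpace_iff {s : Sec L δ k} : s ∈ PSpace n L δ k ↔
    ∀ o, ∀ y ∈ base L o ∩ base δ o,
      ContMDiffAt 𝓜[n] 𝓘(ℝ, ℂ) ∞ (fun y => pCoord L δ k o y (s y)) y := by
  refine forall_congr' fun o => ⟨fun h y hy => (h y hy).contMDiffAt
    (Filter.inter_mem (base_mem_nhds hy.1) (base_mem_nhds hy.2)), fun h y hy =>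
    (h y hy).contMDiffWithinAt⟩

lemma smoothSecSurface_iff {Φ : ℝ² → Sec L δ k} : SmoothSecSurface n Φ ↔
    ∀ u o, ∀ y ∈ base L o ∩ base δ o,
      ContMDiffAt (𝓘(ℝ, ℝ²).prod 𝓜[n]) 𝓘(ℝ, ℂ) ∞
        (fun z : ℝ² × M => pCoord L δ k o z.2 (Φ z.1 z.2)) (u, y) := by
  constructor
  · intro h u o y hy
    refine (h o (u, y) ⟨mem_univ _, hy⟩).contMDiffAt ?_
    exact prod_mem_nhds Filter.univ_mem
      (Filter.inter_mem (base_mem_nhds hy.1) (base_mem_nhds hy.2))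
  · rintro h o ⟨u, y⟩ hy
    exact (h u o y hy.2).contMDiffWithinAt

/-- Smoothness of the coordinate of a family of sections does not depend on the frame. -/
lemma contMDiffAt_pCoord_change {P : Type*} [NormedAddCommGroup P] [NormedSpace ℝ P]
    {Φ : P → Sec L δ k} {u : P} {o x₁ y : M}
    (hy : y ∈ base L o ∩ base δ o) (hy' : y ∈ base L x₁ ∩ base δ x₁)
    (h : ContMDiffAt (𝓘(ℝ, P).prod 𝓜[n]) 𝓘(ℝ, ℂ) ∞
        (fun z : P × M => pCoord L δ k o z.2 (Φ z.1 z.2)) (u, y)) :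
    ContMDiffAt (𝓘(ℝ, P).prod 𝓜[n]) 𝓘(ℝ, ℂ) ∞
        (fun z : P × M => pCoord L δ k x₁ z.2 (Φ z.1 z.2)) (u, y) := by
  have h1 := contMDiffAt_const_param u (contMDiffAt_transition (n := n) hy.1 hy'.1)
  have h2 := contMDiffAt_const_param u (contMDiffAt_transition (n := n) hy.2 hy'.2)
  refine (ContMDiffAt.cmul (ContMDiffAt.cmul (ContMDiffAt.cpow h1 k) h2) h).congr_of_eventuallyEq ?_
  have hn : ∀ᶠ z : P × M in 𝓝 (u, y), z.2 ∈ base L o ∩ base δ o :=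
    (continuous_snd.tendsto' (u, y) y rfl).eventually
      (Filter.inter_mem (base_mem_nhds hy.1) (base_mem_nhds hy.2))
  filter_upwards [hn] with z hz
  exact pCoord_transition hz.1 hz.2 _

lemma smoothSecSurface_of_self {Φ : ℝ² → Sec L δ k}
    (h : ∀ u y, ContMDiffAt (𝓘(ℝ, ℝ²).prod 𝓜[n]) 𝓘(ℝ, ℂ) ∞
        (fun z : ℝ² × M => pCoord L δ k y z.2 (Φ z.1 z.2)) (u, y)) :
    SmoothSecSurface n Φ :=
  smoothSecSurface_iff.2 fun u _ y hy =>
    contMDiffAt_pCoord_change ⟨self_mem_base y, self_mem_base y⟩ hy (h u y)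

lemma SmoothSecSurface.const {s : Sec L δ k} (hs : s ∈ PSpace n L δ k) :
    SmoothSecSurface n (fun _ => s) :=
  smoothSecSurface_iff.2 fun u o y hy =>
    contMDiffAt_const_param u (mem_PSpace_iff.1 hs o y hy)

lemma SmoothSecSurface.mem_PSpace {Φ : ℝ² → Sec L δ k} (h : SmoothSecSurface n Φ) (u : ℝ²) :
    Φ u ∈ PSpace n L δ k :=
  mem_PSpace_iff.2 fun o y hy =>
    contMDiffAt_fix_param (smoothSecSurface_iff.1 h u o y hy)

end PFrames

lemma contDiffAt_clm_of_apply {H E G : Type*} [NormedAddCommGroup H] [NormedSpace ℝ H]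
    [NormedAddCommGroup E] [NormedSpace ℝ E] [FiniteDimensional ℝ E] [NormedAddCommGroup G]
    [NormedSpace ℝ G] {K : H → E →L[ℝ] G} {z : H} (h : ∀ v, ContDiffAt ℝ ∞ (fun y => K y v) z) :
    ContDiffAt ℝ ∞ K z := by
  let b := Module.finBasis ℝ E
  have : K = fun y => ∑ i, (LinearMap.toContinuousLinearMap (b.coord i)).smulRight (K y (b i)) := by
    funext y
    ext v
    have h1 := congrArg (K y) (b.sum_repr v)
    rw [map_sum] at h1
    rw [← h1, sum_apply]
    simp only [map_smul]
    rfl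
  rw [this]
  refine ContDiffAt.sum fun i _ => ?_
  exact (ContinuousLinearMap.smulRightL ℝ E G
    (LinearMap.toContinuousLinearMap (b.coord i))).contDiff.contDiffAt.comp z (h (b i))

lemma contDiffAt_inverse {H E : Type*} [NormedAddCommGroup H] [NormedSpace ℝ H]
    [NormedAddCommGroup E] [NormedSpace ℝ E] [FiniteDimensional ℝ E] {K : H → E →L[ℝ] E} {z : H}
    (hK : ContDiffAt ℝ ∞ K z) (hi : (K z).IsInvertible) :
    ContDiffAt ℝ ∞ (fun y => (K y).inverse) z := by
  have : CompleteSpace E := FiniteDimensional.complete ℝ E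
  obtain ⟨e, he⟩ := hi
  have h := contDiffAt_map_inverse (𝕜 := ℝ) (n := ∞) e
  rw [he] at h
  exact h.comp z hK

section Symplectic

variable {n : ℕ} {M : Type*} [TopologicalSpace M] [ChartedSpace (Model n) M]
  [IsManifold 𝓜[n] ∞ M] {Ω : SymplecticForm n M}
  {o y : M}

lemma finrank_tan (x : M) : Module.finrank ℝ (Tan n x) = 2 * n := by
  change Module.finrank ℝ (Model n) = 2 * n
  simp

lemma SymplecticForm.neg_swap (Ω : SymplecticForm n M) (x : M) (u v : Tan n x) :
    Ω x u v = -Ω x v u := ((Ω.alt x).neg_eq v u).symm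

lemma twist_eq_zero (ja jb : CompatACS Ω) (x : M) (v : Tan n x)
    (h : twist (ja x).toLinearMap (jb x).toLinearMap v = 0) : v = 0 := by
  by_contra hv
  have h1 : v = jb x (ja x v) := by
    have : v - jb x (ja x v) = 0 := h
    exact sub_eq_zero.1 this
  have h2 : jb x v = -(ja x v) := by
    conv_lhs => rw [h1]
    exact jb.sq x _
  have h3 := jb.pos x v hv
  rw [h2, map_neg] at h3
  linarith [ja.pos x v hv]

/-- Families of vector fields depending smoothly on parameters. -/
def SmoothFamVF (X : ℝ² → VF n M) : Prop :=
  ContMDiff (𝓘(ℝ, ℝ²).prod 𝓜[n]) (𝓜[n].tangent) ∞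
      (fun z : ℝ² × M => (⟨z.2, X z.1 z.2⟩ : TangentBundle 𝓜[n] M))

lemma SmoothVF.fam {X : VF n M} (hX : SmoothVF X) : SmoothFamVF (fun _ => X) :=
  hX.comp contMDiff_snd

lemma SmoothSurface.const (j : CompatACS Ω) : SmoothSurface (fun _ => j) :=
  fun X hX => (j.smooth X hX).fam

variable {P : Type*} [NormedAddCommGroup P] [NormedSpace ℝ P]

/-- A family of vector fields in the chart at `o`. -/
def hatV (o : M) (X : P → VF n M) : P × Model n → Model n :=
  flat o fun w : P × M => readV o (X w.1) w.2

/-- A family of almost complex structures in the chart at `o`. -/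
def hatJ (o : M) (p : P → CompatACS Ω) : P × Model n → Model n →L[ℝ] Model n :=
  flat o fun w : P × M => readE o (p w.1).toFun w.2

lemma hatV_apply (hy : y ∈ dom n o) (X : P → VF n M) (u : P) :
    hatV o X (u, chart n o y) = readV o (X u) y := flat_chart hy _ u

lemma hatJ_apply (hy : y ∈ dom n o) (p : P → CompatACS Ω) (u : P) :
    hatJ o p (u, chart n o y) = readE o (p u).toFun y := flat_chart hy _ u

lemma SmoothFamVF.hatV {X : ℝ² → VF n M} (hX : SmoothFamVF X) (hy : y ∈ dom n o) (u : ℝ²) :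
    ContDiffAt ℝ ∞ (hatV o X) (u, chart n o y) :=
  (contMDiffAt_iff_flat hy).1 ((vf_contMDiffAt_iff hy).1 (hX (u, y)))

lemma eventually_chartInv_mem {U : Set M} (hy : y ∈ dom n o) (hU : U ∈ 𝓝 y) (u : P) :
    ∀ᶠ w in 𝓝 (u, chart n o y), chartInv o (w : P × Model n).2 ∈ U := by
  have := (tendsto_chartInv (P := P) hy u).snd_nhds
  exact this hU

lemma target_mem_nhds (hy : y ∈ dom n o) : (extChartAt 𝓜[n] o).target ∈ 𝓝 (chart n o y) :=
  extChartAt_target_mem_nhds' ((extChartAt 𝓜[n] o).map_source (mem_dom_iff.1 hy))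

/-- Points near the image of `y` in the chart come from points near `y`. -/
lemma eventually_exists_chart {U : Set M} (hy : y ∈ dom n o) (hU : U ∈ 𝓝 y) (u : P) :
    ∀ᶠ w in 𝓝 (u, chart n o y), ∃ x ∈ U, x ∈ dom n o ∧ (w : P × Model n) = (w.1, chart n o x) := by
  have h2 : ∀ᶠ w : P × Model n in 𝓝 (u, chart n o y),
      w.2 ∈ (extChartAt 𝓜[n] o).target :=
    (continuous_snd.tendsto' (u, chart n o y) _ rfl).eventually (target_mem_nhds hy)
  filter_upwards [eventually_chartInv_mem hy hU u, h2] with w hw hw2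
  refine ⟨_, hw, ?_, ?_⟩
  · exact mem_dom_iff.2 ((extChartAt 𝓜[n] o).map_target hw2)
  · rw [chart, chartInv, (extChartAt 𝓜[n] o).right_inv hw2]

lemma eventually_chart {U : Set M} (hy : y ∈ dom n o) (hU : U ∈ 𝓝 y) {u : P}
    {Q : P × Model n → Prop} (h : ∀ u', ∀ x ∈ U, x ∈ dom n o → Q (u', chart n o x)) :
    ∀ᶠ w in 𝓝 (u, chart n o y), Q w := by
  filter_upwards [eventually_exists_chart hy hU u] with w hw
  obtain ⟨x, hx, hxd, hxe⟩ := hw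
  rw [hxe]
  exact h _ x hx hxd

lemma hatJ_mul_self (hy : y ∈ dom n o) (p : P → CompatACS Ω) (u : P) :
    hatJ o p (u, chart n o y) * hatJ o p (u, chart n o y) = -1 := by
  rw [hatJ_apply hy]
  ext1 v
  change dchart n o y (p u y (dchartInv n o y (dchart n o y (p u y (dchartInv n o y v))))) = -v
  rw [dchartInv_dchart hy, (p u).sq, map_neg, dchart_dchartInv hy]

lemma eventually_hatJ_mul_self (hy : y ∈ dom n o) (p : P → CompatACS Ω) (u : P) :
    ∀ᶠ w in 𝓝 (u, chart n o y), hatJ o p w * hatJ o p w = -1 :=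
  eventually_chart hy Filter.univ_mem fun u' _ _ hx => hatJ_mul_self hx p u'

lemma hatJ_hatV (hy : y ∈ dom n o) (p : P → CompatACS Ω) (X : P → VF n M) (u : P) :
    hatV o (fun u y => p u y (X u y)) (u, chart n o y)
      = hatJ o p (u, chart n o y) (hatV o X (u, chart n o y)) := by
  rw [hatJ_apply hy, hatV_apply hy, hatV_apply hy, readE_readV hy]

variable [T2Space M]

lemma SmoothSurface.hatJ {p : ℝ² → CompatACS Ω} (hp : SmoothSurface p) (hy : y ∈ dom n o) (u : ℝ²) :
    ContDiffAt ℝ ∞ (hatJ o p) (u, chart n o y) := by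
  refine contDiffAt_clm_of_apply fun v => ?_
  obtain ⟨X, hX, hXv⟩ := exists_constVF_at hy v
  have h := (show SmoothFamVF (fun u y => p u y (X y)) from hp X hX).hatV hy u
  refine h.congr_of_eventuallyEq ?_
  refine eventually_chart hy hXv fun u' x hx hxd => ?_
  rw [hatJ_hatV hxd p (fun _ => X), hatV_apply hxd]
  rw [show readV o X x = v from hx]

lemma SmoothSurface.smoothFamVF {p : ℝ² → CompatACS Ω} (hp : SmoothSurface p) {X : ℝ² → VF n M}
    (hX : SmoothFamVF X) : SmoothFamVF (fun u y => p u y (X u y)) := by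
  rintro ⟨u, y⟩
  refine (vf_contMDiffAt_iff (X := fun u y => p u y (X u y)) (self_mem_dom y)).2
    ((contMDiffAt_iff_flat (self_mem_dom y)).2 ?_)
  refine ((hp.hatJ (self_mem_dom y) u).clm_apply (hX.hatV (self_mem_dom y) u)).congr_of_eventuallyEq ?_
  exact eventually_chart (self_mem_dom y) Filter.univ_mem fun u' x _ hx => hatJ_hatV hx p X u'

end Symplectic

section LineBundles

variable {n : ℕ} {M : Type*} [TopologicalSpace M] [ChartedSpace (Model n) M]
  [IsManifold 𝓜[n] ∞ M]
  {L : M → Type*} [TopologicalSpace (TotalSpace ℂ L)] [∀ x, TopologicalSpace (L x)]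
  [∀ x, AddCommGroup (L x)] [∀ x, Module ℂ (L x)]
  [∀ x, IsTopologicalAddGroup (L x)] [∀ x, ContinuousSMul ℝ (L x)]
  [FiberBundle ℂ L] [VectorBundle ℂ ℂ L] [VectorBundle ℝ ℂ L]
  [ContMDiffVectorBundle ∞ ℂ L 𝓜[n]]
  {δ : M → Type*} [TopologicalSpace (TotalSpace ℂ δ)] [∀ x, TopologicalSpace (δ x)]
  [∀ x, AddCommGroup (δ x)] [∀ x, Module ℂ (δ x)]
  [FiberBundle ℂ δ] [VectorBundle ℂ ℂ δ] [VectorBundle ℝ ℂ δ]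
  [ContMDiffVectorBundle ∞ ℂ δ 𝓜[n]]
  (D : QuantData n L δ)
  {o y : M}

lemma tensor_lineFrame (hy : y ∈ base δ o) (τ : δ y ⊗[ℂ] δ y) :
    ∃ c : ℂ, τ = c • (lineFrame δ o y ⊗ₜ[ℂ] lineFrame δ o y) := by
  induction τ using TensorProduct.induction_on with
  | zero => exact ⟨0, by simp⟩
  | add a b ha hb =>
    obtain ⟨c, hc⟩ := ha
    obtain ⟨c', hc'⟩ := hb
    exact ⟨c + c', by rw [hc, hc', add_smul]⟩
  | tmul a b =>
    refine ⟨lineCoord δ o y a * lineCoord δ o y b, ?_⟩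
    conv_lhs => rw [← lineCoord_smul_lineFrame hy a, ← lineCoord_smul_lineFrame hy b]
    rw [TensorProduct.smul_tmul_smul]

lemma tensor_lineFrame_ne_zero (hy : y ∈ base δ o) : lineFrame δ o y ⊗ₜ[ℂ] lineFrame δ o y ≠ 0 := by
  intro h
  have := congrArg (fun t => LinearMap.mul' ℂ ℂ
    (TensorProduct.map (lineCoord δ o y) (lineCoord δ o y) t)) h
  simp [lineCoord_lineFrame hy] at this

lemma exists_typeN0_base (x : M) : ∃ β ∈ typeN0 n (D.base x), β ≠ 0 := by
  refine ⟨D.half.toEquiv x (lineFrame δ x x ⊗ₜ[ℂ] lineFrame δ x x),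
    (D.half.toEquiv x _).2, fun h => ?_⟩
  have h1 := (D.half.toEquiv x).map_eq_zero_iff.1 (Subtype.ext h)
  exact tensor_lineFrame_ne_zero (self_mem_base x) h1

lemma phi_mem_spec (j : CompatACS D.form) (x : M) (τ : δ x ⊗[ℂ] δ x) :
    D.phi j x τ ∈ typeN0 n (j x) ∧ ∀ v : Fin n → Tan n x,
      D.phi j x τ (fun a => twist (D.base x).toLinearMap (j x).toLinearMap (v a))
        = 2 ^ n * (D.half.toEquiv x τ : Form n x) v :=
  Psi_spec (ja := (D.base x).toLinearMap) (jb := (j x).toLinearMap) (finrank_tan x)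
    (D.base.sq x) (j.sq x) (twist_eq_zero D.base j x) (D.half.toEquiv x τ).2
    (exists_typeN0_base D x)

lemma phi_mem (j : CompatACS D.form) (x : M) (τ : δ x ⊗[ℂ] δ x) :
    D.phi j x τ ∈ typeN0 n (j x) := (phi_mem_spec D j x τ).1

lemma phi_twist (j : CompatACS D.form) (x : M) (τ : δ x ⊗[ℂ] δ x) (v : Fin n → Tan n x) :
    D.phi j x τ (fun a => twist (D.base x).toLinearMap (j x).toLinearMap (v a))
        = 2 ^ n * (D.half.toEquiv x τ : Form n x) v := (phi_mem_spec D j x τ).2 v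

lemma phi_smul (j : CompatACS D.form) (x : M) (c : ℂ) (τ : δ x ⊗[ℂ] δ x) :
    D.phi j x (c • τ) = c • D.phi j x τ := by
  refine eq_of_comp_twist (twist_eq_zero D.base j x) fun v => ?_
  rw [phi_twist, AlternatingMap.smul_apply, phi_twist, map_smul]
  simp only [Submodule.coe_smul, AlternatingMap.smul_apply, smul_eq_mul]
  ring

lemma phi_ne_zero (j : CompatACS D.form) (x : M) {τ : δ x ⊗[ℂ] δ x} (hτ : τ ≠ 0) :
    D.phi j x τ ≠ 0 := by
  intro h
  have h1 : (D.half.toEquiv x τ : Form n x) ≠ 0 := fun h0 =>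
    hτ ((D.half.toEquiv x).map_eq_zero_iff.1 (Subtype.ext h0))
  obtain ⟨v, hv⟩ := ne_zero_iff_exists.1 h1
  have h2 := phi_twist D j x τ v
  rw [h] at h2
  exact mul_ne_zero (pow_ne_zero _ two_ne_zero) hv h2.symm

lemma typeN0_base_line (x : M) :
    ∀ α ∈ typeN0 n (D.base x), ∀ β ∈ typeN0 n (D.base x), α ≠ 0 → ∃ c : ℂ, β = c • α := by
  intro α hα β hβ hne
  obtain ⟨τ, hτ⟩ := (D.half.toEquiv x).surjective ⟨α, hα⟩
  obtain ⟨σ, hσ⟩ := (D.half.toEquiv x).surjective ⟨β, hβ⟩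
  obtain ⟨a, ha⟩ := tensor_lineFrame (self_mem_base x) τ
  obtain ⟨b, hb⟩ := tensor_lineFrame (self_mem_base x) σ
  have ha0 : a ≠ 0 := by
    rintro rfl
    rw [zero_smul] at ha
    rw [ha, map_zero] at hτ
    exact hne (congrArg Subtype.val hτ).symm
  refine ⟨b / a, ?_⟩
  have : σ = (b / a) • τ := by
    rw [ha, hb, smul_smul, div_mul_cancel₀ _ ha0]
  rw [this, map_smul, hτ] at hσ
  exact (congrArg Subtype.val hσ).symm

lemma typeN0_line (j : CompatACS D.form) (x : M) :
    ∀ α ∈ typeN0 n (j x), ∀ β ∈ typeN0 n (j x), α ≠ 0 → ∃ c : ℂ, β = c • α :=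
  typeN0_line_of_twist (ja := (D.base x).toLinearMap) (jb := (j x).toLinearMap) (D.base.sq x)
    (j.sq x) (twist_eq_zero D.base j x) (typeN0_base_line D x)

variable {P : Type*} [NormedAddCommGroup P] [NormedSpace ℝ P]

/-- The form `φ_{p u}(d ⊗ d)`, with `d` the frame of `δ` around `o`. -/
def frameForm (j : CompatACS D.form) (o y : M) : Form n y :=
  D.phi j y (lineFrame δ o y ⊗ₜ[ℂ] lineFrame δ o y)

/-- The form `φ_{p u}(d ⊗ d)` in the chart at `o`, with `d` the frame of `δ` around `o`. -/
def hatForm (o : M) (p : P → CompatACS D.form) (w : P × Model n) : Model n [⋀^Fin n]→ₗ[ℝ] ℂ :=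
  readF o (frameForm D (p w.1) o) (chartInv o w.2)

lemma hatForm_apply (hy : y ∈ dom n o) (p : P → CompatACS D.form) (u : P) :
    hatForm D o p (u, chart n o y) = readF o (frameForm D (p u) o) y := by
  simp only [hatForm, chartInv_chart hy]

lemma readF_mem_typeN0 (hy : y ∈ dom n o) {κ : (x : M) → Form n x} {J : EndField n M}
    (h : κ y ∈ typeN0 n (J y)) : readF o κ y ∈ typeN0 n (readE o J y) := by
  refine typeN0_comp (ja := (readE o J y).toLinearMap) (jb := (J y).toLinearMap) h _ fun v => ?_
  exact dchartInv_dchart hy _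

lemma hatForm_mem (hy : y ∈ dom n o) (p : P → CompatACS D.form) (u : P) :
    hatForm D o p (u, chart n o y) ∈ typeN0 n (hatJ o p (u, chart n o y)) := by
  rw [hatForm_apply D hy, hatJ_apply hy]
  exact readF_mem_typeN0 hy (phi_mem D _ _ _)

lemma readF_dchart (hy : y ∈ dom n o) (κ : (x : M) → Form n x) (v : Fin n → Tan n y) :
    readF o κ y (fun a => dchart n o y (v a)) = κ y v := by
  simp [readF, dchartInv_dchart hy]

lemma hatForm_line (hy : y ∈ dom n o) (hb : y ∈ base δ o) (p : P → CompatACS D.form) (u : P) :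
    ∀ β ∈ typeN0 n (hatJ o p (u, chart n o y)),
      ∃ r : ℂ, β = r • hatForm D o p (u, chart n o y) := by
  intro β hβ
  rw [hatJ_apply hy] at hβ
  have h1 : β.compLinearMap (dchart n o y).toLinearMap ∈ typeN0 n (p u y) := by
    refine typeN0_comp (ja := (p u y).toLinearMap) (jb := (readE o (p u).toFun y).toLinearMap)
      hβ _ fun v => ?_
    change dchart n o y (p u y v) = dchart n o y (p u y (dchartInv n o y (dchart n o y v)))
    rw [dchartInv_dchart hy]
  obtain ⟨r, hr⟩ := typeN0_line D (p u) y _ (phi_mem D (p u) y _) _ h1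
    (phi_ne_zero D (p u) y (tensor_lineFrame_ne_zero hb))
  refine ⟨r, AlternatingMap.ext fun v => ?_⟩
  have h2 := congrArg (fun α : Form n y => α (fun a => dchartInv n o y (v a))) hr
  rw [hatForm_apply D hy]
  have h3 : (fun a => dchart n o y (dchartInv n o y (v a))) = v := by
    funext a
    rw [dchart_dchartInv hy]
  change β (fun a => dchart n o y (dchartInv n o y (v a))) = _ at h2
  rw [h3] at h2
  exact h2

lemma hatForm_ne_zero (hy : y ∈ dom n o) (hb : y ∈ base δ o) (p : P → CompatACS D.form) (u : P) :
    hatForm D o p (u, chart n o y) ≠ 0 := by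
  rw [hatForm_apply D hy]
  obtain ⟨v, hv⟩ := ne_zero_iff_exists.1 (phi_ne_zero D (p u) y (tensor_lineFrame_ne_zero hb))
  refine ne_zero_iff_exists.2 ⟨fun a => dchart n o y (v a), ?_⟩
  rw [readF_dchart hy]
  exact hv

variable [T2Space M]

lemma smoothFormAt_base (hy : y ∈ dom n o) (hb : y ∈ base δ o) (u : P) :
    SmoothFormAt (fun w : P × Model n => readF o (fun y => (D.half.toEquiv y
      (lineFrame δ o y ⊗ₜ[ℂ] lineFrame δ o y) : Form n y)) (chartInv o w.2))
      (u, chart n o y) := by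
  intro v
  choose X hX hXv using fun a => exists_constVF_at hy (v a)
  obtain ⟨s, hs, hsf⟩ := exists_section_eq_lineFrame (n := n) hb
  have h := (contMDiffAt_iff_flat hy).1 (contMDiffAt_const_param u (D.half.smooth s s hs hs X hX y))
  refine h.congr_of_eventuallyEq ?_
  have hU : ∀ᶠ z in 𝓝 y, s z = lineFrame δ o z ∧ ∀ a, readV o (X a) z = v a :=
    hsf.and (Filter.eventually_all.2 hXv)
  refine eventually_chart hy hU fun u' x hx hxd => ?_
  rw [flat_chart hxd]
  simp only [chartInv_chart hxd]
  have h2 := readF_readV hxd (fun y => (D.half.toEquiv y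
      (lineFrame δ o y ⊗ₜ[ℂ] lineFrame δ o y) : Form n y)) X
  have h3 : (fun a => readV o (X a) x) = v := funext hx.2
  rw [h3] at h2
  rw [h2, hx.1]

lemma smoothFormAt_hatForm {p : ℝ² → CompatACS D.form} (hp : SmoothSurface p) (hy : y ∈ dom n o)
    (hb : y ∈ base δ o) (u : ℝ²) : SmoothFormAt (hatForm D o p) (u, chart n o y) := by
  intro v
  let T : ℝ² × Model n → Model n →L[ℝ] Model n := fun w =>
    1 - hatJ o p w * hatJ o (fun _ : ℝ² => D.base) w
  have hT : ContDiffAt ℝ ∞ T (u, chart n o y) := by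
    refine contDiffAt_const.sub ?_
    exact (hp.hatJ hy u).clm_comp ((SmoothSurface.const D.base).hatJ hy u)
  have hTw : ∀ u', ∀ x ∈ dom n o, ∀ v : Tan n x, T (u', chart n o x) (dchart n o x v)
      = dchart n o x (twist (D.base x).toLinearMap (p u' x).toLinearMap v) := by
    intro u' x hx v
    simp only [T, hatJ_apply hx]
    change dchart n o x v - dchart n o x (p u' x (dchartInv n o x (dchart n o x
      (D.base x (dchartInv n o x (dchart n o x v)))))) = _
    rw [dchartInv_dchart hx, dchartInv_dchart hx, ← map_sub]
    rfl
  have hTi : ∀ u', ∀ x ∈ dom n o, (T (u', chart n o x)).IsInvertible := by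
    intro u' x hx
    have hinj : Function.Injective (T (u', chart n o x)) := by
      rw [injective_iff_map_eq_zero]
      intro v hv
      have h1 := hTw u' x hx (dchartInv n o x v)
      rw [dchart_dchartInv hx, hv] at h1
      have h2 := congrArg (dchartInv n o x) h1
      rw [map_zero, dchartInv_dchart hx] at h2
      have h3 := twist_eq_zero D.base (p u') x _ h2.symm
      rw [← dchart_dchartInv hx v, h3, map_zero]
    exact ⟨(LinearEquiv.ofInjectiveEndo _ hinj).toContinuousLinearEquiv, by ext1 v; rfl⟩
  have hTs := contDiffAt_inverse hT (hTi u y hy)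
  have h0 := smoothFormAt_base D hy hb u
  have h1 := h0.apply (w := fun a w => (T w).inverse (v a)) fun a => hTs.clm_apply contDiffAt_const
  refine (contDiffAt_const (c := (2 ^ n : ℂ)).mul h1).congr_of_eventuallyEq ?_
  refine eventually_chart hy (dom_mem_nhds hy) fun u' x _ hxd => ?_
  simp only [chartInv_chart hxd, hatForm_apply D hxd]
  obtain ⟨e, he⟩ := hTi u' x hxd
  rw [← he, ContinuousLinearMap.inverse_equiv]
  have h2 := phi_twist D (p u') x (lineFrame δ o x ⊗ₜ[ℂ] lineFrame δ o x)
    (fun a => dchartInv n o x (e.symm (v a)))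
  refine Eq.trans ?_ h2
  refine Eq.trans ?_ (readF_dchart hxd (frameForm D (p u') o) _)
  congr 1
  funext a
  rw [← hTw u' x hxd, dchart_dchartInv hxd, ← he]
  exact (e.apply_symm_apply (v a)).symm

section DirDeriv

variable {G : Type*} [NormedAddCommGroup G] [NormedSpace ℝ G] {X : VF n M} {y : M}

lemma dirDeriv_congr {f g : M → G} (h : f =ᶠ[𝓝 y] g) : dirDeriv X f y = dirDeriv X g y := by
  simp only [dirDeriv, mvfderiv]
  rw [h.mfderiv_eq, h.eq_of_nhds]

lemma dirDeriv_add {f g : M → G} (hf : MDifferentiableAt 𝓜[n] 𝓘(ℝ, G) f y)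
    (hg : MDifferentiableAt 𝓜[n] 𝓘(ℝ, G) g y) :
    dirDeriv X (fun z => f z + g z) y = dirDeriv X f y + dirDeriv X g y := by
  have h := mvfderiv_add hf hg
  exact congrArg (fun T : Tan n y →L[ℝ] G => T (X y)) h

lemma dirDeriv_clm {G' : Type*} [NormedAddCommGroup G'] [NormedSpace ℝ G'] (T : G →L[ℝ] G')
    {f : M → G} (hf : MDifferentiableAt 𝓜[n] 𝓘(ℝ, G) f y) :
    dirDeriv X (fun z => T (f z)) y = T (dirDeriv X f y) := by
  have h := (T.hasMFDerivAt.comp y hf.hasMFDerivAt).mfderiv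
  exact congrArg (fun S : Tan n y →L[ℝ] G' => S (X y)) h

lemma mdiff_of_smooth {f : M → G} (hf : ContMDiffAt 𝓜[n] 𝓘(ℝ, G) ∞ f y) :
    MDifferentiableAt 𝓜[n] 𝓘(ℝ, G) f y := hf.mdifferentiableAt (by simp)

lemma dirDeriv_cmul {f g : M → ℂ} (hf : ContMDiffAt 𝓜[n] 𝓘(ℝ, ℂ) ∞ f y)
    (hg : ContMDiffAt 𝓜[n] 𝓘(ℝ, ℂ) ∞ g y) :
    dirDeriv X (fun z => f z * g z) y = dirDeriv X f y * g y + f y * dirDeriv X g y := by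
  have hd := self_mem_dom (n := n) y
  rw [dirDeriv_eq_fderiv hd X (mdiff_of_smooth (ContMDiffAt.cmul hf hg)), dirDeriv_eq_fderiv hd X (mdiff_of_smooth hf),
    dirDeriv_eq_fderiv hd X (mdiff_of_smooth hg), fderiv_fun_mul
      (toDiffAt ((contMDiffAt_iff_chart hd).1 hf))
      (toDiffAt ((contMDiffAt_iff_chart hd).1 hg)), chartInv_chart hd]
  simp only [_root_.add_apply, _root_.smul_apply, smul_eq_mul]
  ring

lemma dirDeriv_cpow {f : M → ℂ} (hf : ContMDiffAt 𝓜[n] 𝓘(ℝ, ℂ) ∞ f y) (h0 : f y ≠ 0) (k : ℕ) :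
    dirDeriv X (fun z => f z ^ k) y = f y ^ k * (k * (dirDeriv X f y / f y)) := by
  induction k with
  | zero => simp [dirDeriv, mvfderiv_const]
  | succ k ih =>
    simp only [pow_succ]
    rw [dirDeriv_cmul (ContMDiffAt.cpow hf k) hf, ih]
    field_simp
    push_cast
    ring

lemma along_vertical {F E : Type*} [NormedAddCommGroup F] [NormedSpace ℝ F] [NormedAddCommGroup E]
    [NormedSpace ℝ E] (X Y : F × E → E) (z : F × E) : along 0 Y X z = vert X z (Y z) := by
  simp [along, vert]

end DirDeriv

lemma SmoothVF.hatV {X : VF n M} (hX : SmoothVF X) (hy : y ∈ dom n o) (u : P) :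
    ContDiffAt ℝ ∞ (GeomQuant.hatV o (fun _ : P => X)) (u, chart n o y) :=
  (contMDiffAt_iff_flat hy).1 (contMDiffAt_const_param u (hX.readV hy))

lemma hatV_bracket {X Y : VF n M} (hX : SmoothVF X) (hY : SmoothVF Y) (hy : y ∈ dom n o) (u : P) :
    hatV o (fun _ : P => bracket X Y) (u, chart n o y)
      = flatBracket 0 (hatV o (fun _ : P => X)) 0 (hatV o (fun _ : P => Y))
        (u, chart n o y) := by
  rw [hatV_apply hy, readV_bracket hy hX hY, VectorField.lieBracket, flatBracket]
  have key : ∀ (Z W : VF n M), SmoothVF W → along (0 : P) (hatV o (fun _ : P => Z))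
      (hatV o (fun _ : P => W)) (u, chart n o y) = fderiv ℝ (fun z => readV o W (chartInv o z))
        (chart n o y) (readV o Z y) := by
    intro Z W hW
    have h := along_flat_vertical (P := P) (u := u) hy (fun _ => Z)
      (f := fun w : P × M => readV o W w.2) (contMDiffAt_const_param u (hW.readV hy))
    exact h.trans (dirDeriv_eq_fderiv hy Z (mdiff_of_smooth (hW.readV hy)))
  rw [key X Y hY, key Y X hX, chartInv_chart hy]

variable {Ω : SymplecticForm n M} (Q : Prequantum L Ω)

instance (x : M) : T2Space (Tan n x) := inferInstanceAs (T2Space (Model n))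

/-- The connection form in the frame of `L` around `o`. -/
def lam (o y : M) : Tan n y →L[ℝ] ℂ :=
  LinearMap.toContinuousLinearMap
    ((lineCoord L o y).restrictScalars ℝ ∘ₗ (Q.cov (lineFrame L o) y).toLinearMap)

lemma lam_apply (o y : M) (v : Tan n y) :
    lam Q o y v = lineCoord L o y (Q.cov (lineFrame L o) y v) := rfl

lemma mdiff_section (hy : y ∈ base L o) {a : M → ℂ} (ha : ContMDiffAt 𝓜[n] 𝓘(ℝ, ℂ) ∞ a y) :
    ContMDiffAt 𝓜[n] (𝓜[n].prod 𝓘(ℝ, ℂ)) ∞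
      (fun x => (⟨x, a x • lineFrame L o x⟩ : TotalSpace ℂ L)) y := by
  rw [contMDiffAt_section_iff hy]
  refine ha.congr_of_eventuallyEq ?_
  filter_upwards [base_mem_nhds hy] with z hz
  rw [map_smul, lineCoord_lineFrame hz, smul_eq_mul, mul_one]

lemma cov_congr {s t : (x : M) → L x} {y : M}
    (hs : ContMDiffAt 𝓜[n] (𝓜[n].prod 𝓘(ℝ, ℂ)) ∞ (fun x => (⟨x, s x⟩ : TotalSpace ℂ L)) y)
    (ht : ContMDiffAt 𝓜[n] (𝓜[n].prod 𝓘(ℝ, ℂ)) ∞ (fun x => (⟨x, t x⟩ : TotalSpace ℂ L)) y)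
    (h : ∀ᶠ z in 𝓝 y, s z = t z) : Q.cov s y = Q.cov t y :=
  (Q.cov.isCovariantDerivativeOn (s := univ)).congr_of_eventuallyEq
    (hs.mdifferentiableAt (by simp)) (ht.mdifferentiableAt (by simp)) Filter.univ_mem h

lemma cov_lineFrame_smul (hy : y ∈ base L o) {a : M → ℂ} (ha : ContMDiffAt 𝓜[n] 𝓘(ℝ, ℂ) ∞ a y)
    (X : VF n M) : Q.cov (fun z => a z • lineFrame L o z) y (X y)
      = (dirDeriv X a y + a y * lam Q o y (X y)) • lineFrame L o y := by
  obtain ⟨σ, hσ, hσe⟩ := exists_section_eq_lineFrame (n := n) hy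
  have hI : SmoothLineSec n (fun z => I • σ z) := fun z => by
    rw [contMDiffAt_section_iff (self_mem_base z)]
    refine (ContMDiffAt.cmul (contMDiffAt_const (c := I))
      ((contMDiffAt_section_iff (self_mem_base z)).1 (hσ z))).congr_of_eventuallyEq ?_
    exact .of_forall fun w => by simp
  have hσd := (hσ y).mdifferentiableAt (n := ∞) (by simp)
  have hId := (hI y).mdifferentiableAt (n := ∞) (by simp)
  have hre : ContMDiffAt 𝓜[n] 𝓘(ℝ, ℝ) ∞ (fun z => (a z).re) y :=
    Complex.reCLM.contMDiff.contMDiffAt.comp y ha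
  have him : ContMDiffAt 𝓜[n] 𝓘(ℝ, ℝ) ∞ (fun z => (a z).im) y :=
    Complex.imCLM.contMDiff.contMDiffAt.comp y ha
  have hcov := Q.cov.isCovariantDerivativeOn (s := univ)
  have h1 := hcov.leibniz hσd (mdiff_of_smooth hre)
  have h2 := hcov.leibniz hId (mdiff_of_smooth him)
  have hsd : ∀ {b : M → ℝ} {τ : (x : M) → L x}, ContMDiffAt 𝓜[n] 𝓘(ℝ, ℝ) ∞ b y →
      SmoothLineSec n τ → ContMDiffAt 𝓜[n] (𝓜[n].prod 𝓘(ℝ, ℂ)) ∞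
      (fun x => (⟨x, (b • τ) x⟩ : TotalSpace ℂ L)) y := by
    intro b τ hb hτ
    rw [contMDiffAt_section_iff (self_mem_base y)]
    have hc : ContMDiffAt 𝓜[n] 𝓘(ℝ, ℂ) ∞ (fun w => (b w : ℂ)) y :=
      Complex.ofRealCLM.contMDiff.contMDiffAt.comp y hb
    refine (ContMDiffAt.cmul hc
      ((contMDiffAt_section_iff (self_mem_base y)).1 (hτ y))).congr_of_eventuallyEq ?_
    refine .of_forall fun w => ?_
    change lineCoord L y w ((b w : ℂ) • τ w) = _
    rw [map_smul, smul_eq_mul]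
  have h3 := hcov.add ((hsd hre hσ).mdifferentiableAt (by simp))
    ((hsd him hI).mdifferentiableAt (by simp))
  have h4 : Q.cov (fun z => a z • lineFrame L o z) y
      = Q.cov ((fun z => (a z).re) • σ + (fun z => (a z).im) • (fun z => I • σ z)) y := by
    have e : ∀ᶠ z in 𝓝 y, a z • lineFrame L o z
        = ((fun z => (a z).re) • σ + (fun z => (a z).im) • (fun z => I • σ z)) z := by
      filter_upwards [hσe] with z hz
      change _ = ((a z).re : ℂ) • σ z + ((a z).im : ℂ) • I • σ z
      rw [smul_smul, ← add_smul, Complex.re_add_im, hz]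
    have hs := mdiff_section hy ha
    refine cov_congr Q hs ?_ e
    refine hs.congr_of_eventuallyEq ?_
    filter_upwards [e] with z hz
    rw [hz]
  have h5 : Q.cov σ y = Q.cov (lineFrame L o) y :=
    cov_congr Q (hσ y) (contMDiffAt_lineFrame hy) hσe
  have h6 : Q.cov σ y (X y) = lam Q o y (X y) • lineFrame L o y := by
    rw [h5, lam_apply, lineCoord_smul_lineFrame hy]
  have h7 : Q.cov (fun z => I • σ z) y (X y) = I • Q.cov σ y (X y) :=
    Q.cov_complex σ hσ y (X y)
  have h8 : dirDeriv X a y = ((dirDeriv X (fun z => (a z).re) y : ℝ) : ℂ)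
      + I * ((dirDeriv X (fun z => (a z).im) y : ℝ) : ℂ) := by
    have r := dirDeriv_clm (X := X) Complex.reCLM (mdiff_of_smooth ha)
    have i := dirDeriv_clm (X := X) Complex.imCLM (mdiff_of_smooth ha)
    simp only [Complex.reCLM_apply, Complex.imCLM_apply] at r i
    rw [r, i, mul_comm, Complex.re_add_im]
  rw [h4]
  erw [h3, h1, h2]
  change ((a y).re : ℂ) • Q.cov σ y (X y) + ((dirDeriv X (fun z => (a z).re) y : ℝ) : ℂ) • σ y
    + (((a y).im : ℂ) • Q.cov (fun z => I • σ z) y (X y)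
      + ((dirDeriv X (fun z => (a z).im) y : ℝ) : ℂ) • I • σ y) = _
  rw [h7, h6, hσe.self_of_nhds, h8]
  simp only [smul_smul, ← add_smul]
  congr 1
  conv_rhs => rw [← Complex.re_add_im (a y)]
  ring

lemma contMDiffAt_lam (hy : y ∈ base L o) {X : VF n M} (hX : SmoothVF X) :
    ContMDiffAt 𝓜[n] 𝓘(ℝ, ℂ) ∞ (fun z => lam Q o z (X z)) y := by
  obtain ⟨σ, hσ, hσe⟩ := exists_section_eq_lineFrame (n := n) hy
  have h1 := Q.cov_smooth.contMDiff.contMDiff (σ := σ) (hσ.contMDiffOn.of_le (by simp))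
  have h2 := ContMDiffAt.clm_bundle_apply (h1.contMDiffAt Filter.univ_mem) (hX y)
  have h3 := (contMDiffAt_section_iff hy).1 h2
  refine h3.congr_of_eventuallyEq ?_
  filter_upwards [hσe.eventually_nhds, base_mem_nhds hy] with z hz hb
  rw [lam_apply, cov_congr Q (contMDiffAt_lineFrame hb) (hσ z) (hz.mono fun w hw => hw.symm)]

/-- The connection form of `L` in the chart and the frame at `o`. -/
def hatLam (o : M) (w : P × Model n) : Model n →L[ℝ] ℂ :=
  lam Q o (chartInv o w.2) ∘L dchartInv n o (chartInv o w.2)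

/-- The symplectic form in the chart at `o`. -/
def hatOm (Ω : SymplecticForm n M) (o : M) (w : P × Model n) (a b : Model n) : ℝ :=
  Ω (chartInv o w.2) (dchartInv n o (chartInv o w.2) a) (dchartInv n o (chartInv o w.2) b)

lemma hatLam_apply (hy : y ∈ dom n o) (u : P) :
    hatLam Q o (u, chart n o y) = lam Q o y ∘L dchartInv n o y :=
  congrArg (fun x => lam Q o x ∘L dchartInv n o x) (chartInv_chart hy)

lemma hatOm_apply (hy : y ∈ dom n o) (u : P) (a b : Model n) :
    hatOm Ω o (u, chart n o y) a b = Ω y (dchartInv n o y a) (dchartInv n o y b) :=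
  congrArg (fun x => Ω x (dchartInv n o x a) (dchartInv n o x b)) (chartInv_chart hy)

lemma hatLam_hatV (hy : y ∈ dom n o) (X : P → VF n M) (u : P) :
    hatLam Q o (u, chart n o y) (hatV o X (u, chart n o y)) = lam Q o y (X u y) := by
  rw [hatV_apply hy, hatLam_apply Q hy, readV]
  exact congrArg (lam Q o y) (dchartInv_dchart hy _)

lemma hatOm_hatV (hy : y ∈ dom n o) (X Y : P → VF n M) (u : P) :
    hatOm Ω o (u, chart n o y) (hatV o X (u, chart n o y))
      (hatV o Y (u, chart n o y)) = Ω y (X u y) (Y u y) := by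
  rw [hatV_apply hy, hatV_apply hy, hatOm_apply hy, readV, readV, dchartInv_dchart hy,
    dchartInv_dchart hy]

lemma contDiffAt_hatLam (hy : y ∈ dom n o) (hb : y ∈ base L o) (u : P) :
    ContDiffAt ℝ ∞ (hatLam Q o) (u, chart n o y) := by
  refine contDiffAt_clm_of_apply fun v => ?_
  obtain ⟨X, hX, hXv⟩ := exists_constVF_at hy v
  refine ((contMDiffAt_iff_flat hy).1
    (contMDiffAt_const_param u (contMDiffAt_lam Q hb hX))).congr_of_eventuallyEq ?_
  refine eventually_chart hy hXv fun u' x hx hxd => ?_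
  rw [flat_chart hxd, ← hatLam_hatV Q hxd (fun _ : P => X) u', hatV_apply hxd]
  rw [show readV o X x = v from hx]

lemma fderiv_hatLam_curvature (hy : y ∈ dom n o) (hb : y ∈ base L o) (u : P) (v w : Model n) :
    fderiv ℝ (fun z => hatLam Q o z w) (u, chart n o y) (0, v)
      - fderiv ℝ (fun z => hatLam Q o z v) (u, chart n o y) (0, w)
      = -(I * (hatOm Ω o (u, chart n o y) v w : ℂ)) := by
  obtain ⟨X, hX, hXv⟩ := exists_constVF_at hy v
  obtain ⟨Y, hY, hYw⟩ := exists_constVF_at hy w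
  obtain ⟨σ, hσ, hσe⟩ := exists_section_eq_lineFrame (n := n) hb
  have hc := Q.curvature X Y hX hY σ hσ y
  have hcov : ∀ Z : VF n M, ∀ᶠ z in 𝓝 y, Q.cov σ z (Z z) = lam Q o z (Z z) • lineFrame L o z := by
    intro Z
    filter_upwards [hσe.eventually_nhds, base_mem_nhds hb] with z hz hbz
    rw [lam_apply, cov_congr Q (contMDiffAt_lineFrame hbz) (hσ z) (hz.mono fun w hw => hw.symm),
      lineCoord_smul_lineFrame hbz]
  have hcov2 : ∀ Z W : VF n M, SmoothVF Z → Q.cov (fun z => Q.cov σ z (Z z)) y (W y)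
      = (dirDeriv W (fun z => lam Q o z (Z z)) y + lam Q o y (Z y) * lam Q o y (W y))
        • lineFrame L o y := by
    intro Z W hZ
    rw [← cov_lineFrame_smul Q hb (contMDiffAt_lam Q hb hZ)]
    have hs := mdiff_section hb (contMDiffAt_lam Q hb hZ)
    refine congrArg (fun T : Tan n y →L[ℝ] L y => T (W y)) (cov_congr Q ?_ hs (hcov Z))
    refine hs.congr_of_eventuallyEq ?_
    filter_upwards [hcov Z] with z hz
    rw [hz]
  have hbr : bracket X Y y = 0 := by
    have h := hatV_bracket (P := P) hX hY hy u
    have h1 : ∀ (Z : VF n M) (a : Model n), (∀ᶠ z in 𝓝 y, readV o Z z = a) →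
        ∀ W, along (0 : P) W (hatV o (fun _ : P => Z)) (u, chart n o y) = 0 := by
      intro Z a hZ W
      have e : hatV o (fun _ : P => Z) =ᶠ[𝓝 (u, chart n o y)] fun _ => a :=
        eventually_chart hy hZ fun u' x hx hxd => by rw [hatV_apply hxd]; exact hx
      rw [along_congr e]
      simp [along]
    rw [flatBracket, h1 Y w hYw, h1 X v hXv, sub_zero, hatV_apply hy, readV] at h
    rw [← dchartInv_dchart hy (bracket X Y y), h, map_zero]
  have hderiv : ∀ (Z W : VF n M) (a b : Model n), SmoothVF Z → (∀ᶠ z in 𝓝 y, readV o Z z = a) →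
      (∀ᶠ z in 𝓝 y, readV o W z = b) → dirDeriv W (fun z => lam Q o z (Z z)) y
        = fderiv ℝ (fun z => hatLam Q o z a) (u, chart n o y) (0, b) := by
    intro Z W a b hZs hZ hW
    have h := along_flat_vertical (P := P) (u := u) hy (fun _ => W)
      (f := fun q : P × M => lam Q o q.2 (Z q.2))
      (contMDiffAt_const_param u (contMDiffAt_lam Q hb hZs))
    rw [← h, along, flat_chart hy, hW.self_of_nhds]
    congr 1
    refine Filter.EventuallyEq.fderiv_eq ?_
    refine eventually_chart hy hZ fun u' x hx hxd => ?_
    rw [flat_chart hxd, ← hatLam_hatV Q hxd (fun _ : P => Z) u', hatV_apply hxd]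
    rw [show readV o Z x = a from hx]
  rw [hcov2 Y X hY, hcov2 X Y hX, hbr, map_zero, sub_zero, ← sub_smul, hσe.self_of_nhds] at hc
  have h9 := congrArg (lineCoord L o y) hc
  rw [map_smul, map_smul, lineCoord_lineFrame hb, smul_eq_mul, smul_eq_mul, mul_one, mul_one,
    hderiv Y X w v hY hYw hXv, hderiv X Y v w hX hXv hYw] at h9
  have hom := hatOm_hatV (Ω := Ω) hy (fun _ : P => X) (fun _ : P => Y) u
  rw [hatV_apply hy, hatV_apply hy, hXv.self_of_nhds, hYw.self_of_nhds] at hom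
  rw [hom]
  rw [one_div, Complex.inv_I] at h9
  linear_combination h9

/-- The curvature of the connection form of `L`, on projectable fields. -/
lemma hatLam_curvature (hy : y ∈ dom n o) (hb : y ∈ base L o) (u : P) {c c' : P}
    {X X' : P × Model n → Model n} (hX : DifferentiableAt ℝ X (u, chart n o y))
    (hX' : DifferentiableAt ℝ X' (u, chart n o y)) :
    along c X (fun z => hatLam Q o z (X' z)) (u, chart n o y)
      - along c' X' (fun z => hatLam Q o z (X z)) (u, chart n o y)
      - hatLam Q o (u, chart n o y) (flatBracket c X c' X' (u, chart n o y))
      = -(I * (hatOm Ω o (u, chart n o y) (X (u, chart n o y))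
        (X' (u, chart n o y)) : ℂ)) := by
  set z := (u, chart n o y) with hz
  have hl : DifferentiableAt ℝ (hatLam Q o) z := toDiffAt (contDiffAt_hatLam Q hy hb u)
  have hp : ∀ c : P, fderiv ℝ (hatLam Q o) z (c, 0) = 0 := by
    intro c
    have hd : HasDerivAt (fun t : ℝ => hatLam Q o (u + t • c, chart n o y))
        (fderiv ℝ (hatLam Q o) z (c, 0)) 0 := by
      have h2 : HasDerivAt (fun t : ℝ => ((u + t • c, chart n o y) : P × Model n)) (c, 0) 0 := by
        refine HasDerivAt.prodMk ?_ (hasDerivAt_const _ _)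
        simpa using ((hasDerivAt_id (0 : ℝ)).smul_const c).const_add u
      refine HasFDerivAt.comp_hasDerivAt (l := hatLam Q o) (f := fun t : ℝ => ((u + t • c, chart n o y) : P × Model n))
        (0 : ℝ) ?_ h2
      simpa using hl.hasFDerivAt
    exact hd.unique (hasDerivAt_const (0 : ℝ) (hatLam Q o z))
  have key : ∀ (e : P) (Y Z : P × Model n → Model n), DifferentiableAt ℝ Z z →
      along e Y (fun q => hatLam Q o q (Z q)) z
        = fderiv ℝ (fun q => hatLam Q o q (Z z)) z (0, Y z) + hatLam Q o z (along e Y Z z) := by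
    intro e Y Z hZ
    have h0 : fderiv ℝ (fun q => hatLam Q o q (Z z)) z (0, Y z)
        = fderiv ℝ (hatLam Q o) z (e, Y z) (Z z) := by
      have h1 : ((e, Y z) : P × Model n) = (e, 0) + (0, Y z) := by simp
      rw [h1, map_add, hp, zero_add, fderiv_clm_apply hl (differentiableAt_const _)]
      simp
    simp only [along]
    rw [h0, fderiv_clm_apply hl hZ]
    simp [add_comm]
  rw [key c X X' hX', key c' X' X hX, flatBracket, map_sub,
    ← fderiv_hatLam_curvature Q hy hb u]
  ring

lemma along_zero_congr_slice {F E G : Type*} [NormedAddCommGroup F] [NormedSpace ℝ F]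
    [NormedAddCommGroup E] [NormedSpace ℝ E] [NormedAddCommGroup G] [NormedSpace ℝ G]
    {X X' : F × E → E} {f f' : F × E → G} {z : F × E} (hf : DifferentiableAt ℝ f z)
    (hf' : DifferentiableAt ℝ f' z) (hX : X z = X' z) (he : ∀ᶠ y in 𝓝 z.2, f (z.1, y) = f' (z.1, y))
    : along 0 X f z = along 0 X' f' z := by
  have hs : HasFDerivAt (fun y : E => (z.1, y)) (ContinuousLinearMap.inr ℝ F E) z.2 :=
    hasFDerivAt_prodMk_right _ _
  have h1 := HasFDerivAt.comp (g := f) z.2 hf.hasFDerivAt hs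
  have h2 := HasFDerivAt.comp (g := f') z.2 hf'.hasFDerivAt hs
  have h3 := h1.unique (h2.congr_of_eventuallyEq he)
  simp only [along, hX]
  exact congrArg (fun T : E →L[ℝ] G => T (X' z)) h3

lemma IsConnCoeff.slice {F E : Type*} [NormedAddCommGroup F] [NormedSpace ℝ F]
    [NormedAddCommGroup E] [NormedSpace ℝ E] {n : ℕ} {X X' : F × E → E} {J J' : F × E → E →L[ℝ] E}
    {α α' : F × E → E [⋀^Fin n]→ₗ[ℝ] ℂ} {z : F × E} {θ : ℂ} (hX : DifferentiableAt ℝ X z)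
    (hX' : DifferentiableAt ℝ X' z) (hJ : DifferentiableAt ℝ J z) (hJ' : DifferentiableAt ℝ J' z)
    (hα : SmoothFormAt α z) (hα' : SmoothFormAt α' z)
    (heX : ∀ᶠ y in 𝓝 z.2, X (z.1, y) = X' (z.1, y)) (heJ : ∀ᶠ y in 𝓝 z.2, J (z.1, y) = J' (z.1, y))
    (heα : ∀ᶠ y in 𝓝 z.2, α (z.1, y) = α' (z.1, y)) (h : IsConnCoeff 0 X J α z θ) :
    IsConnCoeff 0 X' J' α' z θ := by
  have h0 : X z = X' z := heX.self_of_nhds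
  have hJ0 : J z = J' z := heJ.self_of_nhds
  have hα0 : α z = α' z := heα.self_of_nhds
  have e1 : vert X z = vert X' z := by
    ext v
    rw [← along_vertical X (fun _ => v) z, ← along_vertical X' (fun _ => v) z]
    exact along_zero_congr_slice hX hX' rfl heX
  have e2 : along 0 X J z = along 0 X' J' z := along_zero_congr_slice hJ hJ' h0 heJ
  intro v
  have e3 : along 0 X (fun y => α y v) z = along 0 X' (fun y => α' y v) z :=
    along_zero_congr_slice (toDiffAt (hα v)) (toDiffAt (hα' v)) h0
      (heα.mono fun y hy => by rw [hy])
  have := h v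
  rw [e3, hα0] at this
  simpa only [connEnd, lieEnd, e1, e2, hJ0] using this

lemma IsConnCoeff.sq_smul {F E : Type*} [NormedAddCommGroup F] [NormedSpace ℝ F]
    [NormedAddCommGroup E] [NormedSpace ℝ E] {n : ℕ} {c : F} {X : F × E → E} {J : F × E → E →L[ℝ] E}
    {α α' : F × E → E [⋀^Fin n]→ₗ[ℝ] ℂ} {z : F × E} {θ : ℂ} {b : F × E → ℂ}
    (hb : DifferentiableAt ℝ b z) (hα : ∀ v, DifferentiableAt ℝ (fun y => α y v) z) (hb0 : b z ≠ 0)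
    (he : ∀ᶠ y in 𝓝 z, α' y = (b y * b y) • α y) (h : IsConnCoeff c X J α z θ) :
    IsConnCoeff c X J α' z (θ + along c X b z / b z) := by
  intro v
  have e : (fun y => α' y v) =ᶠ[𝓝 z] fun y => (b y * b y) * α y v := by
    filter_upwards [he] with y hy
    rw [hy]
    rfl
  rw [along_congr e, along_mul (hb.fun_mul hb) (hα v), along_mul hb hb, he.self_of_nhds]
  have h2 := act_smul_left (α z) (b z * b z) (connEnd c X J z) v
  rw [h2, AlternatingMap.smul_apply, smul_eq_mul]
  have := h v
  field_simp
  linear_combination b z * this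

/-- A field of forms in the chart at `o`, constant in the parameters. -/
def hatF (o : M) (κ : (x : M) → Form n x) (w : ℝ² × Model n) : Model n [⋀^Fin n]→ₗ[ℝ] ℂ :=
  readF o κ (chartInv o w.2)

lemma lieForm_eq (hy : y ∈ dom n o) (u : ℝ²) {X : VF n M} (hX : SmoothVF X) {κ : (x : M) → Form n x}
    (hκ : SmoothFormAt (hatF o κ) (u, chart n o y)) {Y : Fin n → VF n M} (hY : ∀ a, SmoothVF (Y a))
    : lieForm X κ Y y = along 0 (hatV o fun _ => X)
        (fun w => hatF o κ w (fun a => readV o (Y a) y)) (u, chart n o y)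
      + act (hatF o κ (u, chart n o y))
        (vert (hatV o fun _ => X) (u, chart n o y)) (fun a => readV o (Y a) y) := by
  set z : ℝ² × Model n := (u, chart n o y) with hz
  have hYs := fun a => (hY a).hatV hy u
  have hev : (flat o fun w : ℝ² × M => κ w.2 (fun a => Y a w.2)) =ᶠ[𝓝 z]
      fun w => hatF o κ w (fun a => hatV o (fun _ => Y a) w) := by
    refine eventually_chart hy (dom_mem_nhds hy) fun u' x _ hx => ?_
    rw [flat_chart hx]
    simp only [hatV_apply hx, hatF, chartInv_chart hx]
    rw [readF_readV hx]
  have hsm : ContMDiffAt (𝓘(ℝ, ℝ²).prod 𝓜[n]) 𝓘(ℝ, ℂ) ∞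
      (fun w : ℝ² × M => κ w.2 (fun a => Y a w.2)) (u, y) :=
    (contMDiffAt_iff_flat hy).2 ((hκ.apply hYs).congr_of_eventuallyEq hev)
  have h1 := along_flat_vertical hy (fun _ => X) hsm
  have h2 := (along_congr (c := (0 : ℝ²)) (X := hatV o fun _ => X) hev).symm.trans h1
  have hv : (fun a => hatV o (fun _ : ℝ² => Y a) z) = fun a => readV o (Y a) y := by
    funext a
    rw [hatV_apply hy]
  have h3 := hκ.fderiv_apply (w := fun a => hatV o (fun _ : ℝ² => Y a))
    (fun a => toDiffAt (hYs a)) (0, hatV o (fun _ : ℝ² => X) z)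
  rw [hv] at h3
  have h4 : ∀ a, κ y (update (fun b => Y b y) a (bracket X (Y a) y))
      = hatF o κ z (update (fun a => readV o (Y a) y) a
        (fderiv ℝ (hatV o (fun _ : ℝ² => Y a)) z (0, hatV o (fun _ : ℝ² => X) z)
          - vert (hatV o fun _ => X) z (readV o (Y a) y))) := by
    intro a
    have h5 := hatV_bracket hX (hY a) hy u
    rw [flatBracket, along_vertical (hatV o fun _ : ℝ² => X), hatV_apply hy,
      hatV_apply hy (fun _ : ℝ² => Y a)] at h5
    rw [along] at h5
    rw [← h5]
    simp only [hatF, z, chartInv_chart hy]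
    rw [← readF_dchart hy κ]
    congr 1
    funext b
    by_cases hb : b = a
    · subst hb
      simp [readV]
    · simp [Function.update_of_ne hb, readV]
  rw [lieForm]
  have h6 : dirDeriv X (fun y => κ y (fun a => Y a y)) y = _ := h2.symm
  rw [h6]
  simp only [h4, AlternatingMap.map_update_sub, Finset.sum_sub_distrib]
  rw [along, h3]
  simp only [along, act]
  ring

lemma projLieForm_eq (hy : y ∈ dom n o) (u : ℝ²) {j : CompatACS Ω}
    (hJ : ContDiffAt ℝ ∞ (hatJ o fun _ : ℝ² => j) (u, chart n o y)) {X : VF n M} (hX : SmoothVF X)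
    {κ : (x : M) → Form n x} (hκ : SmoothFormAt (hatF o κ) (u, chart n o y))
    (ht : κ y ∈ typeN0 n (j y)) {θ : ℂ}
    (hθ : IsConnCoeff 0 (hatV o fun _ => X) (hatJ o fun _ => j) (hatF o κ) (u, chart n o y) θ)
    {Y : Fin n → VF n M} (hY : ∀ a, SmoothVF (Y a)) :
    projLieForm j X κ Y y = 2 * θ * κ y (fun a => Y a y) := by
  set z : ℝ² × Model n := (u, chart n o y) with hz
  set J := hatJ o (fun _ : ℝ² => j) z with hJdef
  set K := J * lieEnd 0 (hatV o fun _ => X) (hatJ o fun _ : ℝ² => j) z with hK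
  set α := hatF o κ z with hα
  have hsq := eventually_hatJ_mul_self hy (fun _ : ℝ² => j) u
  have h1 : ∀ Y : Fin n → VF n M, (∀ a, SmoothVF (Y a)) → lieForm X κ Y y
      = 2 * θ * α (fun a => readV o (Y a) y)
        - (1 / 2 : ℂ) * act α K (fun a => readV o (Y a) y) := by
    intro Y hY
    rw [lieForm_eq hy u hX hκ hY, hθ]
    have e := act_sub α (fun x => -vert (hatV o fun _ => X) z x) (fun x => (1 / 2 : ℝ) • K x)
      (fun a => readV o (Y a) y)
    rw [act_neg, act_smul] at e
    have e2 : act (hatF o κ z) (connEnd 0 (hatV o fun _ => X) (hatJ o fun _ => j) z)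
        (fun a => readV o (Y a) y) = _ := e
    rw [e2, Complex.real_smul]
    push_cast
    ring
  have hαt : α ∈ typeN0 n J := by
    rw [hα, hJdef, hatJ_apply hy]
    simp only [hatF, hz, chartInv_chart hy]
    exact readF_mem_typeN0 hy ht
  have hKJ : ∀ v, K.toLinearMap (J.toLinearMap v) = -J.toLinearMap (K.toLinearMap v) := by
    have h2 := lieEnd_anticomm (c := 0) (X := hatV o fun _ => X) hJ hsq
    have h3 : K * J = -(J * K) := by
      have h : ∀ a b : Model n →L[ℝ] Model n, b * a = -(a * b) → a * b * a = -(a * (a * b)) := by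
        intro a b h
        rw [mul_assoc, h]
        ext1 v
        exact map_neg a _
      exact h _ _ h2
    intro v
    exact congrArg (fun T : Model n →L[ℝ] Model n => T v) h3
  have hS : ∀ S : Finset (Fin n), (fun a => readV o
      (if a ∈ S then (fun y => j y (Y a y)) else Y a) y)
      = S.piecewise (fun a => J (readV o (Y a) y)) (fun a => readV o (Y a) y) := by
    intro S
    funext a
    by_cases ha : a ∈ S
    · rw [Finset.piecewise_eq_of_mem _ _ _ ha, if_pos ha, hJdef, hatJ_apply hy,
        readE_readV hy]
    · rw [Finset.piecewise_eq_of_notMem _ _ _ ha, if_neg ha]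
  have hYS : ∀ S : Finset (Fin n), ∀ a, SmoothVF
      (if a ∈ S then (fun y => j y (Y a y)) else Y a) := by
    intro S a
    split_ifs
    · exact j.smooth _ (hY a)
    · exact hY a
  have h5 := typeSum_typeN0 hαt (fun a => readV o (Y a) y)
  have h6 := typeSum_act_eq_zero (J := J.toLinearMap) (K := K.toLinearMap) hKJ hαt
    (fun a => readV o (Y a) y)
  simp only [typeSum, Finset.prod_const] at h5 h6
  rw [projLieForm]
  simp only [h1 _ (hYS _), hS, mul_sub, Finset.sum_sub_distrib]
  have h7 : ∑ S : Finset (Fin n), (-I) ^ S.card * (2 * θ * α (S.piecewise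
      (fun a => J (readV o (Y a) y)) (fun a => readV o (Y a) y)))
      = 2 * θ * (2 ^ n * α fun a => readV o (Y a) y) := by
    rw [← h5, Finset.mul_sum]
    refine Finset.sum_congr rfl fun S _ => ?_
    ring
  have h8 : ∑ S : Finset (Fin n), (-I) ^ S.card * ((1 / 2 : ℂ) * act α K (S.piecewise
      (fun a => J (readV o (Y a) y)) (fun a => readV o (Y a) y))) = 0 := by
    have h9 : ∑ S : Finset (Fin n), (-I) ^ S.card * act α K (S.piecewise
      (fun a => J (readV o (Y a) y)) (fun a => readV o (Y a) y)) = 0 := h6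
    rw [← mul_zero (1 / 2 : ℂ), ← h9, Finset.mul_sum]
    refine Finset.sum_congr rfl fun S _ => ?_
    ring
  rw [h7, h8, mul_zero, sub_zero]
  have h10 : α (fun a => readV o (Y a) y) = κ y (fun a => Y a y) := by
    rw [hα]
    simp only [hatF, hz, chartInv_chart hy]
    exact readF_readV hy κ Y
  rw [h10]
  have h11 : (1 / 2 : ℂ) ^ n * 2 ^ n = 1 := by
    rw [← mul_pow]
    norm_num
  linear_combination (2 * θ * κ y fun a => Y a y) * h11

/-- The connection coefficient of `δ` in the frame and the chart at `o`, along `(c, X)`. -/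
def theta (o : M) (p : ℝ² → CompatACS D.form) (c : ℝ²) (X : ℝ² × Model n → Model n)
    (w : ℝ² × Model n) : ℂ :=
  Classical.epsilon (IsConnCoeff c X (hatJ o p) (hatForm D o p) w)

variable {p : ℝ² → CompatACS D.form} 

lemma theta_spec (hp : SmoothSurface p) (hy : y ∈ dom n o) (hb : y ∈ base δ o) (u c : ℝ²)
    (X : ℝ² × Model n → Model n) : IsConnCoeff c X (hatJ o p) (hatForm D o p) (u, chart n o y)
      (theta D o p c X (u, chart n o y)) :=
  Classical.epsilon_spec (exists_isConnCoeff (hp.hatJ hy u) (eventually_hatJ_mul_self hy p u)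
    (smoothFormAt_hatForm D hp hy hb u)
    (eventually_chart hy (dom_mem_nhds hy) fun u' _ _ hx => hatForm_mem D hx p u')
    (hatForm_line D hy hb p u))

lemma contDiffAt_theta (hp : SmoothSurface p) (hy : y ∈ dom n o) (hb : y ∈ base δ o) (u c : ℝ²)
    {X : ℝ² × Model n → Model n} (hX : ContDiffAt ℝ ∞ X (u, chart n o y)) :
    ContDiffAt ℝ ∞ (theta D o p c X) (u, chart n o y) :=
  IsConnCoeff.contDiffAt (hatForm_ne_zero D hy hb p u) hX (hp.hatJ hy u)
    (smoothFormAt_hatForm D hp hy hb u)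
    (eventually_chart hy (base_mem_nhds hb) fun u' _ hxb hx => theta_spec D hp hx hxb u' c X)

/-- Change of the point at which the frame of `δ` is centered. -/
def trans (V : M → Type*) [TopologicalSpace (TotalSpace ℂ V)] [∀ x, TopologicalSpace (V x)]
    [∀ x, AddCommGroup (V x)] [∀ x, Module ℂ (V x)] [FiberBundle ℂ V] [VectorBundle ℂ ℂ V]
    (o y z : M) : ℂ := lineCoord V o z (lineFrame V y z)

lemma trans_smul {V : M → Type*} [TopologicalSpace (TotalSpace ℂ V)] [∀ x, TopologicalSpace (V x)]
    [∀ x, AddCommGroup (V x)] [∀ x, Module ℂ (V x)] [FiberBundle ℂ V] [VectorBundle ℂ ℂ V] {o z : M}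
    (y : M) (hz : z ∈ base V o) : trans V o y z • lineFrame V o z = lineFrame V y z :=
  lineCoord_smul_lineFrame hz _

lemma trans_ne_zero {V : M → Type*} [TopologicalSpace (TotalSpace ℂ V)]
    [∀ x, TopologicalSpace (V x)] [∀ x, AddCommGroup (V x)] [∀ x, Module ℂ (V x)] [FiberBundle ℂ V]
    [VectorBundle ℂ ℂ V] {o y z : M} (hz : z ∈ base V o) (hz' : z ∈ base V y) :
    trans V o y z ≠ 0 := by
  intro h
  have := trans_smul y hz
  rw [h, zero_smul] at this
  exact lineFrame_ne_zero hz' this.symm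

lemma frameForm_trans (j : CompatACS D.form) {o z : M} (y : M) (hz : z ∈ base δ o) :
    frameForm D j y z = (trans δ o y z * trans δ o y z) • frameForm D j o z := by
  rw [frameForm, ← trans_smul y hz, TensorProduct.smul_tmul_smul, phi_smul, frameForm]

lemma lieHalf_eq (hp : SmoothSurface p) {X : ℝ² → VF n M} (hX : SmoothFamVF X) (u : ℝ²)
    (hy : y ∈ dom n o) (hb : y ∈ base δ o) : D.lieHalf (p u) (X u) (lineFrame δ y) y
      = (theta D o p 0 (hatV o X) (u, chart n o y)
        + dirDeriv (X u) (trans δ o y) y / trans δ o y y) • lineFrame δ y y := by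
  set z : ℝ² × Model n := (u, chart n o y) with hz
  set θ := theta D o p 0 (hatV o X) z with hθ
  have hXu : SmoothVF (X u) := fun x =>
    ContMDiffAt.comp x (hX (u, x)) (contMDiffAt_const.prodMk contMDiffAt_id)
  have hbm : ContMDiffAt 𝓜[n] 𝓘(ℝ, ℂ) ∞ (trans δ o y) y :=
    contMDiffAt_transition (self_mem_base y) hb
  have hbs : ContDiffAt ℝ ∞ (flat o fun w : ℝ² × M => trans δ o y w.2) z :=
    (contMDiffAt_iff_flat hy).1 (contMDiffAt_const_param u hbm)
  have hbz : flat o (fun w : ℝ² × M => trans δ o y w.2) z ≠ 0 := by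
    rw [flat_chart hy]
    exact trans_ne_zero hb (self_mem_base y)
  have hJ' := (SmoothSurface.const (p u)).hatJ hy u
  have hα' := smoothFormAt_hatForm D (SmoothSurface.const (p u)) hy hb u
  have h1 : IsConnCoeff 0 (hatV o fun _ => X u) (hatJ o fun _ => p u)
      (hatForm D o fun _ => p u) z θ := by
    refine IsConnCoeff.slice (toDiffAt (hX.hatV hy u))
      (toDiffAt (hXu.hatV hy u)) (toDiffAt (hp.hatJ hy u))
      (toDiffAt hJ') (smoothFormAt_hatForm D hp hy hb u) hα' ?_ ?_ ?_
      (theta_spec D hp hy hb u 0 (hatV o X))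
    all_goals exact .of_forall fun w => rfl
  have he : ∀ᶠ w in 𝓝 z, hatF o (frameForm D (p u) y) w
      = (flat o (fun w : ℝ² × M => trans δ o y w.2) w
        * flat o (fun w : ℝ² × M => trans δ o y w.2) w) • hatForm D o (fun _ => p u) w := by
    refine eventually_chart hy (base_mem_nhds hb) fun u' x hxb hx => ?_
    rw [flat_chart hx, hatForm_apply D hx]
    have e : hatF o (frameForm D (p u) y) (u', chart n o x)
        = readF o (frameForm D (p u) y) x := by simp only [hatF, chartInv_chart hx]
    rw [e, readF, frameForm_trans D (p u) y hxb]
    rfl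
  have h2 := IsConnCoeff.sq_smul (toDiffAt hbs)
    (fun v => toDiffAt (hα' v)) hbz he h1
  have h3 : along 0 (hatV o fun _ => X u) (flat o fun w : ℝ² × M => trans δ o y w.2) z
      = dirDeriv (X u) (trans δ o y) y :=
    along_flat_vertical hy (fun _ => X u) (contMDiffAt_const_param u hbm)
  rw [h3, flat_chart hy] at h2
  have hκ : SmoothFormAt (hatF o (frameForm D (p u) y)) z := by
    intro v
    refine ((hbs.mul hbs).mul (hα' v)).congr_of_eventuallyEq ?_
    filter_upwards [he] with w hw
    rw [hw]
    rfl
  have h4 := fun {Y : Fin n → VF n M} (hY : ∀ a, SmoothVF (Y a)) =>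
    projLieForm_eq hy u hJ' hXu hκ (phi_mem D (p u) y _) h2 hY
  set t := θ + dirDeriv (X u) (trans δ o y) y / trans δ o y y with ht
  have h5 : ∀ (r : ℂ) (Y : Fin n → VF n M), D.phi (p u) y
      (lineFrame δ y y ⊗ₜ[ℂ] (r • lineFrame δ y y)) (fun a => Y a y)
      = r * frameForm D (p u) y y (fun a => Y a y) := by
    intro r Y
    rw [TensorProduct.tmul_smul, phi_smul]
    rfl
  have hex : ∃ v : δ y, ∀ Y : Fin n → VF n M, (∀ a, SmoothVF (Y a)) →
    projLieForm (p u) (X u) (fun x => D.phi (p u) x (lineFrame δ y x ⊗ₜ[ℂ] lineFrame δ y x)) Y y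
      = 2 * D.phi (p u) y (lineFrame δ y y ⊗ₜ[ℂ] v) (fun a => Y a y) := by
    refine ⟨t • lineFrame δ y y, fun Y hY => ?_⟩
    rw [h5, ← mul_assoc]
    exact h4 hY
  have h6 := Classical.epsilon_spec hex
  obtain ⟨r, hr⟩ : ∃ r : ℂ, D.lieHalf (p u) (X u) (lineFrame δ y) y = r • lineFrame δ y y :=
    ⟨_, (lineCoord_smul_lineFrame (self_mem_base y) _).symm⟩
  have h7 : ∀ Y : Fin n → VF n M, (∀ a, SmoothVF (Y a)) →
      2 * t * frameForm D (p u) y y (fun a => Y a y)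
        = 2 * r * frameForm D (p u) y y (fun a => Y a y) := by
    intro Y hY
    have h8 : projLieForm (p u) (X u)
        (fun x => D.phi (p u) x (lineFrame δ y x ⊗ₜ[ℂ] lineFrame δ y x)) Y y
        = 2 * D.phi (p u) y (lineFrame δ y y ⊗ₜ[ℂ] D.lieHalf (p u) (X u) (lineFrame δ y) y)
          (fun a => Y a y) := h6 Y hY
    rw [hr, h5, ← mul_assoc] at h8
    exact (h4 hY).symm.trans h8
  have hne : frameForm D (p u) y y ≠ 0 :=
    phi_ne_zero D (p u) y (tensor_lineFrame_ne_zero (self_mem_base y))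
  obtain ⟨v, hv⟩ := ne_zero_iff_exists.1 hne
  choose Y hY hYv using fun a => exists_constVF_at (self_mem_dom (n := n) y) (dchart n y y (v a))
  have h9 : (fun a => Y a y) = v := by
    funext a
    have := (hYv a).self_of_nhds
    rw [← dchartInv_dchart (self_mem_dom y) (Y a y), ← dchartInv_dchart (self_mem_dom y) (v a)]
    exact congrArg _ this
  have h10 := h7 Y hY
  rw [h9] at h10
  have h11 : t = r := by
    have := mul_right_cancel₀ hv h10
    exact mul_left_cancel₀ two_ne_zero this
  rw [hr, h11]

lemma sum_tprod_update {k : ℕ} (o y : M) (c : ℂ) : (∑ i : Fin k, PiTensorProduct.tprod ℂ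
      (update (fun _ : Fin k => lineFrame L o y) i (c • lineFrame L o y)))
      = (k * c) • PiTensorProduct.tprod ℂ (fun _ : Fin k => lineFrame L o y) := by
  simp only [MultilinearMap.map_update_smul, Function.update_eq_self, Finset.sum_const,
    Finset.card_univ, Fintype.card_fin]
  rw [← Nat.cast_smul_eq_nsmul ℂ, smul_smul]

/-- The operator `∇` in the frame around `o`. -/
lemma pCoord_nabla (hp : SmoothSurface p) {X : ℝ² → VF n M} (hX : SmoothFamVF X) (u : ℝ²) {k : ℕ}
    {s : Sec L δ k} (hy : y ∈ dom n o) (hbL : y ∈ base L o) (hb : y ∈ base δ o)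
    (hs : ContMDiffAt 𝓜[n] 𝓘(ℝ, ℂ) ∞ (fun z => pCoord L δ k o z (s z)) y) :
    pCoord L δ k o y (D.nabla k (p u) (X u) s y)
      = dirDeriv (X u) (fun z => pCoord L δ k o z (s z)) y
        + (k * lam D.preq o y (X u y) + theta D o p 0 (hatV o X) (u, chart n o y))
          * pCoord L δ k o y (s y) := by
  have ha : ContMDiffAt 𝓜[n] 𝓘(ℝ, ℂ) ∞ (trans L o y) y :=
    contMDiffAt_transition (self_mem_base y) hbL
  have hbm : ContMDiffAt 𝓜[n] 𝓘(ℝ, ℂ) ∞ (trans δ o y) y :=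
    contMDiffAt_transition (self_mem_base y) hb
  have ha0 : trans L o y y ≠ 0 := trans_ne_zero hbL (self_mem_base y)
  have hb0 : trans δ o y y ≠ 0 := trans_ne_zero hb (self_mem_base y)
  have hs' : ContMDiffAt 𝓜[n] 𝓘(ℝ, ℂ) ∞ (fun z => pCoord L δ k y z (s z)) y := by
    have h := contMDiffAt_pCoord_change (P := ℝ) (Φ := fun _ => s) (u := 0) ⟨hbL, hb⟩
      ⟨self_mem_base y, self_mem_base y⟩ (contMDiffAt_const_param 0 hs)
    exact contMDiffAt_fix_param h
  have hcov : D.preq.cov (lineFrame L y) y (X u y)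
      = (dirDeriv (X u) (trans L o y) y / trans L o y y + lam D.preq o y (X u y))
        • lineFrame L y y := by
    have h1 := cov_lineFrame_smul D.preq hbL ha (X u)
    have h2 : D.preq.cov (lineFrame L y) y
        = D.preq.cov (fun z => trans L o y z • lineFrame L o z) y := by
      refine cov_congr D.preq (contMDiffAt_lineFrame (self_mem_base y)) (mdiff_section hbL ha) ?_
      filter_upwards [base_mem_nhds hbL] with z hz
      exact (trans_smul y hz).symm
    rw [h2, h1, ← trans_smul y hbL, smul_smul]
    congr 1
    field_simp
  have htr : ∀ z ∈ base L y ∩ base δ y, ∀ t : PFib L δ k z, pCoord L δ k o z t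
      = (trans L o y z ^ k * trans δ o y z) * pCoord L δ k y z t := fun z hz t =>
    pCoord_transition hz.1 hz.2 t
  have hyy : y ∈ base L y ∩ base δ y := ⟨self_mem_base y, self_mem_base y⟩
  have hd : dirDeriv (X u) (fun z => pCoord L δ k o z (s z)) y
      = (trans L o y y ^ k * trans δ o y y) * dirDeriv (X u) (fun z => pCoord L δ k y z (s z)) y
        + (trans L o y y ^ k * trans δ o y y) * pCoord L δ k y y (s y)
          * (k * (dirDeriv (X u) (trans L o y) y / trans L o y y)
            + dirDeriv (X u) (trans δ o y) y / trans δ o y y) := by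
    have e : (fun z => pCoord L δ k o z (s z)) =ᶠ[𝓝 y]
        fun z => (trans L o y z ^ k * trans δ o y z) * pCoord L δ k y z (s z) := by
      filter_upwards [Filter.inter_mem (base_mem_nhds (self_mem_base (V := L) y))
        (base_mem_nhds (self_mem_base (V := δ) y))] with z hz
      exact htr z hz _
    rw [dirDeriv_congr e, dirDeriv_cmul (ContMDiffAt.cmul (ContMDiffAt.cpow ha k) hbm) hs',
      dirDeriv_cmul (ContMDiffAt.cpow ha k) hbm, dirDeriv_cpow ha ha0]
    field_simp
    ring
  have hn : D.nabla k (p u) (X u) s y = (dirDeriv (X u) (fun z => pCoord L δ k y z (s z)) y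
      + pCoord L δ k y y (s y) * (k * (dirDeriv (X u) (trans L o y) y / trans L o y y
          + lam D.preq o y (X u y)) + (theta D o p 0 (hatV o X) (u, chart n o y)
        + dirDeriv (X u) (trans δ o y) y / trans δ o y y))) • pFrame L δ k y y := by
    rw [QuantData.nabla, hcov, lieHalf_eq D hp hX u hy hb, sum_tprod_update,
      ← TensorProduct.smul_tmul', TensorProduct.tmul_smul, ← add_smul, smul_smul]
    exact (add_smul _ _ (pFrame L δ k y y)).symm
  rw [hn, map_smul, smul_eq_mul, htr y hyy (pFrame L δ k y y), pCoord_pFrame hyy.1 hyy.2,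
    hd, htr y hyy (s y)]
  ring

section SquareRoots

lemma exists_sqrt_family {X : Type*} [TopologicalSpace X] {f g : ℝ × X → ℂ} {t₀ : ℝ}
    (hd : ∀ t x, HasDerivAt (fun s => f (s, x)) (g (t, x)) t) (hf : Continuous f)
    (hg : Continuous g) (h0 : ∀ z, f z ≠ 0) (h1 : ∀ x, f (t₀, x) = 1) :
    ∃ c : ℝ → X → ℂ, Continuous (fun z : ℝ × X => c z.1 z.2) ∧ (∀ x, c t₀ x = 1) ∧
      ∀ t x, c t x ^ 2 = f (t, x) := by
  have hq : Continuous fun z => g z / f z := hg.div hf h0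
  have hprim : ∀ t x, HasDerivAt (fun t => ∫ s in t₀..t, g (s, x) / f (s, x)) (g (t, x) / f (t, x)) t := by
    intro t x
    have hx : Continuous fun s : ℝ => g (s, x) / f (s, x) := hq.comp (by fun_prop)
    exact intervalIntegral.integral_hasDerivAt_right (hx.intervalIntegrable _ _)
      (hx.stronglyMeasurableAtFilter _ _) hx.continuousAt
  refine ⟨fun t x => Complex.exp ((1 / 2) * ∫ s in t₀..t, g (s, x) / f (s, x)), ?_, ?_, ?_⟩
  · refine Complex.continuous_exp.comp (continuous_const.mul ?_)
    have hu : Continuous (Function.uncurry fun (z : ℝ × X) (s : ℝ) => g (s, z.2) / f (s, z.2)) :=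
      hq.comp (by fun_prop)
    exact intervalIntegral.continuous_parametric_intervalIntegral_of_continuous hu continuous_fst
  · intro x
    simp
  · intro t x
    rw [← Complex.exp_nat_mul]
    push_cast
    rw [← mul_assoc, show (2 : ℂ) * (1 / 2) = 1 by norm_num, one_mul]
    have hk : ∀ t, HasDerivAt (fun t => f (t, x)
        * Complex.exp (-∫ s in t₀..t, g (s, x) / f (s, x))) 0 t := by
      intro t
      have h := (hd t x).mul ((hprim t x).neg.cexp)
      refine h.congr_deriv ?_
      have hne := mul_div_cancel₀ (g (t, x)) (h0 (t, x))
      generalize Complex.exp _ = E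
      linear_combination -E * hne
    have hconst := is_const_of_deriv_eq_zero (fun t => (hk t).differentiableAt)
      (fun t => (hk t).deriv) t t₀
    simp only [h1, intervalIntegral.integral_same, neg_zero, Complex.exp_zero, mul_one] at hconst
    rw [Complex.exp_neg] at hconst
    field_simp at hconst
    exact hconst.symm

lemma hasDerivAt_of_sq {c f : ℝ → ℂ} {f' : ℂ} {t₀ : ℝ} (hc : ContinuousAt c t₀) (h1 : c t₀ = 1)
    (hsq : ∀ t, c t ^ 2 = f t) (hf : HasDerivAt f f' t₀) : HasDerivAt c (f' / 2) t₀ := by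
  have hne : ∀ᶠ t in 𝓝 t₀, c t + 1 ≠ 0 :=
    (hc.add continuousAt_const).eventually_ne (by
      change c t₀ + 1 ≠ 0
      rw [h1]
      norm_num)
  rw [hasDerivAt_iff_tendsto_slope] at hf ⊢
  have h2 : Filter.Tendsto (fun t => slope f t₀ t * (c t + 1)⁻¹) (𝓝[≠] t₀) (𝓝 (f' * (1 + 1)⁻¹)) := by
    refine hf.mul (Filter.Tendsto.inv₀ ?_ (by norm_num))
    have := (hc.tendsto.add_const 1).mono_left (nhdsWithin_le_nhds (s := {t₀}ᶜ))
    rwa [h1] at this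
  rw [show f' / 2 = f' * (1 + 1)⁻¹ by norm_num [div_eq_mul_inv]]
  refine h2.congr' ?_
  filter_upwards [nhdsWithin_le_nhds hne] with t ht
  have h3 : f t₀ = 1 := by rw [← hsq, h1, one_pow]
  simp only [slope, vsub_eq_sub]
  rw [← hsq t, h3, h1, smul_mul_assoc]
  congr 1
  field_simp
  ring

end SquareRoots

lemma phi_Psi_spec (ja jb : CompatACS D.form) (x : M) (τ : δ x ⊗[ℂ] δ x) :
    Psi (ja x) (jb x) (D.phi ja x τ) ∈ typeN0 n (jb x) ∧ ∀ v : Fin n → Tan n x,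
      Psi (ja x) (jb x) (D.phi ja x τ)
        (fun a => twist (ja x).toLinearMap (jb x).toLinearMap (v a)) = 2 ^ n * D.phi ja x τ v :=
  Psi_spec (ja := (ja x).toLinearMap) (jb := (jb x).toLinearMap) (finrank_tan x)
    (ja.sq x) (jb.sq x) (twist_eq_zero ja jb x) (phi_mem D ja x τ)
    ⟨_, phi_mem D ja x _, phi_ne_zero D ja x (tensor_lineFrame_ne_zero (self_mem_base x))⟩

lemma exists_ratio (ja jb : CompatACS D.form) (x : M) :
    ∃ r : ℂ, ∀ τ : δ x ⊗[ℂ] δ x, Psi (ja x) (jb x) (D.phi ja x τ) = r • D.phi jb x τ := by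
  have hb := self_mem_base (V := δ) x
  obtain ⟨r, hr⟩ := typeN0_line D jb x _ (phi_mem D jb x _) _
    (phi_Psi_spec D ja jb x (lineFrame δ x x ⊗ₜ[ℂ] lineFrame δ x x)).1
    (phi_ne_zero D jb x (tensor_lineFrame_ne_zero hb))
  refine ⟨r, fun τ => ?_⟩
  obtain ⟨c, rfl⟩ := tensor_lineFrame hb τ
  refine eq_of_comp_twist (twist_eq_zero ja jb x) fun v => ?_
  rw [(phi_Psi_spec D ja jb x _).2, phi_smul, phi_smul]
  have := (phi_Psi_spec D ja jb x (lineFrame δ x x ⊗ₜ[ℂ] lineFrame δ x x)).2 v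
  rw [hr] at this
  simp only [AlternatingMap.smul_apply, smul_eq_mul] at this ⊢
  linear_combination -c * this

/-- The function by which `Ψ_{ja, jb} ∘ φ_{ja}` and `φ_{jb}` differ. -/
def ratio (ja jb : CompatACS D.form) (x : M) : ℂ := (exists_ratio D ja jb x).choose

lemma ratio_spec (ja jb : CompatACS D.form) (x : M) (τ : δ x ⊗[ℂ] δ x) :
    Psi (ja x) (jb x) (D.phi ja x τ) = ratio D ja jb x • D.phi jb x τ :=
  (exists_ratio D ja jb x).choose_spec τ

lemma ratio_twist (ja jb : CompatACS D.form) (x : M) (τ : δ x ⊗[ℂ] δ x) (v : Fin n → Tan n x) :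
    ratio D ja jb x * D.phi jb x τ (fun a => twist (ja x).toLinearMap (jb x).toLinearMap (v a))
      = 2 ^ n * D.phi ja x τ v := by
  rw [← (phi_Psi_spec D ja jb x τ).2, ratio_spec]
  rfl

lemma ratio_ne_zero (ja jb : CompatACS D.form) (x : M) : ratio D ja jb x ≠ 0 := by
  intro h
  obtain ⟨v, hv⟩ := ne_zero_iff_exists.1
    (phi_ne_zero D ja x (tensor_lineFrame_ne_zero (self_mem_base (V := δ) x)))
  have := ratio_twist D ja jb x (lineFrame δ x x ⊗ₜ[ℂ] lineFrame δ x x) v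
  rw [h, zero_mul] at this
  exact mul_ne_zero (pow_ne_zero _ two_ne_zero) hv this.symm

lemma twist_self (j : CompatACS D.form) (x : M) (v : Tan n x) :
    twist (j x).toLinearMap (j x).toLinearMap v = v + v := by
  have : twist (j x).toLinearMap (j x).toLinearMap v = v - j x (j x v) := rfl
  rw [this, j.sq, sub_neg_eq_add]

lemma ratio_self (j : CompatACS D.form) (x : M) : ratio D j j x = 1 := by
  obtain ⟨v, hv⟩ := ne_zero_iff_exists.1
    (phi_ne_zero D j x (tensor_lineFrame_ne_zero (self_mem_base (V := δ) x)))
  have := ratio_twist D j j x (lineFrame δ x x ⊗ₜ[ℂ] lineFrame δ x x) v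
  simp only [twist_self] at this
  rw [typeN0_apply_add_self, ← mul_assoc, mul_comm (ratio D j j x), mul_assoc] at this
  have h2 := mul_left_cancel₀ (pow_ne_zero n (two_ne_zero (α := ℂ))) this
  exact mul_right_cancel₀ hv (h2.trans (one_mul _).symm)

lemma isHalfFormFamily_sq {γ : ℝ → CompatACS D.form} {t₀ : ℝ} {c : ℝ → M → ℂ}
    (h : D.IsHalfFormFamily γ t₀ c) (t : ℝ) (x : M) : c t x ^ 2 = ratio D (γ t₀) (γ t) x := by
  have h1 := h.morph t x (lineFrame δ x x ⊗ₜ[ℂ] lineFrame δ x x)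
  rw [phi_smul, ratio_spec] at h1
  obtain ⟨v, hv⟩ := ne_zero_iff_exists.1
    (phi_ne_zero D (γ t) x (tensor_lineFrame_ne_zero (self_mem_base (V := δ) x)))
  exact mul_right_cancel₀ hv (congrArg (fun α : Form n x => α v) h1)

/-- The field of endomorphisms `1 - p(u) p(u₀)` in the chart at `o`. -/
def hatT (o : M) (p : ℝ² → CompatACS D.form) (u₀ : ℝ²) (w : ℝ² × Model n) : Model n →L[ℝ] Model n :=
  1 - hatJ o p w * hatJ o (fun _ : ℝ² => p u₀) w

lemma ratio_hatT (hy : y ∈ dom n o) (u₀ u : ℝ²) (v : Fin n → Model n) :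
    ratio D (p u₀) (p u) y * hatForm D o p (u, chart n o y)
      (fun a => hatT D o p u₀ (u, chart n o y) (v a))
      = 2 ^ n * hatForm D o (fun _ : ℝ² => p u₀) (u, chart n o y) v := by
  have h := ratio_twist D (p u₀) (p u) y (lineFrame δ o y ⊗ₜ[ℂ] lineFrame δ o y)
    (fun a => dchartInv n o y (v a))
  rw [hatForm_apply D hy, hatForm_apply D hy]
  refine Eq.trans ?_ h
  congr 1
  refine Eq.trans ?_ (readF_dchart hy (frameForm D (p u) o) _)
  congr 1
  funext a
  simp only [hatT, hatJ_apply hy]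
  change v a - dchart n o y (p u y (dchartInv n o y (dchart n o y
      (p u₀ y (dchartInv n o y (v a)))))) = _
  rw [dchartInv_dchart hy]
  conv_lhs => rw [← dchart_dchartInv hy (v a)]
  rw [dchartInv_dchart hy, ← map_sub]
  rfl

lemma contDiffAt_hatT (hp : SmoothSurface p) (hy : y ∈ dom n o) (u₀ u : ℝ²) :
    ContDiffAt ℝ ∞ (hatT D o p u₀) (u, chart n o y) :=
  contDiffAt_const.sub ((hp.hatJ hy u).clm_comp ((SmoothSurface.const (p u₀)).hatJ hy u))

lemma contMDiffAt_ratio (hp : SmoothSurface p) (u₀ u : ℝ²) (y : M) :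
    ContMDiffAt (𝓘(ℝ, ℝ²).prod 𝓜[n]) 𝓘(ℝ, ℂ) ∞
      (fun w : ℝ² × M => ratio D (p u₀) (p w.1) w.2) (u, y) := by
  have hy := self_mem_dom (n := n) y
  have hb := self_mem_base (V := δ) y
  rw [contMDiffAt_iff_flat hy]
  obtain ⟨v, hv⟩ := ne_zero_iff_exists.1 (hatForm_ne_zero D hy hb (fun _ : ℝ² => p u₀) u)
  have h1 := smoothFormAt_hatForm D (SmoothSurface.const (p u₀)) hy hb u v
  have h2 := (smoothFormAt_hatForm D hp hy hb u).apply
    (w := fun a w => hatT D y p u₀ w (v a))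
    fun a => (contDiffAt_hatT D hp hy u₀ u).clm_apply contDiffAt_const
  have hne : hatForm D y p (u, chart n y y)
      (fun a => hatT D y p u₀ (u, chart n y y) (v a)) ≠ 0 := by
    intro h0
    have := ratio_hatT D (p := p) hy u₀ u v
    rw [h0, mul_zero] at this
    exact mul_ne_zero (pow_ne_zero _ two_ne_zero) hv this.symm
  refine ((contDiffAt_const (c := (2 ^ n : ℂ)).mul h1).mul (h2.inv hne)).congr_of_eventuallyEq ?_
  have hne' := h2.continuousAt.eventually_ne hne
  have hd : ∀ᶠ w : ℝ² × Model n in 𝓝 (u, chart n y y),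
      flat y (fun w : ℝ² × M => ratio D (p u₀) (p w.1) w.2) w
        * hatForm D y p w (fun a => hatT D y p u₀ w (v a))
      = 2 ^ n * hatForm D y (fun _ : ℝ² => p u₀) w v :=
    eventually_chart hy (dom_mem_nhds hy) fun u' x _ hx => by
      rw [flat_chart hx]
      exact ratio_hatT D hx u₀ u' v
  filter_upwards [hne', hd] with w hw hw'
  refine Eq.trans ?_ (congrArg (· * _) hw')
  simp only [Pi.inv_apply]
  rw [mul_assoc, mul_inv_cancel₀ hw, mul_one]

/-- The derivative of the ratio in the direction `e` at `u₀` is `-2θ`. -/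
lemma along_ratio (hp : SmoothSurface p) (hy : y ∈ dom n o) (hb : y ∈ base δ o)
    (u₀ e : ℝ²) :
    along e (fun _ => 0) (flat (n := n) o fun w : ℝ² × M => ratio D (p u₀) (p w.1) w.2)
      (u₀, chart n o y) = -2 * theta D o p e (fun _ => 0) (u₀, chart n o y) := by
  set z : ℝ² × Model n := (u₀, chart n o y) with hz
  obtain ⟨v, hv⟩ := ne_zero_iff_exists.1 (hatForm_ne_zero D hy hb p u₀)
  set R := flat (n := n) o fun w : ℝ² × M => ratio D (p u₀) (p w.1) w.2 with hR
  have hRs : ContDiffAt ℝ ∞ R z := (contMDiffAt_iff_flat hy).1 (contMDiffAt_ratio D hp u₀ u₀ y)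
  have hα := smoothFormAt_hatForm D hp hy hb u₀
  have hTs := contDiffAt_hatT D hp hy u₀ u₀
  have hA := hα.apply (w := fun a w => hatT D o p u₀ w (v a))
    fun a => hTs.clm_apply contDiffAt_const
  have hev : (fun w => R w * hatForm D o p w (fun a => hatT D o p u₀ w (v a))) =ᶠ[𝓝 z]
      fun w => 2 ^ n * hatForm D o (fun _ : ℝ² => p u₀) w v :=
    eventually_chart hy (dom_mem_nhds hy) fun u' x _ hx => by
      refine Eq.trans ?_ (ratio_hatT D hx u₀ u' v)
      exact congrArg (· * _) (flat_chart hx _ u')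
  have hconst : ∀ {G : Type} [NormedAddCommGroup G] [NormedSpace ℝ G]
      (f : ℝ² × Model n → G) (f0 : Model n → G), (∀ w, f w = f0 w.2) →
      DifferentiableAt ℝ f z → along e (fun _ => 0) f z = 0 := by
    intro G _ _ f f0 hf hd
    have h2 : HasDerivAt (fun t : ℝ => ((u₀ + t • e, chart n o y) : ℝ² × Model n)) (e, 0) 0 := by
      refine HasDerivAt.prodMk ?_ (hasDerivAt_const _ _)
      simpa using ((hasDerivAt_id (0 : ℝ)).smul_const e).const_add u₀
    have hd' : HasFDerivAt f (fderiv ℝ f z) ((u₀ + (0 : ℝ) • e, chart n o y) : ℝ² × Model n) := by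
      simpa using hd.hasFDerivAt
    have h3 := HasFDerivAt.comp_hasDerivAt (l := f)
      (f := fun t : ℝ => ((u₀ + t • e, chart n o y) : ℝ² × Model n)) (0 : ℝ) hd' h2
    have h4 : (f ∘ fun t : ℝ => ((u₀ + t • e, chart n o y) : ℝ² × Model n))
        = fun _ => f0 (chart n o y) := by
      funext t
      exact hf _
    rw [h4] at h3
    exact h3.unique (hasDerivAt_const (0 : ℝ) _)
  have h1 : along e (fun _ => 0) (fun w => R w * hatForm D o p w
      (fun a => hatT D o p u₀ w (v a))) z = 0 := by
    rw [along_congr hev]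
    refine hconst _ (fun y => 2 ^ n * readF o (frameForm D (p u₀) o) (chartInv o y) v)
      (fun w => rfl) ?_
    exact toDiffAt (contDiffAt_const.mul
      (smoothFormAt_hatForm D (SmoothSurface.const (p u₀)) hy hb u₀ v))
  rw [along_mul (toDiffAt hRs) (toDiffAt hA)] at h1
  have hRz : R z = 1 := by
    rw [hR, flat_chart hy]
    exact ratio_self D _ _
  set J := hatJ o p z with hJ
  have hJs := hp.hatJ hy u₀
  have hsq := eventually_hatJ_mul_self hy p u₀
  have hTz : ∀ x, hatT D o p u₀ z x = (2 : ℝ) • x := by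
    intro x
    have h2 : hatJ o (fun _ : ℝ² => p u₀) z = J := rfl
    have h3 : J * J = -1 := hsq.self_of_nhds
    simp only [hatT, h2]
    rw [← hJ, h3, two_smul]
    simp
  set η := along e (fun _ => 0) (hatJ o p) z with hη
  have hη' : lieEnd e (fun _ => 0) (hatJ o p) z = η := by
    simp [lieEnd, vert, hη]
  have hanti : η * J = -(J * η) := by
    have := lieEnd_anticomm (c := e) (X := fun _ => 0) hJs hsq
    rwa [hη'] at this
  have hTd : ∀ x, fderiv ℝ (fun w => hatT D o p u₀ w x) z (e, 0) = (J * η) x := by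
    intro x
    have hK0 : along e (fun _ => 0) (hatJ o fun _ : ℝ² => p u₀) z = 0 :=
      hconst _ (fun y => readE o (p u₀).toFun (chartInv o y)) (fun w => rfl)
        (toDiffAt ((SmoothSurface.const (p u₀)).hatJ hy u₀))
    have h5 : along e (fun _ => 0) (hatT D o p u₀) z = J * η := by
      have h6 := along_mul (c := e) (X := fun _ => 0) (toDiffAt hJs)
        (toDiffAt ((SmoothSurface.const (p u₀)).hatJ hy u₀))
      rw [hK0, mul_zero, add_zero] at h6
      have h7 : along e (fun _ => 0) (hatT D o p u₀) z
          = -along e (fun _ => 0) (fun w => hatJ o p w * hatJ o (fun _ : ℝ² => p u₀) w) z := by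
        simp only [along]
        have h8 : hatT D o p u₀ = fun w => (1 : Model n →L[ℝ] Model n)
          - hatJ o p w * hatJ o (fun _ : ℝ² => p u₀) w := rfl
        rw [h8, fderiv_const_sub]
        rfl
      rw [h7, h6]
      have h8 : hatJ o (fun _ : ℝ² => p u₀) z = J := rfl
      rw [h8, ← hη, hanti, neg_neg]
    have h9 := fderiv_clm_apply (toDiffAt hTs) (differentiableAt_const (x := z) x)
    rw [← h5, along, h9]
    simp
    rfl
  have h2 := hα.fderiv_apply (w := fun a w => hatT D o p u₀ w (v a))
    (fun a => toDiffAt (hTs.clm_apply contDiffAt_const)) (e, 0)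
  have h2 := h2.trans (congrArg (_ + ·) (Finset.sum_congr rfl fun a _ =>
    congrArg (fun x => hatForm D o p z (update
      (fun a => hatT D o p u₀ z (v a)) a x)) (hTd (v a))))
  have hTv : (fun a => hatT D o p u₀ z (v a)) = fun a => v a + v a := by
    funext a
    rw [hTz, two_smul]
  have hup : ∀ a, update (fun a => hatT D o p u₀ z (v a)) a ((J * η) (v a))
      = update (fun a => v a + v a) a ((1 / 2 : ℝ) • ((J * η) (v a) + (J * η) (v a))) := by
    intro a
    rw [hTv, ← two_smul ℝ, smul_smul]
    norm_num
  have hup2 : ∀ a, (update (fun a => v a + v a) a ((J * η) (v a) + (J * η) (v a)))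
      = fun b => update v a ((J * η) (v a)) b + update v a ((J * η) (v a)) b := by
    intro a
    funext b
    by_cases hb : b = a
    · subst hb
      simp
    · simp [Function.update_of_ne hb]
  have h3 : fderiv ℝ (fun w => hatForm D o p w (fun a => hatT D o p u₀ w (v a))) z (e, 0)
      = 2 ^ n * (along e (fun _ => 0) (fun w => hatForm D o p w v) z
        + (1 / 2 : ℂ) * act (hatForm D o p z) (J * η : Model n →L[ℝ] Model n) v) := by
    have hS : ∑ a, hatForm D o p z (update (fun a => hatT D o p u₀ z (v a)) a
        ((J * η) (v a)))
        = 2 ^ n * ((1 / 2 : ℂ) * act (hatForm D o p z) (J * η : Model n →L[ℝ] Model n) v) := by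
      rw [act, Finset.mul_sum, Finset.mul_sum]
      refine Finset.sum_congr rfl fun a _ => ?_
      rw [hup, AlternatingMap.map_update_smul, hup2, typeN0_apply_add_self, Complex.real_smul]
      push_cast
      ring
    have h10 : fderiv ℝ (fun w => hatForm D o p w (fun a => v a + v a)) z (e, 0)
        = 2 ^ n * along e (fun _ => 0) (fun w => hatForm D o p w v) z := by
      simp only [typeN0_apply_add_self, along]
      rw [fderiv_const_mul (toDiffAt (hα v))]
      rfl
    rw [mul_add]
    exact h2.trans (congrArg₂ (· + ·) ((congrArg (fun V => fderiv ℝ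
      (fun w => hatForm D o p w V) z (e, 0)) hTv).trans h10) hS)
  have h4 := theta_spec D hp hy hb u₀ e (fun _ => 0) v
  have h5 : act (hatForm D o p z) (connEnd e (fun _ => 0) (hatJ o p) z) v
      = -((1 / 2 : ℂ) * act (hatForm D o p z) (J * η : Model n →L[ℝ] Model n) v) := by
    have h6 : connEnd e (fun _ => 0) (hatJ o p) z = -((1 / 2 : ℝ) • (J * η)) := by
      rw [connEnd, hη']
      simp [vert, hJ]
    have h7 := act_neg (hatForm D o p z) (fun x => (1 / 2 : ℝ) • (J * η) x) v
    rw [act_smul, Complex.real_smul] at h7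
    rw [h6]
    refine Eq.trans ?_ (h7.trans ?_)
    · rfl
    · push_cast
      rfl
  rw [h5, sub_neg_eq_add] at h4
  have h11 : along e (fun _ => 0) (fun w => hatForm D o p w (fun a => hatT D o p u₀ w (v a))) z
      = 2 ^ n * (2 * theta D o p e (fun _ => 0) z * hatForm D o p z v) := by
    rw [h4]
    exact h3
  rw [h11, hRz, hTv, typeN0_apply_add_self] at h1
  have h12 : (2 ^ n * hatForm D o p z v) * (along e (fun _ => 0) R z
      + 2 * theta D o p e (fun _ => 0) z) = 0 := by
    linear_combination h1
  have h13 := (mul_eq_zero.1 h12).resolve_left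
    (mul_ne_zero (pow_ne_zero _ two_ne_zero) hv)
  linear_combination h13

variable {k : ℕ} {Φ : ℝ² → Sec L δ k} {X : ℝ² × Model n → Model n}

lemma hasDerivAt_line {G : Type*} [NormedAddCommGroup G] [NormedSpace ℝ G] {f : ℝ² × M → G}
    (hy : y ∈ dom n o) (a e : ℝ²) (t : ℝ)
    (hf : ContMDiffAt (𝓘(ℝ, ℝ²).prod 𝓜[n]) 𝓘(ℝ, G) ∞ f (a + t • e, y)) :
    HasDerivAt (fun s : ℝ => f (a + s • e, y))
      (along e (fun _ => 0) (flat o f) (a + t • e, chart n o y)) t := by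
  have h1 := along_flat_param hy e hf
  have h2 : HasDerivAt (fun s : ℝ => s - t) 1 t := (hasDerivAt_id t).sub_const t
  have h3 := HasDerivAt.scomp (h := fun s : ℝ => s - t) t (by simpa using h1) h2
  rw [one_smul] at h3
  refine h3.congr_of_eventuallyEq (.of_forall fun s => ?_)
  simp only [Function.comp]
  congr 2
  rw [sub_smul]
  abel

lemma exists_halfFormFamily (hp : SmoothSurface p) (a e : ℝ²) (t₀ : ℝ) :
    ∃ c, D.IsHalfFormFamily (fun t => p (a + t • e)) t₀ c := by
  have hline : ∀ t : ℝ, Continuous fun z : ℝ × M => ((a + z.1 • e, z.2) : ℝ² × M) :=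
    fun t => by fun_prop
  set r : ℝ² × M → ℂ := fun w => ratio D (p (a + t₀ • e)) (p w.1) w.2 with hr
  have hrs : ∀ u y, ContMDiffAt (𝓘(ℝ, ℝ²).prod 𝓜[n]) 𝓘(ℝ, ℂ) ∞ r (u, y) :=
    fun u y => contMDiffAt_ratio D hp _ u y
  have hrc : Continuous r := continuous_iff_continuousAt.2 fun w => (hrs w.1 w.2).continuousAt
  obtain ⟨c, hc, hc1, hsq⟩ := exists_sqrt_family (t₀ := t₀) (X := M)
    (f := fun z => r (a + z.1 • e, z.2))
    (g := fun z => along e (fun _ => 0) (flat (n := n) z.2 r)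
      (a + z.1 • e, chart n z.2 z.2))
    (fun t x => hasDerivAt_line (self_mem_dom x) a e t (hrs _ _))
    (hrc.comp (hline 0))
    (by
      refine continuous_iff_continuousAt.2 fun w => ?_
      have hy := self_mem_dom (n := n) w.2
      have h1 : ContinuousAt (along e (fun _ => 0) (flat (n := n) w.2 r))
          (a + w.1 • e, chart n w.2 w.2) :=
        (contDiffAt_along contDiffAt_const ((contMDiffAt_iff_flat hy).1 (hrs _ _))).continuousAt
      have h2 : ContinuousAt (fun z : ℝ × M =>
          ((a + z.1 • e, chart n w.2 z.2) : ℝ² × Model n)) w := by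
        refine ContinuousAt.prodMk (by fun_prop) ?_
        exact ContinuousAt.comp (f := Prod.snd) (continuousAt_chart hy) continuousAt_snd
      have h3 := ContinuousAt.comp (f := fun z : ℝ × M =>
          ((a + z.1 • e, chart n w.2 z.2) : ℝ² × Model n)) (x := w) h1 h2
      refine h3.congr ?_
      have hd : ∀ᶠ z : ℝ × M in 𝓝 w, z.2 ∈ dom n w.2 :=
        continuousAt_snd.eventually (dom_mem_nhds hy)
      filter_upwards [hd] with z hz
      exact (hasDerivAt_line hz a e z.1 (hrs _ _)).unique
        (hasDerivAt_line (self_mem_dom z.2) a e z.1 (hrs _ _)))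
    (fun z => ratio_ne_zero D _ _ _) (fun x => ratio_self D _ _)
  refine ⟨c, hc, hc1, fun t x τ => ?_⟩
  rw [phi_smul, hsq, ratio_spec]

lemma hasDerivAt_halfFormFamily (hp : SmoothSurface p) {a e : ℝ²} {t₀ : ℝ} {c : ℝ → M → ℂ}
    (hc : D.IsHalfFormFamily (fun t => p (a + t • e)) t₀ c) (hy : y ∈ dom n o) (hb : y ∈ base δ o) :
    HasDerivAt (fun t => c t y) (-theta D o p e (fun _ => 0) (a + t₀ • e, chart n o y)) t₀ := by
  have h1 := hasDerivAt_line hy a e t₀ (contMDiffAt_ratio D hp (a + t₀ • e) (a + t₀ • e) y)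
  rw [along_ratio D hp hy hb] at h1
  have h2 : ContinuousAt (fun t => c t y) t₀ :=
    (hc.cont.comp (Continuous.prodMk continuous_id continuous_const)).continuousAt
  have h3 := hasDerivAt_of_sq h2 (hc.init y) (fun t => isHalfFormFamily_sq D hc t y) h1
  refine h3.congr_deriv ?_
  ring

/-- A family of sections in the chart and the frames at `o`. -/
def hatS (o : M) (Φ : ℝ² → Sec L δ k) : ℝ² × Model n → ℂ :=
  flat o fun w : ℝ² × M => pCoord L δ k o w.2 (Φ w.1 w.2)

lemma hatS_apply (hy : y ∈ dom n o) (Φ : ℝ² → Sec L δ k) (u : ℝ²) :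
    hatS o Φ (u, chart n o y) = pCoord L δ k o y (Φ u y) := flat_chart hy _ u

lemma _root_.GeomQuant.SmoothSecSurface.hatS (hΦ : SmoothSecSurface n Φ) (hy : y ∈ dom n o)
    (hbL : y ∈ base L o) (hb : y ∈ base δ o) (u : ℝ²) :
    ContDiffAt ℝ ∞ (hatS o Φ) (u, chart n o y) :=
  (contMDiffAt_iff_flat hy).1 (smoothSecSurface_iff.1 hΦ u o y ⟨hbL, hb⟩)

lemma smoothSecSurface_of_hatS (h : ∀ u (y : M), ContDiffAt ℝ ∞ (hatS y Φ) (u, chart n y y)) :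
    SmoothSecSurface n Φ :=
  smoothSecSurface_of_self fun u y => (contMDiffAt_iff_flat (self_mem_dom y)).2 (h u y)

/-- The covariant derivative along the field `(c, X)`, in the chart and the frames at `o`. -/
def conn (k : ℕ) (o : M) (p : ℝ² → CompatACS D.form) (c : ℝ²) (X : ℝ² × Model n → Model n)
    (h : ℝ² × Model n → ℂ) (w : ℝ² × Model n) : ℂ :=
  along c X h w + (k * hatLam D.preq o w (X w) + theta D o p c X w) * h w

lemma covDerivP_eq (hp : SmoothSurface p) (hΦ : SmoothSecSurface n Φ) (a e : ℝ²) (t₀ : ℝ)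
    (hy : y ∈ dom n o) (hbL : y ∈ base L o) (hb : y ∈ base δ o) :
    pCoord L δ k o y (D.covDerivP k (fun t => p (a + t • e)) (fun t => Φ (a + t • e)) t₀ y)
      = conn D k o p e (fun _ => 0) (hatS o Φ) (a + t₀ • e, chart n o y) := by
  have hc := Classical.epsilon_spec (exists_halfFormFamily D hp a e t₀)
  set c := Classical.epsilon (D.IsHalfFormFamily (fun t => p (a + t • e)) t₀) with hcd
  have h1 := hasDerivAt_halfFormFamily D hp hc hy hb
  have h2 := hasDerivAt_line hy a e t₀ (smoothSecSurface_iff.1 hΦ (a + t₀ • e) o y ⟨hbL, hb⟩)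
  have h3 := (h1.inv (by rw [hc.init y]; exact one_ne_zero)).mul h2
  set T := lineCoord L y y (lineFrame L o y) ^ k * lineCoord δ y y (lineFrame δ o y) with hT
  have hTr : ∀ s : PFib L δ k y, pCoord L δ k y y s = T * pCoord L δ k o y s :=
    fun s => pCoord_transition hbL hb s
  have h4 := h3.const_mul T
  have h5 := (h4.congr_of_eventuallyEq
    (f₁ := fun t => pCoord L δ k y y ((c t y)⁻¹ • Φ (a + t • e) y))
    (.of_forall fun t => by
      simp only [map_smul, hTr, smul_eq_mul, Pi.mul_apply, Pi.inv_apply])).deriv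
  have h6 : D.covDerivP k (fun t => p (a + t • e)) (fun t => Φ (a + t • e)) t₀ y
      = deriv (fun t => pCoord L δ k y y ((c t y)⁻¹ • Φ (a + t • e) y)) t₀ • pFrame L δ k y y := rfl
  have h7 : T * pCoord L δ k o y (pFrame L δ k y y) = 1 := by
    rw [← hTr, pCoord_pFrame (self_mem_base y) (self_mem_base y)]
  rw [h6, map_smul, h5, smul_eq_mul, mul_right_comm, h7, one_mul, conn, hatS_apply hy]
  simp only [Pi.inv_apply, hc.init y, map_zero, mul_zero, zero_add, inv_one, one_mul, one_pow,
    div_one, neg_neg]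
  rw [add_comm]
  rfl

lemma covP₁_eq (hp : SmoothSurface p) (hΦ : SmoothSecSurface n Φ) (u : ℝ²) (hy : y ∈ dom n o)
    (hbL : y ∈ base L o) (hb : y ∈ base δ o) : hatS o (D.covP₁ k p Φ) (u, chart n o y)
      = conn D k o p (1, 0) (fun _ => 0) (hatS o Φ) (u, chart n o y) := by
  have h := covDerivP_eq D hp hΦ (0, u.2) (1, 0) u.1 hy hbL hb
  have e : ∀ t : ℝ, ((0, u.2) + t • (1, 0) : ℝ²) = (t, u.2) := fun t => by simp
  simp only [e] at h
  rw [hatS_apply hy]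
  exact h

lemma covP₂_eq (hp : SmoothSurface p) (hΦ : SmoothSecSurface n Φ) (u : ℝ²) (hy : y ∈ dom n o)
    (hbL : y ∈ base L o) (hb : y ∈ base δ o) : hatS o (D.covP₂ k p Φ) (u, chart n o y)
      = conn D k o p (0, 1) (fun _ => 0) (hatS o Φ) (u, chart n o y) := by
  have h := covDerivP_eq D hp hΦ (u.1, 0) (0, 1) u.2 hy hbL hb
  have e : ∀ t : ℝ, ((u.1, 0) + t • (0, 1) : ℝ²) = (u.1, t) := fun t => by simp
  simp only [e] at h
  rw [hatS_apply hy]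
  exact h

lemma nabla_eq (hp : SmoothSurface p) {X : ℝ² → VF n M} (hX : SmoothFamVF X)
    (hΦ : SmoothSecSurface n Φ) (u : ℝ²) (hy : y ∈ dom n o) (hbL : y ∈ base L o) (hb : y ∈ base δ o)
    : hatS o (fun u => D.nabla k (p u) (X u) (Φ u)) (u, chart n o y)
      = conn D k o p 0 (hatV o X) (hatS o Φ) (u, chart n o y) := by
  have h1 := smoothSecSurface_iff.1 hΦ u o y ⟨hbL, hb⟩
  rw [hatS_apply hy, pCoord_nabla D hp hX u hy hbL hb (contMDiffAt_fix_param h1), conn,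
    hatS_apply hy, hatLam_hatV D.preq hy]
  congr 1
  exact (along_flat_vertical hy X h1).symm

lemma contDiffAt_conn (hp : SmoothSurface p) (hy : y ∈ dom n o) (hbL : y ∈ base L o)
    (hb : y ∈ base δ o) (u c : ℝ²) (hX : ContDiffAt ℝ ∞ X (u, chart n o y)) {h : ℝ² × Model n → ℂ}
    (hh : ContDiffAt ℝ ∞ h (u, chart n o y)) :
    ContDiffAt ℝ ∞ (conn D k o p c X h) (u, chart n o y) :=
  (contDiffAt_along hX hh).add (((contDiffAt_const.mul
    ((contDiffAt_hatLam D.preq hy hbL u).clm_apply hX)).add (contDiffAt_theta D hp hy hb u c hX)).mul hh)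

lemma conn_congr {o : M} {c : ℝ²} {h h' : ℝ² × Model n → ℂ} {w : ℝ² × Model n} (e : h =ᶠ[𝓝 w] h') :
    conn D k o p c X h w = conn D k o p c X h' w := by
  rw [conn, conn, along_congr e, e.self_of_nhds]

lemma good_mem_nhds (hy : y ∈ dom n o) (hbL : y ∈ base L o) (hb : y ∈ base δ o) :
    dom n o ∩ (base L o ∩ base δ o) ∈ 𝓝 y :=
  Filter.inter_mem (dom_mem_nhds hy) (Filter.inter_mem (base_mem_nhds hbL) (base_mem_nhds hb))

lemma eventually_good (hy : y ∈ dom n o) (hbL : y ∈ base L o)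
    (hb : y ∈ base δ o) {u : ℝ²} {f g : ℝ² × Model n → ℂ}
    (h : ∀ u' : ℝ², ∀ x, x ∈ dom n o → x ∈ base L o → x ∈ base δ o →
      f (u', chart n o x) = g (u', chart n o x)) :
    f =ᶠ[𝓝 (u, chart n o y)] g :=
  eventually_chart hy (good_mem_nhds hy hbL hb) fun u' x hx _ => h u' x hx.1 hx.2.1 hx.2.2

lemma smoothSecSurface_of_conn (hp : SmoothSurface p) {Φ Φ' : ℝ² → Sec L δ k} (c : ℝ²)
    {X : M → ℝ² × Model n → Model n}
    (hX : ∀ u (y : M), ContDiffAt ℝ ∞ (X y) (u, chart n y y)) (hΦ : SmoothSecSurface n Φ)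
    (h : ∀ (u : ℝ²) (o y : M), y ∈ dom n o → y ∈ base L o → y ∈ base δ o →
      hatS o Φ' (u, chart n o y)
        = conn D k o p c (X o) (hatS o Φ) (u, chart n o y)) : SmoothSecSurface n Φ' :=
  smoothSecSurface_of_hatS fun u y =>
    (contDiffAt_conn D hp (self_mem_dom y) (self_mem_base y) (self_mem_base y) u c (hX u y)
      (hΦ.hatS (self_mem_dom y) (self_mem_base y) (self_mem_base y) u)).congr_of_eventuallyEq
      (eventually_good (self_mem_dom y) (self_mem_base y) (self_mem_base y)
        fun u' x h1 h2 h3 => h u' y x h1 h2 h3)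

lemma smoothSecSurface_covP₁ (hp : SmoothSurface p) (hΦ : SmoothSecSurface n Φ) :
    SmoothSecSurface n (D.covP₁ k p Φ) :=
  smoothSecSurface_of_conn D hp _ (fun _ _ => contDiffAt_const) hΦ
    fun u _ _ h1 h2 h3 => covP₁_eq D hp hΦ u h1 h2 h3

lemma smoothSecSurface_covP₂ (hp : SmoothSurface p) (hΦ : SmoothSecSurface n Φ) :
    SmoothSecSurface n (D.covP₂ k p Φ) :=
  smoothSecSurface_of_conn D hp _ (fun _ _ => contDiffAt_const) hΦ
    fun u _ _ h1 h2 h3 => covP₂_eq D hp hΦ u h1 h2 h3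

lemma smoothSecSurface_nabla (hp : SmoothSurface p) {X : ℝ² → VF n M} (hX : SmoothFamVF X)
    (hΦ : SmoothSecSurface n Φ) : SmoothSecSurface n (fun u => D.nabla k (p u) (X u) (Φ u)) :=
  smoothSecSurface_of_conn D hp 0 (fun u y => hX.hatV (self_mem_dom y) u) hΦ
    fun u _ _ h1 h2 h3 => nabla_eq D hp hX hΦ u h1 h2 h3

/-- The curvature of the half-form part of the connection. -/
def thetaCurv (o : M) (p : ℝ² → CompatACS D.form) (c : ℝ²) (X : ℝ² × Model n → Model n) (c' : ℝ²)
    (X' : ℝ² × Model n → Model n) (z : ℝ² × Model n) : ℂ :=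
  along c X (theta D o p c' X') z - along c' X' (theta D o p c X) z
    - theta D o p 0 (flatBracket c X c' X') z

lemma conn_commutator (hp : SmoothSurface p) (hy : y ∈ dom n o) (hbL : y ∈ base L o)
    (hb : y ∈ base δ o) (u c c' : ℝ²) {X X' : ℝ² × Model n → Model n}
    (hX : ContDiffAt ℝ ∞ X (u, chart n o y)) (hX' : ContDiffAt ℝ ∞ X' (u, chart n o y))
    {h : ℝ² × Model n → ℂ} (hh : ContDiffAt ℝ ∞ h (u, chart n o y)) :
    conn D k o p c X (conn D k o p c' X' h) (u, chart n o y)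
      - conn D k o p c' X' (conn D k o p c X h) (u, chart n o y)
      = conn D k o p 0 (flatBracket c X c' X') h (u, chart n o y)
        + (thetaCurv D o p c X c' X' (u, chart n o y)
          - I * k * (hatOm D.form o (u, chart n o y) (X (u, chart n o y))
            (X' (u, chart n o y)) : ℂ)) * h (u, chart n o y) := by
  set z : ℝ² × Model n := (u, chart n o y) with hz
  have hl := contDiffAt_hatLam D.preq hy hbL u
  have hθ := contDiffAt_theta D hp hy hb u c hX
  have hθ' := contDiffAt_theta D hp hy hb u c' hX'
  have hm : ∀ (X : ℝ² × Model n → Model n) (θ : ℝ² × Model n → ℂ), ContDiffAt ℝ ∞ X z →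
      ContDiffAt ℝ ∞ θ z → ContDiffAt ℝ ∞ (fun w => k * hatLam D.preq o w (X w) + θ w) z :=
    fun X θ h1 h2 => (contDiffAt_const.mul (hl.clm_apply h1)).add h2
  have key : ∀ (c : ℝ²) (X : ℝ² × Model n → Model n) (c' : ℝ²)
      (X' : ℝ² × Model n → Model n), ContDiffAt ℝ ∞ X z → ContDiffAt ℝ ∞ X' z →
      along c X (conn D k o p c' X' h) z = along c X (along c' X' h) z
        + ((k * along c X (fun w => hatLam D.preq o w (X' w)) z
            + along c X (theta D o p c' X') z) * h z
          + (k * hatLam D.preq o z (X' z) + theta D o p c' X' z) * along c X h z) := by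
    intro c X c' X' hX hX'
    have hθ' := contDiffAt_theta D hp hy hb u c' hX'
    have hlx := hl.clm_apply hX'
    have e1 := along_add (c := c) (X := X)
      (toDiffAt (contDiffAt_along (c := c') hX' hh))
      (toDiffAt ((hm X' _ hX' hθ').mul hh))
    have e2 := along_mul (c := c) (X := X) (toDiffAt (hm X' _ hX' hθ'))
      (toDiffAt hh)
    have e3 := along_add (c := c) (X := X)
      (toDiffAt ((contDiffAt_const (c := (k : ℂ))).mul hlx)) (toDiffAt hθ')
    have e4 := along_mul (c := c) (X := X) (differentiableAt_const (k : ℂ) (x := z))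
      (toDiffAt hlx)
    have e5 : along c X (fun _ => (k : ℂ)) z = 0 := by simp [along]
    rw [e5, zero_mul, zero_add] at e4
    refine e1.trans ?_
    rw [e2, e3, e4]
  have h1 := key c X c' X' hX hX'
  have h2 := key c' X' c X hX' hX
  have h3 := along_commutator (c := c) (c' := c') (toDiffAt hX)
    (toDiffAt hX') hh
  have h4 := hatLam_curvature D.preq hy hbL u (c := c) (c' := c') (toDiffAt hX)
    (toDiffAt hX')
  rw [← hz] at h4
  have e1 : conn D k o p c X (conn D k o p c' X' h) z
      = along c X (conn D k o p c' X' h) z + (k * hatLam D.preq o z (X z) + theta D o p c X z)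
        * conn D k o p c' X' h z := rfl
  have e2 : conn D k o p c' X' (conn D k o p c X h) z
      = along c' X' (conn D k o p c X h) z
        + (k * hatLam D.preq o z (X' z) + theta D o p c' X' z) * conn D k o p c X h z := rfl
  rw [e1, e2, h1, h2, thetaCurv]
  simp only [conn]
  rw [← h3]
  linear_combination (k : ℂ) * h z * h4

lemma thetaCurv_spec (hp : SmoothSurface p) (hy : y ∈ dom n o) (hb : y ∈ base δ o) (u c c' : ℝ²)
    {X X' : ℝ² × Model n → Model n} (hX : ContDiffAt ℝ ∞ X (u, chart n o y))
    (hX' : ContDiffAt ℝ ∞ X' (u, chart n o y)) (v : Fin n → Model n) :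
    2 * thetaCurv D o p c X c' X' (u, chart n o y)
        * hatForm D o p (u, chart n o y) v
      = (1 / 4 : ℝ) • act (hatForm D o p (u, chart n o y))
        (lieEnd c X (hatJ o p) (u, chart n o y) * lieEnd c' X' (hatJ o p) (u, chart n o y)
          - lieEnd c' X' (hatJ o p) (u, chart n o y)
            * lieEnd c X (hatJ o p) (u, chart n o y)) v :=
  IsConnCoeff.curvature (hatForm_ne_zero D hy hb p u) hX hX' (hp.hatJ hy u)
    (eventually_hatJ_mul_self hy p u) (smoothFormAt_hatForm D hp hy hb u)
    (eventually_chart hy (Filter.inter_mem (dom_mem_nhds hy) (base_mem_nhds hb))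
      fun u' _ hx _ => theta_spec D hp hx.1 hx.2 u' c X)
    (eventually_chart hy (Filter.inter_mem (dom_mem_nhds hy) (base_mem_nhds hb))
      fun u' _ hx _ => theta_spec D hp hx.1 hx.2 u' c' X')
    (theta_spec D hp hy hb u 0 _) v

lemma thetaCurv_congr (hp : SmoothSurface p) (hy : y ∈ dom n o) (hb : y ∈ base δ o)
    (u c c' e e' : ℝ²) {X X' Y Y' : ℝ² × Model n → Model n} (hX : ContDiffAt ℝ ∞ X (u, chart n o y))
    (hX' : ContDiffAt ℝ ∞ X' (u, chart n o y)) (hY : ContDiffAt ℝ ∞ Y (u, chart n o y))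
    (hY' : ContDiffAt ℝ ∞ Y' (u, chart n o y))
    (h : lieEnd c X (hatJ o p) (u, chart n o y) = lieEnd e Y (hatJ o p) (u, chart n o y))
    (h' : lieEnd c' X' (hatJ o p) (u, chart n o y) = lieEnd e' Y' (hatJ o p) (u, chart n o y)) :
    thetaCurv D o p c X c' X' (u, chart n o y) = thetaCurv D o p e Y e' Y' (u, chart n o y) := by
  obtain ⟨v, hv⟩ := ne_zero_iff_exists.1 (hatForm_ne_zero D hy hb p u)
  have h1 := thetaCurv_spec D hp hy hb u c c' hX hX' v
  rw [h, h', ← thetaCurv_spec D hp hy hb u e e' hY hY' v] at h1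
  exact mul_left_cancel₀ two_ne_zero (mul_right_cancel₀ hv h1)

lemma theta_zero (hp : SmoothSurface p) (hy : y ∈ dom n o) (hb : y ∈ base δ o) (u : ℝ²)
    (hX : X =ᶠ[𝓝 (u, chart n o y)] fun _ => 0) : theta D o p 0 X (u, chart n o y) = 0 := by
  refine (theta_spec D hp hy hb u 0 X).unique (hatForm_ne_zero D hy hb p u) ?_
  intro v
  have h0 : X (u, chart n o y) = 0 := hX.self_of_nhds
  have h1 : vert X (u, chart n o y) = 0 := by
    simp only [vert]
    rw [hX.fderiv_eq]
    simp
  have h2 : connEnd 0 X (hatJ o p) (u, chart n o y) = 0 := by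
    simp [connEnd, lieEnd, h1, along, h0, ← Prod.zero_eq_mk]
  rw [h2]
  have h3 : along 0 X (fun y => hatForm D o p y v) (u, chart n o y) = 0 := by
    simp [along, h0, ← Prod.zero_eq_mk]
  rw [h3]
  have h4 := act_smul (hatForm D o p (u, chart n o y)) 0 (fun x => x) v
  simp only [zero_smul] at h4
  have h5 : act (hatForm D o p (u, chart n o y)) ((0 : Model n →L[ℝ] Model n)) v = 0 := h4
  rw [h5]
  simp

section Functions

variable {G : Type*} [NormedAddCommGroup G] [NormedSpace ℝ G]

/-- A function in the chart at `o`, constant in the parameters. -/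
def hatG (o : M) (f : M → G) : ℝ² × Model n → G :=
  flat o fun w : ℝ² × M => f w.2

lemma hatG_apply (hy : y ∈ dom n o) (f : M → G) (u : ℝ²) :
    hatG o f (u, chart n o y) = f y := flat_chart hy _ u

lemma contDiffAt_hatG (hy : y ∈ dom n o) {f : M → G} (hf : ContMDiffAt 𝓜[n] 𝓘(ℝ, G) ∞ f y) (u : ℝ²)
    : ContDiffAt ℝ ∞ (hatG o f) (u, chart n o y) :=
  (contMDiffAt_iff_flat hy).1 (contMDiffAt_const_param u hf)

lemma along_hatG (hy : y ∈ dom n o) (X : ℝ² → VF n M) {f : M → G}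
    (hf : ContMDiffAt 𝓜[n] 𝓘(ℝ, G) ∞ f y) (u : ℝ²) :
    along 0 (hatV o X) (hatG o f) (u, chart n o y) = dirDeriv (X u) f y :=
  along_flat_vertical hy X (contMDiffAt_const_param u hf)

lemma hatG_dirDeriv {U : Set M} (hy : y ∈ dom n o) (hU : U ∈ 𝓝 y) (X : VF n M) {f : M → G}
    (hf : ∀ x ∈ U, ContMDiffAt 𝓜[n] 𝓘(ℝ, G) ∞ f x) (u : ℝ²) :
    hatG o (dirDeriv X f) =ᶠ[𝓝 (u, chart n o y)] along 0 (hatV o fun _ => X) (hatG o f) :=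
  eventually_chart hy hU fun u' x hx hxd => by
    rw [hatG_apply hxd, along_hatG hxd (fun _ => X) (hf x hx)]

lemma contMDiffAt_dirDeriv {y : M} {U : Set M} (hU : U ∈ 𝓝 y) {X : VF n M} (hX : SmoothVF X)
    {f : M → G} (hf : ∀ x ∈ U, ContMDiffAt 𝓜[n] 𝓘(ℝ, G) ∞ f x) :
    ContMDiffAt 𝓜[n] 𝓘(ℝ, G) ∞ (dirDeriv X f) y := by
  have hy := self_mem_dom (n := n) y
  have h1 : ContDiffAt ℝ ∞ (hatG y (dirDeriv X f)) (((0, 0) : ℝ²), chart n y y) :=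
    (contDiffAt_along (hX.hatV hy _) (contDiffAt_hatG hy (hf y (mem_of_mem_nhds hU)) _)).congr_of_eventuallyEq
      (hatG_dirDeriv hy hU X hf _)
  exact contMDiffAt_fix_param ((contMDiffAt_iff_flat hy).2 h1)

lemma dirDeriv_bracket {y : M} {U : Set M} (hU : U ∈ 𝓝 y) {X Y : VF n M} (hX : SmoothVF X)
    (hY : SmoothVF Y) {f : M → G} (hf : ∀ x ∈ U, ContMDiffAt 𝓜[n] 𝓘(ℝ, G) ∞ f x) :
    dirDeriv (bracket X Y) f y = dirDeriv X (dirDeriv Y f) y - dirDeriv Y (dirDeriv X f) y := by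
  have hy := self_mem_dom (n := n) y
  have hs := contDiffAt_hatG hy (hf y (mem_of_mem_nhds hU)) (0, 0)
  have h1 := along_commutator (c := 0) (c' := 0)
    (toDiffAt (hX.hatV hy ((0, 0) : ℝ²)))
    (toDiffAt (hY.hatV hy ((0, 0) : ℝ²))) hs
  rw [along_congr (hatG_dirDeriv hy hU Y hf _).symm, along_congr (hatG_dirDeriv hy hU X hf _).symm,
    along_hatG hy (fun _ => X) (contMDiffAt_dirDeriv hU hY hf),
    along_hatG hy (fun _ => Y) (contMDiffAt_dirDeriv hU hX hf)] at h1
  rw [h1, ← along_hatG hy (fun _ => bracket X Y) (hf y (mem_of_mem_nhds hU)) (0, 0), along, along,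
    hatV_bracket hX hY hy]

end Functions

lemma contDiffAt_hatOm (hy : y ∈ dom n o) (u : ℝ²) (a b : Model n) :
    ContDiffAt ℝ ∞ (fun w => hatOm Ω o w a b) (u, chart n o y) := by
  obtain ⟨X, hX, hXv⟩ := exists_constVF_at hy a
  obtain ⟨Y, hY, hYv⟩ := exists_constVF_at hy b
  refine (contDiffAt_hatG hy (Ω.smooth X Y hX hY y) u).congr_of_eventuallyEq ?_
  refine eventually_chart hy (Filter.inter_mem hXv hYv) fun u' x hx hxd => ?_
  rw [hatG_apply hxd, ← hatOm_hatV hxd (fun _ => X) (fun _ => Y) u', hatV_apply hxd,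
    hatV_apply hxd]
  exact (congrArg₂ (hatOm Ω o (u', chart n o x)) hx.1 hx.2).symm

/-- The symplectic form in the chart at `o`, as a continuous bilinear map. -/
def hatB (Ω : SymplecticForm n M) (o : M) (w : ℝ² × Model n) : Model n →L[ℝ] Model n →L[ℝ] ℝ :=
  LinearMap.toContinuousLinearMap (LinearMap.toContinuousLinearMap.toLinearMap ∘ₗ
    (LinearMap.compl₁₂ (Ω (chartInv o w.2)) (dchartInv n o (chartInv o w.2)).toLinearMap
      (dchartInv n o (chartInv o w.2)).toLinearMap))

lemma hatB_apply (o : M) (w : ℝ² × Model n) (a b : Model n) :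
    hatB Ω o w a b = hatOm Ω o w a b := rfl

lemma contDiffAt_hatB (hy : y ∈ dom n o) (u : ℝ²) : ContDiffAt ℝ ∞ (hatB Ω o) (u, chart n o y) :=
  contDiffAt_clm_of_apply fun a => contDiffAt_clm_of_apply fun b => contDiffAt_hatOm hy u a b

lemma hatB_nondeg (hy : y ∈ dom n o) (u : ℝ²) {a : Model n}
    (h : ∀ b, hatB Ω o (u, chart n o y) a b = 0) : a = 0 := by
  have h1 : dchartInv n o y a = 0 := by
    refine (Ω.nondeg y).1 _ fun v => ?_
    have := h (dchart n o y v)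
    rwa [hatB_apply, hatOm_apply hy, dchartInv_dchart hy] at this
  rw [← dchart_dchartInv hy a, h1, map_zero]

lemma hatB_isInvertible (hy : y ∈ dom n o) (u : ℝ²) : (hatB Ω o (u, chart n o y)).IsInvertible := by
  have hinj : Function.Injective (hatB Ω o (u, chart n o y)).toLinearMap := by
    rw [← LinearMap.ker_eq_bot, LinearMap.ker_eq_bot']
    intro a ha
    exact hatB_nondeg hy u fun b => congrArg (fun T : Model n →L[ℝ] ℝ => T b) ha
  have hdim : Module.finrank ℝ (Model n) = Module.finrank ℝ (Model n →L[ℝ] ℝ) := by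
    rw [← LinearEquiv.finrank_eq (LinearMap.toContinuousLinearMap (𝕜 := ℝ) (E := Model n) (F' := ℝ))]
    exact (Subspace.dual_finrank_eq (K := ℝ) (V := Model n)).symm
  exact ⟨(LinearEquiv.ofInjectiveOfFinrankEq _ hinj hdim).toContinuousLinearEquiv, by ext; rfl⟩

lemma hamVF_spec (f : M → ℝ) (x : M) (v : Tan n x) : Ω x (hamVF Ω f x) v = -mvfderiv 𝓜[n] f x v :=
  LinearMap.BilinForm.apply_toDual_symm_apply (hB := Ω.nondeg x) _ _

lemma form_hamVF (f : M → ℝ) (X : VF n M) (x : M) : Ω x (hamVF Ω f x) (X x) = -dirDeriv X f x :=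
  hamVF_spec f x (X x)

lemma form_ext {x : M} {a b : Tan n x} (h : ∀ v, Ω x a v = Ω x b v) : a = b := by
  rw [← sub_eq_zero]
  refine (Ω.nondeg x).1 _ fun v => ?_
  rw [map_sub, LinearMap.sub_apply, h, sub_self]

lemma smoothVF_hamVF {f : M → ℝ} (hf : Smooth[n] f) : SmoothVF (hamVF Ω f) := by
  intro y
  have hy := self_mem_dom (n := n) y
  rw [vf_contMDiffAt_iff' hy]
  have h0 : ContDiffAt ℝ ∞ (fun w : ℝ² × Model n =>
      -((hatB Ω y w).inverse (fderiv ℝ (hatG y f) w ∘L ContinuousLinearMap.inr ℝ _ _)))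
      (((0, 0) : ℝ²), chart n y y) := by
    obtain ⟨e, he⟩ := hatB_isInvertible (Ω := Ω) hy (0, 0)
    have h1 : ContDiffAt ℝ ∞ (fun w => (hatB Ω y w).inverse)
        (((0, 0) : ℝ²), chart n y y) := by
      refine ContDiffAt.comp (g := ContinuousLinearMap.inverse) _ ?_ (contDiffAt_hatB hy _)
      rw [← he]
      exact contDiffAt_map_inverse e
    exact (h1.clm_apply (((contDiffAt_hatG hy (hf y) _).fderiv_right (by simp)).clm_comp
      contDiffAt_const)).neg
  have h2 : ContDiffAt ℝ ∞ (flat y fun w : ℝ² × M => readV y (hamVF Ω f) w.2)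
      (((0, 0) : ℝ²), chart n y y) := by
    refine h0.congr_of_eventuallyEq ?_
    refine eventually_chart hy (dom_mem_nhds hy) fun u x _ hx => ?_
    rw [flat_chart hx]
    have hi := hatB_isInvertible (Ω := Ω) hx u
    have key : fderiv ℝ (hatG y f) (u, chart n y x) ∘L ContinuousLinearMap.inr ℝ _ _
        = hatB Ω y (u, chart n y x) (-readV y (hamVF Ω f) x) := by
      ext b
      have h3 : (b : Model n) = readV y (fun z => dchartInv n y z b) x :=
        (dchart_dchartInv hx b).symm
      have h4 := along_hatG hx (fun _ z => dchartInv n y z b) (hf x) u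
      rw [along, hatV_apply hx, ← h3] at h4
      have h5 := form_hamVF (Ω := Ω) f (fun z => dchartInv n y z b) x
      rw [← h4] at h5
      have h6 : hatB Ω y (u, chart n y x) (-readV y (hamVF Ω f) x) b
          = -hatOm Ω y (u, chart n y x) (readV y (hamVF Ω f) x) b := by
        rw [map_neg]
        rfl
      rw [h6, hatOm_apply hx, readV, dchartInv_dchart hx, h5, neg_neg]
      rfl
    have h7 := hi.inverse_apply_eq.2 key
    exact ((congrArg Neg.neg h7).trans (neg_neg _)).symm
  exact contMDiffAt_fix_param ((contMDiffAt_iff_flat hy).2 h2)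

lemma poisson_eq (f g : M → ℝ) (x : M) : poisson Ω f g x = dirDeriv (hamVF Ω f) g x := by
  rw [poisson, Ω.neg_swap, form_hamVF, neg_neg]

lemma contMDiff_poisson {f g : M → ℝ} (hf : Smooth[n] f) (hg : Smooth[n] g) :
    Smooth[n] (poisson Ω f g) :=
  Ω.smooth _ _ (smoothVF_hamVF hf) (smoothVF_hamVF hg)

lemma bracket_swap (X Y : VF n M) (x : M) : bracket X Y x = -bracket Y X x :=
  congrFun VectorField.mlieBracket_swap x

lemma smoothVF_bracket {X Y : VF n M} (hX : SmoothVF X) (hY : SmoothVF Y) :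
    SmoothVF (bracket X Y) := by
  intro y
  have hy := self_mem_dom (n := n) y
  rw [vf_contMDiffAt_iff' hy]
  have h1 : ContDiffAt ℝ ∞ (hatV y fun _ : ℝ² => bracket X Y)
      (((0, 0) : ℝ²), chart n y y) := by
    refine (contDiffAt_flatBracket (c := 0) (c' := 0) (hX.hatV hy _)
      (hY.hatV hy _)).congr_of_eventuallyEq ?_
    exact eventually_chart hy (dom_mem_nhds hy) fun u x _ hx => hatV_bracket hX hY hx u
  exact contMDiffAt_fix_param ((contMDiffAt_iff_flat hy).2 h1)

/-- The symplectic form is invariant by Hamiltonian fields. -/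
lemma lie_form_hamVF {f : M → ℝ} (hf : Smooth[n] f) {Y Z : VF n M} (hY : SmoothVF Y)
    (hZ : SmoothVF Z) (x : M) : dirDeriv (hamVF Ω f) (fun y => Ω y (Y y) (Z y)) x
      = Ω x (bracket (hamVF Ω f) Y x) (Z x) + Ω x (Y x) (bracket (hamVF Ω f) Z x) := by
  have hX := smoothVF_hamVF (Ω := Ω) hf
  have h1 := Ω.closed _ Y Z hX hY hZ x
  have e1 : (fun y => Ω y (Z y) (hamVF Ω f y)) = dirDeriv Z f := by
    funext y
    rw [Ω.neg_swap, form_hamVF, neg_neg]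
  have e2 : (fun y => Ω y (hamVF Ω f y) (Y y)) = fun y => -dirDeriv Y f y := by
    funext y
    exact form_hamVF f Y y
  have e3 := dirDeriv_bracket (Filter.univ_mem (f := 𝓝 x)) hY hZ (f := f) fun z _ => hf z
  have e4 : Ω x (bracket Y Z x) (hamVF Ω f x) = dirDeriv (bracket Y Z) f x := by
    rw [Ω.neg_swap, form_hamVF, neg_neg]
  have e5 : dirDeriv Z (fun y => -dirDeriv Y f y) x = -dirDeriv Z (dirDeriv Y f) x :=
    dirDeriv_clm (-ContinuousLinearMap.id ℝ ℝ)
      (mdiff_of_smooth (contMDiffAt_dirDeriv (Filter.univ_mem (f := 𝓝 x)) hY fun z _ => hf z))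
  have e6 : Ω x (bracket Z (hamVF Ω f) x) (Y x) = Ω x (Y x) (bracket (hamVF Ω f) Z x) := by
    rw [bracket_swap, map_neg, LinearMap.neg_apply, ← Ω.neg_swap]
  rw [e1, e2, e4, e5, e3, e6] at h1
  linarith

lemma bracket_hamVF {f g : M → ℝ} (hf : Smooth[n] f) (hg : Smooth[n] g) :
    bracket (hamVF Ω f) (hamVF Ω g) = hamVF Ω (poisson Ω f g) := by
  funext x
  refine form_ext (Ω := Ω) fun v => ?_
  obtain ⟨Z, hZ, hZv⟩ := exists_constVF_at (self_mem_dom (n := n) x) (dchart n x x v)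
  have hZx : Z x = v := by
    have := hZv.self_of_nhds
    rw [← dchartInv_dchart (self_mem_dom x) (Z x), ← dchartInv_dchart (self_mem_dom x) v]
    exact congrArg (dchartInv n x x) this
  have hX := smoothVF_hamVF (Ω := Ω) hf
  have hY := smoothVF_hamVF (Ω := Ω) hg
  have h1 := lie_form_hamVF (Ω := Ω) hf hY hZ x
  have e1 : (fun y => Ω y (hamVF Ω g y) (Z y)) = fun y => -dirDeriv Z g y := by
    funext y
    exact form_hamVF g Z y
  have e2 : dirDeriv (hamVF Ω f) (fun y => -dirDeriv Z g y) x
      = -dirDeriv (hamVF Ω f) (dirDeriv Z g) x :=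
    dirDeriv_clm (-ContinuousLinearMap.id ℝ ℝ)
      (mdiff_of_smooth (contMDiffAt_dirDeriv (Filter.univ_mem (f := 𝓝 x)) hZ fun z _ => hg z))
  have e3 := dirDeriv_bracket (Filter.univ_mem (f := 𝓝 x)) hX hZ (f := g) fun z _ => hg z
  rw [e1, e2, form_hamVF, e3] at h1
  have e4 : poisson Ω f g = dirDeriv (hamVF Ω f) g := funext fun y => poisson_eq f g y
  rw [← hZx, form_hamVF, e4]
  linarith

/-- The symplectic form is invariant by Hamiltonian fields, in a chart. -/
lemma along_hatOm_hamVF {f : M → ℝ} (hf : Smooth[n] f) (hy : y ∈ dom n o) (u : ℝ²) (a b : Model n) :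
    along 0 (hatV o fun _ => hamVF Ω f) (fun w => hatOm Ω o w a b) (u, chart n o y)
      = -hatOm Ω o (u, chart n o y)
          (vert (hatV o fun _ => hamVF Ω f) (u, chart n o y) a) b
        - hatOm Ω o (u, chart n o y) a
          (vert (hatV o fun _ => hamVF Ω f) (u, chart n o y) b) := by
  obtain ⟨Y, hY, hYv⟩ := exists_constVF_at hy a
  obtain ⟨Z, hZ, hZv⟩ := exists_constVF_at hy b
  have hX := smoothVF_hamVF (Ω := Ω) hf
  have h1 := lie_form_hamVF (Ω := Ω) hf hY hZ y
  have hc : ∀ (W : VF n M) (c : Model n), (∀ᶠ z in 𝓝 y, readV o W z = c) →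
      hatV o (fun _ : ℝ² => W) =ᶠ[𝓝 (u, chart n o y)] fun _ => c := fun W c h =>
    eventually_chart hy h fun u' x hx hxd => by
      rw [hatV_apply hxd]
      exact hx
  have hbr : ∀ (W : VF n M) (c : Model n), SmoothVF W → (∀ᶠ z in 𝓝 y, readV o W z = c) →
      readV o (bracket (hamVF Ω f) W) y
        = -vert (hatV o fun _ => hamVF Ω f) (u, chart n o y) c := by
    intro W c hW h
    rw [← hatV_apply hy (fun _ => bracket (hamVF Ω f) W) u, hatV_bracket hX hW hy, flatBracket,
      along_congr (hc W c h), along_vertical]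
    have e0 : along 0 (hatV o fun _ : ℝ² => W) (hatV o fun _ => hamVF Ω f)
        (u, chart n o y) = vert (hatV o fun _ => hamVF Ω f) (u, chart n o y) c := by
      rw [along_vertical, hatV_apply hy, h.self_of_nhds]
    rw [e0]
    simp [vert]
  have e1 : along 0 (hatV o fun _ => hamVF Ω f) (fun w => hatOm Ω o w a b) (u, chart n o y)
      = dirDeriv (hamVF Ω f) (fun y => Ω y (Y y) (Z y)) y := by
    rw [← along_hatG hy (fun _ => hamVF Ω f) (Ω.smooth Y Z hY hZ y) u]
    refine along_congr ?_
    refine eventually_chart hy (Filter.inter_mem hYv hZv) fun u' x hx hxd => ?_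
    rw [hatG_apply hxd, ← hatOm_hatV hxd (fun _ => Y) (fun _ => Z) u', hatV_apply hxd,
      hatV_apply hxd]
    exact (congrArg₂ (hatOm Ω o (u', chart n o x)) hx.1 hx.2).symm
  rw [e1, h1, ← hatOm_hatV hy (fun _ => bracket (hamVF Ω f) Y) (fun _ => Z) u,
    ← hatOm_hatV hy (fun _ => Y) (fun _ => bracket (hamVF Ω f) Z) u, hatV_apply hy, hatV_apply hy,
    hatV_apply hy, hatV_apply hy, hbr Y a hY hYv, hbr Z b hZ hZv, hYv.self_of_nhds,
    hZv.self_of_nhds]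
  simp only [← hatB_apply, map_neg, neg_apply]
  ring

section Flow

variable {X : VF n M} {φ : ℝ → M → M}

/-- A flow, in the chart at `o`. -/
def hatFlow (o : M) (φ : ℝ → M → M) : ℝ × Model n → Model n :=
  flat o fun w : ℝ × M => chart n o (φ w.1 w.2)

lemma contMDiffAt_flow (h : IsFlow X φ) {t : ℝ} (hy : φ t y ∈ dom n o) :
    ContMDiffAt (𝓘(ℝ, ℝ).prod 𝓜[n]) 𝓜[n] ∞ (fun w : ℝ × M => chart n o (φ w.1 w.2)) (t, y) :=
  ContMDiffAt.comp (t, y) (g := chart n o) (contMDiffAt_chart hy) (h.smooth (t, y))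

lemma hasDerivAt_flow (h : IsFlow X φ) {t : ℝ} (hy : φ t y ∈ dom n o) :
    HasDerivAt (fun s => chart n o (φ s y)) (readV o X (φ t y)) t := by
  have h1 := h.integral y t
  have h2 : HasMFDerivAt 𝓜[n] 𝓜[n] (chart n o) (φ t y)
      (dchart n o (φ t y)) :=
    ((contMDiffAt_chart hy).mdifferentiableAt (by simp)).hasMFDerivAt
  have h3 := HasMFDerivAt.comp (g := chart n o) (f := fun s => φ s y) t h2 h1
  have h4 : HasFDerivAt (fun s => chart n o (φ s y))
      ((1 : ℝ →L[ℝ] ℝ).smulRight (readV o X (φ t y))) t := by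
    refine hasMFDerivAt_iff_hasFDerivAt.1 (h3.congr_mfderiv ?_)
    refine ContinuousLinearMap.ext fun r => ?_
    exact (dchart n o (φ t y)).map_smul (show ℝ from r) (X (φ t y))
  have h5 := h4.hasDerivAt
  rwa [ContinuousLinearMap.smulRight_apply, one_apply_eq_self, one_smul] at h5

lemma eventually_flow_mem (h : IsFlow X φ) (hy : y ∈ dom n o) :
    ∀ᶠ w : ℝ × M in 𝓝 (0, y), φ w.1 w.2 ∈ dom n o :=
  h.smooth.continuous.continuousAt.eventually_mem (by
    change dom n o ∈ 𝓝 (φ 0 y)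
    rw [h.zero]
    exact dom_mem_nhds hy)

lemma along_hatFlow (h : IsFlow X φ) (hy : y ∈ dom n o) :
    along 1 (fun _ => 0) (hatFlow o φ) =ᶠ[𝓝 (0, chart n o y)]
      fun w => readV o X (chartInv o (hatFlow o φ w)) := by
  have h1 := (tendsto_chartInv hy (0 : ℝ)).eventually (eventually_flow_mem h hy)
  filter_upwards [h1, eventually_exists_chart hy (dom_mem_nhds hy) (0 : ℝ)] with w hw hx
  obtain ⟨x, -, hx, hwx⟩ := hx
  rw [hwx] at hw ⊢
  simp only [chartInv_chart hx] at hw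
  have h2 := along_flat_param hx 1 (contMDiffAt_flow h hw)
  have h3 : HasDerivAt (fun t : ℝ => chart n o (φ (w.1 + t • (1 : ℝ)) x))
      (readV o X (φ w.1 x)) 0 := by
    have h4 : HasDerivAt (fun t : ℝ => w.1 + t • (1 : ℝ)) 1 0 := by
      simpa using ((hasDerivAt_id (0 : ℝ)).const_add w.1)
    have h5 := HasDerivAt.scomp (h := fun t : ℝ => w.1 + t • (1 : ℝ))
      (g₁ := fun s => chart n o (φ s x)) 0
      (by simpa using hasDerivAt_flow h hw) h4
    rwa [one_smul] at h5
  have h6 : hatFlow o φ (w.1, chart n o x) = chart n o (φ w.1 x) := flat_chart hx _ _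
  rw [h6, chartInv_chart hw]
  exact h2.unique h3

lemma contDiffAt_hatFlow (h : IsFlow X φ) (hy : y ∈ dom n o) :
    ContDiffAt ℝ ∞ (hatFlow o φ) (0, chart n o y) :=
  (contMDiffAt_iff_flat hy).1 (contMDiffAt_flow h (by rwa [h.zero]))

/-- The derivative of the time `t` map of a flow, in the chart at `o`. -/
lemma vert_hatFlow (h : IsFlow X φ) {t : ℝ} (hy : y ∈ dom n o) (hyt : φ t y ∈ dom n o) (v : Tan n y)
    : vert (hatFlow o φ) (t, chart n o y) (dchart n o y v)
      = dchart n o (φ t y) (mfderiv 𝓜[n] 𝓜[n] (φ t) y v) := by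
  have h1 := contMDiffAt_flow h hyt
  have h2 := along_flat_vertical hy (fun _ z => dchartInv n o z (dchart n o y v)) h1
  have h3 : flat (n := n) o (fun w : ℝ × M => readV (n := n) o
      (fun z => dchartInv n o z (dchart n o y v)) w.2) (t, chart n o y) = dchart n o y v := by
    rw [flat_chart hy, readV, dchartInv_dchart hy]
  have h4 : along 0 (flat (n := n) o (fun w : ℝ × M => readV (n := n) o
      (fun z => dchartInv n o z (dchart n o y v)) w.2)) (hatFlow o φ) (t, chart n o y)
      = vert (hatFlow o φ) (t, chart n o y) (dchart n o y v) := by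
    rw [along_vertical, h3]
  rw [← h4]
  refine h2.trans ?_
  have h5 : HasMFDerivAt 𝓜[n] 𝓜[n] (φ t) y
      (mfderiv 𝓜[n] 𝓜[n] (φ t) y) := by
    have : ContMDiffAt 𝓜[n] 𝓜[n] ∞ (φ t) y :=
      ContMDiffAt.comp y (g := fun w : ℝ × M => φ w.1 w.2) (h.smooth (t, y))
        (contMDiffAt_const.prodMk contMDiffAt_id)
    exact (this.mdifferentiableAt (by simp)).hasMFDerivAt
  have h6 : HasMFDerivAt 𝓜[n] 𝓜[n] (chart n o) (φ t y)
      (dchart n o (φ t y)) :=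
    ((contMDiffAt_chart hyt).mdifferentiableAt (by simp)).hasMFDerivAt
  have h7 := (HasMFDerivAt.comp (g := chart n o) (f := φ t) y h6 h5).mfderiv
  have h8 : dirDeriv (fun z => dchartInv n o z (dchart n o y v))
      (fun z => chart n o (φ t z)) y
      = mfderiv 𝓜[n] 𝓜[n] (chart n o ∘ φ t) y
        (dchartInv n o y (dchart n o y v)) := rfl
  rw [dchartInv_dchart hy, h7] at h8
  exact h8

set_option maxHeartbeats 1000000 in
/-- The derivative of the pull-backs by a flow, in a chart. -/
lemma readE_of_hasDerivAt_pullback (hX : SmoothVF X) (h : IsFlow X φ) (j : CompatACS Ω)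
    {η : EndField n M}
    (hη : ∀ x v, HasDerivAt (fun t : ℝ => pullbackACS (φ t) j.toFun x v) (η x v) 0)
    (hy : y ∈ dom n o) (u : ℝ²) :
    readE o η y = lieEnd 0 (hatV o fun _ => X) (hatJ o fun _ : ℝ² => j) (u, chart n o y) := by
  set z : ℝ × Model n := (0, chart n o y) with hz
  have hF := contDiffAt_hatFlow h hy
  have hFz : hatFlow o φ z = chart n o y := by
    refine (flat_chart hy _ _).trans ?_
    rw [h.zero]
  have hvz : vert (hatFlow o φ) z = 1 := by
    refine ContinuousLinearMap.ext fun v => ?_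
    have h1 := vert_hatFlow h hy (t := 0) (by rwa [h.zero]) (dchartInv n o y v)
    rw [dchart_dchartInv hy] at h1
    have h2 : φ 0 = id := funext h.zero
    rw [hz, h1, h2, mfderiv_id]
    exact dchart_dchartInv hy v
  set Xh : Model n → Model n := fun w => readV o X (chartInv o w) with hXh
  have hXs : ContDiffAt ℝ ∞ Xh (chart n o y) := hX.readV_chart hy
  set G : Model n →L[ℝ] Model n := fderiv ℝ Xh (chart n o y) with hG
  have hvX : vert (hatV o fun _ : ℝ² => X) (u, chart n o y) = G := by
    have h1 : hatV o (fun _ : ℝ² => X) = Xh ∘ Prod.snd := rfl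
    rw [vert, h1, fderiv_comp (g := Xh) (u, chart n o y) (toDiffAt hXs)
      differentiableAt_snd, fderiv_snd]
    rfl
  have hvF : along 1 (fun _ => 0) (vert (hatFlow o φ)) z = G := by
    have h1 := vert_along (c := (1 : ℝ)) (X := fun _ => 0) (X' := hatFlow o φ) (z := z)
      (differentiableAt_const _) hF
    have h2 : vert (fun _ : ℝ × Model n => (0 : Model n)) z = 0 := by simp [vert]
    rw [h2, mul_zero, add_zero] at h1
    rw [← h1, vert, (along_hatFlow h hy).fderiv_eq]
    have h3 : (fun w => readV o X (chartInv o (hatFlow o φ w))) = Xh ∘ hatFlow o φ := rfl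
    rw [h3, fderiv_comp _ (by rw [← hz, hFz]; exact toDiffAt hXs)
      (toDiffAt hF), ← hz, hFz, ContinuousLinearMap.comp_assoc]
    change G * vert (hatFlow o φ) z = G
    rw [hvz, mul_one]
  have hline : HasDerivAt (fun t : ℝ => ((t, chart n o y) : ℝ × Model n)) (1, 0) 0 :=
    (hasDerivAt_id _).prodMk (hasDerivAt_const _ _)
  have hA : HasDerivAt (fun t : ℝ => vert (hatFlow o φ) (t, chart n o y)) G 0 := by
    have h1 := HasFDerivAt.comp_hasDerivAt (f := fun t : ℝ => ((t, chart n o y) : ℝ × Model n))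
      0 (toDiffAt (contDiffAt_vert hF)).hasFDerivAt hline
    rw [← hvF]
    exact h1
  have hp : HasDerivAt (fun t : ℝ => hatFlow o φ (t, chart n o y))
      (readV o X y) 0 := by
    have h1 := hasDerivAt_flow h (t := 0) (y := y) (o := o) (by rwa [h.zero])
    rw [h.zero] at h1
    exact h1.congr_of_eventuallyEq
      (.of_forall fun t => (flat_chart hy _ _))
  set Jh : Model n → Model n →L[ℝ] Model n := fun w => readE o j.toFun (chartInv o w) with hJh
  have hJs : ContDiffAt ℝ ∞ (hatJ o fun _ : ℝ² => j) (u, chart n o y) :=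
    (SmoothSurface.const j).hatJ hy u
  have hJs' : ContDiffAt ℝ ∞ Jh (chart n o y) := by
    have := (contMDiffAt_iff_flat hy).2 hJs
    exact (contMDiffAt_iff_chart hy).1 (contMDiffAt_fix_param this)
  have hJa : along 0 (hatV o fun _ => X) (hatJ o fun _ : ℝ² => j) (u, chart n o y)
      = fderiv ℝ Jh (chart n o y) (readV o X y) := by
    have h1 : hatJ o (fun _ : ℝ² => j) = Jh ∘ Prod.snd := rfl
    rw [along, h1, fderiv_comp (g := Jh) (u, chart n o y) (toDiffAt hJs') differentiableAt_snd, fderiv_snd,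
      hatV_apply hy]
    rfl
  have hJp : HasDerivAt (fun t : ℝ => Jh (hatFlow o φ (t, chart n o y)))
      (fderiv ℝ Jh (chart n o y) (readV o X y)) 0 :=
    HasFDerivAt.comp_hasDerivAt (l := Jh) (f := fun t : ℝ => hatFlow o φ (t, chart n o y)) 0
      (by rw [← hz, hFz]; exact (toDiffAt hJs').hasFDerivAt) hp
  have hmem : ∀ᶠ t : ℝ in 𝓝 0, φ t y ∈ dom n o := by
    have h1 : Filter.Tendsto (fun t : ℝ => (t, y)) (𝓝 0) (𝓝 ((0 : ℝ), y)) :=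
      (Continuous.prodMk continuous_id continuous_const).tendsto' _ _ rfl
    exact h1.eventually (eventually_flow_mem h hy)
  have hinv : ∀ᶠ t : ℝ in 𝓝 0, IsUnit (vert (hatFlow o φ) (t, chart n o y)) := by
    refine hA.continuousAt.eventually_mem (Units.isOpen.mem_nhds ?_)
    change IsUnit (vert (hatFlow o φ) z)
    rw [hvz]
    exact isUnit_one
  refine ContinuousLinearMap.ext fun v => ?_
  have hP : HasDerivAt (fun t : ℝ => dchart n o y (pullbackACS (φ t) j.toFun y (dchartInv n o y v)))
      (readE o η y v) 0 := by
    have h1 : HasDerivAt (F := Model n)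
        (fun t : ℝ => pullbackACS (φ t) j.toFun y (dchartInv n o y v))
        (η y (dchartInv n o y v)) 0 := hη y (dchartInv n o y v)
    exact HasFDerivAt.comp_hasDerivAt (E := Model n) (F := Model n) (l := dchart n o y)
      (l' := dchart n o y) (0 : ℝ) (ContinuousLinearMap.hasFDerivAt (E := Model n) (F := Model n)
        (dchart n o y)) h1
  have hL := hA.clm_apply hP
  have hR := hJp.clm_apply (hA.clm_apply (hasDerivAt_const (0 : ℝ) v))
  have heq : (fun t : ℝ => vert (hatFlow o φ) (t, chart n o y)
        (dchart n o y (pullbackACS (φ t) j.toFun y (dchartInv n o y v))))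
      =ᶠ[𝓝 0] fun t : ℝ => Jh (hatFlow o φ (t, chart n o y))
        (vert (hatFlow o φ) (t, chart n o y) v) := by
    filter_upwards [hmem, hinv] with t ht hu
    have hvert := vert_hatFlow h hy ht
    have hm : (mfderiv 𝓜[n] 𝓜[n] (φ t) y).IsInvertible := by
      obtain ⟨e1, he1⟩ := isInvertible_dchart (n := n) hy
      obtain ⟨e2, he2⟩ := isInvertible_dchart (n := n) ht
      obtain ⟨a, ha⟩ := hu
      refine ⟨e1.trans ((ContinuousLinearEquiv.unitsEquiv ℝ (Model n) a).trans e2.symm), ?_⟩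
      refine ContinuousLinearMap.ext fun w => ?_
      change e2.symm ((a : Model n →L[ℝ] Model n) (e1 w)) = _
      rw [ContinuousLinearEquiv.symm_apply_eq, ha]
      have := hvert w
      rw [← he1, ← he2] at this
      exact this
    have hf2 : hatFlow o φ (t, chart n o y) = chart n o (φ t y) := flat_chart hy _ _
    simp only [hf2, hJh]
    rw [hvert]
    have hv2 := hvert (dchartInv n o y v)
    rw [dchart_dchartInv hy] at hv2
    rw [hv2, chartInv_chart ht]
    simp only [readE, ContinuousLinearMap.comp_apply]
    rw [dchartInv_dchart ht]
    congr 1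
    obtain ⟨m, hm'⟩ := hm
    simp only [pullbackACS, ContinuousLinearMap.comp_apply]
    rw [← hm']
    simp
  have hfin := hL.unique (hR.congr_of_eventuallyEq heq)
  have hP0 : dchart n o y (pullbackACS (φ 0) j.toFun y (dchartInv n o y v))
      = Jh (chart n o y) v := by
    have h2 : φ 0 = id := funext h.zero
    have h3 := heq.self_of_nhds
    simp only [← hz, hvz, hFz] at h3
    exact h3
  rw [hP0] at hfin
  simp only [← hz, hvz, hFz, one_apply_eq_self, map_zero, add_zero] at hfin
  rw [lieEnd, hvX, hJa]
  have hJz : hatJ o (fun _ : ℝ² => j) (u, chart n o y) = Jh (chart n o y) := rfl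
  rw [hJz]
  change _ = fderiv ℝ Jh (chart n o y) (readV o X y) v - G (Jh (chart n o y) v)
    + Jh (chart n o y) (G v)
  rw [eq_sub_of_add_eq' hfin]
  abel

end Flow

lemma IsInfAction.readE_eq {f : M → ℝ} (hf : Smooth[n] f) {j : CompatACS Ω} {η : EndField n M}
    (h : IsInfAction Ω f j η) (hy : y ∈ dom n o) (u : ℝ²) :
    readE o η y = lieEnd 0 (hatV o fun _ => hamVF Ω f) (hatJ o fun _ : ℝ² => j)
      (u, chart n o y) := by
  obtain ⟨φ, hφ, hη⟩ := h
  exact readE_of_hasDerivAt_pullback (smoothVF_hamVF hf) hφ j hη hy u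

section Exponential

variable {E : Type*} [NormedAddCommGroup E] [NormedSpace ℝ E] [CompleteSpace E]

lemma exp_mul_exp_neg (K : E →L[ℝ] E) : NormedSpace.exp K * NormedSpace.exp (-K) = 1 := by
  let _ : NormedAlgebra ℚ (E →L[ℝ] E) := NormedAlgebra.restrictScalars ℚ ℝ _
  rw [← NormedSpace.exp_add_of_commute (Commute.neg_right (Commute.refl K)), add_neg_cancel,
    NormedSpace.exp_zero]

lemma exp_neg_mul_exp (K : E →L[ℝ] E) : NormedSpace.exp (-K) * NormedSpace.exp K = 1 := by
  simpa using exp_mul_exp_neg (-K)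

/-- The conjugate of `J` by the exponential of `K`. -/
def expConj (J K : E →L[ℝ] E) : E →L[ℝ] E := NormedSpace.exp K * J * NormedSpace.exp (-K)

lemma expConj_zero (J : E →L[ℝ] E) : expConj J 0 = J := by
  simp [expConj, NormedSpace.exp_zero]

lemma expConj_mul_self {J : E →L[ℝ] E} (hJ : J * J = -1) (K : E →L[ℝ] E) :
    expConj J K * expConj J K = -1 := by
  have h := exp_neg_mul_exp K
  calc expConj J K * expConj J K
      = NormedSpace.exp K * J * (NormedSpace.exp (-K) * NormedSpace.exp K) * J
        * NormedSpace.exp (-K) := by simp only [expConj, mul_assoc]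
    _ = -1 := by
      rw [h, mul_one, mul_assoc (NormedSpace.exp K), hJ]
      ext v
      have h1 := exp_mul_exp_neg K
      change NormedSpace.exp K (-(NormedSpace.exp (-K) v)) = -v
      rw [map_neg]
      exact congrArg (fun T : E →L[ℝ] E => -(T v)) h1

lemma hasDerivAt_expConj (J K : E →L[ℝ] E) :
    HasDerivAt (fun t : ℝ => expConj J (t • K)) (K * J - J * K) 0 := by
  have h1 := hasDerivAt_exp_smul_const (𝕂 := ℝ) K (0 : ℝ)
  have h2 := hasDerivAt_exp_smul_const (𝕂 := ℝ) (-K) (0 : ℝ)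
  simp only [zero_smul, NormedSpace.exp_zero, one_mul, smul_neg] at h1 h2
  refine ((h1.mul_const J).mul h2).congr_deriv ?_
  simp only [zero_smul, neg_zero, NormedSpace.exp_zero, one_mul, mul_one]
  ext v
  change K (J v) + J (-(K v)) = K (J v) - J (K v)
  rw [map_neg, sub_eq_add_neg]

lemma contDiffAt_expConj {H : Type*} [NormedAddCommGroup H] [NormedSpace ℝ H] {J K : H → E →L[ℝ] E}
    {z : H} (hJ : ContDiffAt ℝ ∞ J z) (hK : ContDiffAt ℝ ∞ K z) :
    ContDiffAt ℝ ∞ (fun w => expConj (J w) (K w)) z := by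
  have he : ∀ T : E →L[ℝ] E, ContDiffAt ℝ ∞ NormedSpace.exp T := fun T =>
    (NormedSpace.exp_analytic (𝕂 := ℝ) T).contDiffAt
  exact ((ContDiffAt.comp z (he _) hK).clm_comp hJ).clm_comp (ContDiffAt.comp z (he _) hK.neg)

lemma bilin_exp [FiniteDimensional ℝ E] (B : LinearMap.BilinForm ℝ E) {K : E →L[ℝ] E}
    (h : ∀ v w, B (K v) w + B v (K w) = 0) (v w : E) :
    B (NormedSpace.exp K v) (NormedSpace.exp K w) = B v w := by
  set C : E →L[ℝ] E →L[ℝ] ℝ := LinearMap.toContinuousLinearMap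
    (LinearMap.toContinuousLinearMap.toLinearMap ∘ₗ B) with hC
  have hd : ∀ (x : E) (t : ℝ), HasDerivAt (fun t : ℝ => NormedSpace.exp (t • K) x)
      (K (NormedSpace.exp (t • K) x)) t := fun x t => by
    simpa using (hasDerivAt_exp_smul_const' (𝕂 := ℝ) K t).clm_apply (hasDerivAt_const t x)
  have hk : ∀ t : ℝ, HasDerivAt
      (fun t : ℝ => C (NormedSpace.exp (t • K) v) (NormedSpace.exp (t • K) w)) 0 t := by
    intro t
    have h1 : HasDerivAt (fun t : ℝ => C (NormedSpace.exp (t • K) v))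
        (C (K (NormedSpace.exp (t • K) v))) t := C.hasFDerivAt.comp_hasDerivAt t (hd v t)
    exact (h1.clm_apply (hd w t)).congr_deriv (h _ _)
  have hconst := is_const_of_deriv_eq_zero (fun t => (hk t).differentiableAt)
    (fun t => (hk t).deriv) 1 0
  simp only [one_smul, zero_smul, NormedSpace.exp_zero] at hconst
  exact hconst

lemma hasDerivAt_expConj_apply (J A C : E →L[ℝ] E) (v : E) :
    HasDerivAt (fun t : ℝ => expConj J (t • A + (0 : ℝ) • C) v) (A (J v) - J (A v)) 0 ∧
      HasDerivAt (fun t : ℝ => expConj J ((0 : ℝ) • C + t • A) v) (A (J v) - J (A v)) 0 := by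
  have h1 := (hasDerivAt_expConj J A).clm_apply (hasDerivAt_const 0 v)
  simp only [map_zero, add_zero, zero_smul, zero_add] at h1 ⊢
  exact ⟨h1, h1⟩

lemma sp_comb (B : LinearMap.BilinForm ℝ E) {A C : E →L[ℝ] E}
    (hA : ∀ v w, B (A v) w + B v (A w) = 0) (hC : ∀ v w, B (C v) w + B v (C w) = 0) (r s : ℝ)
    (v w : E) : B ((r • A + s • C) v) w + B v ((r • A + s • C) w) = 0 := by
  have h : ∀ x, (r • A + s • C) x = r • A x + s • C x := fun _ => rfl
  rw [h, h]
  simp only [map_add, map_smul, LinearMap.add_apply, LinearMap.smul_apply, smul_eq_mul]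
  linear_combination r * hA v w + s * hC v w

lemma expConj_compat [FiniteDimensional ℝ E] (B : LinearMap.BilinForm ℝ E) {J K : E →L[ℝ] E}
    (hJ : ∀ v w, B (J v) (J w) = B v w) (hK : ∀ v w, B (K v) w + B v (K w) = 0) (v w : E) :
    B (expConj J K v) (expConj J K w) = B v w := by
  have hK' : ∀ v w, B ((-K) v) w + B v ((-K) w) = 0 := fun v w => by
    have h := hK v w
    simp only [neg_apply, map_neg, LinearMap.neg_apply]
    linarith
  exact (bilin_exp B hK _ _).trans ((hJ _ _).trans (bilin_exp B hK' v w))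

lemma expConj_pos [FiniteDimensional ℝ E] (B : LinearMap.BilinForm ℝ E) {J K : E →L[ℝ] E}
    (hJ : ∀ v, v ≠ 0 → 0 < B v (J v)) (hK : ∀ v w, B (K v) w + B v (K w) = 0) (v : E) (hv : v ≠ 0) :
    0 < B v (expConj J K v) := by
  have h6 : NormedSpace.exp K (NormedSpace.exp (-K) v) = v :=
    congrArg (fun T : E →L[ℝ] E => T v) (exp_mul_exp_neg K)
  have hw0 : NormedSpace.exp (-K) v ≠ 0 := by
    intro h0
    rw [h0, map_zero] at h6
    exact hv h6.symm
  have h8 := bilin_exp B hK (NormedSpace.exp (-K) v) (J (NormedSpace.exp (-K) v))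
  rw [h6] at h8
  exact lt_of_lt_of_eq (hJ _ hw0) h8.symm

lemma expConj_conj {E' : Type*} [NormedAddCommGroup E'] [NormedSpace ℝ E'] [CompleteSpace E']
    (e : E ≃L[ℝ] E') (J K : E →L[ℝ] E) : expConj ((e : E →L[ℝ] E') ∘L J ∘L (e.symm : E' →L[ℝ] E))
      ((e : E →L[ℝ] E') ∘L K ∘L (e.symm : E' →L[ℝ] E))
      = (e : E →L[ℝ] E') ∘L expConj J K ∘L (e.symm : E' →L[ℝ] E) := by
  let _ : NormedAlgebra ℚ (E →L[ℝ] E) := NormedAlgebra.restrictScalars ℚ ℝ _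
  let _ : NormedAlgebra ℚ (E' →L[ℝ] E') := NormedAlgebra.restrictScalars ℚ ℝ _
  have hc : Continuous fun T : E →L[ℝ] E => (e : E →L[ℝ] E') ∘L T ∘L (e.symm : E' →L[ℝ] E) := by
    fun_prop
  let F : (E →L[ℝ] E) →+* (E' →L[ℝ] E') :=
    { toFun := fun T => (e : E →L[ℝ] E') ∘L T ∘L (e.symm : E' →L[ℝ] E)
      map_one' := by ext; simp
      map_mul' := fun S T => by ext; simp
      map_zero' := by ext; simp
      map_add' := fun S T => by ext; simp }
  have h1 : ∀ T : E →L[ℝ] E, F (NormedSpace.exp T) = NormedSpace.exp (F T) :=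
    NormedSpace.map_exp F hc
  have h2 : F (expConj J K) = expConj (F J) (F K) := by
    simp only [expConj, map_mul, h1, map_neg]
  exact h2.symm

end Exponential

lemma readE_expConj (hy : y ∈ dom n o) (J K : EndField n M) :
    readE o (fun x => expConj (E := Model n) (J x) (K x)) y
      = expConj (readE o J y) (readE o K y) := by
  obtain ⟨e, he⟩ := isInvertible_dchart (n := n) hy
  have h1 : dchartInv n o y = e.symm := by
    rw [dchartInv, ← he, ContinuousLinearMap.inverse_equiv]
  simp only [readE, h1, ← he]
  exact (expConj_conj (E := Model n) e (J y) (K y)).symm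

/-- Infinitesimal symplectic fields of endomorphisms. -/
structure SpField (Ω : SymplecticForm n M) (K : EndField n M) : Prop where
  sp : ∀ x v w, Ω x (K x v) w + Ω x v (K x w) = 0
  smooth : ∀ (o : M) (y : M), y ∈ dom n o → ∀ u : ℝ²,
    ContDiffAt ℝ ∞ (flat o fun w : ℝ² × M => readE o K w.2) (u, chart n o y)

lemma contDiffAt_expSurface (j : CompatACS Ω) {A B : EndField n M} (hA : SpField Ω A)
    (hB : SpField Ω B) (hy : y ∈ dom n o) (u : ℝ²) :
    ContDiffAt ℝ ∞ (flat o fun w : ℝ² × M =>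
      readE o (fun x => expConj (E := Model n) (j x) (w.1.1 • A x + w.1.2 • B x)) w.2)
      (u, chart n o y) := by
  have h1 := contDiffAt_expConj ((SmoothSurface.const j).hatJ hy u)
    (((contDiffAt_fst.comp (u, chart n o y) contDiffAt_fst).smul (hA.smooth o y hy u)).add
      ((contDiffAt_snd.comp (u, chart n o y) contDiffAt_fst).smul (hB.smooth o y hy u)))
  refine h1.congr_of_eventuallyEq ?_
  refine eventually_chart hy (dom_mem_nhds hy) fun u' x _ hx => ?_
  have e1 := flat_chart hx (fun w : ℝ² × M => readE o A w.2) u'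
  have e2 := flat_chart hx (fun w : ℝ² × M => readE o B w.2) u'
  change _ = expConj (hatJ o (fun _ : ℝ² => j) (u', chart n o x))
    (u'.1 • flat o (fun w : ℝ² × M => readE o A w.2) (u', chart n o x)
      + u'.2 • flat o (fun w : ℝ² × M => readE o B w.2) (u', chart n o x))
  rw [flat_chart hx, hatJ_apply hx, e1, e2]
  refine (readE_expConj hx _ _).trans (congrArg _ ?_)
  refine ContinuousLinearMap.ext fun v => ?_
  have h2 : ∀ (r : ℝ) (w : Tan n x), dchart n o x (r • w) = r • dchart n o x w :=
    fun r w => map_smul _ r w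
  change dchart n o x (u'.1 • A x _ + u'.2 • B x _) = _
  rw [map_add, h2, h2]
  rfl

lemma smoothFamVF_of_readE {p : ℝ² → EndField n M}
    (hp : ∀ (y : M) (u : ℝ²),
      ContDiffAt ℝ ∞ (flat y fun w : ℝ² × M => readE y (p w.1) w.2) (u, chart n y y))
    {X : VF n M} (hX : SmoothVF X) : SmoothFamVF (fun u y => p u y (X y)) := by
  rintro ⟨u, y⟩
  have hy := self_mem_dom (n := n) y
  refine (vf_contMDiffAt_iff (X := fun u y => p u y (X y)) hy).2 ?_
  rw [contMDiffAt_iff_flat hy]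
  refine ((hp y u).clm_apply (hX.hatV hy u)).congr_of_eventuallyEq ?_
  refine eventually_chart hy (dom_mem_nhds hy) fun u' x _ hx => ?_
  rw [flat_chart hx]
  change _ = flat y (fun w : ℝ² × M => readE y (p w.1) w.2) (u', chart n y x)
    (hatV y (fun _ => X) (u', chart n y x))
  rw [flat_chart hx, hatV_apply hx]
  exact (readE_readV hx _ _).symm

/-- A two-parameter family of almost complex structures with given velocities. -/
def expSurface (j : CompatACS Ω) {A B : EndField n M} (hA : SpField Ω A) (hB : SpField Ω B)
    (u : ℝ²) : CompatACS Ω where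
  toFun x := expConj (E := Model n) (j x) (u.1 • A x + u.2 • B x)
  sq x v := by
    have h := expConj_mul_self (E := Model n) (J := j x)
      (ContinuousLinearMap.ext fun v => j.sq x v) (u.1 • A x + u.2 • B x)
    exact congrArg (fun T : Model n →L[ℝ] Model n => T v) h
  compat x := expConj_compat (E := Model n) (Ω x) (j.compat x)
    (sp_comb (E := Model n) (Ω x) (hA.sp x) (hB.sp x) u.1 u.2)
  pos x := expConj_pos (E := Model n) (Ω x) (j.pos x)
    (sp_comb (E := Model n) (Ω x) (hA.sp x) (hB.sp x) u.1 u.2)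
  smooth X hX := by
    have h1 := smoothFamVF_of_readE (p := fun u x =>
      expConj (E := Model n) (j x) (u.1 • A x + u.2 • B x))
      (fun y u => contDiffAt_expSurface j hA hB (self_mem_dom y) u) hX
    intro y
    exact ContMDiffAt.comp y (h1 (u, y)) (contMDiffAt_const.prodMk contMDiffAt_id)

lemma isSurfaceAt_expSurface (j : CompatACS Ω) {A B η μ : EndField n M} (hA : SpField Ω A)
    (hB : SpField Ω B) (hη : ∀ x v, A x (j x v) - j x (A x v) = η x v)
    (hμ : ∀ x v, B x (j x v) - j x (B x v) = μ x v) :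
    IsSurfaceAt (expSurface j hA hB) j η μ where
  smooth X hX := smoothFamVF_of_readE (p := fun u x =>
      expConj (E := Model n) (j x) (u.1 • A x + u.2 • B x))
      (fun y u => contDiffAt_expSurface j hA hB (self_mem_dom y) u) hX
  base := by
    have : (expSurface j hA hB (0, 0)).toFun = j.toFun := by
      funext x
      change expConj (E := Model n) (j x) ((0 : ℝ) • A x + (0 : ℝ) • B x) = j x
      refine Eq.trans (congrArg _ ?_) (expConj_zero (E := Model n) (j x))
      exact (congrArg₂ (· + ·) (zero_smul ℝ (A x)) (zero_smul ℝ (B x))).trans (add_zero 0)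
    cases j
    simp only [expSurface] at this ⊢
    congr
  fst x v := by
    rw [← hη]
    exact (hasDerivAt_expConj_apply (E := Model n) (j x) (A x) (B x) v).1
  snd x v := by
    rw [← hμ]
    exact (hasDerivAt_expConj_apply (E := Model n) (j x) (B x) (A x) v).2

section InfAction

variable {f : M → ℝ} {j : CompatACS Ω} {η : EndField n M}

lemma IsInfAction.anticomm (hf : Smooth[n] f) (h : IsInfAction Ω f j η) (x : M) (v : Tan n x) :
    η x (j x v) = -j x (η x v) := by
  have hx := self_mem_dom (n := n) x
  have h1 := lieEnd_anticomm (c := (0 : ℝ²)) (X := hatV x fun _ => hamVF Ω f)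
    ((SmoothSurface.const j).hatJ hx (0, 0)) (eventually_hatJ_mul_self hx (fun _ => j) (0, 0))
  rw [← h.readE_eq hf hx, hatJ_apply hx] at h1
  have h2 := congrArg (fun T : Model n →L[ℝ] Model n => dchartInv n x x (T (dchart n x x v))) h1
  change dchartInv n x x (dchart n x x (η x (dchartInv n x x (dchart n x x (j x
    (dchartInv n x x (dchart n x x v))))))) = dchartInv n x x (-(dchart n x x (j x
    (dchartInv n x x (dchart n x x (η x (dchartInv n x x (dchart n x x v)))))))) at h2
  rw [map_neg] at h2
  rw [dchartInv_dchart hx, dchartInv_dchart hx, dchartInv_dchart hx, dchartInv_dchart hx,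
    dchartInv_dchart hx] at h2
  exact h2

lemma IsInfAction.form_symm (hf : Smooth[n] f) (h : IsInfAction Ω f j η) (x : M) (v w : Tan n x) :
    Ω x (η x v) (j x w) + Ω x (j x v) (η x w) = 0 := by
  have hx := self_mem_dom (n := n) x
  set z : ℝ² × Model n := ((0, 0), chart n x x) with hz
  set X := hatV x (fun _ : ℝ² => hamVF Ω f) with hX
  set J := hatJ x (fun _ : ℝ² => j) with hJ
  set a := dchart n x x v with ha
  set b := dchart n x x w with hb
  have hJs := (SmoothSurface.const j).hatJ hx (0, 0)
  have hBs := contDiffAt_hatB (Ω := Ω) hx (0, 0)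
  have hinv : (fun w => hatB Ω x w (J w a) (J w b)) =ᶠ[𝓝 z] fun w => hatOm Ω x w a b :=
    eventually_chart hx (dom_mem_nhds hx) fun u' y _ hy => by
      beta_reduce
      rw [hatB_apply, hJ, hatJ_apply hy, hatOm_apply hy, hatOm_apply hy]
      simp only [readE, ContinuousLinearMap.comp_apply]
      rw [dchartInv_dchart hy, dchartInv_dchart hy, j.compat]
  have h1 := (along_congr (c := 0) (X := X) hinv).trans (along_hatOm_hamVF hf hx (0, 0) a b)
  have hd : along 0 X (fun w => hatB Ω x w (J w a) (J w b)) z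
      = along 0 X (fun w => hatOm Ω x w (J z a) (J z b)) z
        + hatOm Ω x z (along 0 X J z a) (J z b) + hatOm Ω x z (J z a) (along 0 X J z b) := by
    have e1 := (toDiffAt hBs).hasFDerivAt
    have e2 := (toDiffAt hJs).hasFDerivAt
    have e3 := (e1.clm_apply (e2.clm_apply (hasFDerivAt_const a z))).clm_apply
      (e2.clm_apply (hasFDerivAt_const b z))
    have e4 := (e1.clm_apply (hasFDerivAt_const (J z a) z)).clm_apply (hasFDerivAt_const (J z b) z)
    have e5 : (fun w => hatOm Ω x w (J z a) (J z b)) = fun w => hatB Ω x w (J z a) (J z b) := rfl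
    rw [along, e3.fderiv, e5, along, e4.fderiv]
    simp only [along, ← hatB_apply, ← hJ, ← hz]
    simp
    ring
  rw [hd, along_hatOm_hamVF hf hx (0, 0)] at h1
  have h2 := h.readE_eq hf hx (0, 0)
  simp only [← hX, ← hJ, ← hz] at h1 h2
  set G := vert X z with hG
  have h3 : ∀ c, along 0 X J z c = readE x η x c + G (J z c) - J z (G c) := fun c => by
    rw [h2, lieEnd]
    change _ = along 0 X J z c - G (J z c) + J z (G c) + G (J z c) - J z (G c)
    abel
  have hcompat : ∀ c d, hatOm Ω x z (J z c) (J z d) = hatOm Ω x z c d := fun c d => by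
    rw [hJ, hz, hatJ_apply hx, hatOm_apply hx, hatOm_apply hx]
    simp only [readE, ContinuousLinearMap.comp_apply]
    rw [dchartInv_dchart hx, dchartInv_dchart hx, j.compat]
  rw [h3, h3] at h1
  simp only [← hatB_apply, map_add, map_sub, add_apply, sub_apply] at h1
  simp only [hatB_apply] at h1
  have c1 := hcompat (G a) b
  have c2 := hcompat a (G b)
  have h4 : hatOm Ω x z (readE x η x a) (J z b) + hatOm Ω x z (J z a) (readE x η x b) = 0 := by
    linarith
  rw [hJ, hz, hatJ_apply hx, hatOm_apply hx, hatOm_apply hx] at h4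
  simp only [readE, ContinuousLinearMap.comp_apply] at h4
  rw [ha, hb, dchartInv_dchart hx, dchartInv_dchart hx, dchartInv_dchart hx, dchartInv_dchart hx,
    dchartInv_dchart hx, dchartInv_dchart hx] at h4
  exact h4

lemma IsInfAction.spField (hf : Smooth[n] f)
    (h : IsInfAction Ω f j η) : SpField Ω (fun x => (1 / 2 : ℝ) • (j x ∘L η x)) where
  sp x v w := by
    have h1 := h.form_symm hf x v w
    have h2 : Ω x (j x (η x v)) w = -Ω x (η x v) (j x w) := by
      rw [← j.compat x (η x v) (j x w), j.sq, map_neg, neg_neg]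
    have h3 : Ω x v (j x (η x w)) = -Ω x (j x v) (η x w) := by
      rw [← j.compat x v (j x (η x w)), j.sq, map_neg]
    change Ω x ((1 / 2 : ℝ) • j x (η x v)) w + Ω x v ((1 / 2 : ℝ) • j x (η x w)) = 0
    simp only [map_smul, LinearMap.smul_apply, smul_eq_mul]
    rw [h2, h3]
    linear_combination -(1 / 2 : ℝ) * h1
  smooth o y hy u := by
    have h1 : ContDiffAt ℝ ∞ (fun w => (1 / 2 : ℝ) • (hatJ o (fun _ : ℝ² => j) w
        * lieEnd 0 (hatV o fun _ => hamVF Ω f) (hatJ o fun _ : ℝ² => j) w))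
        (u, chart n o y) :=
      (contDiffAt_const (c := (1 / 2 : ℝ))).smul (((SmoothSurface.const j).hatJ hy u).clm_comp
        (contDiffAt_lieEnd (c := (0 : ℝ²)) ((smoothVF_hamVF hf).hatV hy u) ((SmoothSurface.const j).hatJ hy u)))
    refine h1.congr_of_eventuallyEq ?_
    refine eventually_chart hy (dom_mem_nhds hy) fun u' x _ hx => ?_
    rw [flat_chart hx]
    beta_reduce
    rw [← h.readE_eq hf hx, hatJ_apply hx]
    refine ContinuousLinearMap.ext fun v => ?_
    simp only [readE]
    change dchart n o x ((1 / 2 : ℝ) • j x (η x (dchartInv n o x v)))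
      = (1 / 2 : ℝ) • dchart n o x (j x (dchartInv n o x (dchart n o x (η x (dchartInv n o x v)))))
    rw [dchartInv_dchart hx]
    exact map_smul _ _ _

lemma exists_isSurfaceAt {g : M → ℝ} {μ : EndField n M} (hf : Smooth[n] f) (hg : Smooth[n] g)
    (hη : IsInfAction Ω f j η) (hμ : IsInfAction Ω g j μ) :
    ∃ p : ℝ² → CompatACS Ω, IsSurfaceAt p j η μ := by
  have key : ∀ {f : M → ℝ} {η : EndField n M}, Smooth[n] f →
      IsInfAction Ω f j η → ∀ x v, ((1 / 2 : ℝ) • (j x ∘L η x)) (j x v)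
        - j x (((1 / 2 : ℝ) • (j x ∘L η x)) v) = η x v := by
    intro f η hf hη x v
    change (1 / 2 : ℝ) • j x (η x (j x v)) - j x ((1 / 2 : ℝ) • j x (η x v)) = η x v
    have e : j x ((1 / 2 : ℝ) • j x (η x v)) = (1 / 2 : ℝ) • j x (j x (η x v)) := map_smul _ _ _
    rw [e, hη.anticomm hf, map_neg, j.sq, neg_neg, smul_neg, sub_neg_eq_add, ← add_smul]
    norm_num
  exact ⟨_, isSurfaceAt_expSurface j (hη.spField hf) (hμ.spField hg) (key hf hη) (key hg hμ)⟩

end InfAction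

variable {f : M → ℝ}

section Velocity

variable {Ω : SymplecticForm n M} {q : ℝ² → CompatACS Ω} {j : CompatACS Ω} {η μ : EndField n M}

lemma along_hatJ_eq (hq : SmoothSurface q) {c u : ℝ²}
    (h : ∀ x v, HasDerivAt (F := Model n) (fun t : ℝ => q (u + t • c) x v) (η x v) 0)
    (hy : y ∈ dom n o) :
    along c (fun _ => 0) (hatJ o q) (u, chart n o y) = readE o η y := by
  have h1 := along_flat_param hy c ((contMDiffAt_iff_flat
    (f := fun w : ℝ² × M => readE o (q w.1).toFun w.2) hy).2 (hq.hatJ hy u))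
  refine ContinuousLinearMap.ext fun v => ?_
  have h2 := h1.clm_apply (hasDerivAt_const 0 v)
  rw [map_zero, add_zero] at h2
  refine h2.unique ?_
  exact ((dchart n o y : Model n →L[ℝ] Model n).hasFDerivAt).comp_hasDerivAt (0 : ℝ)
    (h y (dchartInv n o y v))

lemma IsSurfaceAt.along_fst (h : IsSurfaceAt q j η μ) (hy : y ∈ dom n o) :
    lieEnd (1, 0) (fun _ => 0) (hatJ o q) ((0, 0), chart n o y) = readE o η y := by
  rw [← along_hatJ_eq (c := (1, 0)) (u := (0, 0)) h.smooth (fun x v => ?_) hy]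
  · simp [lieEnd, vert]
  · have h1 := h.fst x v
    simp only [Prod.smul_mk, Prod.mk_add_mk, smul_eq_mul, mul_one, mul_zero, zero_add, add_zero]
    exact h1

lemma IsSurfaceAt.along_snd (h : IsSurfaceAt q j η μ) (hy : y ∈ dom n o) :
    lieEnd (0, 1) (fun _ => 0) (hatJ o q) ((0, 0), chart n o y) = readE o μ y := by
  rw [← along_hatJ_eq (c := (0, 1)) (u := (0, 0)) h.smooth (fun x v => ?_) hy]
  · simp [lieEnd, vert]
  · have h1 := h.snd x v
    simp only [Prod.smul_mk, Prod.mk_add_mk, smul_eq_mul, mul_one, mul_zero, zero_add, add_zero]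
    exact h1

lemma lieEnd_hatJ_slice (hq : SmoothSurface q) (hy : y ∈ dom n o) (u : ℝ²)
    (X : ℝ² × Model n → Model n) :
    lieEnd 0 X (hatJ o q) (u, chart n o y) = lieEnd 0 X (hatJ o fun _ => q u) (u, chart n o y) := by
  have h1 : ∀ᶠ w in 𝓝 (u, chart n o y), w.1 = u → hatJ o q w = hatJ o (fun _ => q u) w :=
    eventually_chart hy (dom_mem_nhds hy) fun u' x _ hx h => by
      rw [hatJ_apply hx, hatJ_apply hx, show u' = u from h]
  have h2 : ∀ᶠ z in 𝓝 (chart n o y), hatJ o q (u, z) = hatJ o (fun _ => q u) (u, z) := by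
    have hc : ContinuousAt (fun z : Model n => (u, z)) (chart n o y) := by fun_prop
    filter_upwards [hc.eventually h1] with z hz
    exact hz rfl
  rw [lieEnd, lieEnd, along_zero_congr_slice (z := (u, chart n o y)) (X' := X)
    (toDiffAt (hq.hatJ hy u))
    (toDiffAt ((SmoothSurface.const (q u)).hatJ hy u)) rfl h2, h2.self_of_nhds]

lemma IsInfAction.lieEnd_eq (hf : Smooth[n] f) (h : IsInfAction Ω f j η) (hq : SmoothSurface q)
    (hj : q (0, 0) = j) (hy : y ∈ dom n o) :
    lieEnd 0 (hatV o fun _ => hamVF Ω f) (hatJ o q) ((0, 0), chart n o y) = readE o η y := by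
  rw [lieEnd_hatJ_slice hq hy, hj, h.readE_eq hf hy]

end Velocity

lemma conn_mul {o : M} {c : ℝ²} {a h : ℝ² × Model n → ℂ} {w : ℝ² × Model n}
    (ha : DifferentiableAt ℝ a w) (hh : DifferentiableAt ℝ h w) :
    conn D k o p c X (fun w => a w * h w) w = along c X a w * h w + a w * conn D k o p c X h w := by
  simp only [conn]
  rw [along_mul ha hh]
  ring

lemma conn_add {o : M} {c : ℝ²} {a h : ℝ² × Model n → ℂ} {w : ℝ² × Model n}
    (ha : DifferentiableAt ℝ a w) (hh : DifferentiableAt ℝ h w) :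
    conn D k o p c X (fun w => a w + h w) w = conn D k o p c X a w + conn D k o p c X h w := by
  simp only [conn]
  rw [along_add ha hh]
  ring

lemma conn_const_mul {o : M} {c : ℝ²} (a : ℂ) {h : ℝ² × Model n → ℂ} {w : ℝ² × Model n}
    (hh : DifferentiableAt ℝ h w) :
    conn D k o p c X (fun w => a * h w) w = a * conn D k o p c X h w := by
  rw [conn_mul D (a := fun _ => a) (differentiableAt_const a) hh]
  simp [along]

lemma smoothSecSurface_Op (hp : SmoothSurface p) (hf : Smooth[n] f) (hΦ : SmoothSecSurface n Φ) :
    SmoothSecSurface n (fun u => D.Op k f (p u) (Φ u)) := by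
  have h1 := smoothSecSurface_nabla D hp (smoothVF_hamVF (Ω := D.form) hf).fam hΦ
  refine smoothSecSurface_iff.2 fun u o y hy => ?_
  have h2 : ContMDiffAt (𝓘(ℝ, ℝ²).prod 𝓜[n]) 𝓘(ℝ, ℂ) ∞
      (fun w : ℝ² × M => (f w.2 : ℂ)) (u, y) :=
    contMDiffAt_const_param u ((Complex.ofRealCLM.contMDiff.comp hf) y)
  have h3 := ContMDiffAt.add (ContMDiffAt.cmul h2 (smoothSecSurface_iff.1 hΦ u o y hy))
    (ContMDiffAt.cmul (contMDiffAt_const (c := 1 / (I * (k : ℂ))))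
      (smoothSecSurface_iff.1 h1 u o y hy))
  refine h3.congr_of_eventuallyEq (.of_forall fun w => ?_)
  simp [QuantData.Op]

lemma hatS_Op (hp : SmoothSurface p) (hf : Smooth[n] f) (hΦ : SmoothSecSurface n Φ) (u : ℝ²)
    (hy : y ∈ dom n o) (hbL : y ∈ base L o) (hb : y ∈ base δ o) :
    hatS o (fun u => D.Op k f (p u) (Φ u)) (u, chart n o y)
      = hatG o (fun x => (f x : ℂ)) (u, chart n o y) * hatS o Φ (u, chart n o y)
        + (1 / (I * (k : ℂ))) * conn D k o p 0 (hatV o fun _ => hamVF D.form f)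
          (hatS o Φ) (u, chart n o y) := by
  rw [← nabla_eq D hp (smoothVF_hamVF hf).fam hΦ u hy hbL hb, hatS_apply hy, hatS_apply hy,
    hatS_apply hy, hatG_apply hy]
  simp [QuantData.Op]

lemma contMDiff_ofReal (hf : Smooth[n] f) : ContMDiff 𝓜[n] 𝓘(ℝ, ℂ) ∞ (fun x => (f x : ℂ)) :=
  Complex.ofRealCLM.contMDiff.comp hf

lemma dirDeriv_ofReal (hf : Smooth[n] f) (X : VF n M) (y : M) :
    dirDeriv X (fun x => (f x : ℂ)) y = (dirDeriv X f y : ℝ) :=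
  dirDeriv_clm Complex.ofRealCLM (mdiff_of_smooth (hf y))

/-- `Op_k(f)` applied twice, in a chart. -/
lemma hatS_Op_Op (hp : SmoothSurface p) {f g : M → ℝ}
    (hf : Smooth[n] f) (hg : Smooth[n] g)
    (hΦ : SmoothSecSurface n Φ) (u : ℝ²) (hy : y ∈ dom n o) (hbL : y ∈ base L o) (hb : y ∈ base δ o) :
    let κ := 1 / (I * (k : ℂ))
    let z := (u, chart n o y)
    let cf := conn D k o p 0 (hatV o fun _ => hamVF D.form f)
    let cg := conn D k o p 0 (hatV o fun _ => hamVF D.form g)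
    hatS o (fun u => D.Op k f (p u) (D.Op k g (p u) (Φ u))) z
      = f y * (g y * hatS o Φ z + κ * cg (hatS o Φ) z)
        + κ * ((poisson D.form f g y : ℝ) * hatS o Φ z + g y * cf (hatS o Φ) z
          + κ * cf (cg (hatS o Φ)) z) := by
  intro κ z cf cg
  have hh := hΦ.hatS hy hbL hb u
  have hG := contDiffAt_hatG hy (contMDiff_ofReal hg y) u
  have hXf := (smoothVF_hamVF (Ω := D.form) hf).hatV hy u
  have hXg := (smoothVF_hamVF (Ω := D.form) hg).hatV hy u
  have hc := contDiffAt_conn D (k := k) hp hy hbL hb u 0 hXg hh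
  rw [hatS_Op D hp hf (smoothSecSurface_Op D hp hg hΦ) u hy hbL hb]
  have h1 : hatS o (fun u => D.Op k g (p u) (Φ u)) =ᶠ[𝓝 (u, chart n o y)] fun w =>
      hatG o (fun x => (g x : ℂ)) w * hatS o Φ w + κ * cg (hatS o Φ) w :=
    eventually_good hy hbL hb fun u' x a b c => hatS_Op D hp hg hΦ u' a b c
  rw [conn_congr D h1, h1.self_of_nhds, conn_add D
    (toDiffAt (hG.mul hh)) (toDiffAt (contDiffAt_const.mul hc)),
    conn_mul D (toDiffAt hG) (toDiffAt hh),
    conn_const_mul D _ (toDiffAt hc),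
    along_hatG hy (fun _ => hamVF D.form f) (contMDiff_ofReal hg y), dirDeriv_ofReal hg,
    ← poisson_eq, hatG_apply hy, hatG_apply hy]
  beta_reduce
  rw [hatG_apply hy]

lemma poisson_swap {Ω : SymplecticForm n M} (f g : M → ℝ) (x : M) :
    poisson Ω g f x = -poisson Ω f g x :=
  SymplecticForm.neg_swap _ _ _ _

lemma conn_congr_field {o : M} {c : ℝ²} {X X' : ℝ² × Model n → Model n} {h : ℝ² × Model n → ℂ}
    {w : ℝ² × Model n} (e : X =ᶠ[𝓝 w] X') : conn D k o p c X h w = conn D k o p c X' h w := by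
  have e1 : X w = X' w := e.self_of_nhds
  have e2 : vert X w = vert X' w := by simp only [vert, e.fderiv_eq]
  have e3 : IsConnCoeff c X (hatJ o p) (hatForm D o p) w
      = IsConnCoeff c X' (hatJ o p) (hatForm D o p) w := by
    funext θ
    simp only [IsConnCoeff, connEnd, lieEnd, along, e1, e2]
  simp only [conn, theta, along, e1, e3]

lemma hatS_Op_commutator (hk : 0 < k) (hp : SmoothSurface p) {f g : M → ℝ} (hf : Smooth[n] f)
    (hg : Smooth[n] g) (hΦ : SmoothSecSurface n Φ) (u : ℝ²) (hy : y ∈ dom n o) (hbL : y ∈ base L o)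
    (hb : y ∈ base δ o) : (I * (k : ℂ)) * ((I * (k : ℂ)) *
      (hatS o (fun u => D.Op k f (p u) (D.Op k g (p u) (Φ u))) (u, chart n o y)
      - hatS o (fun u => D.Op k g (p u) (D.Op k f (p u) (Φ u))) (u, chart n o y))
      - hatS o (fun u => D.Op k (poisson D.form f g) (p u) (Φ u)) (u, chart n o y))
      = thetaCurv D o p 0 (hatV o fun _ => hamVF D.form f) 0
          (hatV o fun _ => hamVF D.form g) (u, chart n o y)
        * hatS o Φ (u, chart n o y) := by
  have hk0 : (k : ℂ) ≠ 0 := by exact_mod_cast hk.ne'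
  have hh := hΦ.hatS hy hbL hb u
  have hXf := (smoothVF_hamVF (Ω := D.form) hf).hatV hy u
  have hXg := (smoothVF_hamVF (Ω := D.form) hg).hatV hy u
  have h1 := conn_commutator D (k := k) hp hy hbL hb u 0 0 hXf hXg hh
  rw [hatOm_hatV hy] at h1
  have h2 : flatBracket 0 (hatV o fun _ : ℝ² => hamVF D.form f) 0
      (hatV o fun _ => hamVF D.form g) =ᶠ[𝓝 (u, chart n o y)]
      hatV o (fun _ => hamVF D.form (poisson D.form f g)) :=
    eventually_chart hy (dom_mem_nhds hy) fun u' x _ hx => by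
      rw [← hatV_bracket (smoothVF_hamVF hf) (smoothVF_hamVF hg) hx, bracket_hamVF hf hg]
  rw [conn_congr_field D h2] at h1
  have h3 := hatS_Op_Op D hp hf hg hΦ u hy hbL hb
  have h4 := hatS_Op_Op D hp hg hf hΦ u hy hbL hb
  have h5 := hatS_Op D hp (contMDiff_poisson (Ω := D.form) hf hg) hΦ u hy hbL hb
  rw [hatG_apply hy] at h5
  simp only [poisson_swap f g] at h4
  have e : (poisson D.form f g y : ℝ) = D.form y (hamVF D.form f y) (hamVF D.form g y) := rfl
  rw [← e] at h1
  rw [h3, h4, h5]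
  push_cast
  field_simp
  linear_combination h1

lemma Op_mem_PSpace (hf : Smooth[n] f) (j : CompatACS D.form) {s : Sec L δ k}
    (hs : s ∈ PSpace n L δ k) : D.Op k f j s ∈ PSpace n L δ k :=
  (smoothSecSurface_Op D (SmoothSurface.const j) hf (SmoothSecSurface.const hs)).mem_PSpace 0

/-- The operator `Op_k(f)` as a linear map. -/
def opLin (k : ℕ) (hf : Smooth[n] f)
    (j : CompatACS D.form) : PSpace n L δ k →ₗ[ℂ] PSpace n L δ k where
  toFun s := ⟨D.Op k f j s, Op_mem_PSpace D hf j s.2⟩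
  map_add' s t := by
    refine Subtype.ext (funext fun x => ?_)
    simp only [QuantData.Op, Submodule.coe_add, Pi.add_apply]
    rw [D.nabla_add j _ s.2 t.2, smul_add, smul_add]
    abel
  map_smul' c s := by
    refine Subtype.ext (funext fun x => ?_)
    simp only [QuantData.Op, Submodule.coe_smul, Pi.smul_apply, RingHom.id_apply]
    rw [D.nabla_smul j _ c s.2, smul_add, smul_comm c, smul_comm c]

lemma opLin_coe (hf : Smooth[n] f) (j : CompatACS D.form) (s : PSpace n L δ k) :
    (opLin D k hf j s : Sec L δ k) = D.Op k f j s :=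
  rfl

/-- The commutator of the covariant derivatives in terms of that of the operators `Op_k`. -/
lemma covP_commutator (hk : 0 < k) {f g : M → ℝ} (hf : Smooth[n] f) (hg : Smooth[n] g)
    {j : CompatACS D.form} {η μ : EndField n M} (hη : IsInfAction D.form f j η)
    (hμ : IsInfAction D.form g j μ) (hp : IsSurfaceAt p j η μ) (hΦ : SmoothSecSurface n Φ) :
    D.covP₁ k p (D.covP₂ k p Φ) (0, 0) - D.covP₂ k p (D.covP₁ k p Φ) (0, 0)
      = (I * (k : ℂ)) • ((I * (k : ℂ)) •
        (D.Op k f j (D.Op k g j (Φ (0, 0))) - D.Op k g j (D.Op k f j (Φ (0, 0))))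
        - D.Op k (poisson D.form f g) j (Φ (0, 0))) := by
  funext y
  have hy := self_mem_dom (n := n) y
  have hbL := self_mem_base (V := L) y
  have hb := self_mem_base (V := δ) y
  refine pCoord_injective hbL hb ?_
  have hs := hp.smooth
  have hh := hΦ.hatS hy hbL hb (0, 0)
  have h1 := hatS_Op_commutator D hk hs hf hg hΦ (0, 0) hy hbL hb
  have hc0 : ∀ u : ℝ², ContDiffAt ℝ ∞ (fun _ : ℝ² × Model n => (0 : Model n))
    (u, chart n y y) := fun u => contDiffAt_const
  have h2 := conn_commutator D (k := k) hs hy hbL hb (0, 0) (1, 0) (0, 1) (hc0 _) (hc0 _) hh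
  have e1 := covP₁_eq D hs (smoothSecSurface_covP₂ D hs hΦ) (0, 0) hy hbL hb
  have e2 := covP₂_eq D hs (smoothSecSurface_covP₁ D hs hΦ) (0, 0) hy hbL hb
  rw [conn_congr D (eventually_good (u := (0, 0)) hy hbL hb fun u' x a b c =>
    covP₂_eq D hs hΦ u' a b c)] at e1
  rw [conn_congr D (eventually_good (u := (0, 0)) hy hbL hb fun u' x a b c =>
    covP₁_eq D hs hΦ u' a b c)] at e2
  rw [← e1, ← e2] at h2
  have e3 : flatBracket ((1, 0) : ℝ²) (fun _ => (0 : Model n)) ((0, 1) : ℝ²)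
      (fun _ => (0 : Model n)) = fun _ => 0 := by
    funext w
    simp [flatBracket, along]
  have e4 : hatOm D.form y (((0, 0) : ℝ²), chart n y y) 0 0 = 0 := by
    rw [hatOm_apply hy]
    simp
  have e5 : conn D k y p 0 (fun _ => 0) (hatS y Φ) ((0, 0), chart n y y) = 0 := by
    simp only [conn, along, theta_zero D hs hy hb (0, 0) Filter.EventuallyEq.rfl, map_zero]
    rw [mul_zero, add_zero, zero_mul, add_zero]
    exact map_zero _
  have e6 := thetaCurv_congr D hs hy hb (0, 0) (1, 0) (0, 1) 0 0 (hc0 _) (hc0 _)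
    ((smoothVF_hamVF (Ω := D.form) hf).hatV hy (0, 0))
    ((smoothVF_hamVF (Ω := D.form) hg).hatV hy (0, 0))
    ((hp.along_fst hy).trans (hη.lieEnd_eq hf hs hp.base hy).symm)
    ((hp.along_snd hy).trans (hμ.lieEnd_eq hg hs hp.base hy).symm)
  rw [e3, e5, e4, e6] at h2
  simp only [Complex.ofReal_zero, mul_zero, sub_zero, zero_add] at h2
  rw [← h1] at h2
  simp only [hatS_apply hy, hp.base] at h2
  simp only [Pi.sub_apply, Pi.smul_apply, map_sub, map_smul, smul_eq_mul]
  exact h2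

lemma exists_isCurvatureP (hk : 0 < k) {f g : M → ℝ} (hf : Smooth[n] f) (hg : Smooth[n] g)
    {j : CompatACS D.form} {η μ : EndField n M} (hη : IsInfAction D.form f j η)
    (hμ : IsInfAction D.form g j μ) :
    ∃ R : PSpace n L δ k →ₗ[ℂ] PSpace n L δ k, D.IsCurvatureP k j η μ R ∧
      ∀ s : PSpace n L δ k,
        (I * (k : ℂ)) • (D.Op k f j (D.Op k g j s) - D.Op k g j (D.Op k f j s))
          = D.Op k (poisson D.form f g) j s
            + (I * (k : ℂ))⁻¹ • (R s : Sec L δ k) := by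
  have hk0 : I * (k : ℂ) ≠ 0 :=
    mul_ne_zero Complex.I_ne_zero (by exact_mod_cast hk.ne')
  obtain ⟨R, key⟩ : ∃ R : PSpace n L δ k →ₗ[ℂ] PSpace n L δ k, ∀ s : PSpace n L δ k,
      (R s : Sec L δ k) = (I * (k : ℂ)) • ((I * (k : ℂ)) •
        (D.Op k f j (D.Op k g j s) - D.Op k g j (D.Op k f j s))
        - D.Op k (poisson D.form f g) j s) := by
    refine ⟨(I * (k : ℂ)) • ((I * (k : ℂ)) •
      (opLin D k hf j ∘ₗ opLin D k hg j + (-1 : ℂ) • opLin D k hg j ∘ₗ opLin D k hf j)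
        + (-1 : ℂ) • opLin D k (contMDiff_poisson (Ω := D.form) hf hg) j), fun s => ?_⟩
    simp only [LinearMap.smul_apply, LinearMap.add_apply, LinearMap.comp_apply,
      Submodule.coe_smul, Submodule.coe_add, opLin_coe, neg_one_smul, sub_eq_add_neg]
  refine ⟨R, ⟨exists_isSurfaceAt hf hg hη hμ, fun p hp Φ hΦ s hs => ?_⟩, fun s => ?_⟩
  · rw [covP_commutator D hk hf hg hη hμ hp hΦ, hs, key]
  · rw [key, inv_smul_smul₀ hk0]
    abel

section Hermitian

variable {n : ℕ} {V : Type*} [AddCommGroup V] [Module ℝ V] {B : LinearMap.BilinForm ℝ V}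
  {J : V →ₗ[ℝ] V}

/-- A complex structure on `V`, compatible with the alternating form `B` and positive. -/
structure IsKaehler (B : LinearMap.BilinForm ℝ V) (J : V →ₗ[ℝ] V) : Prop where
  alt : ∀ v w, B v w = -B w v
  sq : ∀ v, J (J v) = -v
  compat : ∀ v w, B (J v) (J w) = B v w
  pos : ∀ v, v ≠ 0 → 0 < B v (J v)

/-- The complex vector space defined by a complex structure. -/
@[reducible] def cplxModule (hJ : ∀ v, J (J v) = -v) : Module ℂ V where
  smul c v := c.re • v + c.im • J v
  one_smul v := by
    change (1 : ℂ).re • v + (1 : ℂ).im • J v = v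
    simp
  mul_smul c d v := by
    change (c * d).re • v + (c * d).im • J v
      = c.re • (d.re • v + d.im • J v) + c.im • J (d.re • v + d.im • J v)
    simp only [Complex.mul_re, Complex.mul_im, map_add, map_smul, hJ]
    module
  smul_zero c := by
    change c.re • (0 : V) + c.im • J 0 = 0
    simp
  smul_add c v w := by
    change c.re • (v + w) + c.im • J (v + w) = (c.re • v + c.im • J v) + (c.re • w + c.im • J w)
    rw [map_add]
    module
  add_smul c d v := by
    change (c + d).re • v + (c + d).im • J v = (c.re • v + c.im • J v) + (d.re • v + d.im • J v)
    rw [Complex.add_re, Complex.add_im]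
    module
  zero_smul v := by
    change (0 : ℂ).re • v + (0 : ℂ).im • J v = 0
    simp

/-- The Hermitian form of `B` and `J`. -/
def hermForm (B : LinearMap.BilinForm ℝ V) (J : V →ₗ[ℝ] V) (v w : V) : ℂ :=
  (B v (J w) : ℂ) + I * (B v w : ℂ)

lemma IsKaehler.apply_J (h : IsKaehler B J) (v w : V) : B (J v) w = -B v (J w) := by
  rw [← h.compat v (J w), h.sq, map_neg, neg_neg]

lemma IsKaehler.symm (h : IsKaehler B J) (v w : V) : B v (J w) = B w (J v) := by
  rw [h.alt v, h.apply_J, neg_neg]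

/-- The inner product of `B` and `J`. -/
@[reducible] def IsKaehler.core (h : IsKaehler B J) :
    letI := cplxModule h.sq
    InnerProductSpace.Core ℂ V :=
  letI := cplxModule h.sq
  { inner := hermForm B J
    conj_inner_symm := fun v w => by
      simp only [hermForm, map_add, map_mul, Complex.conj_ofReal, Complex.conj_I]
      rw [h.symm w v, h.alt w v]
      push_cast
      ring
    re_inner_nonneg := fun v => by
      change 0 ≤ (hermForm B J v v).re
      have h0 : B v v = 0 := by
        have := h.alt v v
        linarith
      rcases eq_or_ne v 0 with rfl | hv
      · simp [hermForm]
      · simpa [hermForm, h0] using (h.pos v hv).le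
    add_left := fun u v w => by
      simp only [hermForm, map_add, LinearMap.add_apply]
      push_cast
      ring
    smul_left := fun v w c => by
      change hermForm B J (c.re • v + c.im • J v) w = conj c * hermForm B J v w
      simp only [hermForm, map_add, map_smul, LinearMap.add_apply, LinearMap.smul_apply, smul_eq_mul]
      rw [h.compat, h.apply_J]
      apply Complex.ext <;> simp
    definite := fun v hv => by
      by_contra h0
      have h1 : (hermForm B J v v).re = 0 := by
        rw [show hermForm B J v v = 0 from hv, Complex.zero_re]
      have h2 := h.pos v h0
      simp [hermForm] at h1
      linarith }

lemma finrank_cplxModule [FiniteDimensional ℝ V] (hdim : Module.finrank ℝ V = 2 * n)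
    (hJ : ∀ v, J (J v) = -v) :
    letI := cplxModule hJ
    FiniteDimensional ℂ V ∧ Module.finrank ℂ V = n := by
  letI := cplxModule hJ
  haveI : IsScalarTower ℝ ℂ V := ⟨fun r c v => by
    change (r • c).re • v + (r • c).im • J v = r • (c.re • v + c.im • J v)
    simp only [Complex.smul_re, Complex.smul_im, smul_eq_mul]
    module⟩
  have h1 := Module.finrank_mul_finrank ℝ ℂ V
  rw [Complex.finrank_real_complex] at h1
  exact ⟨FiniteDimensional.right ℝ ℂ V, by omega⟩

lemma typeN0_map_smul {α : V [⋀^Fin n]→ₗ[ℝ] ℂ} (hα : α ∈ typeN0 n J) (v : Fin n → V) (i : Fin n)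
    (c : ℂ) (x : V) : α (update v i (c.re • x + c.im • J x)) = c • α (update v i x) := by
  rw [α.map_update_add, α.map_update_smul, α.map_update_smul, typeN0_update hα]
  rw [Complex.real_smul, Complex.real_smul, smul_eq_mul]
  nth_rewrite 3 [← Complex.re_add_im c]
  ring

/-- The form `α`, of type `(n, 0)`, as a complex form. -/
def cplxForm (hJ : ∀ v, J (J v) = -v) {α : V [⋀^Fin n]→ₗ[ℝ] ℂ} (hα : α ∈ typeN0 n J) :
    letI := cplxModule hJ
    V [⋀^Fin n]→ₗ[ℂ] ℂ :=
  letI := cplxModule hJ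
  { toFun := α
    map_update_add' := fun v i x y => by
      have := α.map_update_add v i x y
      convert this
    map_update_smul' := fun v i c x => by
      convert typeN0_map_smul hα v i c x
      rfl
    map_eq_zero_of_eq' := α.map_eq_zero_of_eq' }

/-- A frame which is unitary for `B` and `J`. -/
def IsUnitary (B : LinearMap.BilinForm ℝ V) (J : V →ₗ[ℝ] V) (v : Fin n → V) : Prop :=
  ∀ a b, B (v a) (v b) = 0 ∧ B (v a) (J (v b)) = if a = b then 1 else 0

lemma IsUnitary.hermForm {v : Fin n → V} (hv : IsUnitary B J v) (a b : Fin n) :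
    hermForm B J (v a) (v b) = if a = b then 1 else 0 := by
  rw [GeomQuant.hermForm, (hv a b).1, (hv a b).2]
  split_ifs <;> simp

lemma exists_isUnitary [FiniteDimensional ℝ V] (hdim : Module.finrank ℝ V = 2 * n)
    (h : IsKaehler B J) : ∃ v : Fin n → V, IsUnitary B J v := by
  letI := cplxModule h.sq
  letI := h.core
  letI : NormedAddCommGroup V := h.core.toNormedAddCommGroup
  letI : InnerProductSpace ℂ V := InnerProductSpace.ofCore h.core.toCore
  obtain ⟨hfd, hd⟩ := finrank_cplxModule hdim h.sq
  let b := (stdOrthonormalBasis ℂ V).reindex (finCongr hd)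
  refine ⟨b, fun a c => ?_⟩
  have h1 : hermForm B J (b a) (b c) = if a = c then 1 else 0 :=
    orthonormal_iff_ite.1 b.orthonormal a c
  have h2 := congrArg Complex.re h1
  have h3 := congrArg Complex.im h1
  split_ifs at h2 h3 ⊢ <;> simp [hermForm] at h2 h3 <;> exact ⟨h3, h2⟩

lemma norm_sq_typeN0 [FiniteDimensional ℝ V] (hdim : Module.finrank ℝ V = 2 * n) (h : IsKaehler B J)
    {α : V [⋀^Fin n]→ₗ[ℝ] ℂ} (hα : α ∈ typeN0 n J) {v : Fin n → V} (hv : IsUnitary B J v)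
    (w : Fin n → V) :
    α w * conj (α w) = α v * conj (α v) * (Matrix.of fun a b => hermForm B J (w a) (w b)).det := by
  letI := cplxModule h.sq
  letI := h.core
  letI : NormedAddCommGroup V := h.core.toNormedAddCommGroup
  letI : InnerProductSpace ℂ V := InnerProductSpace.ofCore h.core.toCore
  obtain ⟨hfd, hd⟩ := finrank_cplxModule hdim h.sq
  have ho : Orthonormal ℂ v := orthonormal_iff_ite.2 hv.hermForm
  let b : OrthonormalBasis (Fin n) ℂ V := OrthonormalBasis.mk ho (by
    rw [LinearIndependent.span_eq_top_of_card_eq_finrank' ho.linearIndependent (by simp [hd])])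
  have hb : ⇑b = v := OrthonormalBasis.coe_mk _ _
  have h1 := (cplxForm h.sq hα).eq_smul_basis_det b.toBasis
  have h2 : α w = α v * (b.toBasis.toMatrix w).det := by
    have := congrArg (fun T : V [⋀^Fin n]→ₗ[ℂ] ℂ => T w) h1
    simp only [AlternatingMap.smul_apply, Module.Basis.det_apply, OrthonormalBasis.coe_toBasis,
      hb] at this
    exact this
  have h3 : (Matrix.of fun a c => hermForm B J (w a) (w c))
      = (b.toBasis.toMatrix w).conjTranspose * b.toBasis.toMatrix w := by
    ext a c
    have h4 : hermForm B J (w a) (w c) = ∑ i, inner ℂ (w a) (b i) * inner ℂ (b i) (w c) :=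
      (b.sum_inner_mul_inner (w a) (w c)).symm
    simp only [Matrix.of_apply, h4, Matrix.mul_apply, Matrix.conjTranspose_apply,
      Module.Basis.toMatrix_apply, OrthonormalBasis.coe_toBasis_repr_apply,
      OrthonormalBasis.repr_apply_apply]
    refine Finset.sum_congr rfl fun i _ => ?_
    rw [← inner_conj_symm (w a) (b i)]
    rfl
  rw [h2, h3, Matrix.det_mul, Matrix.det_conjTranspose, map_mul]
  simp only [Complex.star_def]
  ring

lemma typeN0_update_unitary [FiniteDimensional ℝ V] (hdim : Module.finrank ℝ V = 2 * n)
    (h : IsKaehler B J) {α : V [⋀^Fin n]→ₗ[ℝ] ℂ} (hα : α ∈ typeN0 n J) {v : Fin n → V}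
    (hv : IsUnitary B J v) (a : Fin n) (x : V) : α (update v a x) = hermForm B J (v a) x * α v := by
  letI := cplxModule h.sq
  letI := h.core
  letI : NormedAddCommGroup V := h.core.toNormedAddCommGroup
  letI : InnerProductSpace ℂ V := InnerProductSpace.ofCore h.core.toCore
  obtain ⟨hfd, hd⟩ := finrank_cplxModule hdim h.sq
  have ho : Orthonormal ℂ v := orthonormal_iff_ite.2 hv.hermForm
  let b : OrthonormalBasis (Fin n) ℂ V := OrthonormalBasis.mk ho (by
    rw [LinearIndependent.span_eq_top_of_card_eq_finrank' ho.linearIndependent (by simp [hd])])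
  have hb : ⇑b = v := OrthonormalBasis.coe_mk _ _
  have h1 : x = ∑ i, inner ℂ (v i) x • v i := by
    have := b.sum_repr' x
    rw [hb] at this
    exact this.symm
  let T := cplxForm h.sq hα
  have h2 : T (update v a x) = ∑ i, inner ℂ (v i) x * T (update v a (v i)) := by
    conv_lhs => rw [h1]
    rw [T.map_update_sum]
    exact Finset.sum_congr rfl fun i _ => T.map_update_smul v a _ _
  rw [Finset.sum_eq_single a (fun i _ hi => by rw [T.map_update_self v hi.symm, mul_zero])
    (by simp), Function.update_eq_self] at h2
  exact h2

end Hermitian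

lemma hasDerivAt_det_one {𝕜 : Type*} [NontriviallyNormedField 𝕜] [NormedAlgebra ℝ 𝕜] {m : ℕ}
    {A : ℝ → Matrix (Fin m) (Fin m) 𝕜} {A' : Matrix (Fin m) (Fin m) 𝕜} {t : ℝ} (h1 : A t = 1)
    (hA : ∀ a b, HasDerivAt (fun s => A s a b) (A' a b) t) :
    HasDerivAt (fun s => (A s).det) A'.trace t := by
  have h2 : ∀ σ : Equiv.Perm (Fin m), HasDerivAt
      (fun s => ((Equiv.Perm.sign σ : ℤ) : 𝕜) * ∏ i, A s (σ i) i) (((Equiv.Perm.sign σ : ℤ) : 𝕜) *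
        ∑ i, (∏ k ∈ Finset.univ.erase i, A t (σ k) k) • A' (σ i) i) t := fun σ =>
    (HasDerivAt.fun_finsetProd fun i _ => hA (σ i) i).const_mul _
  have h3 := HasDerivAt.fun_sum fun σ (_ : σ ∈ Finset.univ) => h2 σ
  refine (h3.congr_of_eventuallyEq (.of_forall fun s =>
    Matrix.det_apply' (A s))).congr_deriv ?_
  rw [Finset.sum_eq_single 1 (fun σ _ hσ => ?_) (by simp)]
  · simp [h1, Matrix.trace]
  · rw [Finset.sum_eq_zero, mul_zero]
    intro i _
    obtain ⟨k, hk, hki⟩ : ∃ k, σ k ≠ k ∧ k ≠ i := by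
      by_contra! h
      refine hσ (Equiv.ext fun k => ?_)
      by_contra hk
      have e1 := h k hk
      have e2 := h (σ k) (fun e => hk (σ.injective e))
      exact hk (e2.trans e1.symm)
    rw [Finset.prod_eq_zero (Finset.mem_erase.2 ⟨hki, Finset.mem_univ k⟩), zero_smul]
    rw [h1, Matrix.one_apply_ne hk]

section Norm

variable {n : ℕ} {F E : Type*} [NormedAddCommGroup F] [NormedSpace ℝ F] [NormedAddCommGroup E]
  [NormedSpace ℝ E] [FiniteDimensional ℝ E] {B : F × E → E →L[ℝ] E →L[ℝ] ℝ}
  {J : F × E → E →L[ℝ] E} {α : F × E → E [⋀^Fin n]→ₗ[ℝ] ℂ} {N : F × E → ℝ} {z : F × E}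
  {B₀ : LinearMap.BilinForm ℝ E}

/-- The Gram matrix of a frame. -/
def gram (B : E →L[ℝ] E →L[ℝ] ℝ) (J : E →L[ℝ] E) (e : Fin n → E) : Matrix (Fin n) (Fin n) ℂ :=
  Matrix.of fun a b => (B (e a) (J (e b)) : ℂ) + I * (B (e a) (e b) : ℂ)

lemma contDiffAt_gram (hB : ContDiffAt ℝ ∞ B z) (hJ : ContDiffAt ℝ ∞ J z) (e : Fin n → E)
    (a b : Fin n) : ContDiffAt ℝ ∞ (fun w => gram (B w) (J w) e a b) z := by
  have h1 := (hB.clm_apply (contDiffAt_const (c := e a))).clm_apply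
    (hJ.clm_apply (contDiffAt_const (c := e b)))
  have h2 := (hB.clm_apply (contDiffAt_const (c := e a))).clm_apply (contDiffAt_const (c := e b))
  exact (Complex.ofRealCLM.contDiff.contDiffAt.comp z h1).add
    (contDiffAt_const.mul (Complex.ofRealCLM.contDiff.contDiffAt.comp z h2))

lemma gram_unitary (h0 : ∀ a b, B₀ a b = B z a b) {v : Fin n → E}
    (hv : IsUnitary B₀ (J z).toLinearMap v) : gram (B z) (J z) v = 1 := by
  ext a b
  have := hv.hermForm a b
  rw [hermForm, h0, h0] at this
  rw [Matrix.one_apply]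
  exact this

lemma contDiffAt_gram_det (hB : ContDiffAt ℝ ∞ B z) (hJ : ContDiffAt ℝ ∞ J z) (e : Fin n → E) :
    ContDiffAt ℝ ∞ (fun w => (gram (B w) (J w) e).det) z := by
  have h1 : ContDiffAt ℝ ∞ (fun w => ∑ σ : Equiv.Perm (Fin n), ((Equiv.Perm.sign σ : ℤ) : ℂ)
      * ∏ i, gram (B w) (J w) e (σ i) i) z :=
    ContDiffAt.sum fun σ _ => contDiffAt_const.mul
      (contDiffAt_prod fun i _ => contDiffAt_gram hB hJ e (σ i) i)
  exact h1.congr_of_eventuallyEq (.of_forall fun w => Matrix.det_apply' _)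

/-- `N` is the norm of the forms `α`. -/
structure IsFormNorm (B : F × E → E →L[ℝ] E →L[ℝ] ℝ) (J : F × E → E →L[ℝ] E)
    (α : F × E → E [⋀^Fin n]→ₗ[ℝ] ℂ) (N : F × E → ℝ) (z : F × E)
    (B₀ : LinearMap.BilinForm ℝ E) : Prop where
  hB : ContDiffAt ℝ ∞ B z
  hJ : ContDiffAt ℝ ∞ J z
  hα : SmoothFormAt α z
  hN : ∀ᶠ w in 𝓝 z, 0 < N w ∧ ∀ e : Fin n → E,
    (N w : ℂ) ^ 2 * (gram (B w) (J w) e).det = α w e * conj (α w e)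
  hdim : Module.finrank ℝ E = 2 * n
  h0 : ∀ a b, B₀ a b = B z a b
  hK : IsKaehler B₀ (J z).toLinearMap

lemma IsFormNorm.contDiffAt (h : IsFormNorm B J α N z B₀) : ContDiffAt ℝ ∞ N z := by
  obtain ⟨hB, hJ, hα, hN, hdim, h0, hK⟩ := h
  obtain ⟨v, hv⟩ := exists_isUnitary (n := n) hdim hK
  have h1 := gram_unitary h0 hv
  have h2 := contDiffAt_gram_det hB hJ v
  have h3 : (gram (B z) (J z) v).det ≠ 0 := by rw [h1, Matrix.det_one]; exact one_ne_zero
  have h4 : ContDiffAt ℝ ∞ (fun w => (α w v * conj (α w v) / (gram (B w) (J w) v).det).re) z :=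
    Complex.reCLM.contDiff.contDiffAt.comp z (((hα v).mul
      (Complex.conjCLE.contDiff.contDiffAt.comp z (hα v))).mul (h2.inv h3))
  have h5 : ∀ᶠ w in 𝓝 z, (α w v * conj (α w v) / (gram (B w) (J w) v).det).re = N w ^ 2 := by
    filter_upwards [hN, h2.continuousAt.eventually_ne h3] with w hw hne
    rw [← hw.2 v, mul_div_cancel_right₀ _ hne]
    norm_cast
  refine (h4.sqrt ?_).congr_of_eventuallyEq ?_
  · rw [h5.self_of_nhds]
    exact (pow_pos hN.self_of_nhds.1 2).ne'
  · filter_upwards [hN, h5] with w hw h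
    rw [h, Real.sqrt_sq hw.1.le]

lemma hasDerivAt_along {G : Type*} [NormedAddCommGroup G] [NormedSpace ℝ G] {f : F × E → G}
    (hf : ContDiffAt ℝ ∞ f z) {c : F} {X : F × E → E} :
    HasDerivAt (fun t : ℝ => f (z + t • (c, X z))) (along c X f z) 0 := by
  have hl : HasDerivAt (fun t : ℝ => z + t • (c, X z)) (c, X z) 0 := by
    simpa using ((hasDerivAt_id (0 : ℝ)).smul_const (c, X z)).const_add z
  have h := (toDiffAt hf).hasFDerivAt
  rw [show z = z + (0 : ℝ) • (c, X z) by simp] at h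
  have h2 := h.comp_hasDerivAt (0 : ℝ) hl
  rw [zero_smul, add_zero] at h2
  exact h2

lemma IsFormNorm.along_eq (h : IsFormNorm B J α N z B₀) {c : F} {X : F × E → E} {θ : ℂ}
    (hsq : ∀ᶠ w in 𝓝 z, J w * J w = -1) (hαJ : α z ∈ typeN0 n (J z).toLinearMap)
    (hX : ∀ a b, along c X (fun w => B w a b) z = -B z (vert X z a) b - B z a (vert X z b))
    (hθ : IsConnCoeff c X J α z θ) : along c X N z = 2 * θ.re * N z := by
  have hNs := h.contDiffAt
  obtain ⟨hB, hJ, hα, hN, hdim, h0, hK⟩ := h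
  obtain ⟨v, hv⟩ := exists_isUnitary (n := n) hdim hK
  have h1 := gram_unitary h0 hv
  set A := connEnd c X J z with hA
  set ξ : F × E := (c, X z) with hξ
  have key : ∀ {G : Type} [NormedAddCommGroup G] [NormedSpace ℝ G] {f : F × E → G},
      ContDiffAt ℝ ∞ f z → HasDerivAt (fun t : ℝ => f (z + t • ξ)) (along c X f z) 0 :=
    fun hf => hasDerivAt_along hf
  have hJ' := connEnd_comm (c := c) (X := X) hJ hsq
  have hL := lieEnd_anticomm (c := c) (X := X) hJ hsq
  have hG : ∀ a, vert X z a = -A a - (1 / 2 : ℝ) • J z (lieEnd c X J z a) := fun a => by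
    rw [hA, connEnd]
    simp
  have htr : ∀ a, along c X (fun w => gram (B w) (J w) v a a) z
      = ((2 * (hermForm B₀ (J z).toLinearMap (v a) (A (v a))).re : ℝ) : ℂ) := by
    intro a
    have d0 := hasDerivAt_const (0 : ℝ) (v a)
    have d1 := (hasDerivAt_along hB (c := c) (X := X)).clm_apply d0
    have d2 := d1.clm_apply ((hasDerivAt_along hJ (c := c) (X := X)).clm_apply d0)
    have d3 := d2.ofReal_comp.add ((d1.clm_apply d0).ofReal_comp.const_mul I)
    refine (key (contDiffAt_gram hB hJ v a a)).unique (d3.congr_deriv ?_)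
    have e1 : ∀ x y, along c X B z x y = along c X (fun w => B w x y) z := fun x y => by
      have d4 := (hasDerivAt_along hB (c := c) (X := X)).clm_apply (hasDerivAt_const (0 : ℝ) x)
      have d5 := d4.clm_apply (hasDerivAt_const (0 : ℝ) y)
      simp only [zero_smul, add_zero, map_zero] at d5
      exact d5.unique (key ((hB.clm_apply contDiffAt_const).clm_apply contDiffAt_const))
    have halt : ∀ x y, B z x y = -B z y x := fun x y => by rw [← h0, ← h0, hK.alt]
    have hap : ∀ x y, B z (J z x) y = -B z x (J z y) := fun x y => by
      have := hK.apply_J x y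
      rwa [h0, h0] at this
    have eJ : along c X J z (v a) = J z (A (v a)) - A (J z (v a)) :=
      congrArg (fun T : E →L[ℝ] E => T (v a)) hJ'.symm
    have eL : J z (lieEnd c X J z (J z (v a))) = lieEnd c X J z (v a) := by
      have l1 := congrArg (fun T : E →L[ℝ] E => T (J z (v a))) hL
      have l2 : ∀ x, J z (J z x) = -x := hK.sq
      change lieEnd c X J z (J z (J z (v a))) = -(J z (lieEnd c X J z (J z (v a)))) at l1
      rw [l2, map_neg, neg_inj] at l1
      exact l1.symm
    have hre : (hermForm B₀ (J z).toLinearMap (v a) (A (v a))).re = B z (v a) (J z (A (v a))) := by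
      simp [hermForm, h0]
    rw [hre]
    simp only [zero_smul, add_zero, map_zero, e1, hX, hG, eJ]
    simp only [map_sub, map_neg, map_smul, sub_apply, neg_apply, smul_apply, smul_eq_mul, eL, hap]
    have f1 := halt (A (v a)) (J z (v a))
    have f2 := hap (v a) (A (v a))
    have f3 := halt (A (v a)) (v a)
    have f4 := halt (lieEnd c X J z (v a)) (J z (v a))
    have f5 := hap (v a) (lieEnd c X J z (v a))
    have f6 : B z (lieEnd c X J z (v a)) (J z (J z (v a)))
        = B z (v a) (lieEnd c X J z (v a)) := by
      have l2 : ∀ x, J z (J z x) = -x := hK.sq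
      rw [l2, map_neg, halt, neg_neg]
    rw [f6, f1, f2, f3, f4, f5]
    push_cast
    ring
  have hdet := hasDerivAt_det_one (A := fun t : ℝ => gram (B (z + t • ξ)) (J (z + t • ξ)) v)
    (A' := Matrix.of fun a b => along c X (fun w => gram (B w) (J w) v a b) z) (t := 0)
    (by simpa using h1) (fun a b => key (contDiffAt_gram hB hJ v a b))
  have hlhs := (((key hNs).ofReal_comp).pow 2).mul hdet
  have hα1 := key (hα v)
  have hrhs := hα1.mul ((Complex.conjCLE.hasFDerivAt).comp_hasDerivAt (0 : ℝ) hα1)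
  have hev : ∀ᶠ t : ℝ in 𝓝 0, (N (z + t • ξ) : ℂ) ^ 2
      * (gram (B (z + t • ξ)) (J (z + t • ξ)) v).det
      = α (z + t • ξ) v * conj (α (z + t • ξ) v) := by
    have hc : Filter.Tendsto (fun t : ℝ => z + t • ξ) (𝓝 0) (𝓝 z) := by
      have : Continuous fun t : ℝ => z + t • ξ := by fun_prop
      simpa using this.tendsto 0
    filter_upwards [hc.eventually hN] with t ht using ht.2 v
  have h2 := hlhs.unique (hrhs.congr_of_eventuallyEq hev)
  have h3 : along c X (fun w => α w v) z
      = 2 * θ * α z v + (∑ a, hermForm B₀ (J z).toLinearMap (v a) (A (v a))) * α z v := by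
    rw [hθ v, act, Finset.sum_mul]
    simp only [typeN0_update_unitary hdim hK hαJ hv, hA]
    ring
  have h4 : (Matrix.of fun a b => along c X (fun w => gram (B w) (J w) v a b) z).trace
      = ∑ a, hermForm B₀ (J z).toLinearMap (v a) (A (v a))
        + conj (∑ a, hermForm B₀ (J z).toLinearMap (v a) (A (v a))) := by
    rw [Matrix.trace, map_sum, ← Finset.sum_add_distrib]
    refine Finset.sum_congr rfl fun a _ => ?_
    rw [Complex.add_conj]
    exact htr a
  have h5 := hN.self_of_nhds.2 v
  rw [h1, Matrix.det_one, mul_one] at h5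
  set S := ∑ a, hermForm B₀ (J z).toLinearMap (v a) (A (v a)) with hS
  simp only [zero_smul, add_zero, h1, h4, Matrix.det_one, Function.comp, Pi.pow_apply, h3] at h2
  change _ = _ * conj (α z v) + α z v * conj ((2 * θ * α z v + S * α z v)) at h2
  simp only [map_add, map_mul, Complex.conj_ofNat] at h2
  have hne : (N z : ℂ) ≠ 0 := by exact_mod_cast hN.self_of_nhds.1.ne'
  have h6 : (N z : ℂ) * ((along c X N z : ℝ) : ℂ) = (N z : ℂ) * ((2 * θ.re * N z : ℝ) : ℂ) := by
    have h7 := Complex.add_conj θ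
    push_cast at h2 h7 ⊢
    linear_combination (1 / 2 : ℂ) * h2 - (1 / 2 : ℂ) * (2 * θ + 2 * conj θ + S + conj S) * h5
      + (N z : ℂ) ^ 2 * h7
  exact_mod_cast mul_left_cancel₀ hne h6

end Norm

variable {A B : ℝ² → Sec L δ k} {j : CompatACS D.form} {η μ : EndField n M}

lemma isKaehler (j : CompatACS Ω) (x : M) :
    IsKaehler (Ω x) (j x).toLinearMap where
  alt v w := Ω.neg_swap x v w
  sq := j.sq x
  compat := j.compat x
  pos := j.pos x

/-- The symplectic form at `y` in the chart at `o`. -/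
def chartForm (Ω : SymplecticForm n M) (o y : M) : LinearMap.BilinForm ℝ (Model n) :=
  (Ω y).compl₁₂ (dchartInv n o y).toLinearMap (dchartInv n o y).toLinearMap

lemma isKaehler_chart (j : CompatACS Ω) (hy : y ∈ dom n o) :
    IsKaehler (chartForm Ω o y) (readE o j.toFun y).toLinearMap := by
  have h := isKaehler j y
  have e : ∀ v, dchartInv n o y (readE o j.toFun y v) = j y (dchartInv n o y v) := fun v =>
    dchartInv_dchart hy _
  refine ⟨fun v w => h.alt _ _, fun v => ?_, fun v w => ?_, fun v hv => ?_⟩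
  · change dchart n o y (j y (dchartInv n o y (readE o j.toFun y v))) = -v
    rw [e, j.sq, map_neg, dchart_dchartInv hy]
  · change Ω y (dchartInv n o y (readE o j.toFun y v))
      (dchartInv n o y (readE o j.toFun y w)) = _
    rw [e, e, j.compat]
    rfl
  · change 0 < Ω y (dchartInv n o y v) (dchartInv n o y (readE o j.toFun y v))
    rw [e]
    refine j.pos y _ fun h0 => hv ?_
    rw [← dchart_dchartInv hy v, h0, map_zero]

/-- The norm of the forms `φ_{p u}(d ⊗ d)` in the chart at `o`. -/
def hatN (o : M) (p : ℝ² → CompatACS D.form) : ℝ² × Model n → ℝ :=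
  flat o fun w : ℝ² × M => normN0 D.form (p w.1) w.2 (frameForm D (p w.1) o w.2)

lemma hatN_apply (hy : y ∈ dom n o) (u : ℝ²) :
    hatN D o p (u, chart n o y) = normN0 D.form (p u) y (frameForm D (p u) o y) :=
  flat_chart hy _ u

lemma isUnitary_epsilon (j : CompatACS Ω) (x : M) :
    IsUnitary (Ω x) (j x).toLinearMap (Classical.epsilon (IsUnitaryFrame Ω j x)) :=
  Classical.epsilon_spec (exists_isUnitary (finrank_tan x) (isKaehler j x))

lemma hatN_spec (hy : y ∈ dom n o) (u : ℝ²) (e : Fin n → Model n) :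
    (hatN D o p (u, chart n o y) : ℂ) ^ 2
      * (gram (hatB D.form o (u, chart n o y)) (hatJ o p (u, chart n o y)) e).det
      = hatForm D o p (u, chart n o y) e * conj (hatForm D o p (u, chart n o y) e) := by
  have h1 := norm_sq_typeN0 (finrank_tan y) (isKaehler (p u) y)
    (phi_mem D (p u) y (lineFrame δ o y ⊗ₜ[ℂ] lineFrame δ o y)) (isUnitary_epsilon (p u) y)
    (fun a => dchartInv n o y (e a))
  have h2 : gram (hatB D.form o (u, chart n o y)) (hatJ o p (u, chart n o y)) e
      = Matrix.of fun a b => hermForm (D.form y) (p u y).toLinearMap (dchartInv n o y (e a))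
        (dchartInv n o y (e b)) := by
    ext a b
    simp only [gram, Matrix.of_apply, hatB_apply, hatOm_apply hy, hatJ_apply hy, hermForm, readE,
      ContinuousLinearMap.comp_apply]
    rw [dchartInv_dchart hy]
    rfl
  rw [h2, hatN_apply D hy, hatForm_apply D hy, normN0, ← Complex.ofReal_pow, ← Complex.normSq_eq_norm_sq,
    Complex.normSq_eq_conj_mul_self, mul_comm (conj _)]
  exact h1.symm

lemma hatN_pos (hy : y ∈ dom n o) (hb : y ∈ base δ o) (u : ℝ²) :
    0 < hatN D o p (u, chart n o y) := by
  refine lt_of_le_of_ne (by rw [hatN_apply D hy]; exact norm_nonneg _) fun h0 => ?_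
  obtain ⟨e, he⟩ := ne_zero_iff_exists.1 (hatForm_ne_zero D hy hb p u)
  have h1 := hatN_spec D (p := p) hy u e
  rw [← h0, Complex.ofReal_zero, zero_pow two_ne_zero, zero_mul] at h1
  rcases mul_eq_zero.1 h1.symm with h | h
  · exact he h
  · exact he ((map_eq_zero _).1 h)

lemma isFormNorm_hatN (hp : SmoothSurface p) (hy : y ∈ dom n o) (hb : y ∈ base δ o)
    (u : ℝ²) : IsFormNorm (hatB D.form o) (hatJ o p) (hatForm D o p) (hatN D o p)
      (u, chart n o y) (chartForm D.form o y) where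
  hB := contDiffAt_hatB hy u
  hJ := hp.hatJ hy u
  hα := smoothFormAt_hatForm D hp hy hb u
  hN := eventually_chart hy (Filter.inter_mem (dom_mem_nhds hy) (base_mem_nhds hb))
    fun u' x hx _ => ⟨hatN_pos D hx.1 hx.2 u', hatN_spec D hx.1 u'⟩
  hdim := by simp
  h0 a b := by
    rw [hatB_apply, hatOm_apply hy]
    rfl
  hK := by
    rw [hatJ_apply hy]
    exact isKaehler_chart (p u) hy

/-- The symplectic form is invariant under the flow of the field `(c, X)`. -/
def PreservesForm (Ω : SymplecticForm n M) (o : M) (c : ℝ²) (X : ℝ² × Model n → Model n)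
    (z : ℝ² × Model n) : Prop :=
  ∀ a b, along c X (fun w => hatB Ω o w a b) z
    = -hatB Ω o z (vert X z a) b - hatB Ω o z a (vert X z b)

lemma preservesForm_hamVF (hf : Smooth[n] f) (hy : y ∈ dom n o) (u : ℝ²) :
    PreservesForm Ω o 0 (hatV o fun _ => hamVF Ω f) (u, chart n o y) :=
  along_hatOm_hamVF hf hy u

lemma fderiv_flat_snd {G : Type*} [NormedAddCommGroup G] [NormedSpace ℝ G] {f : M → G}
    (hy : y ∈ dom n o) (hf : ContMDiffAt 𝓜[n] 𝓘(ℝ, G) ∞ f y) (u c : ℝ²) (X : ℝ² × Model n → Model n)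
    : along c X (hatG o f) (u, chart n o y)
      = dirDeriv (fun y => dchartInv n o y (X (u, chart n o y))) f y := by
  have h1 := (toDiffAt ((contMDiffAt_iff_chart hy).1 hf)).hasFDerivAt
  have h2 := h1.comp (u, chart n o y) (hasFDerivAt_snd (𝕜 := ℝ) (p := (u, chart n o y)))
  rw [dirDeriv_eq_fderiv hy _ (mdiff_of_smooth hf), readV, dchart_dchartInv hy, along]
  exact congrArg (fun T : ℝ² × Model n →L[ℝ] G => T (c, X (u, chart n o y))) h2.fderiv

lemma preservesForm_const (hy : y ∈ dom n o) (u c : ℝ²) :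
    PreservesForm Ω o c (fun _ => 0) (u, chart n o y) := by
  intro a b
  have h1 := (toDiffAt (contDiffAt_hatOm (Ω := Ω) hy u a b))
  have h2 : along c (fun _ => (0 : Model n)) (fun w => hatB Ω o w a b) (u, chart n o y) = 0 := by
    have h3 : HasDerivAt (fun t : ℝ => hatOm Ω o ((u, chart n o y)
        + t • ((c, 0) : ℝ² × Model n)) a b) _ 0 :=
      hasDerivAt_along (contDiffAt_hatOm (Ω := Ω) hy u a b) (c := c) (X := fun _ => 0)
    refine h3.unique ?_
    have h4 : (fun t : ℝ => hatOm Ω o ((u, chart n o y)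
        + t • ((c, 0) : ℝ² × Model n)) a b)
        = fun _ => hatOm Ω o (u, chart n o y) a b := by
      funext t
      have h5 : ((u, chart n o y) + t • ((c, 0) : ℝ² × Model n)).2 = chart n o y := by
        change chart n o y + t • (0 : Model n) = _
        rw [smul_zero, add_zero]
      exact congrArg (fun m => Ω (chartInv o m) (dchartInv n o (chartInv o m) a)
        (dchartInv n o (chartInv o m) b)) h5
    rw [h4]
    exact hasDerivAt_const (0 : ℝ) _
  rw [h2]
  simp [vert]

/-- The Hermitian metric of `L` on the frame at `o`, in the chart. -/
def frameHerm (o y : M) : ℂ := D.preq.herm y (lineFrame L o y) (lineFrame L o y)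

lemma contMDiffAt_frameHerm (hb : y ∈ base L o) : ContMDiffAt 𝓜[n] 𝓘(ℝ, ℂ) ∞ (frameHerm D o) y ∧
      ∀ X : VF n M, dirDeriv X (frameHerm D o) y
        = ((2 * (lam D.preq o y (X y)).re : ℝ) : ℂ) * frameHerm D o y := by
  obtain ⟨σ, hσ, hσe⟩ := exists_section_eq_lineFrame (n := n) hb
  have he : frameHerm D o =ᶠ[𝓝 y] fun x => D.preq.herm x (σ x) (σ x) := by
    filter_upwards [hσe] with x hx
    rw [frameHerm, hx]
  refine ⟨(D.preq.herm_smooth σ σ hσ hσ y).congr_of_eventuallyEq he, fun X => ?_⟩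
  have h5 : D.preq.cov σ y = D.preq.cov (lineFrame L o) y :=
    cov_congr D.preq (hσ y) (contMDiffAt_lineFrame hb) hσe
  have h6 : D.preq.cov σ y (X y) = lam D.preq o y (X y) • lineFrame L o y := by
    rw [h5, lam_apply, lineCoord_smul_lineFrame hb]
  have h7 : ∀ (c : ℂ) (v w : L y), D.preq.herm y v (c • w) = conj c * D.preq.herm y v w := by
    intro c v w
    rw [← D.preq.herm_symm, D.preq.herm_smul, map_mul, D.preq.herm_symm]
  rw [dirDeriv_congr he, D.preq.cov_herm σ σ hσ hσ X y, h6, hσe.self_of_nhds, D.preq.herm_smul, h7,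
    ← add_mul, Complex.add_conj]
  rfl

lemma hermP_eq (j : CompatACS D.form) (s t : Sec L δ k) (hbL : y ∈ base L o) (hb : y ∈ base δ o) :
    D.hermP k j s t y
      = pCoord L δ k o y (s y) * conj (pCoord L δ k o y (t y)) * frameHerm D o y ^ k
        * (normN0 D.form j y (frameForm D j o y) : ℂ) := by
  have h1 : frameHerm D y y = trans L o y y * conj (trans L o y y) * frameHerm D o y := by
    rw [frameHerm, ← trans_smul y hbL, D.preq.herm_smul, ← D.preq.herm_symm, D.preq.herm_smul,
      map_mul, D.preq.herm_symm, mul_assoc]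
    rfl
  have h2 : (normN0 D.form j y (frameForm D j y y) : ℂ) = trans δ o y y * conj (trans δ o y y)
      * (normN0 D.form j y (frameForm D j o y) : ℂ) := by
    rw [normN0, frameForm_trans D j y hb, AlternatingMap.smul_apply, smul_eq_mul, norm_mul, norm_mul,
      Complex.ofReal_mul, Complex.ofReal_mul, Complex.mul_conj, Complex.normSq_eq_norm_sq]
    push_cast
    rw [sq]
    rfl
  have h3 := lineTransition_mul (V := L) hbL (self_mem_base y)
  have h4 := lineTransition_mul (V := δ) hb (self_mem_base y)
  have h5 : ∀ s : Sec L δ k, pCoord L δ k y y (s y) = _ := fun s =>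
    pCoord_transition (x₁ := y) hbL hb (s y)
  have hL := congrArg (· ^ k) h3
  simp only [mul_pow, one_pow] at hL
  have hL' := congrArg conj hL
  have h4' := congrArg conj h4
  simp only [map_mul, map_pow, map_one] at hL' h4'
  change pCoord L δ k y y (s y) * conj (pCoord L δ k y y (t y)) * frameHerm D y y ^ k
    * (normN0 D.form j y (frameForm D j y y) : ℂ) = _
  rw [h5, h5, h1, h2]
  simp only [map_mul, map_pow, mul_pow]
  simp only [trans] at *
  set a := lineCoord L y y (lineFrame L o y) ^ k
  set a' := lineCoord L o y (lineFrame L y y) ^ k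
  set b := lineCoord δ y y (lineFrame δ o y)
  set b' := lineCoord δ o y (lineFrame δ y y)
  set A := conj (lineCoord L y y (lineFrame L o y)) ^ k
  set A' := conj (lineCoord L o y (lineFrame L y y)) ^ k
  linear_combination (pCoord L δ k o y (s y) * conj (pCoord L δ k o y (t y)) * frameHerm D o y ^ k
    * (normN0 D.form j y (frameForm D j o y) : ℂ)) * (hL * (A * A') * (b * b') * (conj b * conj b')
      + hL' * (b * b') * (conj b * conj b') + h4 * (conj b * conj b') + h4')

/-- The Hermitian product of sections with coordinates `h₁` and `h₂`, in the chart. -/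
def hatP (k : ℕ) (o : M) (p : ℝ² → CompatACS D.form) (h₁ h₂ : ℝ² × Model n → ℂ) (w : ℝ² × Model n) :
    ℂ :=
  h₁ w * conj (h₂ w) * hatG o (frameHerm D o) w ^ k * (hatN D o p w : ℂ)

lemma contDiffAt_hatP (hp : SmoothSurface p) (hy : y ∈ dom n o) (hbL : y ∈ base L o)
    (hb : y ∈ base δ o) (u : ℝ²) {h₁ h₂ : ℝ² × Model n → ℂ}
    (hh₁ : ContDiffAt ℝ ∞ h₁ (u, chart n o y)) (hh₂ : ContDiffAt ℝ ∞ h₂ (u, chart n o y)) :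
    ContDiffAt ℝ ∞ (hatP D k o p h₁ h₂) (u, chart n o y) :=
  ((hh₁.mul (Complex.conjCLE.contDiff.contDiffAt.comp _ hh₂)).mul
    ((contDiffAt_hatG hy (contMDiffAt_frameHerm D hbL).1 u).pow k)).mul
    (Complex.ofRealCLM.contDiff.contDiffAt.comp _ (isFormNorm_hatN D hp hy hb u).contDiffAt)

/-- The connection is compatible with the metric, in the directions preserving the symplectic
form. -/
lemma along_hatP (hp : SmoothSurface p) (hy : y ∈ dom n o) (hbL : y ∈ base L o) (hb : y ∈ base δ o)
    (u c : ℝ²) (hX : PreservesForm D.form o c X (u, chart n o y)) {h₁ h₂ : ℝ² × Model n → ℂ}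
    (hh₁ : ContDiffAt ℝ ∞ h₁ (u, chart n o y)) (hh₂ : ContDiffAt ℝ ∞ h₂ (u, chart n o y)) :
    along c X (hatP D k o p h₁ h₂) (u, chart n o y)
      = hatP D k o p (conn D k o p c X h₁) h₂ (u, chart n o y)
        + hatP D k o p h₁ (conn D k o p c X h₂) (u, chart n o y) := by
  have hH := contMDiffAt_frameHerm D hbL
  have hN := isFormNorm_hatN D hp hy hb u
  have hθ := theta_spec D hp hy hb u c X
  have e1 := hN.along_eq (c := c) (eventually_hatJ_mul_self hy p u) (hatForm_mem D hy p u) hX hθ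
  have e2 := (fderiv_flat_snd hy hH.1 u c X).trans (hH.2 _)
  have d0 := hasDerivAt_along (contDiffAt_hatP D (k := k) hp hy hbL hb u hh₁ hh₂) (c := c) (X := X)
  have d1 := hasDerivAt_along hh₁ (c := c) (X := X)
  have d2 := hasDerivAt_along hh₂ (c := c) (X := X)
  have d3 := hasDerivAt_along (contDiffAt_hatG hy hH.1 u) (c := c) (X := X)
  have d4 := hasDerivAt_along hN.contDiffAt (c := c) (X := X)
  set z : ℝ² × Model n := (u, chart n o y) with hz
  have d5 := ((d1.mul (Complex.conjCLE.toContinuousLinearMap.hasFDerivAt.comp_hasDerivAt (0 : ℝ) d2)).mul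
    (d3.pow k)).mul d4.ofReal_comp
  have d6 := d0.unique d5
  have e3 : lam D.preq o y (dchartInv n o y (X z)) = hatLam D.preq o z (X z) := by
    rw [hz, hatLam_apply D.preq hy]
    rfl
  rw [e3] at e2
  rw [d6, e1, e2]
  have ec : ∀ w, Complex.conjCLE.toContinuousLinearMap w = conj w := fun _ => rfl
  have ek : ∀ H : ℂ, (k : ℂ) * H ^ (k - 1) * H = k * H ^ k := fun H => by
    rcases k with _ | m
    · simp
    · rw [Nat.add_sub_cancel, pow_succ, mul_assoc]
  simp only [Pi.mul_apply, Pi.pow_apply, zero_smul, add_zero, Function.comp, hatP, conn, ec,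
    ← hatG_apply hy (frameHerm D o) u, ← hz, Complex.ofReal_mul (2 * _) (hatN D o p z),
    ← Complex.add_conj, map_add, map_mul, map_natCast]
  linear_combination (h₁ z * conj (h₂ z) * (hatLam D.preq o z (X z)
    + conj (hatLam D.preq o z (X z))) * (hatN D o p z : ℂ)) * ek (hatG o (frameHerm D o) z)

/-- The Hermitian product of families of sections. -/
def hermFam (k : ℕ) (p : ℝ² → CompatACS D.form) (A B : ℝ² → Sec L δ k) (z : ℝ² × M) : ℂ :=
  D.hermP k (p z.1) (A z.1) (B z.1) z.2

lemma hatP_hatS (hy : y ∈ dom n o) (hbL : y ∈ base L o) (hb : y ∈ base δ o) (u : ℝ²) :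
    hatP D k o p (hatS o A) (hatS o B) (u, chart n o y) = hermFam D k p A B (u, y) := by
  rw [hatP, hermFam, hermP_eq D (p u) (A u) (B u) hbL hb, hatS_apply hy, hatS_apply hy,
    hatG_apply hy, hatN_apply D hy]

lemma flat_hermFam (hy : y ∈ dom n o) (hbL : y ∈ base L o) (hb : y ∈ base δ o) (u : ℝ²) :
    flat o (hermFam D k p A B) =ᶠ[𝓝 (u, chart n o y)] hatP D k o p (hatS o A) (hatS o B) :=
  eventually_good hy hbL hb fun u' x a b c => by rw [hatP_hatS D a b c, flat_chart a]

lemma contMDiff_hermFam (hp : SmoothSurface p) (hA : SmoothSecSurface n A)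
    (hB : SmoothSecSurface n B) : ContMDiff (𝓘(ℝ, ℝ²).prod 𝓜[n]) 𝓘(ℝ, ℂ) ∞ (hermFam D k p A B) := by
  rintro ⟨u, y⟩
  have hy := self_mem_dom (n := n) y
  exact (contMDiffAt_iff_flat hy).2 ((contDiffAt_hatP D hp hy (self_mem_base y) (self_mem_base y) u
    (hA.hatS hy (self_mem_base y) (self_mem_base y) u)
    (hB.hatS hy (self_mem_base y) (self_mem_base y) u)).congr_of_eventuallyEq
    (flat_hermFam D hy (self_mem_base y) (self_mem_base y) u))

/-- Compatibility with the metric, for sections. -/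
lemma along_hermFam (hp : SmoothSurface p) {A B A' B' : ℝ² → Sec L δ k} (hA : SmoothSecSurface n A)
    (hB : SmoothSecSurface n B) (u c : ℝ²) (y : M)
    (hX : PreservesForm D.form y c X (u, chart n y y))
    (hA' : hatS y A' (u, chart n y y) = conn D k y p c X (hatS y A) (u, chart n y y))
    (hB' : hatS y B' (u, chart n y y) = conn D k y p c X (hatS y B) (u, chart n y y)) :
    along c X (flat y (hermFam D k p A B)) (u, chart n y y)
      = hermFam D k p A' B (u, y) + hermFam D k p A B' (u, y) := by
  have hy := self_mem_dom (n := n) y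
  have hbL := self_mem_base (V := L) y
  have hb := self_mem_base (V := δ) y
  rw [along_congr (flat_hermFam D hy hbL hb u), along_hatP D hp hy hbL hb u c hX
    (hA.hatS hy hbL hb u) (hB.hatS hy hbL hb u), ← hatP_hatS D hy hbL hb, ← hatP_hatS D hy hbL hb]
  simp only [hatP, hA', hB']

lemma hasDerivAt_hermFam₁ (hp : SmoothSurface p) (hA : SmoothSecSurface n A)
    (hB : SmoothSecSurface n B) (y : M) (t : ℝ) :
    HasDerivAt (fun t : ℝ => hermFam D k p A B ((t, 0), y))
      (hermFam D k p (D.covP₁ k p A) B ((t, 0), y) + hermFam D k p A (D.covP₁ k p B) ((t, 0), y)) t := by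
  have hy := self_mem_dom (n := n) y
  have hbL := self_mem_base (V := L) y
  have hb := self_mem_base (V := δ) y
  have h := hasDerivAt_line hy ((0, 0) : ℝ²) (1, 0) t (contMDiff_hermFam D hp hA hB _)
  have e : ∀ t : ℝ, ((0, 0) + t • (1, 0) : ℝ²) = (t, 0) := fun t => by simp
  simp only [e] at h
  rwa [along_hermFam D hp hA hB _ _ y (preservesForm_const hy _ _)
    (covP₁_eq D hp hA _ hy hbL hb) (covP₁_eq D hp hB _ hy hbL hb)] at h

/-- Hamiltonian derivatives of Hermitian products. -/
lemma dirDeriv_hermP (hf : Smooth[n] f) (j : CompatACS D.form) {s t : Sec L δ k}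
    (hs : s ∈ PSpace n L δ k) (ht : t ∈ PSpace n L δ k) (y : M) :
    dirDeriv (hamVF D.form f) (D.hermP k j s t) y
      = D.hermP k j (D.nabla k j (hamVF D.form f) s) t y
        + D.hermP k j s (D.nabla k j (hamVF D.form f) t) y := by
  have hy := self_mem_dom (n := n) y
  have hbL := self_mem_base (V := L) y
  have hb := self_mem_base (V := δ) y
  have hp := SmoothSurface.const j
  have hX := (smoothVF_hamVF (Ω := D.form) hf).fam
  have hs' := SmoothSecSurface.const hs
  have ht' := SmoothSecSurface.const ht
  have h := along_hermFam D hp hs' ht' (0, 0) 0 y (preservesForm_hamVF hf hy _)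
    (nabla_eq D hp hX hs' _ hy hbL hb) (nabla_eq D hp hX ht' _ hy hbL hb)
  exact (along_flat_vertical hy (fun _ => hamVF D.form f)
    (contMDiff_hermFam D hp hs' ht' _)).symm.trans h

section LinearAlgebra

variable {V : Type*} [AddCommGroup V] [Module ℝ V] {B : LinearMap.BilinForm ℝ V} {J : V →ₗ[ℝ] V}
  {ι : Type*} [Fintype ι] [DecidableEq ι]

lemma IsKaehler.det_pos (h : IsKaehler B J) (b : Module.Basis ι ℝ V) :
    0 < (LinearMap.BilinForm.toMatrix b B).det := by
  have h1 : (LinearMap.BilinForm.toMatrix b (B.compRight J)).PosDef := by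
    refine Matrix.PosDef.of_dotProduct_mulVec_pos ?_ fun x hx => ?_
    · ext i k
      simp only [Matrix.conjTranspose_apply, LinearMap.BilinForm.toMatrix_apply, star_trivial,
        LinearMap.BilinForm.compRight_apply]
      rw [← h.compat, h.sq, map_neg]
      exact (h.alt _ _).symm
    · rw [star_trivial, LinearMap.BilinForm.dotProduct_toMatrix_mulVec]
      exact h.pos _ fun h0 => hx (b.equivFun.symm.map_eq_zero_iff.1 h0)
  have h2 := h1.det_pos
  rw [LinearMap.BilinForm.toMatrix_compRight, Matrix.det_mul, LinearMap.det_toMatrix] at h2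
  have h3 : (1 + J) * (1 + J) = (2 : ℝ) • J := by
    ext v
    simp only [Module.End.mul_apply, LinearMap.add_apply, Module.End.one_apply, map_add, h.sq,
      two_smul]
    abel
  have h4 := congrArg LinearMap.det h3
  rw [map_mul, LinearMap.det_smul] at h4
  have h5 : 0 ≤ LinearMap.det J := by
    have h6 : (0 : ℝ) < 2 ^ Module.finrank ℝ V := by positivity
    exact nonneg_of_mul_nonneg_right (h4 ▸ mul_self_nonneg _) h6
  by_contra hn
  exact absurd h2 (not_lt.2 (mul_nonpos_of_nonpos_of_nonneg (not_lt.1 hn) h5))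

end LinearAlgebra

lemma mfderiv_chart_symm (hy : y ∈ dom n o) (v : Model n) :
    mfderiv 𝓜[n] 𝓜[n] (chartAt (Model n) o).symm (chart n o y) v
      = dchartInv n o ((chartAt (Model n) o).symm (chart n o y)) v := by
  have h := mdifferentiable_chart (I := 𝓜[n]) o
  have h1 := h.comp_symm_deriv ((chartAt (Model n) o).map_source hy)
  have h2 := congrArg (fun T : Model n →L[ℝ] Model n => T v) h1
  have h3 : (chartAt (Model n) o).symm (chart n o y) ∈ dom n o :=
    (chartAt (Model n) o).map_target ((chartAt (Model n) o).map_source hy)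
  rw [← dchartInv_dchart h3 (mfderiv 𝓜[n] 𝓜[n] (chartAt (Model n) o).symm
    (chart n o y) v)]
  exact congrArg _ h2

lemma hasFDerivAt_chart_change {o x₁ y : M} (h₀ : y ∈ dom n o) (h₁ : y ∈ dom n x₁) :
    HasFDerivAt (fun m => chart n x₁ (chartInv o m))
      (dchart n x₁ y ∘L dchartInv n o y : Model n →L[ℝ] Model n) (chart n o y) := by
  have h1 := ((contMDiffAt_chartInv h₀).mdifferentiableAt (by simp)).hasMFDerivAt
  have h2 := ((contMDiffAt_chart h₁).mdifferentiableAt (by simp)).hasMFDerivAt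
  rw [← chartInv_chart h₀] at h2
  have h3 := hasMFDerivAt_iff_hasFDerivAt.1 (HasMFDerivAt.comp _ h2 h1)
  refine h3.congr_fderiv ?_
  ext1 v
  have h4 := mfderiv_chart_symm h₀ v
  have h5 : ∀ x, x = y → (mfderiv 𝓜[n] 𝓜[n] (chart n x₁) x :
      Model n →L[ℝ] Model n) (dchartInv n o x v) = dchart n x₁ y (dchartInv n o y v) := by
    rintro _ rfl
    rfl
  refine Eq.trans ?_ (h5 _ (chartInv_chart h₀))
  exact congrArg (fun w => (mfderiv 𝓜[n] 𝓜[n] (chart n x₁)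
    (chartInv o (chart n o y)) : Model n →L[ℝ] Model n) w) h4

/-- The density of the Liouville measure in the chart at `o`. -/
def dens (Ω : SymplecticForm n M) (o : M) (m : Model n) : ℝ :=
  Real.sqrt (Matrix.det (Matrix.of fun a b : Fin (2 * n) => hatOm Ω o ((0 : ℝ²), m)
    (EuclideanSpace.single a (1 : ℝ)) (EuclideanSpace.single b (1 : ℝ))))

lemma det_hatOm (Ω : SymplecticForm n M) (hy : y ∈ dom n o) :
    Matrix.det (Matrix.of fun a b : Fin (2 * n) => hatOm Ω o ((0 : ℝ²), chart n o y)
      (EuclideanSpace.single a (1 : ℝ)) (EuclideanSpace.single b (1 : ℝ)))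
    = (LinearMap.BilinForm.toMatrix (EuclideanSpace.basisFun (Fin (2 * n)) ℝ).toBasis
        (chartForm Ω o y)).det := by
  congr 1
  ext a b
  rw [Matrix.of_apply, hatOm_apply hy, LinearMap.BilinForm.toMatrix_apply]
  simp only [OrthonormalBasis.coe_toBasis, EuclideanSpace.basisFun_apply]
  rfl

lemma dens_change (Ω : SymplecticForm n M) {o x₁ y : M} (h₀ : y ∈ dom n o) (h₁ : y ∈ dom n x₁) :
    dens Ω o (chart n o y) = |(dchart n x₁ y ∘L dchartInv n o y : Model n →L[ℝ] Model n).det|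
      * dens Ω x₁ (chart n x₁ y) := by
  rw [dens, dens, det_hatOm Ω h₀, det_hatOm Ω h₁]
  have h : chartForm Ω o y = (chartForm Ω x₁ y).comp
      (dchart n x₁ y ∘L dchartInv n o y : Model n →L[ℝ] Model n).toLinearMap
      (dchart n x₁ y ∘L dchartInv n o y : Model n →L[ℝ] Model n).toLinearMap := by
    ext v w
    change _ = Ω y (dchartInv n x₁ y (dchart n x₁ y (dchartInv n o y v)))
      (dchartInv n x₁ y (dchart n x₁ y (dchartInv n o y w)))
    rw [dchartInv_dchart h₁, dchartInv_dchart h₁]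
    rfl
  rw [h, LinearMap.BilinForm.toMatrix_comp (EuclideanSpace.basisFun (Fin (2 * n)) ℝ).toBasis
    (EuclideanSpace.basisFun (Fin (2 * n)) ℝ).toBasis,
    Matrix.det_mul, Matrix.det_mul, Matrix.det_transpose, LinearMap.det_toMatrix]
  change Real.sqrt (ContinuousLinearMap.det _ * _ * ContinuousLinearMap.det _) = _
  rw [mul_right_comm, ← sq, Real.sqrt_mul (sq_nonneg _), Real.sqrt_sq_eq_abs]

lemma dens_pos (j : CompatACS Ω) (hy : y ∈ dom n o) : 0 < dens Ω o (chart n o y) := by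
  rw [dens, det_hatOm Ω hy]
  exact Real.sqrt_pos.2 ((isKaehler_chart j hy).det_pos _)

lemma contDiffAt_det_hatOm (Ω : SymplecticForm n M) (hy : y ∈ dom n o) :
    ContDiffAt ℝ ∞ (fun m => Matrix.det (Matrix.of fun a b : Fin (2 * n) =>
      hatOm Ω o ((0 : ℝ²), m) (EuclideanSpace.single a (1 : ℝ)) (EuclideanSpace.single b (1 : ℝ))))
      (chart n o y) := by
  simp only [Matrix.det_apply', Matrix.of_apply]
  refine ContDiffAt.sum fun σ _ => contDiffAt_const.mul (contDiffAt_prod fun i _ => ?_)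
  exact (contDiffAt_hatOm hy (0 : ℝ²) _ _).comp (chart n o y)
    (contDiffAt_const.prodMk contDiffAt_id)

lemma contDiffAt_dens (j : CompatACS Ω) (hy : y ∈ dom n o) :
    ContDiffAt ℝ ∞ (dens Ω o) (chart n o y) :=
  (contDiffAt_det_hatOm Ω hy).sqrt (Real.sqrt_pos.1 (dens_pos j hy)).ne'

variable [MeasurableSpace M]

/-- The Liouville measure of the domain of the chart at `o`. -/
def chartMeasure (Ω : SymplecticForm n M) (o : M) : Measure M :=
  (((volume : Measure (Model n)).restrict (chartAt (Model n) o).target).withDensity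
    fun m => ENNReal.ofReal (dens Ω o m)).map (chartInv o)

lemma exists_eq_chart {o : M} {m : Model n} (hm : m ∈ (chartAt (Model n) o).target) :
    ∃ y ∈ dom n o, m = chart n o y :=
  ⟨_, (chartAt (Model n) o).map_target hm, ((chartAt (Model n) o).right_inv hm).symm⟩

lemma chart_mem_target (hy : y ∈ dom n o) :
    chart n o y ∈ (chartAt (Model n) o).target := (chartAt (Model n) o).map_source hy

lemma liouville_eq (Ω : SymplecticForm n M) : liouville Ω = ⨆ o, chartMeasure Ω o := by
  refine iSup_congr fun o => ?_
  change Measure.map (chartInv o) _ = Measure.map (chartInv o) _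
  congr 1
  refine withDensity_congr_ae ?_
  filter_upwards [ae_restrict_mem (chartAt (Model n) o).open_target.measurableSet] with m hm
  obtain ⟨y, hy, rfl⟩ := exists_eq_chart hm
  rw [dens]
  congr 3
  ext a b
  rw [Matrix.of_apply, Matrix.of_apply]
  refine Eq.trans ?_ (rfl : Ω ((chartAt (Model n) o).symm (chart n o y))
    (dchartInv n o _ (EuclideanSpace.single a 1)) (dchartInv n o _ (EuclideanSpace.single b 1)) = _)
  rw [← mfderiv_chart_symm hy, ← mfderiv_chart_symm hy]

variable [BorelSpace M]

lemma aemeasurable_chartInv (Ω : SymplecticForm n M) (o : M) : AEMeasurable (chartInv o)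
    (((volume : Measure (Model n)).restrict (chartAt (Model n) o).target).withDensity
      fun m => ENNReal.ofReal (dens Ω o m)) :=
  ((chartAt (Model n) o).continuousOn_symm.aemeasurable
    (chartAt (Model n) o).open_target.measurableSet).mono_ac (withDensity_absolutelyContinuous _ _)

lemma chartMeasure_apply (Ω : SymplecticForm n M) (o : M) {A : Set M} (hA : MeasurableSet A) :
    chartMeasure Ω o A = ∫⁻ m in chartInv o ⁻¹' A ∩ (chartAt (Model n) o).target,
      ENNReal.ofReal (dens Ω o m) := by
  rw [chartMeasure, Measure.map_apply_of_aemeasurable (aemeasurable_chartInv Ω o) hA,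
    withDensity_apply', Measure.restrict_restrict' (chartAt (Model n) o).open_target.measurableSet]

lemma measurableSet_chart_preimage (o : M) {A : Set M} (hA : MeasurableSet A) :
    MeasurableSet (chartInv o ⁻¹' A ∩ (chartAt (Model n) o).target) := by
  have h := ((continuousOn_iff_continuous_domRestrict.1
    (chartAt (Model n) o).continuousOn_symm).measurable hA)
  have h2 := (chartAt (Model n) o).open_target.measurableSet.subtype_image h
  convert h2 using 1
  ext m
  constructor
  · rintro ⟨hm, hm'⟩
    exact ⟨⟨m, hm'⟩, hm, rfl⟩
  · rintro ⟨⟨m', hm'⟩, hm, rfl⟩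
    exact ⟨hm, hm'⟩

lemma chartMeasure_overlap (Ω : SymplecticForm n M) (o x₁ : M) {A : Set M} (hA : MeasurableSet A)
    (h₀ : A ⊆ dom n o) (h₁ : A ⊆ dom n x₁) : chartMeasure Ω x₁ A = chartMeasure Ω o A := by
  rw [chartMeasure_apply Ω o hA, chartMeasure_apply Ω x₁ hA]
  have hS := measurableSet_chart_preimage (n := n) o hA
  have key : ∀ m ∈ chartInv o ⁻¹' A ∩ (chartAt (Model n) o).target, ∃ y ∈ A, m = chart n o y := by
    rintro m ⟨hm, hm'⟩
    exact ⟨_, hm, ((chartAt (Model n) o).right_inv hm').symm⟩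
  have h1 : chartInv x₁ ⁻¹' A ∩ (chartAt (Model n) x₁).target = (fun m => chart n x₁ (chartInv o m)) ''
      (chartInv o ⁻¹' A ∩ (chartAt (Model n) o).target) := by
    ext m
    constructor
    · rintro ⟨hm, hm'⟩
      refine ⟨chart n o (chartInv x₁ m), ⟨?_, chart_mem_target (h₀ hm)⟩, ?_⟩
      · rwa [mem_preimage, chartInv_chart (h₀ hm)]
      · beta_reduce
        rw [chartInv_chart (h₀ hm)]
        exact (chartAt (Model n) x₁).right_inv hm'
    · rintro ⟨m', hm', rfl⟩
      obtain ⟨y, hy, rfl⟩ := key m' hm'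
      beta_reduce
      rw [chartInv_chart (h₀ hy)]
      exact ⟨by rwa [mem_preimage, chartInv_chart (h₁ hy)], chart_mem_target (h₁ hy)⟩
  rw [h1, lintegral_image_eq_lintegral_abs_det_fderiv_mul volume hS
    (f' := fun m => (dchart n x₁ (chartInv o m) ∘L dchartInv n o (chartInv o m) :
      Model n →L[ℝ] Model n)) (fun m hm => ?_) (fun m hm m' hm' h => ?_)]
  · refine setLIntegral_congr_fun hS fun m hm => ?_
    obtain ⟨y, hy, rfl⟩ := key m hm
    beta_reduce
    rw [chartInv_chart (h₀ hy), dens_change Ω (h₀ hy) (h₁ hy), ENNReal.ofReal_mul (abs_nonneg _)]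
  · obtain ⟨y, hy, rfl⟩ := key m hm
    beta_reduce
    rw [chartInv_chart (h₀ hy)]
    exact (hasFDerivAt_chart_change (h₀ hy) (h₁ hy)).hasFDerivWithinAt
  · obtain ⟨y, hy, rfl⟩ := key m hm
    obtain ⟨y', hy', rfl⟩ := key m' hm'

    rw [chartInv_chart (h₀ hy), chartInv_chart (h₀ hy')] at h
    rw [← chartInv_chart (h₁ hy), h, chartInv_chart (h₁ hy')]

lemma measurableSet_dom (o : M) : MeasurableSet (dom n o) :=
  (chartAt (Model n) o).open_source.measurableSet

lemma liouville_apply (Ω : SymplecticForm n M) (o : M) {A : Set M} (hA : MeasurableSet A)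
    (h₀ : A ⊆ dom n o) : liouville Ω A = chartMeasure Ω o A := by
  refine le_antisymm ?_ ?_
  · have h : liouville Ω ≤ chartMeasure Ω o + (liouville Ω).restrict (dom n o)ᶜ := by
      conv_lhs => rw [liouville_eq]
      refine iSup_le fun x => Measure.le_iff.2 fun B hB => ?_
      rw [Measure.add_apply, Measure.restrict_apply hB,
        ← measure_inter_add_sdiff B (measurableSet_dom (n := n) o)]
      refine add_le_add ?_ ?_
      · rw [← measure_inter_add_sdiff (B ∩ dom n o) (measurableSet_dom (n := n) x)]
        have h0 : chartMeasure Ω x ((B ∩ dom n o) \ dom n x) = 0 := by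
          rw [chartMeasure_apply Ω x ((hB.inter (measurableSet_dom o)).diff (measurableSet_dom x))]
          convert setLIntegral_empty _
          refine eq_empty_of_forall_notMem fun m hm => hm.1.2 ?_
          exact (chartAt (Model n) x).map_target hm.2
        rw [h0, add_zero, chartMeasure_overlap Ω o x ((hB.inter (measurableSet_dom o)).inter
          (measurableSet_dom x)) (fun y hy => hy.1.2) (fun y hy => hy.2)]
        exact measure_mono fun y hy => hy.1.1
      · rw [sdiff_eq]
        exact ((liouville_eq Ω).symm ▸ le_iSup (chartMeasure Ω) x : chartMeasure Ω x ≤ _) _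
    refine (h A).trans ?_
    rw [Measure.add_apply, Measure.restrict_apply hA, show A ∩ (dom n o)ᶜ = ∅ from
      eq_empty_of_forall_notMem fun y hy => hy.2 (h₀ hy.1), measure_empty, add_zero]
  · exact ((liouville_eq Ω).symm ▸ le_iSup (chartMeasure Ω) o : chartMeasure Ω o ≤ _) A

lemma sum_single (v : Model n) : ∑ a, v a • EuclideanSpace.single a (1 : ℝ) = v := by
  simpa using (EuclideanSpace.basisFun (Fin (2 * n)) ℝ).sum_repr v

/-- Hamiltonian fields preserve the Liouville density. -/
lemma fderiv_dens (j : CompatACS Ω) (hf : Smooth[n] f) (hy : y ∈ dom n o) :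
    fderiv ℝ (dens Ω o) (chart n o y) (readV o (hamVF Ω f) y)
      = -(dens Ω o (chart n o y) * ∑ a : Fin (2 * n),
        vert (hatV o fun _ : ℝ² => hamVF Ω f) (0, chart n o y)
          (EuclideanSpace.single a 1) a) := by
  set m := chart n o y with hm
  set X := hatV o fun _ : ℝ² => hamVF Ω f with hX
  set e : Fin (2 * n) → Model n := fun a => EuclideanSpace.single a (1 : ℝ) with he
  set T := vert X (0, m) with hT
  set A : ℝ → Matrix (Fin (2 * n)) (Fin (2 * n)) ℝ := fun t => Matrix.of fun a b =>
    hatOm Ω o ((0 : ℝ²), m + t • X (0, m)) (e a) (e b) with hA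
  set Tm : Matrix (Fin (2 * n)) (Fin (2 * n)) ℝ := Matrix.of fun c a => T (e a) c with hTm
  have hpos : 0 < (A 0).det := by
    have := Real.sqrt_pos.1 (dens_pos j hy)
    simpa [hA] using this
  have hexp : ∀ v, ∑ c, v c • e c = v := sum_single
  have hA' : ∀ a b, HasDerivAt (fun t => A t a b) ((-(Tm.transpose * A 0 + A 0 * Tm)) a b) 0 := by
    intro a b
    have h1 := hasDerivAt_along (contDiffAt_hatOm (Ω := Ω) hy (0 : ℝ²) (e a) (e b)) (c := 0) (X := X)
    rw [along_hatOm_hamVF hf hy] at h1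
    refine (h1.congr_deriv ?_).congr_of_eventuallyEq (.of_forall fun t => ?_)
    · have e1 : ∀ v, hatOm Ω o ((0 : ℝ²), m) v (e b)
          = ∑ c, v c * hatOm Ω o ((0 : ℝ²), m) (e c) (e b) := fun v => by
        conv_lhs => rw [← hexp v]
        simp [hatOm]
      have e2 : ∀ v, hatOm Ω o ((0 : ℝ²), m) (e a) v
          = ∑ c, v c * hatOm Ω o ((0 : ℝ²), m) (e a) (e c) := fun v => by
        conv_lhs => rw [← hexp v]
        simp [hatOm]
      rw [e1, e2]
      simp only [Matrix.neg_apply, Matrix.add_apply, Matrix.mul_apply, Matrix.transpose_apply, hA,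
        hTm, Matrix.of_apply, zero_smul, add_zero, neg_add, sub_eq_add_neg]
      congr 2
      exact Finset.sum_congr rfl fun c _ => mul_comm _ _
    · change hatOm Ω o _ _ _ = hatOm Ω o _ _ _
      congr 1
      ext1 <;> simp [hm]
  have hdet := hasDerivAt_det_one (A := fun t => (A 0)⁻¹ * A t)
    (A' := (A 0)⁻¹ * -(Tm.transpose * A 0 + A 0 * Tm)) (t := 0)
    (Matrix.nonsing_inv_mul _ (isUnit_iff_ne_zero.2 hpos.ne')) fun a b => by
      simp only [Matrix.mul_apply]
      exact HasDerivAt.fun_sum fun c _ => (hA' c b).const_mul _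
  have htr : ((A 0)⁻¹ * -(Tm.transpose * A 0 + A 0 * Tm)).trace = -2 * Tm.trace := by
    rw [mul_neg, mul_add, Matrix.trace_neg, Matrix.trace_add, ← mul_assoc, ← mul_assoc,
      Matrix.trace_mul_comm _ (A 0), ← mul_assoc, Matrix.mul_nonsing_inv _ (isUnit_iff_ne_zero.2 hpos.ne'),
      Matrix.nonsing_inv_mul _ (isUnit_iff_ne_zero.2 hpos.ne'), one_mul, one_mul, Matrix.trace_transpose]
    ring
  rw [htr] at hdet
  have hdet2 : HasDerivAt (fun t => (A t).det) ((A 0).det * (-2 * Tm.trace)) 0 := by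
    refine (hdet.const_mul (A 0).det).congr_of_eventuallyEq (.of_forall fun t => ?_)
    beta_reduce
    rw [Matrix.det_mul, ← mul_assoc, ← Matrix.det_mul,
      Matrix.mul_nonsing_inv _ (isUnit_iff_ne_zero.2 hpos.ne'), Matrix.det_one, one_mul]
  have h3 := hdet2.sqrt hpos.ne'
  have hl : HasDerivAt (fun t : ℝ => m + t • X (0, m)) (X (0, m)) 0 := by
    simpa using ((hasDerivAt_id (0 : ℝ)).smul_const (X (0, m))).const_add m
  have h4 := (toDiffAt (contDiffAt_dens j hy)).hasFDerivAt
  rw [← hm, show m = m + (0 : ℝ) • X (0, m) by simp] at h4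
  have h5 := h4.comp_hasDerivAt (0 : ℝ) hl
  rw [zero_smul, add_zero] at h5
  have hXm : X (0, m) = readV o (hamVF Ω f) y := hatV_apply hy _ _
  rw [← hXm, h5.unique h3]
  have h7 : dens Ω o m = √(A 0).det := by simp [dens, hA, he]
  rw [h7]
  have h8 := Real.mul_self_sqrt hpos.le
  have h9 : √(A 0).det ≠ 0 := (Real.sqrt_pos.2 hpos).ne'
  change _ = -(√(A 0).det * Tm.trace)
  rw [div_eq_iff (mul_ne_zero two_ne_zero h9)]
  linear_combination (2 * Tm.trace) * h8

lemma liouville_restrict (Ω : SymplecticForm n M) (o : M) :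
    (liouville Ω).restrict (dom n o) = chartMeasure Ω o := by
  ext B hB
  rw [Measure.restrict_apply hB, liouville_apply Ω o (hB.inter (measurableSet_dom o))
    inter_subset_right, chartMeasure_apply Ω o hB,
    chartMeasure_apply Ω o (hB.inter (measurableSet_dom o))]
  congr 2
  ext m
  exact ⟨fun h => ⟨h.1.1, h.2⟩, fun h => ⟨⟨h.1, (chartAt (Model n) o).map_target h.2⟩, h.2⟩⟩

lemma aemeasurable_dens (j : CompatACS Ω) (o : M) :
    AEMeasurable (fun m => ENNReal.ofReal (dens Ω o m))
      ((volume : Measure (Model n)).restrict (chartAt (Model n) o).target) := by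
  have h : ContinuousOn (dens Ω o) (chartAt (Model n) o).target := fun m hm => by
    obtain ⟨y, hy, rfl⟩ := exists_eq_chart hm
    exact (contDiffAt_dens j hy).continuousAt.continuousWithinAt
  exact (h.aemeasurable (chartAt (Model n) o).open_target.measurableSet).ennreal_ofReal

lemma integral_liouville (j : CompatACS Ω) (o : M) {F : M → ℂ}
    (hF : Continuous F) (h0 : ∀ x, x ∉ dom n o → F x = 0) :
    ∫ x, F x ∂(liouville Ω) = ∫ m in (chartAt (Model n) o).target, dens Ω o m • F (chartInv o m) := by
  rw [← setIntegral_eq_integral_of_forall_compl_eq_zero h0, liouville_restrict, chartMeasure,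
    integral_map (aemeasurable_chartInv Ω o) hF.aestronglyMeasurable,
    integral_withDensity_eq_integral_toReal_smul₀ (aemeasurable_dens j o)
      (.of_forall fun _ => ENNReal.ofReal_lt_top)]
  refine setIntegral_congr_fun (chartAt (Model n) o).open_target.measurableSet fun m _ => ?_
  rw [ENNReal.toReal_ofReal (show 0 ≤ dens Ω o m from Real.sqrt_nonneg _)]

lemma isLocallyFiniteMeasure_liouville (j : CompatACS Ω) :
    IsLocallyFiniteMeasure (liouville Ω) := by
  refine ⟨fun y => ?_⟩
  have hy := self_mem_dom (n := n) y
  have h1 := (contDiffAt_dens j hy).continuousAt.eventually (eventually_lt_nhds (lt_add_one _))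
  obtain ⟨r, hr, hball⟩ := Metric.eventually_nhds_iff_ball.1 h1
  set U : Set M := dom n y ∩ chart n y ⁻¹' Metric.ball (chart n y y) r with hU
  have hUo : IsOpen U := (chartAt (Model n) y).isOpen_inter_preimage Metric.isOpen_ball
  refine ⟨U, hUo.mem_nhds ⟨hy, Metric.mem_ball_self hr⟩, ?_⟩
  rw [liouville_apply Ω y hUo.measurableSet inter_subset_left, chartMeasure_apply Ω y hUo.measurableSet]
  have h2 : chartInv y ⁻¹' U ∩ (chartAt (Model n) y).target ⊆ Metric.ball (chart n y y) r := by
    rintro m ⟨hm, hm'⟩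
    have := hm.2
    rwa [mem_preimage, show chart n y (chartInv y m) = m from
      (chartAt (Model n) y).right_inv hm'] at this
  refine (lintegral_mono_set h2).trans_lt ?_
  refine (setLIntegral_mono' Metric.isOpen_ball.measurableSet (g := fun _ =>
    ENNReal.ofReal (dens Ω y (chart n y y) + 1)) fun m hm =>
      ENNReal.ofReal_le_ofReal (hball m hm).le).trans_lt ?_
  rw [setLIntegral_const]
  exact ENNReal.mul_lt_top ENNReal.ofReal_lt_top measure_ball_lt_top

lemma isOpenPosMeasure_liouville (j : CompatACS Ω) : (liouville Ω).IsOpenPosMeasure := by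
  refine ⟨fun U hU hne h0 => ?_⟩
  obtain ⟨y, hy⟩ := hne
  have hyd := self_mem_dom (n := n) y
  have hV : IsOpen (dom n y ∩ U) := (chartAt (Model n) y).open_source.inter hU
  have h1 : liouville Ω (dom n y ∩ U) = 0 := measure_mono_null inter_subset_right h0
  rw [liouville_apply Ω y hV.measurableSet inter_subset_left, chartMeasure,
    Measure.map_apply_of_aemeasurable (aemeasurable_chartInv Ω y) hV.measurableSet,
    withDensity_apply_eq_zero' (aemeasurable_dens j y),
    Measure.restrict_apply' (chartAt (Model n) y).open_target.measurableSet] at h1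
  have h2 : IsOpen ((chartAt (Model n) y).target ∩ chartInv y ⁻¹' (dom n y ∩ U)) :=
    (chartAt (Model n) y).symm.isOpen_inter_preimage hV
  refine h2.measure_ne_zero volume ⟨chart n y y, chart_mem_target hyd, ?_⟩
    (measure_mono_null ?_ h1)
  · rw [mem_preimage, chartInv_chart hyd]
    exact ⟨hyd, hy⟩
  · rintro m ⟨hm, hm'⟩
    refine ⟨⟨?_, hm'⟩, hm⟩
    obtain ⟨x, hx, rfl⟩ := exists_eq_chart hm
    exact (ENNReal.ofReal_pos.2 (dens_pos j hx)).ne'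

lemma integral_fderiv_eq_zero {N : ℕ} {w : EuclideanSpace ℝ (Fin N) → ℂ} (hw : ContDiff ℝ 1 w)
    (hc : HasCompactSupport w) (v : EuclideanSpace ℝ (Fin N)) :
    Integrable (fun m => fderiv ℝ w m v) ∧ ∫ m, fderiv ℝ w m v = 0 := by
  have h1 : Integrable (fun m => fderiv ℝ w m v) :=
    ((hw.continuous_fderiv one_ne_zero).clm_apply continuous_const).integrable_of_hasCompactSupport
      (hc.fderiv_apply ℝ v)
  have h2 : Integrable w := hw.continuous.integrable_of_hasCompactSupport hc
  refine ⟨h1, ?_⟩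
  have h := integral_mul_fderiv_eq_neg_fderiv_mul_of_integrable (μ := volume) (𝕜 := ℂ)
    (f := fun _ : EuclideanSpace ℝ (Fin N) => (1 : ℂ)) (g := w) (v := v)
    (by simp) (by simpa using h1) (by simpa using h2)
    (fun x _ => differentiableAt_const _) (fun x _ => (hw.differentiable one_ne_zero) x)
  simpa using h

lemma dirDeriv_eq_zero {X : VF n M} {v : M → ℂ} {y : M} (hy : y ∉ tsupport v) :
    dirDeriv X v y = 0 := by
  rw [dirDeriv_congr (notMem_tsupport_iff_eventuallyEq.1 hy)]
  change mvfderiv 𝓜[n] (fun _ => (0 : ℂ)) y (X y) = 0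
  simp [mvfderiv]

variable [CompactSpace M]

lemma integral_dirDeriv_hamVF_of_chart (j : CompatACS Ω) (hf : Smooth[n] f) {v : M → ℂ}
    (hv : ContMDiff 𝓜[n] 𝓘(ℝ, ℂ) ∞ v) {o : M} (hs : tsupport v ⊆ dom n o) :
    ∫ x, dirDeriv (hamVF Ω f) v x ∂(liouville Ω) = 0 := by
  have hX := smoothVF_hamVF (Ω := Ω) hf
  have hc : Continuous (dirDeriv (hamVF Ω f) v) :=
    ContMDiff.continuous (I := 𝓜[n]) (I' := 𝓘(ℝ, ℂ)) (n := ∞) fun y =>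
      contMDiffAt_dirDeriv Filter.univ_mem hX fun x _ => hv x
  rw [integral_liouville j o hc fun x hx => dirDeriv_eq_zero fun h => hx (hs h)]
  set target := (chartAt (Model n) o).target with htar
  set X : Model n → Model n := fun m => hatV o (fun _ : ℝ² => hamVF Ω f) (0, m) with hXd
  set w : Fin (2 * n) → Model n → ℂ := fun a => target.indicator fun m =>
    ((dens Ω o m * X m a : ℝ) : ℂ) * v (chartInv o m) with hw
  set K : Set (Model n) := chart n o '' tsupport v with hK
  have hKc : IsCompact K := (isClosed_tsupport v).isCompact.image_of_continuousOn fun y hy =>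
    (continuousAt_chart (hs hy)).continuousWithinAt
  have hKt : K ⊆ target := by
    rintro _ ⟨y, hy, rfl⟩
    exact chart_mem_target (hs hy)
  have hw0 : ∀ a, ∀ m ∉ K, w a m = 0 := by
    intro a m hm
    by_cases hmt : m ∈ target
    · obtain ⟨y, hy, rfl⟩ := exists_eq_chart hmt
      have h1 : y ∉ tsupport v := fun h => hm ⟨y, h, rfl⟩
      simp only [hw, indicator_of_mem hmt, chartInv_chart hy, image_eq_zero_of_notMem_tsupport h1,
        mul_zero]
    · exact indicator_of_notMem hmt _
  have hev : ∀ a, ∀ m ∉ K, w a =ᶠ[𝓝 m] fun _ => 0 := fun a m hm => by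
    filter_upwards [hKc.isClosed.isOpen_compl.mem_nhds hm] with m' hm' using hw0 a m' hm'
  have hto : IsOpen target := (chartAt (Model n) o).open_target
  have hXs : ∀ y ∈ dom n o, HasFDerivAt X
      (vert (hatV o fun _ : ℝ² => hamVF Ω f) (0, chart n o y)) (chart n o y) := fun y hy =>
    ((toDiffAt (hX.hatV hy (0 : ℝ²))).hasFDerivAt).comp (chart n o y)
      (hasFDerivAt_prodMk_right (0 : ℝ²) (chart n o y))
  have hXc : ∀ y ∈ dom n o, ∀ a, ContDiffAt ℝ ∞ (fun m => X m a) (chart n o y) := fun y hy a =>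
    (EuclideanSpace.proj (𝕜 := ℝ) a).contDiff.contDiffAt.comp _
      ((hX.hatV hy (0 : ℝ²)).comp (chart n o y) (contDiffAt_const.prodMk contDiffAt_id))
  have hwc : ∀ y ∈ dom n o, ∀ a, w a =ᶠ[𝓝 (chart n o y)] fun m =>
      ((dens Ω o m * X m a : ℝ) : ℂ) * v (chartInv o m) := fun y hy a => by
    filter_upwards [hto.mem_nhds (chart_mem_target hy)] with m hm using indicator_of_mem hm _
  have hws : ∀ a, ContDiff ℝ 1 (w a) := by
    refine fun a => contDiff_iff_contDiffAt.2 fun m => ?_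
    by_cases hmK : m ∈ K
    · obtain ⟨y, hy, rfl⟩ := hmK
      refine ContDiffAt.congr_of_eventuallyEq ?_ (hwc y (hs hy) a)
      refine ContDiffAt.of_le (n := ∞) ?_ (by exact_mod_cast le_top)
      exact (Complex.ofRealCLM.contDiff.contDiffAt.comp _ ((contDiffAt_dens j (hs hy)).mul
        (hXc y (hs hy) a))).mul ((contMDiffAt_iff_chart (hs hy)).1 (hv y))
    · exact contDiffAt_const.congr_of_eventuallyEq (hev a m hmK)
  have hwi := fun a => integral_fderiv_eq_zero (hws a) (HasCompactSupport.intro hKc (hw0 a))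
    (EuclideanSpace.single a (1 : ℝ))
  rw [← integral_indicator hto.measurableSet]
  have key : target.indicator (fun m => dens Ω o m • dirDeriv (hamVF Ω f) v (chartInv o m))
      = fun m => ∑ a, fderiv ℝ (w a) m (EuclideanSpace.single a (1 : ℝ)) := by
    funext m
    by_cases hmt : m ∈ target
    · obtain ⟨y, hy, rfl⟩ := exists_eq_chart hmt
      rw [indicator_of_mem hmt, chartInv_chart hy, dirDeriv_eq_fderiv hy _ (mdiff_of_smooth (hv y))]
      have h1 := (toDiffAt (contDiffAt_dens j hy)).hasFDerivAt
      have h2 := (toDiffAt ((contMDiffAt_iff_chart hy).1 (hv y))).hasFDerivAt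
      have hXm : X (chart n o y) = readV o (hamVF Ω f) y := hatV_apply hy _ _
      have h3 := fderiv_dens j hf hy
      set m := chart n o y with hm
      set T := vert (hatV o fun _ : ℝ² => hamVF Ω f) (0, m) with hT
      set v' := fderiv ℝ (fun z => v (chartInv o z)) m with hv'
      have h4 : ∀ a, fderiv ℝ (w a) m (EuclideanSpace.single a (1 : ℝ))
          = ((dens Ω o m * X m a : ℝ) : ℂ) * v' (EuclideanSpace.single a (1 : ℝ))
            + ((dens Ω o m * T (EuclideanSpace.single a (1 : ℝ)) a
              + X m a * fderiv ℝ (dens Ω o) m (EuclideanSpace.single a (1 : ℝ)) : ℝ) : ℂ)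
              * v (chartInv o m) := by
        intro a
        rw [(hwc y hy a).fderiv_eq]
        have h5 := (Complex.ofRealCLM.hasFDerivAt.comp m (h1.mul
          ((EuclideanSpace.proj (𝕜 := ℝ) a).hasFDerivAt.comp m (hXs y hy)))).mul h2
        refine (congrArg (fun T : Model n →L[ℝ] ℂ => T (EuclideanSpace.single a 1))
          (HasFDerivAt.fderiv h5)).trans ?_
        exact congrArg₂ (· + ·) rfl (mul_comm (v (chartInv o m)) _)
      simp only [h4]
      rw [Finset.sum_add_distrib, ← Finset.sum_mul, ← Complex.ofReal_sum, Finset.sum_add_distrib,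
        ← Finset.mul_sum, ← hXm]
      have h6 : ∑ a, X m a * fderiv ℝ (dens Ω o) m (EuclideanSpace.single a (1 : ℝ))
          = fderiv ℝ (dens Ω o) m (X m) := by
        conv_rhs => rw [← sum_single (X m), map_sum]
        simp
      have h7 : v' (X m) = ∑ a, (X m a : ℂ) * v' (EuclideanSpace.single a (1 : ℝ)) := by
        conv_lhs => rw [← sum_single (X m), map_sum]
        simp
      rw [h6, hXm, h3, add_neg_cancel, Complex.ofReal_zero, zero_mul, add_zero, ← hXm, h7,
        Finset.smul_sum]
      refine Finset.sum_congr rfl fun a _ => ?_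
      rw [Complex.real_smul]
      push_cast
      ring
    · rw [indicator_of_notMem hmt]
      refine (Finset.sum_eq_zero fun a _ => ?_).symm
      rw [(hev a m fun h => hmt (hKt h)).fderiv_eq]
      simp
  rw [key, integral_finsetSum _ fun a _ => (hwi a).1]
  exact Finset.sum_eq_zero fun a _ => (hwi a).2

lemma isFiniteMeasure_liouville (j : CompatACS Ω) : IsFiniteMeasure (liouville Ω) := by
  have := isLocallyFiniteMeasure_liouville j
  infer_instance

lemma integrable_liouville (j : CompatACS Ω) {E : Type*} [NormedAddCommGroup E]
    [SecondCountableTopology E] {F : M → E} (hF : Continuous F) : Integrable F (liouville Ω) := by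
  have := isLocallyFiniteMeasure_liouville j
  exact hF.integrable_of_hasCompactSupport (HasCompactSupport.of_compactSpace F)

/-- Hamiltonian fields preserve the Liouville measure. -/
lemma integral_dirDeriv_hamVF (j : CompatACS Ω) (hf : Smooth[n] f) {v : M → ℂ}
    (hv : ContMDiff 𝓜[n] 𝓘(ℝ, ℂ) ∞ v) : ∫ x, dirDeriv (hamVF Ω f) v x ∂(liouville Ω) = 0 := by
  obtain ⟨ρ, hρ⟩ := SmoothPartitionOfUnity.exists_isSubordinate_chartAt_source 𝓜[n] M
  have hfin := ρ.locallyFinite.finite_nonempty_of_compact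
  have hX := smoothVF_hamVF (Ω := Ω) hf
  have hc : ∀ v : M → ℂ, ContMDiff 𝓜[n] 𝓘(ℝ, ℂ) ∞ v →
      Continuous (dirDeriv (hamVF Ω f) v) := fun v hv =>
    ContMDiff.continuous (I := 𝓜[n]) (I' := 𝓘(ℝ, ℂ)) (n := ∞) fun y =>
      contMDiffAt_dirDeriv Filter.univ_mem hX fun x _ => hv x
  have hs : ∀ i, ContMDiff 𝓜[n] 𝓘(ℝ, ℂ) ∞ fun x => (ρ i x : ℂ) * v x := fun i x =>
    ContMDiffAt.cmul (Complex.ofRealCLM.contMDiff.contMDiffAt.comp x ((ρ i).contMDiff x)) (hv x)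
  have key : ∀ T : Finset M, (ContMDiff 𝓜[n] 𝓘(ℝ, ℂ) ∞ fun x => ∑ i ∈ T, (ρ i x : ℂ) * v x) ∧
      ∫ x, dirDeriv (hamVF Ω f) (fun x => ∑ i ∈ T, (ρ i x : ℂ) * v x) x ∂(liouville Ω) = 0 := by
    classical
    intro T
    induction T using Finset.induction_on with
    | empty =>
      refine ⟨by simpa using contMDiff_const, ?_⟩
      have h0 : ∀ x, dirDeriv (hamVF Ω f) (fun _ => (0 : ℂ)) x = 0 := fun x =>
        dirDeriv_eq_zero (by simp [tsupport])
      simp [h0]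
    | insert i T hi ih =>
      simp only [Finset.sum_insert hi]
      refine ⟨(hs i).add ih.1, ?_⟩
      have h1 : dirDeriv (hamVF Ω f) (fun x => (ρ i x : ℂ) * v x + ∑ i ∈ T, (ρ i x : ℂ) * v x)
          = fun x => dirDeriv (hamVF Ω f) (fun x => (ρ i x : ℂ) * v x) x
            + dirDeriv (hamVF Ω f) (fun x => ∑ i ∈ T, (ρ i x : ℂ) * v x) x :=
        funext fun x => dirDeriv_add (mdiff_of_smooth (hs i x)) (mdiff_of_smooth (ih.1 x))
      rw [h1, integral_add (integrable_liouville j (hc _ (hs i))) (integrable_liouville j (hc _ ih.1)),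
        ih.2, add_zero]
      refine integral_dirDeriv_hamVF_of_chart j hf (hs i) (o := i) ((closure_mono ?_).trans (hρ i))
      intro x hx h0
      exact hx (by simp [h0])
  have h2 : (fun x => ∑ i ∈ hfin.toFinset, (ρ i x : ℂ) * v x) = v := by
    funext x
    have h3 := ρ.sum_eq_one (mem_univ x)
    rw [finsum_eq_sum_of_support_subset (s := hfin.toFinset) _ fun i hi =>
      Finset.mem_coe.2 (hfin.mem_toFinset.2 ⟨x, hi⟩)] at h3
    rw [← Finset.sum_mul, ← Complex.ofReal_sum, h3, Complex.ofReal_one, one_mul]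
  rw [← h2]
  exact (key _).2

lemma conj_herm_self (x : M) (v : L x) : conj (D.preq.herm x v v) = D.preq.herm x v v :=
  D.preq.herm_symm x v v

lemma hermP_add_left (j : CompatACS D.form) (s s' t : Sec L δ k) (x : M) :
    D.hermP k j (s + s') t x = D.hermP k j s t x + D.hermP k j s' t x := by
  simp only [QuantData.hermP, Pi.add_apply, map_add]
  ring

lemma hermP_smul_left (j : CompatACS D.form) (c : ℂ) (s t : Sec L δ k) (x : M) :
    D.hermP k j (c • s) t x = c * D.hermP k j s t x := by
  simp only [QuantData.hermP, Pi.smul_apply, map_smul, smul_eq_mul]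
  ring

lemma conj_hermP (j : CompatACS D.form) (s t : Sec L δ k) (x : M) :
    conj (D.hermP k j s t x) = D.hermP k j t s x := by
  simp only [QuantData.hermP, map_mul, map_pow, Complex.conj_conj, Complex.conj_ofReal,
    conj_herm_self]
  ring

lemma hermP_self (j : CompatACS D.form) (s : Sec L δ k) (x : M) :
    ∃ r : ℝ, 0 < r ∧ D.hermP k j s s x = ((Complex.normSq (pCoord L δ k x x (s x)) * r : ℝ) : ℂ) := by
  have h1 : lineFrame L x x ≠ 0 := fun h => by
    have := lineCoord_lineFrame (V := L) (self_mem_base x)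
    rw [h, map_zero] at this
    exact zero_ne_one this
  have h2 := D.preq.herm_pos x _ h1
  have h3 := Complex.conj_eq_iff_real.1 (conj_herm_self D x (lineFrame L x x))
  obtain ⟨a, ha⟩ := h3
  rw [ha, Complex.ofReal_re] at h2
  have h4 := hatN_pos D (p := fun _ => j) (self_mem_dom (n := n) x) (self_mem_base x) (0, 0)
  rw [hatN_apply D (self_mem_dom (n := n) x)] at h4
  refine ⟨a ^ k * normN0 D.form j x (frameForm D j x x), mul_pos (pow_pos h2 k) h4, ?_⟩
  rw [QuantData.hermP, ha, Complex.mul_conj]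
  push_cast
  rw [← mul_assoc]
  rfl

lemma continuous_hermFam (hp : SmoothSurface p) (hA : SmoothSecSurface n A)
    (hB : SmoothSecSurface n B) : Continuous (hermFam D k p A B) :=
  (contMDiff_hermFam D hp hA hB).continuous

lemma continuous_hermP (j : CompatACS D.form) {s t : Sec L δ k} (hs : s ∈ PSpace n L δ k)
    (ht : t ∈ PSpace n L δ k) : Continuous (D.hermP k j s t) := by
  have h := continuous_hermFam D (SmoothSurface.const j) (SmoothSecSurface.const hs)
    (SmoothSecSurface.const ht)
  have h2 : Continuous fun x : M => (((0, 0), x) : ℝ² × M) := Continuous.prodMk_right _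
  have h3 := Continuous.comp h h2
  rwa [show (hermFam D k (fun _ => j) (fun _ => s) (fun _ => t)) ∘
    (fun x : M => (((0, 0), x) : ℝ² × M)) = D.hermP k j s t from rfl] at h3

lemma covP₁_sum (hp : SmoothSurface p) {d : ℕ} {σ : Fin d → ℝ² → Sec L δ k}
    (hσ : ∀ a, SmoothSecSurface n (σ a)) {w : Fin d → ℝ → ℂ} {w' : Fin d → ℂ}
    (hw : ∀ a, HasDerivAt (w a) (w' a) 0) {W : ℝ² → Sec L δ k}
    (hW : ∀ᶠ t in 𝓝 (0 : ℝ), W (t, 0) = ∑ a, w a t • σ a (t, 0)) :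
    D.covP₁ k p W (0, 0) = ∑ a, (w' a • σ a (0, 0) + w a 0 • D.covP₁ k p (σ a) (0, 0)) := by
  funext y
  have hy := self_mem_dom (n := n) y
  have hbL := self_mem_base (V := L) y
  have hb := self_mem_base (V := δ) y
  have e : ∀ t : ℝ, ((0, 0) + t • (1, 0) : ℝ²) = (t, 0) := fun t => by simp
  have hc := Classical.epsilon_spec (exists_halfFormFamily D hp (0, 0) (1, 0) 0)
  have h1 := hasDerivAt_halfFormFamily D hp hc hy hb
  simp only [e] at hc h1
  set c := Classical.epsilon (D.IsHalfFormFamily (fun t => p (t, 0)) 0) with hcd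
  set E : Fin d → ℝ → ℂ := fun a t => pCoord L δ k y y ((c t y)⁻¹ • σ a (t, 0) y) with hE
  have hEd : ∀ a, DifferentiableAt ℝ (E a) 0 := fun a => by
    have h2 := hasDerivAt_line hy ((0, 0) : ℝ²) (1, 0) 0
      (smoothSecSurface_iff.1 (hσ a) _ y y ⟨hbL, hb⟩)
    simp only [e] at h2
    have h3 := (h1.inv (by rw [hc.init y]; exact one_ne_zero)).mul h2
    refine (h3.congr_of_eventuallyEq (.of_forall fun t => ?_)).differentiableAt
    simp only [hE, map_smul, smul_eq_mul, Pi.mul_apply, Pi.inv_apply]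
  have h4 := HasDerivAt.fun_sum (u := Finset.univ) fun a _ => (hw a).mul (hEd a).hasDerivAt
  have h5 : (fun t => pCoord L δ k y y ((c t y)⁻¹ • W (t, 0) y)) =ᶠ[𝓝 0]
      fun t => ∑ a, (w a * E a) t := by
    filter_upwards [hW] with t ht
    rw [ht, Finset.sum_apply, Finset.smul_sum, map_sum]
    refine Finset.sum_congr rfl fun a _ => ?_
    simp only [hE, Pi.smul_apply, Pi.mul_apply, map_smul, smul_eq_mul]
    ring
  have h6 : D.covP₁ k p W (0, 0) y
      = deriv (fun t => pCoord L δ k y y ((c t y)⁻¹ • W (t, 0) y)) 0 • pFrame L δ k y y := rfl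
  have h7 : ∀ a, D.covP₁ k p (σ a) (0, 0) y = deriv (E a) 0 • pFrame L δ k y y := fun a => rfl
  have h8 : ∀ a, E a 0 • pFrame L δ k y y = σ a (0, 0) y := fun a => by
    simp only [hE, hc.init y, inv_one, one_smul]
    exact pCoord_smul_pFrame hbL hb _
  rw [h6, h5.deriv_eq, h4.deriv, Finset.sum_apply, Finset.sum_smul]
  refine Finset.sum_congr rfl fun a _ => ?_
  rw [Pi.add_apply, Pi.smul_apply, Pi.smul_apply, h7, ← h8, add_smul, mul_smul, mul_smul]

lemma scalarP_add_left (j : CompatACS D.form) {s s' t : Sec L δ k} (hs : s ∈ PSpace n L δ k)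
    (hs' : s' ∈ PSpace n L δ k) (ht : t ∈ PSpace n L δ k) :
    D.scalarP k j (s + s') t = D.scalarP k j s t + D.scalarP k j s' t := by
  simp only [QuantData.scalarP, hermP_add_left]
  exact integral_add (integrable_liouville j (continuous_hermP D j hs ht))
    (integrable_liouville j (continuous_hermP D j hs' ht))

lemma scalarP_smul_left (j : CompatACS D.form) (c : ℂ) (s t : Sec L δ k) :
    D.scalarP k j (c • s) t = c * D.scalarP k j s t := by
  simp only [QuantData.scalarP, hermP_smul_left]
  exact integral_const_mul c _

lemma conj_scalarP (j : CompatACS D.form) (s t : Sec L δ k) :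
    conj (D.scalarP k j s t) = D.scalarP k j t s := by
  rw [QuantData.scalarP, ← integral_conj]
  simp only [conj_hermP]
  rfl

lemma scalarP_smul_right (j : CompatACS D.form) (c : ℂ) (s t : Sec L δ k) :
    D.scalarP k j s (c • t) = conj c * D.scalarP k j s t := by
  rw [← conj_scalarP, scalarP_smul_left, map_mul, conj_scalarP]

lemma scalarP_add_right (j : CompatACS D.form) {s t t' : Sec L δ k} (hs : s ∈ PSpace n L δ k)
    (ht : t ∈ PSpace n L δ k) (ht' : t' ∈ PSpace n L δ k) :
    D.scalarP k j s (t + t') = D.scalarP k j s t + D.scalarP k j s t' := by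
  rw [← conj_scalarP, scalarP_add_left D j ht ht' hs, map_add, conj_scalarP, conj_scalarP]

lemma scalarP_sub_left (j : CompatACS D.form) {s s' t : Sec L δ k} (hs : s ∈ PSpace n L δ k)
    (hs' : s' ∈ PSpace n L δ k) (ht : t ∈ PSpace n L δ k) :
    D.scalarP k j (s - s') t = D.scalarP k j s t - D.scalarP k j s' t := by
  rw [sub_eq_add_neg, ← neg_one_smul ℂ s', scalarP_add_left D j hs (Submodule.smul_mem _ _ hs') ht,
    scalarP_smul_left, neg_one_mul, sub_eq_add_neg]

lemma scalarP_sum_left (j : CompatACS D.form) {d : ℕ} {s : Fin d → Sec L δ k} {t : Sec L δ k}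
    (hs : ∀ a, s a ∈ PSpace n L δ k) (ht : t ∈ PSpace n L δ k) :
    D.scalarP k j (∑ a, s a) t = ∑ a, D.scalarP k j (s a) t := by
  simp only [QuantData.scalarP]
  rw [← integral_finsetSum _ fun a _ => integrable_liouville j (continuous_hermP D j (hs a) ht)]
  refine integral_congr_ae (.of_forall fun x => ?_)
  simp only [QuantData.hermP, Finset.sum_apply, map_sum, Finset.sum_mul]

lemma eq_zero_of_scalarP_self (j : CompatACS D.form) {s : Sec L δ k} (hs : s ∈ PSpace n L δ k)
    (h : D.scalarP k j s s = 0) : s = 0 := by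
  have := isOpenPosMeasure_liouville j
  have := isFiniteMeasure_liouville j
  choose r hr hrs using hermP_self D j s
  have hc : Continuous fun x => (D.hermP k j s s x).re :=
    Complex.continuous_re.comp (continuous_hermP D j hs hs)
  have h0 : (0 : M → ℝ) ≤ fun x => (D.hermP k j s s x).re := fun x => by
    change (0 : ℝ) ≤ (D.hermP k j s s x).re
    rw [hrs, Complex.ofReal_re]
    exact mul_nonneg (Complex.normSq_nonneg _) (hr x).le
  by_contra hne
  obtain ⟨x, hx⟩ := Function.ne_iff.1 hne
  have h1 := hc.integral_pos_of_hasCompactSupport_nonneg_nonzero (μ := liouville D.form) (x := x)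
    (HasCompactSupport.of_compactSpace _) h0 (by
      rw [hrs, Complex.ofReal_re]
      refine mul_ne_zero (fun h => hx ?_) (hr x).ne'
      refine pCoord_injective (self_mem_base x) (self_mem_base x) ?_
      rw [Complex.normSq_eq_zero.1 h, Pi.zero_apply, map_zero])
  have h2 : ∫ x, (D.hermP k j s s x).re ∂(liouville D.form) = (D.scalarP k j s s).re :=
    integral_re (integrable_liouville j (continuous_hermP D j hs hs))
  rw [h2, h, Complex.zero_re] at h1
  exact lt_irrefl _ h1

/-- The operators `Op_k(f)` are symmetric. -/
lemma scalarP_Op (hf : Smooth[n] f) (j : CompatACS D.form) {s t : Sec L δ k}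
    (hs : s ∈ PSpace n L δ k) (ht : t ∈ PSpace n L δ k) :
    D.scalarP k j (D.Op k f j s) t = D.scalarP k j s (D.Op k f j t) := by
  have hX := smoothVF_hamVF (Ω := D.form) hf
  have hsm := contMDiff_hermFam D (SmoothSurface.const j) (SmoothSecSurface.const hs)
    (SmoothSecSurface.const ht)
  have h1 := integral_dirDeriv_hamVF j hf (v := D.hermP k j s t)
    fun y => contMDiffAt_fix_param (u := ((0, 0) : ℝ²)) (hsm ((0, 0), y))
  simp only [dirDeriv_hermP D hf j hs ht] at h1
  have hκ : conj (1 / (I * (k : ℂ))) = -(1 / (I * (k : ℂ))) := by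
    simp
  have h2 : ∀ x, D.hermP k j (D.Op k f j s) t x - D.hermP k j s (D.Op k f j t) x
      = (1 / (I * (k : ℂ))) * (D.hermP k j (D.nabla k j (hamVF D.form f) s) t x
        + D.hermP k j s (D.nabla k j (hamVF D.form f) t) x) := by
    intro x
    simp only [QuantData.hermP, QuantData.Op, map_add, map_smul, smul_eq_mul, map_mul, hκ,
      Complex.conj_ofReal]
    ring
  rw [← sub_eq_zero, QuantData.scalarP, QuantData.scalarP, ← integral_sub
    (integrable_liouville j (continuous_hermP D j (Op_mem_PSpace D hf j hs) ht))
    (integrable_liouville j (continuous_hermP D j hs (Op_mem_PSpace D hf j ht)))]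
  simp only [h2]
  rw [integral_const_mul, h1, mul_zero]

lemma hasDerivAt_integral_liouville (j : CompatACS Ω) {F F' : ℝ × M → ℂ} (hF : Continuous F)
    (hF' : Continuous F') (h : ∀ x t, HasDerivAt (fun t => F (t, x)) (F' (t, x)) t) :
    HasDerivAt (fun t => ∫ x, F (t, x) ∂(liouville Ω)) (∫ x, F' (0, x) ∂(liouville Ω)) 0 := by
  have := isFiniteMeasure_liouville j
  obtain ⟨C, hC⟩ := ((isCompact_Icc (a := (-1 : ℝ)) (b := 1)).prod
    (isCompact_univ (X := M))).exists_bound_of_continuousOn hF'.continuousOn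
  refine (hasDerivAt_integral_of_dominated_loc_of_deriv_le (F := fun t x => F (t, x))
    (F' := fun t x => F' (t, x)) (bound := fun _ => C) (Icc_mem_nhds (by norm_num) one_pos)
    (.of_forall fun t => ?_) ?_ ?_
    (.of_forall fun x t ht => hC (t, x) ⟨ht, mem_univ x⟩) (integrable_const C)
    (.of_forall fun x t _ => h x t)).2
  · exact (hF.comp (Continuous.prodMk_right t)).aestronglyMeasurable
  · exact integrable_liouville j (hF.comp (Continuous.prodMk_right (0 : ℝ)))
  · exact (hF'.comp (Continuous.prodMk_right (0 : ℝ))).aestronglyMeasurable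

/-- The connection of the bundle of prequantum spaces is unitary. -/
lemma hasDerivAt_scalarP (hp : SmoothSurface p) (hA : SmoothSecSurface n A)
    (hB : SmoothSecSurface n B) :
    HasDerivAt (fun t : ℝ => D.scalarP k (p (t, 0)) (A (t, 0)) (B (t, 0)))
      (D.scalarP k (p (0, 0)) (D.covP₁ k p A (0, 0)) (B (0, 0))
        + D.scalarP k (p (0, 0)) (A (0, 0)) (D.covP₁ k p B (0, 0))) 0 := by
  have hA' := smoothSecSurface_covP₁ D hp hA
  have hB' := smoothSecSurface_covP₁ D hp hB
  have hc : Continuous fun z : ℝ × M => (((z.1, 0), z.2) : ℝ² × M) := by fun_prop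
  set F := hermFam D k p A B with hF
  set F₁ := hermFam D k p (D.covP₁ k p A) B with hF₁
  set F₂ := hermFam D k p A (D.covP₁ k p B) with hF₂
  have c0 : Continuous F := continuous_hermFam D hp hA hB
  have c1 : Continuous F₁ := continuous_hermFam D hp hA' hB
  have c2 : Continuous F₂ := continuous_hermFam D hp hA hB'
  have hd : ∀ x t, HasDerivAt (fun t : ℝ => F ((t, 0), x)) (F₁ ((t, 0), x) + F₂ ((t, 0), x)) t :=
    fun x t => hasDerivAt_hermFam₁ D hp hA hB x t
  have d1 : Continuous fun z : ℝ × M => F₁ ((z.1, 0), z.2) := Continuous.comp c1 hc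
  have d2 : Continuous fun z : ℝ × M => F₂ ((z.1, 0), z.2) := Continuous.comp c2 hc
  have h := hasDerivAt_integral_liouville (p (0, 0)) (F := fun z => F ((z.1, 0), z.2))
    (F' := fun z => F₁ ((z.1, 0), z.2) + F₂ ((z.1, 0), z.2)) (Continuous.comp c0 hc) (d1.add d2) hd
  have hx : Continuous fun x : M => (((0, 0), x) : ℝ² × M) := Continuous.prodMk_right _
  have e1 : Continuous fun x : M => F₁ ((0, 0), x) := Continuous.comp c1 hx
  have e2 : Continuous fun x : M => F₂ ((0, 0), x) := Continuous.comp c2 hx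
  have h2 := integral_add (integrable_liouville (p (0, 0)) e1) (integrable_liouville (p (0, 0)) e2)
  rw [h2] at h
  exact h

section Flat

variable {F E : Type*} [NormedAddCommGroup F] [NormedSpace ℝ F] [NormedAddCommGroup E]
  [NormedSpace ℝ E]

lemma flatBracket_apply {c : F} {Y V : F × E → E} {J : F × E → E →L[ℝ] E} {z : F × E}
    (hJ : DifferentiableAt ℝ J z) (hV : DifferentiableAt ℝ V z) :
    flatBracket 0 (fun w => J w (V w)) c Y z
      = J z (flatBracket 0 V c Y z) - lieEnd c Y J z (V z) := by
  have h1 : along c Y (fun w => J w (V w)) z = along c Y J z (V z) + J z (along c Y V z) := by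
    simp only [along]
    rw [(hJ.hasFDerivAt.clm_apply hV.hasFDerivAt).fderiv]
    simp [add_comm]
  have h2 : ∀ Z : F × E → E, along 0 Z Y z = vert Y z (Z z) := fun Z => rfl
  simp only [flatBracket, h1, h2, lieEnd, map_sub, add_apply, sub_apply, mul_apply_eq_comp]
  abel

lemma vert_zero_sub {X : F × E → E} {z : F × E} : vert (fun w => 0 - X w) z = -vert X z := by
  simp [vert]

lemma along_zero_sub {G : Type*} [NormedAddCommGroup G] [NormedSpace ℝ G] {c : F} {X : F × E → E}
    {f : F × E → G} {z : F × E} :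
    along c (fun w => 0 - X w) f z = along c (fun _ => 0) f z - along 0 X f z := by
  simp only [along]
  rw [← map_sub, Prod.mk_sub_mk, sub_zero]

lemma lieEnd_zero_sub {c : F} {X : F × E → E} {J : F × E → E →L[ℝ] E} {z : F × E} :
    lieEnd c (fun w => 0 - X w) J z = lieEnd c (fun _ => 0) J z - lieEnd 0 X J z := by
  simp only [lieEnd, along_zero_sub, vert_zero_sub]
  have h : vert (fun _ : F × E => (0 : E)) z = 0 := by simp [vert]
  rw [h, neg_mul, mul_neg, zero_mul, mul_zero]
  abel

end Flat

lemma conn_zero_sub (hp : SmoothSurface p) (hy : y ∈ dom n o) (hb : y ∈ base δ o) (u c : ℝ²)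
    (hX : ContDiffAt ℝ ∞ X (u, chart n o y)) (h : ℝ² × Model n → ℂ) :
    conn D k o p c (fun w => 0 - X w) h (u, chart n o y)
      = conn D k o p c (fun _ => 0) h (u, chart n o y)
        - conn D k o p 0 X h (u, chart n o y) := by
  have h1 := (theta_spec D hp hy hb u c fun _ => 0).sub (differentiableAt_const _)
    (toDiffAt hX) (theta_spec D hp hy hb u 0 X)
  rw [sub_zero] at h1
  have h2 := (theta_spec D hp hy hb u c fun w => 0 - X w).unique (hatForm_ne_zero D hy hb p u) h1
  simp only [conn, along_zero_sub, h2, map_sub, map_zero]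
  ring

lemma conn_congr_slice (hp : SmoothSurface p) (hy : y ∈ dom n o) (hb : y ∈ base δ o) (u : ℝ²)
    {X X' : ℝ² × Model n → Model n} (hX : ContDiffAt ℝ ∞ X (u, chart n o y))
    (hX' : ContDiffAt ℝ ∞ X' (u, chart n o y)) (h : ℝ² × Model n → ℂ)
    (he : ∀ᶠ m in 𝓝 (chart n o y), X (u, m) = X' (u, m)) :
    conn D k o p 0 X h (u, chart n o y) = conn D k o p 0 X' h (u, chart n o y) := by
  have h1 := (theta_spec D hp hy hb u 0 X).congr_slice (toDiffAt hX)
    (toDiffAt hX') he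
  have h2 := (theta_spec D hp hy hb u 0 X').unique (hatForm_ne_zero D hy hb p u) h1
  have h3 : X (u, chart n o y) = X' (u, chart n o y) := he.self_of_nhds
  simp only [conn, h2, h3, along]

lemma along_hatV_const {X : VF n M} (hX : SmoothVF X) (hy : y ∈ dom n o) (u c : ℝ²) :
    along c (fun _ => 0) (hatV o fun _ : ℝ² => X) (u, chart n o y) = 0 := by
  have h1 := along_flat_param hy c (contMDiffAt_const_param u (hX.readV hy))
  exact h1.unique (hasDerivAt_const (0 : ℝ) (readV o X y))

/-- If the velocity of a family of almost complex structures is the infinitesimal action of `f`,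
the covariant derivatives of its holomorphic sections are given by the action of `f`, up to
holomorphic sections. -/
lemma covP₁_sub_Op_mem_QSpace (hk : 0 < k) (hf : Smooth[n] f) (hη : IsInfAction D.form f j η)
    (hp : IsSurfaceAt p j η μ) (hΦ : SmoothSecSurface n Φ)
    (hQ : ∀ᶠ u in 𝓝 ((0, 0) : ℝ²), Φ u ∈ D.QSpace k (p u)) :
    D.covP₁ k p Φ (0, 0) - (I * (k : ℂ)) • D.Op k f j (Φ (0, 0)) ∈ D.QSpace k j := by
  have hs := hp.smooth
  have hk0 : I * (k : ℂ) ≠ 0 :=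
    mul_ne_zero Complex.I_ne_zero (by exact_mod_cast hk.ne')
  set κ := I * (k : ℂ) with hκ
  have hXf := smoothVF_hamVF (Ω := D.form) hf
  have c1 := smoothSecSurface_covP₁ D hs hΦ
  have c2 := smoothSecSurface_Op D hs hf hΦ
  set Ψ : ℝ² → Sec L δ k := fun u => D.covP₁ k p Φ u - κ • D.Op k f (p u) (Φ u) with hΨ
  have e0 : D.covP₁ k p Φ (0, 0) - κ • D.Op k f j (Φ (0, 0)) = Ψ (0, 0) := by
    rw [hΨ, ← hp.base]
  rw [e0]
  have hΨh : ∀ (u : ℝ²) (o y : M), y ∈ dom n o → y ∈ base L o → y ∈ base δ o →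
      hatS o Ψ (u, chart n o y)
        = conn D k o p (1, 0) (fun w => 0 - hatV o (fun _ => hamVF D.form f) w) (hatS o Φ)
            (u, chart n o y)
          + (-κ) * (hatG o (fun x => (f x : ℂ)) (u, chart n o y)
            * hatS o Φ (u, chart n o y)) := by
    intro u o y hy hbL hb
    have e1 := covP₁_eq D hs hΦ u hy hbL hb
    have e2 := hatS_Op D hs hf hΦ u hy hbL hb
    rw [conn_zero_sub D hs hy hb u (1, 0) (hXf.hatV hy u), ← e1]
    rw [hatS_apply hy] at e2 ⊢
    rw [hatS_apply hy (D.covP₁ k p Φ)]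
    simp only [hΨ, Pi.sub_apply, Pi.smul_apply, map_sub, map_smul, smul_eq_mul]
    rw [e2, mul_add, ← mul_assoc κ (1 / κ), mul_one_div_cancel hk0]
    ring
  have hΨs : SmoothSecSurface n Ψ := by
    refine smoothSecSurface_of_hatS fun u y => ?_
    have hy := self_mem_dom (n := n) y
    have hbL := self_mem_base (V := L) y
    have hb := self_mem_base (V := δ) y
    refine ((c1.hatS hy hbL hb u).sub ((contDiffAt_const (c := κ)).mul
      (c2.hatS hy hbL hb u))).congr_of_eventuallyEq ?_
    refine eventually_good hy hbL hb fun u' x a b c => ?_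
    simp only [hatS_apply a, hΨ, Pi.sub_apply, Pi.smul_apply, map_sub, map_smul, smul_eq_mul]
  refine ⟨hΨs.mem_PSpace _, fun X hX y => ?_⟩
  have hy := self_mem_dom (n := n) y
  have hbL := self_mem_base (V := L) y
  have hb := self_mem_base (V := δ) y
  have hXJ := hs.smoothFamVF hX.fam
  set z : ℝ² × Model n := ((0, 0), chart n y y) with hz
  set V := hatV y fun _ : ℝ² => X with hV
  set W := hatV y fun (u : ℝ²) x => p u x (X x) with hW
  set Xf := hatV y fun _ : ℝ² => hamVF D.form f with hXfd
  set Y : ℝ² × Model n → Model n := fun w => 0 - Xf w with hYd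
  set h := hatS (n := n) y Φ with hh
  set F := hatG (n := n) y (fun x => (f x : ℂ)) with hFd
  set J := hatJ y p with hJd
  have hVs : ContDiffAt ℝ ∞ V z := hX.hatV hy _
  have hWs : ContDiffAt ℝ ∞ W z := hXJ.hatV hy _
  have hXfs : ContDiffAt ℝ ∞ Xf z := hXf.hatV hy _
  have hYs : ContDiffAt ℝ ∞ Y z := contDiffAt_const.sub hXfs
  have hhs : ContDiffAt ℝ ∞ h z := hΦ.hatS hy hbL hb _
  have hfC : ContMDiffAt 𝓜[n] 𝓘(ℝ, ℂ) ∞ (fun x => (f x : ℂ)) y :=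
    (Complex.ofRealCLM.contMDiff.comp hf) y
  have hFs : ContDiffAt ℝ ∞ F z := contDiffAt_hatG hy hfC _
  refine pCoord_injective hbL hb ?_
  have n1 := nabla_eq D hs hX.fam hΨs (0, 0) hy hbL hb
  have n2 := nabla_eq D hs hXJ hΨs (0, 0) hy hbL hb
  simp only [hatS_apply hy, hp.base] at n1 n2
  rw [map_add, map_smul, map_zero, n1, n2, smul_eq_mul]
  have hev : hatS (n := n) y Ψ =ᶠ[𝓝 z] fun w => conn D k y p (1, 0) Y h w + (-κ) * (F w * h w) :=
    eventually_good hy hbL hb fun u' x a b c => hΨh u' y x a b c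
  rw [conn_congr D hev, conn_congr D hev]
  have hcs := contDiffAt_conn D (k := k) hs hy hbL hb (0, 0) (1, 0) hYs hhs
  have key : ∀ Z : ℝ² × Model n → Model n,
      conn D k y p 0 Z (fun w => conn D k y p (1, 0) Y h w + (-κ) * (F w * h w)) z
        = conn D k y p 0 Z (conn D k y p (1, 0) Y h) z
          + (-κ) * (along 0 Z F z * h z + F z * conn D k y p 0 Z h z) := by
    intro Z
    rw [conn_add D (toDiffAt hcs)
      (toDiffAt ((contDiffAt_const (c := -κ)).mul (hFs.mul hhs))),
      conn_const_mul D (-κ) (toDiffAt (hFs.mul hhs)),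
      conn_mul D (toDiffAt hFs) (toDiffAt hhs)]
  have hol : ∀ X : VF n M, SmoothVF X → ∀ᶠ w in 𝓝 z,
      conn D k y p 0 (hatV y fun _ => X) h w
        + I * conn D k y p 0 (hatV y fun u x => p u x (X x)) h w = 0 := by
    intro X hX
    have h1 : ∀ᶠ w in 𝓝 z, Φ (w : ℝ² × Model n).1 ∈ D.QSpace k (p w.1) →
        conn D k y p 0 (hatV y fun _ => X) h w
          + I * conn D k y p 0 (hatV y fun u x => p u x (X x)) h w = 0 := by
      refine eventually_chart hy (good_mem_nhds hy hbL hb) fun u' x hx _ hq => ?_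
      have h2 := congrArg (pCoord L δ k y x) (hq.2 X hX x)
      have m1 := nabla_eq D hs hX.fam hΦ u' hx.1 hx.2.1 hx.2.2
      have m2 := nabla_eq D hs (hs.smoothFamVF hX.fam) hΦ u' hx.1 hx.2.1 hx.2.2
      rw [hatS_apply hx.1] at m1 m2
      rw [map_add, map_smul, map_zero, m1, m2] at h2
      exact h2
    filter_upwards [h1, (continuous_fst.tendsto z).eventually hQ] with w hw hw' using hw hw'
  have hlie : ∀ x ∈ dom n y, lieEnd (1, 0) Y J ((0, 0), chart n y x) = 0 := fun x hx => by
    rw [hYd, lieEnd_zero_sub, hp.along_fst hx, hη.lieEnd_eq hf hs hp.base hx, sub_self]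
  have hcurv : ∀ Z, ContDiffAt ℝ ∞ Z z → thetaCurv D y p 0 Z (1, 0) Y z = 0 := by
    intro Z hZ
    obtain ⟨v, hv⟩ := ne_zero_iff_exists.1 (hatForm_ne_zero D hy hb p (0, 0))
    have h1 := thetaCurv_spec D hs hy hb (0, 0) 0 (1, 0) hZ hYs v
    rw [hlie y hy, mul_zero, zero_mul, sub_zero] at h1
    have h4 := act_smul (hatForm D y p z) 0 (fun x => x) v
    simp only [zero_smul] at h4
    have h5 : act (hatForm D y p z) ((0 : Model n →L[ℝ] Model n)) v = 0 := h4
    rw [h5, smul_zero] at h1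
    rcases mul_eq_zero.1 h1 with h | h
    · exact (mul_eq_zero.1 h).resolve_left two_ne_zero
    · exact absurd h hv
  have C1 := conn_commutator D (k := k) hs hy hbL hb (0, 0) 0 (1, 0) hVs hYs hhs
  have C2 := conn_commutator D (k := k) hs hy hbL hb (0, 0) 0 (1, 0) hWs hYs hhs
  have hz0 : conn D k y p (1, 0) Y (conn D k y p 0 V h) z
      + I * conn D k y p (1, 0) Y (conn D k y p 0 W h) z = 0 := by
    have d1 := toDiffAt (contDiffAt_conn D (k := k) hs hy hbL hb (0, 0) 0 hVs hhs)
    have d2 := toDiffAt (contDiffAt_conn D (k := k) hs hy hbL hb (0, 0) 0 hWs hhs)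
    rw [← conn_const_mul D _ d2, ← conn_add D d1 (d2.const_mul _), conn_congr D (hol X hX)]
    simp [conn, along]
  have o1 : hatOm D.form y z (V z) (Y z) = -dirDeriv X f y := by
    have h1 := hatOm_hatV (Ω := D.form) hy (fun _ : ℝ² => hamVF D.form f) (fun _ => X) (0, 0)
    rw [form_hamVF] at h1
    have h2 := hatOm_hatV (Ω := D.form) hy (fun _ : ℝ² => X) (fun _ => hamVF D.form f) (0, 0)
    rw [D.form.neg_swap, form_hamVF, neg_neg] at h2
    rw [← h2]
    have h3 : Y z = -Xf z := zero_sub _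
    rw [h3, hatOm, map_neg, map_neg]
    rfl
  have o2 : hatOm D.form y z (W z) (Y z) = -dirDeriv (fun x => p (0, 0) x (X x)) f y := by
    have h2 := hatOm_hatV (Ω := D.form) hy (fun (u : ℝ²) x => p u x (X x))
      (fun _ => hamVF D.form f) (0, 0)
    beta_reduce at h2
    rw [D.form.neg_swap, form_hamVF f (fun x => p (0, 0) x (X x)) y, neg_neg] at h2
    rw [← h2]
    have h3 : Y z = -Xf z := zero_sub _
    rw [h3, hatOm, map_neg, map_neg]
    rfl
  have a1 : along 0 V F z = ((dirDeriv X f y : ℝ) : ℂ) := by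
    rw [hV, hFd, hz, along_hatG hy (fun _ => X) hfC, dirDeriv_ofReal hf]
  have a2 : along 0 W F z = ((dirDeriv (fun x => p (0, 0) x (X x)) f y : ℝ) : ℂ) := by
    rw [hW, hFd, hz, along_hatG hy (fun (u : ℝ²) x => p u x (X x)) hfC, dirDeriv_ofReal hf]
  have hbr := smoothVF_bracket hXf hX
  have b1 : ∀ (u : ℝ²), ∀ x ∈ dom n y, flatBracket 0 V (1, 0) Y (u, chart n y x)
      = hatV y (fun _ => bracket (hamVF D.form f) X) (u, chart n y x) := by
    intro u x hx
    rw [hatV_bracket hXf hX hx u]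
    have h1 := along_hatV_const hX hx u (1, 0)
    have h2 : along 0 V Y (u, chart n y x) = -along 0 V Xf (u, chart n y x) := by
      rw [hYd, along_sub (differentiableAt_const _) (toDiffAt (hXf.hatV hx u))]
      simp [along, hXfd]
    simp only [flatBracket]
    rw [h2, hYd, along_zero_sub, h1]
    abel
  have b2 : ∀ᶠ m in 𝓝 (chart n y y), flatBracket 0 W (1, 0) Y ((0, 0), m)
      = hatV y (fun u x => p u x (bracket (hamVF D.form f) X x)) ((0, 0), m) := by
    have h1 : ∀ᶠ w in 𝓝 z, (w : ℝ² × Model n).1 = (0, 0) → flatBracket 0 W (1, 0) Y w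
        = hatV y (fun u x => p u x (bracket (hamVF D.form f) X x)) w :=
      eventually_chart hy (dom_mem_nhds hy) fun u' x hx _ hu => by
        obtain rfl : u' = (0, 0) := hu
        have e1 : W =ᶠ[𝓝 ((0, 0), chart n y x)] fun w => J w (V w) :=
          eventually_chart hx (dom_mem_nhds hx) fun u' x' hx' _ => hatJ_hatV hx' p (fun _ => X) u'
        have e2 : flatBracket 0 W (1, 0) Y ((0, 0), chart n y x)
            = flatBracket 0 (fun w => J w (V w)) (1, 0) Y ((0, 0), chart n y x) := by
          simp only [flatBracket]
          rw [along_congr e1]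
          simp only [along, e1.self_of_nhds]
        rw [e2, flatBracket_apply (toDiffAt (hs.hatJ hx _))
          (toDiffAt (hX.hatV hx _)), hlie x hx, b1 (0, 0) x hx,
          hatJ_hatV hx p (fun _ => bracket (hamVF D.form f) X)]
        exact sub_zero _
    have hc : ContinuousAt (fun m : Model n => (((0, 0) : ℝ²), m)) (chart n y y) := by fun_prop
    filter_upwards [hc.eventually h1] with m hm
    exact hm rfl
  have B1 : conn D k y p 0 (flatBracket 0 V (1, 0) Y) h z
      = conn D k y p 0 (hatV y fun _ => bracket (hamVF D.form f) X) h z :=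
    conn_congr_field D (eventually_chart hy (dom_mem_nhds hy) fun u' x hx _ => b1 u' x hx)
  have B2 : conn D k y p 0 (flatBracket 0 W (1, 0) Y) h z
      = conn D k y p 0 (hatV y fun u x => p u x (bracket (hamVF D.form f) X x)) h z :=
    conn_congr_slice D hs hy hb (0, 0) (contDiffAt_flatBracket hWs hYs)
      ((hs.smoothFamVF hbr.fam).hatV hy _) h b2
  have hfin := (hol _ hbr).self_of_nhds
  have hol0 := (hol X hX).self_of_nhds
  rw [key, key, a1, a2]
  rw [← hz, hcurv V hVs, o1, B1] at C1
  rw [← hz, hcurv W hWs, o2, B2] at C2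
  push_cast at C1 C2
  linear_combination C1 + I * C2 + hz0 + hfin - κ * F z * hol0

lemma differentiableAt_det {d : ℕ} {A : ℝ → Matrix (Fin d) (Fin d) ℂ} {t₀ : ℝ}
    (h : ∀ a b, DifferentiableAt ℝ (fun t => A t a b) t₀) :
    DifferentiableAt ℝ (fun t => (A t).det) t₀ := by
  simp only [Matrix.det_apply']
  exact DifferentiableAt.fun_sum fun τ _ => (differentiableAt_const _).mul
    (HasDerivAt.fun_finsetProd fun i _ => (h (τ i) i).hasDerivAt).differentiableAt

lemma smoothSurface_swap (hp : SmoothSurface p) : SmoothSurface (p ∘ Prod.swap) := fun X hX => by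
  have h : ContMDiff (𝓘(ℝ, ℝ²).prod 𝓜[n]) (𝓘(ℝ, ℝ²).prod 𝓜[n]) ∞
      (fun z : ℝ² × M => ((z.1.swap, z.2) : ℝ² × M)) :=
    ((contDiff_snd.prodMk contDiff_fst).contMDiff.comp contMDiff_fst).prodMk contMDiff_snd
  exact (hp X hX).comp h

lemma IsSurfaceAt.swap (hp : IsSurfaceAt p j η μ) : IsSurfaceAt (p ∘ Prod.swap) j μ η :=
  ⟨smoothSurface_swap D hp.smooth, hp.base, hp.snd, hp.fst⟩

lemma SmoothSecSurface.swap (hΦ : SmoothSecSurface n Φ) :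
    SmoothSecSurface n (Φ ∘ Prod.swap) := fun o => by
  have h : ContMDiff (𝓘(ℝ, ℝ²).prod 𝓜[n]) (𝓘(ℝ, ℝ²).prod 𝓜[n]) ∞
      (fun z : ℝ² × M => ((z.1.swap, z.2) : ℝ² × M)) :=
    ((contDiff_snd.prodMk contDiff_fst).contMDiff.comp contMDiff_fst).prodMk contMDiff_snd
  exact (hΦ o).comp h.contMDiffOn fun z hz => ⟨mem_univ _, hz.2⟩

lemma scalarP_eq_zero_of_mem_span (j : CompatACS D.form) {d : ℕ} {σ : Fin d → Sec L δ k}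
    (hσ : ∀ a, σ a ∈ PSpace n L δ k) {s : Sec L δ k} (hs : s ∈ PSpace n L δ k)
    (h : ∀ a, D.scalarP k j s (σ a) = 0) {r : Sec L δ k} (hr : r ∈ Submodule.span ℂ (range σ)) :
    D.scalarP k j s r = 0 := by
  have key : r ∈ PSpace n L δ k ∧ D.scalarP k j s r = 0 := by
    induction hr using Submodule.span_induction with
    | mem x hx =>
      obtain ⟨a, rfl⟩ := hx
      exact ⟨hσ a, h a⟩
    | zero =>
      refine ⟨Submodule.zero_mem _, ?_⟩
      rw [← zero_smul ℂ (0 : Sec L δ k), scalarP_smul_right, map_zero, zero_mul]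
    | add x y _ _ hx hy =>
      exact ⟨Submodule.add_mem _ hx.1 hy.1,
        by rw [scalarP_add_right D j hs hx.1 hy.1, hx.2, hy.2, add_zero]⟩
    | smul c x _ hx =>
      exact ⟨Submodule.smul_mem _ _ hx.1, by rw [scalarP_smul_right, hx.2, mul_zero]⟩
  exact key.2

/-- The Gram matrix of a finite family of sections. -/
def secGram (k : ℕ) (j : CompatACS D.form) {d : ℕ} (σ : Fin d → Sec L δ k) :
    Matrix (Fin d) (Fin d) ℂ :=
  Matrix.of fun a b => D.scalarP k j (σ b) (σ a)

lemma secGram_mulVec (j : CompatACS D.form) {d : ℕ} {σ : Fin d → Sec L δ k}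
    (hσ : ∀ a, σ a ∈ PSpace n L δ k) (w : Fin d → ℂ) (a : Fin d) :
    (secGram D k j σ).mulVec w a = D.scalarP k j (∑ b, w b • σ b) (σ a) := by
  rw [scalarP_sum_left D j (fun b => Submodule.smul_mem _ _ (hσ b)) (hσ a)]
  simp only [scalarP_smul_left, secGram, Matrix.mulVec, dotProduct, Matrix.of_apply, mul_comm]

lemma sum_smul_mem_span {d : ℕ} (σ : Fin d → Sec L δ k) (w : Fin d → ℂ) :
    ∑ b, w b • σ b ∈ Submodule.span ℂ (range σ) :=
  Submodule.sum_mem _ fun b _ => Submodule.smul_mem _ _ (Submodule.subset_span (mem_range_self b))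

lemma det_secGram_ne_zero (j : CompatACS D.form) {d : ℕ} {σ : Fin d → Sec L δ k}
    (hσ : ∀ a, σ a ∈ PSpace n L δ k) (hli : LinearIndependent ℂ σ) : (secGram D k j σ).det ≠ 0 := by
  intro h
  obtain ⟨v, hv, h0⟩ := Matrix.exists_mulVec_eq_zero_iff.2 h
  have hr : ∑ b, v b • σ b ∈ PSpace n L δ k :=
    Submodule.sum_mem _ fun b _ => Submodule.smul_mem _ _ (hσ b)
  have h1 := scalarP_eq_zero_of_mem_span D j hσ hr
    (fun a => by rw [← secGram_mulVec D j hσ v a, h0, Pi.zero_apply]) (sum_smul_mem_span σ v)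
  have h2 := eq_zero_of_scalarP_self D j hr h1
  exact hv (funext (Fintype.linearIndependent_iff.1 hli v h2))

lemma proj_eq_of_orthogonal (j : CompatACS D.form) {s q : Sec L δ k} (hs : s ∈ PSpace n L δ k)
    (hq : q ∈ D.QSpace k j) (ho : ∀ r ∈ D.QSpace k j, D.scalarP k j (s - q) r = 0) :
    D.proj k j s = q := by
  have h : D.proj k j s ∈ D.QSpace k j ∧
      ∀ r ∈ D.QSpace k j, D.scalarP k j (s - D.proj k j s) r = 0 :=
    Classical.epsilon_spec (p := fun q : Sec L δ k => q ∈ D.QSpace k j ∧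
      ∀ r ∈ D.QSpace k j, D.scalarP k j (s - q) r = 0) ⟨q, hq, ho⟩
  have hd : D.proj k j s - q ∈ D.QSpace k j := Submodule.sub_mem _ h.1 hq
  have e : D.proj k j s - q = (s - q) - (s - D.proj k j s) := by abel
  refine sub_eq_zero.1 (eq_zero_of_scalarP_self D j hd.1 ?_)
  refine (congrArg (fun r => D.scalarP k j r (D.proj k j s - q)) e).trans ?_
  rw [scalarP_sub_left D j (Submodule.sub_mem _ hs hq.1) (Submodule.sub_mem _ hs h.1.1) hd.1,
    ho _ hd, h.2 _ hd, sub_zero]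

/-- The orthogonal projection on the span of the family `σ`. -/
def spanProj (k : ℕ) (j : CompatACS D.form) {d : ℕ} (σ : Fin d → Sec L δ k) (s : Sec L δ k) :
    Sec L δ k :=
  ∑ a, ((secGram D k j σ).det⁻¹ *
    ((secGram D k j σ).updateCol a fun b => D.scalarP k j s (σ b)).det) • σ a

lemma spanProj_spec (j : CompatACS D.form) {d : ℕ} {σ : Fin d → Sec L δ k}
    (hli : LinearIndependent ℂ σ) (hsp : Submodule.span ℂ (range σ) = D.QSpace k j) {s : Sec L δ k}
    (hs : s ∈ PSpace n L δ k) : spanProj D k j σ s ∈ D.QSpace k j ∧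
      ∀ r ∈ D.QSpace k j, D.scalarP k j (s - spanProj D k j σ s) r = 0 := by
  have hσ : ∀ a, σ a ∈ PSpace n L δ k := fun a =>
    (hsp ▸ Submodule.subset_span (mem_range_self a) : σ a ∈ D.QSpace k j).1
  have hw : spanProj D k j σ s ∈ D.QSpace k j := hsp ▸ sum_smul_mem_span σ _
  refine ⟨hw, fun r hr => ?_⟩
  rw [← hsp] at hr
  refine scalarP_eq_zero_of_mem_span D j hσ (Submodule.sub_mem _ hs hw.1) (fun a => ?_) hr
  rw [scalarP_sub_left D j hs hw.1 (hσ a), spanProj, ← secGram_mulVec D j hσ _ a]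
  have h1 : (fun a => (secGram D k j σ).det⁻¹ *
      ((secGram D k j σ).updateCol a fun b => D.scalarP k j s (σ b)).det)
      = (secGram D k j σ).det⁻¹ • (secGram D k j σ).cramer fun b => D.scalarP k j s (σ b) := rfl
  rw [h1, Matrix.mulVec_smul, Matrix.mulVec_cramer, smul_smul,
    inv_mul_cancel₀ (det_secGram_ne_zero D j hσ hli), one_smul, sub_self]

lemma proj_eq_spanProj (j : CompatACS D.form) {d : ℕ} {σ : Fin d → Sec L δ k}
    (hli : LinearIndependent ℂ σ) (hsp : Submodule.span ℂ (range σ) = D.QSpace k j) {s : Sec L δ k}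
    (hs : s ∈ PSpace n L δ k) : D.proj k j s = spanProj D k j σ s :=
  proj_eq_of_orthogonal D j hs (spanProj_spec D j hli hsp hs).1 (spanProj_spec D j hli hsp hs).2

/-- The quantum space at `j` has a finite basis. -/
def HasFrame (k : ℕ) (j : CompatACS D.form) : Prop :=
  ∃ (d : ℕ) (σ : Fin d → Sec L δ k), LinearIndependent ℂ σ ∧
    Submodule.span ℂ (range σ) = D.QSpace k j

variable {D}

lemma HasFrame.proj_spec (hj : HasFrame D k j) {s : Sec L δ k} (hs : s ∈ PSpace n L δ k) :
    D.proj k j s ∈ D.QSpace k j ∧ ∀ r ∈ D.QSpace k j, D.scalarP k j (s - D.proj k j s) r = 0 := by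
  obtain ⟨d, σ, hli, hsp⟩ := hj
  rw [proj_eq_spanProj D j hli hsp hs]
  exact spanProj_spec D j hli hsp hs

lemma HasFrame.proj_add (hj : HasFrame D k j) {s t : Sec L δ k} (hs : s ∈ PSpace n L δ k)
    (ht : t ∈ PSpace n L δ k) : D.proj k j (s + t) = D.proj k j s + D.proj k j t := by
  obtain ⟨h1, h2⟩ := hj.proj_spec hs
  obtain ⟨h3, h4⟩ := hj.proj_spec ht
  refine proj_eq_of_orthogonal D j (Submodule.add_mem _ hs ht) (Submodule.add_mem _ h1 h3)
    fun r hr => ?_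
  rw [add_sub_add_comm, scalarP_add_left D j (Submodule.sub_mem _ hs h1.1)
    (Submodule.sub_mem _ ht h3.1) hr.1, h2 r hr, h4 r hr, add_zero]

lemma HasFrame.proj_smul (hj : HasFrame D k j) (c : ℂ) {s : Sec L δ k} (hs : s ∈ PSpace n L δ k) :
    D.proj k j (c • s) = c • D.proj k j s := by
  obtain ⟨h1, h2⟩ := hj.proj_spec hs
  refine proj_eq_of_orthogonal D j (Submodule.smul_mem _ _ hs) (Submodule.smul_mem _ _ h1)
    fun r hr => ?_
  have e : c • s - c • D.proj k j s = c • (s - D.proj k j s) := (smul_sub c _ _).symm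
  rw [e, scalarP_smul_left, h2 r hr, mul_zero]

lemma HasFrame.proj_sub (hj : HasFrame D k j) {s t : Sec L δ k} (hs : s ∈ PSpace n L δ k)
    (ht : t ∈ PSpace n L δ k) : D.proj k j (s - t) = D.proj k j s - D.proj k j t := by
  obtain ⟨h1, h2⟩ := hj.proj_spec hs
  obtain ⟨h3, h4⟩ := hj.proj_spec ht
  refine proj_eq_of_orthogonal D j (Submodule.sub_mem _ hs ht) (Submodule.sub_mem _ h1 h3)
    fun r hr => ?_
  rw [sub_sub_sub_comm, scalarP_sub_left D j (Submodule.sub_mem _ hs h1.1)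
    (Submodule.sub_mem _ ht h3.1) hr.1, h2 r hr, h4 r hr, sub_zero]

lemma proj_of_mem (j : CompatACS D.form) {q : Sec L δ k} (hq : q ∈ D.QSpace k j) :
    D.proj k j q = q :=
  proj_eq_of_orthogonal D j hq.1 hq fun r _ => by
    rw [sub_self, ← zero_smul ℂ (0 : Sec L δ k), scalarP_smul_left, zero_mul]

/-- The operator `Q_k(f)` as a linear endomorphism of the quantum space. -/
def qOpLin (hj : HasFrame D k j) (hf : Smooth[n] f) : D.QSpace k j →ₗ[ℂ] D.QSpace k j where
  toFun s := ⟨D.QOp k f j s, (hj.proj_spec (Op_mem_PSpace D hf j s.2.1)).1⟩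
  map_add' s t := by
    have h := congrArg Subtype.val ((opLin D k hf j).map_add ⟨s, s.2.1⟩ ⟨t, t.2.1⟩)
    refine Subtype.ext ?_
    exact (congrArg (D.proj k j) h).trans
      (hj.proj_add (Op_mem_PSpace D hf j s.2.1) (Op_mem_PSpace D hf j t.2.1))
  map_smul' c s := by
    have h := congrArg Subtype.val ((opLin D k hf j).map_smul c ⟨s, s.2.1⟩)
    exact Subtype.ext ((congrArg (D.proj k j) h).trans
      (hj.proj_smul c (Op_mem_PSpace D hf j s.2.1)))

lemma qOpLin_coe (hj : HasFrame D k j) (hf : Smooth[n] f) (s : D.QSpace k j) :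
    (qOpLin hj hf s : Sec L δ k) = D.QOp k f j s :=
  rfl

lemma differentiableAt_scalarP (hp : SmoothSurface p) (hA : SmoothSecSurface n A)
    (hB : SmoothSecSurface n B) :
    DifferentiableAt ℝ (fun t : ℝ => D.scalarP k (p (t, 0)) (A (t, 0)) (B (t, 0))) 0 :=
  (hasDerivAt_scalarP D hp hA hB).differentiableAt

lemma exists_hasDerivAt_proj (hp : SmoothSurface p) {d : ℕ} {σ : Fin d → ℝ² → Sec L δ k}
    (hσ : ∀ a, SmoothSecSurface n (σ a))
    (hfr : ∀ᶠ u in 𝓝 ((0, 0) : ℝ²), LinearIndependent ℂ (fun a => σ a u) ∧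
      Submodule.span ℂ (range fun a => σ a u) = D.QSpace k (p u))
    {A : ℝ² → Sec L δ k} (hA : SmoothSecSurface n A) :
    ∃ (w : Fin d → ℝ → ℂ) (w' : Fin d → ℂ), (∀ a, HasDerivAt (w a) (w' a) 0) ∧
      ∀ᶠ t in 𝓝 (0 : ℝ), D.proj k (p (t, 0)) (A (t, 0)) = ∑ a, w a t • σ a (t, 0) := by
  have hli := hfr.self_of_nhds
  have hG : ∀ a b, DifferentiableAt ℝ
      (fun t : ℝ => secGram D k (p (t, 0)) (fun a => σ a (t, 0)) a b) 0 := fun a b =>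
    differentiableAt_scalarP hp (hσ b) (hσ a)
  have hw : ∀ a, DifferentiableAt ℝ
      (fun t : ℝ => (secGram D k (p (t, 0)) fun a => σ a (t, 0)).det⁻¹ *
        ((secGram D k (p (t, 0)) fun a => σ a (t, 0)).updateCol a fun b =>
          D.scalarP k (p (t, 0)) (A (t, 0)) (σ b (t, 0))).det) 0 := by
    refine fun a => ((differentiableAt_det hG).inv
      (det_secGram_ne_zero D _ (fun a => (hσ a).mem_PSpace _) hli.1)).mul
      (differentiableAt_det fun b c => ?_)
    simp only [Matrix.updateCol_apply]
    by_cases h : c = a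
    · simp only [h, if_true]
      exact differentiableAt_scalarP hp hA (hσ b)
    · simp only [h, if_false]
      exact hG b c
  refine ⟨_, _, fun a => (hw a).hasDerivAt, ?_⟩
  have hc : ContinuousAt (fun t : ℝ => ((t, 0) : ℝ²)) 0 := by fun_prop
  filter_upwards [hc.eventually hfr] with t ht
  exact proj_eq_spanProj D _ ht.1 ht.2 (hA.mem_PSpace _)

/-- The covariant derivative of the orthogonal projection of a family of sections. -/
lemma proj_covP₁_proj (hk : 0 < k) (hf : Smooth[n] f)
    (hη : IsInfAction D.form f j η)
    (hp : IsSurfaceAt p j η μ) {d : ℕ} {σ : Fin d → ℝ² → Sec L δ k}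
    (hσ : ∀ a, SmoothSecSurface n (σ a))
    (hfr : ∀ᶠ u in 𝓝 ((0, 0) : ℝ²), LinearIndependent ℂ (fun a => σ a u) ∧
      Submodule.span ℂ (range fun a => σ a u) = D.QSpace k (p u))
    {A : ℝ² → Sec L δ k} (hA : SmoothSecSurface n A) :
    D.proj k j (D.covP₁ k p (fun u => D.proj k (p u) (A u)) (0, 0))
      = D.proj k j (D.covP₁ k p A (0, 0)
        - (I * (k : ℂ)) • D.Op k f j (A (0, 0) - D.proj k j (A (0, 0)))) := by
  have hs := hp.smooth
  have hb := hp.base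
  subst hb
  set κ := I * (k : ℂ) with hκ
  obtain ⟨w, w', hw, hW⟩ := exists_hasDerivAt_proj hs hσ hfr hA
  have e1 := covP₁_sum D hs hσ hw (W := fun u => D.proj k (p u) (A u)) hW
  have hfr0 := hfr.self_of_nhds
  have hfrm : HasFrame D k (p (0, 0)) := ⟨d, _, hfr0⟩
  have hA0 := hA.mem_PSpace (0, 0)
  have hσ0 : ∀ a, σ a (0, 0) ∈ PSpace n L δ k := fun a => (hσ a).mem_PSpace _
  have hdσ : ∀ a, D.covP₁ k p (σ a) (0, 0) ∈ PSpace n L δ k := fun a =>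
    (smoothSecSurface_covP₁ D hs (hσ a)).mem_PSpace _
  have hdA : D.covP₁ k p A (0, 0) ∈ PSpace n L δ k := (smoothSecSurface_covP₁ D hs hA).mem_PSpace _
  set c := D.covP₁ k p (fun u => D.proj k (p u) (A u)) (0, 0) with hc
  have hcP : c ∈ PSpace n L δ k := by
    rw [e1]
    exact Submodule.sum_mem _ fun a _ => Submodule.add_mem _ (Submodule.smul_mem _ _ (hσ0 a))
      (Submodule.smul_mem _ _ (hdσ a))
  obtain ⟨hqQ, hqo⟩ := hfrm.proj_spec hA0
  have hW0 := hW.self_of_nhds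
  set q := D.proj k (p (0, 0)) (A (0, 0)) with hq
  have hNP : A (0, 0) - q ∈ PSpace n L δ k := Submodule.sub_mem _ hA0 hqQ.1
  have hON := Op_mem_PSpace D hf (p (0, 0)) hNP
  have hκc : conj κ = -κ := by simp [hκ]
  have d1 : ∀ b, D.scalarP k (p (0, 0)) (D.covP₁ k p A (0, 0)) (σ b (0, 0))
      + D.scalarP k (p (0, 0)) (A (0, 0)) (D.covP₁ k p (σ b) (0, 0))
      = D.scalarP k (p (0, 0)) c (σ b (0, 0))
        + D.scalarP k (p (0, 0)) q (D.covP₁ k p (σ b) (0, 0)) := by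
    intro b
    have h1 := hasDerivAt_scalarP D hs hA (hσ b)
    have h2 : HasDerivAt
        (fun t : ℝ => ∑ a, w a t * D.scalarP k (p (t, 0)) (σ a (t, 0)) (σ b (t, 0))) _ 0 :=
      HasDerivAt.fun_sum fun a _ => (hw a).mul (hasDerivAt_scalarP D hs (hσ a) (hσ b))
    have hct : ContinuousAt (fun t : ℝ => ((t, 0) : ℝ²)) 0 := by fun_prop
    have h3 : (fun t : ℝ => D.scalarP k (p (t, 0)) (A (t, 0)) (σ b (t, 0))) =ᶠ[𝓝 0]
        fun t : ℝ => ∑ a, w a t * D.scalarP k (p (t, 0)) (σ a (t, 0)) (σ b (t, 0)) := by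
      filter_upwards [hW, hct.eventually hfr] with t ht hft
      have hAt := hA.mem_PSpace (t, 0)
      have hbt := (hσ b).mem_PSpace (t, 0)
      have hm : σ b (t, 0) ∈ D.QSpace k (p (t, 0)) := by
        rw [← hft.2]
        exact Submodule.subset_span (mem_range_self b)
      obtain ⟨hpQ, hpo⟩ := HasFrame.proj_spec ⟨d, _, hft⟩ hAt
      have h4 := hpo _ hm
      rw [scalarP_sub_left D _ hAt hpQ.1 hbt, sub_eq_zero, ht, scalarP_sum_left D _
        (fun a => Submodule.smul_mem _ _ ((hσ a).mem_PSpace _)) hbt] at h4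
      simpa only [scalarP_smul_left] using h4
    rw [h1.unique (h2.congr_of_eventuallyEq h3), e1, hW0,
      scalarP_sum_left D _ (fun a => Submodule.add_mem _ (Submodule.smul_mem _ _ (hσ0 a))
        (Submodule.smul_mem _ _ (hdσ a))) (hσ0 b),
      scalarP_sum_left D _ (fun a => Submodule.smul_mem _ _ (hσ0 a)) (hdσ b),
      ← Finset.sum_add_distrib]
    refine Finset.sum_congr rfl fun a _ => ?_
    rw [scalarP_add_left D _ (Submodule.smul_mem _ _ (hσ0 a)) (Submodule.smul_mem _ _ (hdσ a))
      (hσ0 b)]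
    simp only [scalarP_smul_left]
    ring
  have d2 : ∀ b, D.scalarP k (p (0, 0))
      (D.covP₁ k p A (0, 0) - κ • D.Op k f (p (0, 0)) (A (0, 0) - q) - c) (σ b (0, 0)) = 0 := by
    intro b
    have hmem : ∀ᶠ u in 𝓝 ((0, 0) : ℝ²), σ b u ∈ D.QSpace k (p u) := by
      filter_upwards [hfr] with u hu
      rw [← hu.2]
      exact Submodule.subset_span (mem_range_self b)
    have h1 := covP₁_sub_Op_mem_QSpace D hk hf hη hp (hσ b) hmem
    have hOσ := Op_mem_PSpace D hf (p (0, 0)) (hσ0 b)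
    have h2 := hqo _ h1
    have e : D.covP₁ k p (σ b) (0, 0) = (D.covP₁ k p (σ b) (0, 0)
        - κ • D.Op k f (p (0, 0)) (σ b (0, 0))) + κ • D.Op k f (p (0, 0)) (σ b (0, 0)) := by abel
    have h3 : D.scalarP k (p (0, 0)) (A (0, 0) - q) (D.covP₁ k p (σ b) (0, 0))
        = -κ * D.scalarP k (p (0, 0)) (D.Op k f (p (0, 0)) (A (0, 0) - q)) (σ b (0, 0)) := by
      rw [scalarP_Op D hf _ hNP (hσ0 b), ← hκc, ← scalarP_smul_right]
      refine (congrArg (D.scalarP k (p (0, 0)) (A (0, 0) - q)) e).trans ?_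
      rw [scalarP_add_right D _ hNP h1.1 (Submodule.smul_mem _ _ hOσ), h2, zero_add]
    have h4 := d1 b
    rw [scalarP_sub_left D _ hA0 hqQ.1 (hdσ b)] at h3
    rw [scalarP_sub_left D _ (Submodule.sub_mem _ hdA (Submodule.smul_mem _ _ hON)) hcP (hσ0 b),
      scalarP_sub_left D _ hdA (Submodule.smul_mem _ _ hON) (hσ0 b), scalarP_smul_left]
    linear_combination h4 - h3
  have hdN := Submodule.sub_mem _ hdA (Submodule.smul_mem _ κ hON)
  obtain ⟨g1, g2⟩ := hfrm.proj_spec hcP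
  refine (proj_eq_of_orthogonal D _ hdN g1 fun r hr => ?_).symm
  have e : D.covP₁ k p A (0, 0) - κ • D.Op k f (p (0, 0)) (A (0, 0) - q)
      - D.proj k (p (0, 0)) c = (D.covP₁ k p A (0, 0)
        - κ • D.Op k f (p (0, 0)) (A (0, 0) - q) - c) + (c - D.proj k (p (0, 0)) c) := by abel
  have h5 := scalarP_eq_zero_of_mem_span D (p (0, 0)) hσ0 (Submodule.sub_mem _ hdN hcP) d2
    (hfr0.2.symm ▸ hr)
  rw [e, scalarP_add_left D _ (Submodule.sub_mem _ hdN hcP) (Submodule.sub_mem _ hcP g1.1) hr.1,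
    h5, g2 r hr, add_zero]

lemma covQ₁_covQ₂ (hk : 0 < k) {f g : M → ℝ} (hf : Smooth[n] f) (hg : Smooth[n] g)
    (hη : IsInfAction D.form f j η) (hμ : IsInfAction D.form g j μ) (hp : IsSurfaceAt p j η μ)
    {S : Set (CompatACS D.form)} (hS : D.IsSubbundle k S) (hpS : ∀ u, p u ∈ S)
    (hΦ : SmoothSecSurface n Φ) (hQ : ∀ u, Φ u ∈ D.QSpace k (p u)) :
    D.covQ₁ k p (D.covQ₂ k p Φ) (0, 0)
      = D.proj k j (D.covP₁ k p (D.covP₂ k p Φ) (0, 0))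
        - (I * (k : ℂ)) ^ 2 • (D.proj k j (D.Op k f j (D.Op k g j (Φ (0, 0))))
          - D.QOp k f j (D.QOp k g j (Φ (0, 0)))) := by
  obtain ⟨d, σ, hσ, hfr⟩ := hS p hp.smooth hpS (0, 0)
  have hj : HasFrame D k j := hp.base ▸ ⟨d, _, hfr.self_of_nhds⟩
  have hA := smoothSecSurface_covP₂ D hp.smooth hΦ
  have h0 : D.covQ₁ k p (D.covQ₂ k p Φ) (0, 0)
      = D.proj k j (D.covP₁ k p (fun u => D.proj k (p u) (D.covP₂ k p Φ u)) (0, 0)) :=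
    congrArg (fun i => D.proj k i (D.covP₁ k p (D.covQ₂ k p Φ) (0, 0))) hp.base
  have h1 := covP₁_sub_Op_mem_QSpace D hk hg hμ hp.swap hΦ.swap
    (.of_forall fun u => hQ u.swap)
  replace h1 : D.covP₂ k p Φ (0, 0) - (I * (k : ℂ)) • D.Op k g j (Φ (0, 0))
    ∈ D.QSpace k j := h1
  have hs := hΦ.mem_PSpace (0, 0)
  rw [h0, proj_covP₁_proj hk hf hη hp hσ hfr hA]
  set κ := I * (k : ℂ) with hκ
  have hOg := Op_mem_PSpace D hg j hs
  have hA0 := hA.mem_PSpace (0, 0)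
  have hQg : D.QOp k g j (Φ (0, 0)) ∈ D.QSpace k j := (hj.proj_spec hOg).1
  have e : D.covP₂ k p Φ (0, 0) - D.proj k j (D.covP₂ k p Φ (0, 0))
      = κ • (D.Op k g j (Φ (0, 0)) - D.QOp k g j (Φ (0, 0))) := by
    have h2 := proj_of_mem j h1
    rw [hj.proj_sub hA0 (Submodule.smul_mem _ κ hOg), hj.proj_smul κ hOg] at h2
    have h3 : κ • (D.Op k g j (Φ (0, 0)) - D.QOp k g j (Φ (0, 0)))
        = κ • D.Op k g j (Φ (0, 0)) - κ • D.proj k j (D.Op k g j (Φ (0, 0))) := smul_sub κ _ _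
    rw [h3, sub_eq_sub_iff_sub_eq_sub, ← h2]
  have hlin : D.Op k f j (κ • (D.Op k g j (Φ (0, 0)) - D.QOp k g j (Φ (0, 0))))
      = κ • (D.Op k f j (D.Op k g j (Φ (0, 0))) - D.Op k f j (D.QOp k g j (Φ (0, 0)))) := by
    have hN := Submodule.sub_mem _ hOg hQg.1
    have h1 : D.Op k f j (D.Op k g j (Φ (0, 0)))
        = D.Op k f j (D.Op k g j (Φ (0, 0)) - D.QOp k g j (Φ (0, 0)))
          + D.Op k f j (D.QOp k g j (Φ (0, 0))) :=
      (congrArg (D.Op k f j) (sub_add_cancel _ _).symm).trans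
        (congrArg Subtype.val ((opLin D k hf j).map_add ⟨_, hN⟩ ⟨_, hQg.1⟩))
    rw [h1, add_sub_cancel_right]
    exact congrArg Subtype.val ((opLin D k hf j).map_smul κ ⟨_, hN⟩)
  have hOOg := Op_mem_PSpace D hf j hOg
  have hOQg := Op_mem_PSpace D hf j hQg.1
  have hcA := (smoothSecSurface_covP₁ D hp.smooth hA).mem_PSpace (0, 0)
  have hsub := Submodule.sub_mem _ hOOg hOQg
  rw [e, hlin, hj.proj_sub hcA (Submodule.smul_mem _ κ (Submodule.smul_mem _ κ hsub)),
    hj.proj_smul κ (Submodule.smul_mem _ κ hsub), hj.proj_smul κ hsub, hj.proj_sub hOOg hOQg,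
    smul_smul, ← sq]
  rfl

/-- The curvature of the bundle of quantum spaces along infinitesimal actions. -/
lemma exists_isCurvatureQ (hk : 0 < k) {f g : M → ℝ} (hf : Smooth[n] f) (hg : Smooth[n] g)
    (hη : IsInfAction D.form f j η) (hμ : IsInfAction D.form g j μ) {S : Set (CompatACS D.form)}
    (hS : D.IsSubbundle k S) (hne : ∃ p : ℝ² → CompatACS D.form, IsSurfaceAt p j η μ ∧ ∀ u, p u ∈ S)
    : ∃ R : D.QSpace k j →ₗ[ℂ] D.QSpace k j, D.IsCurvatureQ k S j η μ R ∧
      ∀ s : D.QSpace k j,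
        (I * (k : ℂ)) • (D.QOp k f j (D.QOp k g j s) - D.QOp k g j (D.QOp k f j s))
          = D.QOp k (poisson D.form f g) j s
            + (I * (k : ℂ))⁻¹ • (R s : Sec L δ k) := by
  have hk0 : I * (k : ℂ) ≠ 0 :=
    mul_ne_zero Complex.I_ne_zero (by exact_mod_cast hk.ne')
  have hfg := contMDiff_poisson (Ω := D.form) hf hg
  have hj : HasFrame D k j := by
    obtain ⟨p, hp, hpS⟩ := hne
    obtain ⟨d, σ, -, hfr⟩ := hS p hp.smooth hpS (0, 0)
    exact hp.base ▸ ⟨d, _, hfr.self_of_nhds⟩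
  obtain ⟨R, key⟩ : ∃ R : D.QSpace k j →ₗ[ℂ] D.QSpace k j, ∀ s : D.QSpace k j,
      (R s : Sec L δ k) = (I * (k : ℂ)) • ((I * (k : ℂ)) •
        (D.QOp k f j (D.QOp k g j s) - D.QOp k g j (D.QOp k f j s))
        - D.QOp k (poisson D.form f g) j s) := by
    refine ⟨(I * (k : ℂ)) • ((I * (k : ℂ)) •
      (qOpLin hj hf ∘ₗ qOpLin hj hg + (-1 : ℂ) • qOpLin hj hg ∘ₗ qOpLin hj hf)
        + (-1 : ℂ) • qOpLin hj hfg), fun s => ?_⟩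
    simp only [LinearMap.smul_apply, LinearMap.add_apply, LinearMap.comp_apply,
      Submodule.coe_smul, Submodule.coe_add, qOpLin_coe, neg_one_smul, sub_eq_add_neg]
  refine ⟨R, ⟨hne, fun p hp hpS Φ hΦ hQ s hs => ?_⟩, fun s => ?_⟩
  · have c1 := covQ₁_covQ₂ hk hf hg hη hμ hp hS hpS hΦ hQ
    have c2 := covQ₁_covQ₂ hk hg hf hμ hη hp.swap hS (fun u => hpS u.swap) hΦ.swap
      fun u => hQ u.swap
    replace c2 : D.covQ₂ k p (D.covQ₁ k p Φ) (0, 0)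
      = D.proj k j (D.covP₂ k p (D.covP₁ k p Φ) (0, 0))
        - (I * (k : ℂ)) ^ 2 • (D.proj k j (D.Op k g j (D.Op k f j (Φ (0, 0))))
          - D.QOp k g j (D.QOp k f j (Φ (0, 0)))) := c2
    have c3 := congrArg (D.proj k j) (covP_commutator D hk hf hg hη hμ hp hΦ)
    have hΦ0 := hΦ.mem_PSpace (0, 0)
    have m1 := (smoothSecSurface_covP₁ D hp.smooth
      (smoothSecSurface_covP₂ D hp.smooth hΦ)).mem_PSpace (0, 0)
    have m2 := (smoothSecSurface_covP₂ D hp.smooth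
      (smoothSecSurface_covP₁ D hp.smooth hΦ)).mem_PSpace (0, 0)
    have m3 := Op_mem_PSpace D hf j (Op_mem_PSpace D hg j hΦ0)
    have m4 := Op_mem_PSpace D hg j (Op_mem_PSpace D hf j hΦ0)
    have m5 := Op_mem_PSpace D hfg j hΦ0
    have m6 := Submodule.smul_mem _ (I * (k : ℂ)) (Submodule.sub_mem _ m3 m4)
    rw [hj.proj_sub m1 m2, hj.proj_smul _ (Submodule.sub_mem _ m6 m5), hj.proj_sub m6 m5,
      hj.proj_smul _ (Submodule.sub_mem _ m3 m4), hj.proj_sub m3 m4] at c3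
    rw [c1, c2, key, ← hs]
    have c4 : D.QOp k (poisson D.form f g) j (Φ (0, 0))
      = D.proj k j (D.Op k (poisson D.form f g) j (Φ (0, 0))) := rfl
    rw [sub_sub_sub_comm, c3, c4]
    funext x
    simp only [Pi.sub_apply, Pi.smul_apply]
    module
  · rw [key, inv_smul_smul₀ hk0]
    abel

end LineBundles

end GeomQuant

open GeomQuant in
theorem mainTheorem10 {n : ℕ} {M : Type*} [TopologicalSpace M] [ChartedSpace (Model n) M]
    [IsManifold 𝓘(ℝ, Model n) ∞ M] [T2Space M] [CompactSpace M] [ConnectedSpace M]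
    [MeasurableSpace M] [BorelSpace M]
    {L : M → Type*} [TopologicalSpace (TotalSpace ℂ L)] [∀ x, TopologicalSpace (L x)]
    [∀ x, AddCommGroup (L x)] [∀ x, Module ℂ (L x)]
    [∀ x, IsTopologicalAddGroup (L x)] [∀ x, ContinuousSMul ℝ (L x)]
    [FiberBundle ℂ L] [VectorBundle ℂ ℂ L] [VectorBundle ℝ ℂ L]
    [ContMDiffVectorBundle ∞ ℂ L 𝓘(ℝ, Model n)]
    {δ : M → Type*} [TopologicalSpace (TotalSpace ℂ δ)] [∀ x, TopologicalSpace (δ x)]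
    [∀ x, AddCommGroup (δ x)] [∀ x, Module ℂ (δ x)]
    [FiberBundle ℂ δ] [VectorBundle ℂ ℂ δ] [VectorBundle ℝ ℂ δ]
    [ContMDiffVectorBundle ∞ ℂ δ 𝓘(ℝ, Model n)]
    (D : QuantData n L δ) (k : ℕ) (hk : 0 < k)
    (f g : M → ℝ) (hf : ContMDiff 𝓘(ℝ, Model n) 𝓘(ℝ, ℝ) ∞ f)
    (hg : ContMDiff 𝓘(ℝ, Model n) 𝓘(ℝ, ℝ) ∞ g) :
    (∀ (j : CompatACS D.form) (η μ : EndField n M),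
      IsInfAction D.form f j η → IsInfAction D.form g j μ →
      ∃ R : PSpace n L δ k →ₗ[ℂ] PSpace n L δ k, D.IsCurvatureP k j η μ R ∧
        ∀ s : PSpace n L δ k,
          (Complex.I * (k : ℂ)) • (D.Op k f j (D.Op k g j s) - D.Op k g j (D.Op k f j s))
            = D.Op k (poisson D.form f g) j s
              + (Complex.I * (k : ℂ))⁻¹ • (R s : Sec L δ k)) ∧
    (∀ S : Set (CompatACS D.form), (∀ j ∈ S, j.Integrable) → D.IsSubbundle k S →
      ∀ j ∈ S, ∀ η μ : EndField n M,
        IsInfAction D.form f j η → IsInfAction D.form g j μ →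
        (∃ p : ℝ × ℝ → CompatACS D.form, IsSurfaceAt p j η μ ∧ ∀ u, p u ∈ S) →
        ∃ R : D.QSpace k j →ₗ[ℂ] D.QSpace k j, D.IsCurvatureQ k S j η μ R ∧
          ∀ s : D.QSpace k j,
            (Complex.I * (k : ℂ)) •
                (D.QOp k f j (D.QOp k g j s) - D.QOp k g j (D.QOp k f j s))
              = D.QOp k (poisson D.form f g) j s
                + (Complex.I * (k : ℂ))⁻¹ • (R s : Sec L δ k)) := by
  refine ⟨fun j η μ hη hμ => exists_isCurvatureP D hk hf hg hη hμ, ?_⟩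
  exact fun S _ hS j _ η μ hη hμ hne => exists_isCurvatureQ hk hf hg hη hμ hS hne
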